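/- **Setting.** Let $M$ be a smooth five-manifold with a CR structure, i.e. a smooth complex rank $2$ subbundle $T^{1,0}\subset TM\otimes\mathbb C$ with $T^{1,0}\cap\overline{T^{1,0}}=0$ and $[T^{1,0},T^{1,0}]\subset T^{1,0}$, which is nondegenerate: for every contact form $\theta$ (a real one-form with $\ker\theta=\operatorname{Re}(T^{1,0}\oplus\overline{T^{1,0}})$) the Levi form $-i\,d\theta(Z,\overline W)$ on $T^{1,0}$ is nondegenerate. Fix a contact form $\theta$, with Reeb field $T$ ($\theta(T)=1$, $d\theta(T,\cdot)=0$). Near every point there are admissible coframes $\{\theta^\alpha\}_{\alpha=1}^2$ (one-forms annihilating $T$ and $\overline{T^{1,0}}$ and restricting to a coframe of $T^{1,0}$). With $\theta^{\bar\beta}=\overline{\theta^\beta}$, they determine $h_{\alpha\bar\beta}$, the connection forms $\omega_\alpha{}^\gamma$ and the torsion $A$ by $d\theta=ih_{\alpha\bar\beta}\theta^\alpha\wedge\theta^{\bar\beta}$, $d\theta^\alpha=\theta^\mu\wedge\omega_\mu{}^\alpha+A^\alpha{}_{\bar\beta}\theta\wedge\theta^{\bar\beta}$, $dh_{\alpha\bar\beta}=\omega_{\alpha\bar\beta}+\omega_{\bar\beta\alpha}$,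 $A_{\alpha\gamma}=A_{\gamma\alpha}$; let $\nabla$ be the resulting (Tanaka–Webster) covariant derivative, with indices raised and lowered by $h$. Let $R_\alpha{}^\gamma{}_{\rho\bar\sigma}$ be the coefficient of $\theta^\rho\wedge\theta^{\bar\sigma}$ in $d\omega_\alpha{}^\gamma-\omega_\alpha{}^\mu\wedge\omega_\mu{}^\gamma$, and put $R_{\alpha\bar\beta}=R_{\alpha\bar\beta\mu}{}^\mu$, $R=R_\mu{}^\mu$, $E_{\alpha\bar\beta}=\frac14(R_{\alpha\bar\beta}-\frac R2h_{\alpha\bar\beta})$. **The spaces.** $\mathscr R^{p,q}$ denotes the bigraded Rumin complex, realized by forms. In particular $\mathscr R^{0,1}$ consists of the forms $u_{\bar\beta}\theta^{\bar\beta}+\frac i2\nabla^{\bar\nu}u_{\bar\nu}\,\theta$; $\mathscr R^{1,1}$ of the forms $w_{\alpha\bar\beta}\theta^\alpha\wedge\theta^{\bar\beta}-i\nabla^\mu w_{\mu\bar\beta}\,\theta\wedge\theta^{\bar\beta}-i\nabla^{\bar\nu}w_{\alpha\bar\nu}\,\theta\wedge\theta^\alpha$ with $w_\mu{}^\mu=0$;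 $\mathscr R^{3,0}$, $\mathscr R^{2,1}$, $\mathscr R^{1,2}$ of the forms $\frac12a_{\alpha\beta}\theta\wedge\theta^\alpha\wedge\theta^\beta$, $w_{\alpha\bar\beta}\theta\wedge\theta^\alpha\wedge\theta^{\bar\beta}$ ($w_\mu{}^\mu=0$), $\frac12c_{\bar\alpha\bar\beta}\theta\wedge\theta^{\bar\alpha}\wedge\theta^{\bar\beta}$; and $\mathscr R^{3,1}$, $\mathscr R^{2,2}$ of the forms $v_\alpha\theta\wedge\theta^\alpha\wedge d\theta$, $c_{\bar\beta}\theta\wedge\theta^{\bar\beta}\wedge d\theta$. Elements of $\mathscr R^{p,q}$, $p+q\le2$, are identified by their parts not containing $\theta$ (written $\equiv$). **The operators.** On $\mathscr R^{0,1}$: $\partial_bu\equiv(\nabla_\alpha u_{\bar\beta}-\frac12h_{\alpha\bar\beta}\nabla^{\bar\nu}u_{\bar\nu})\theta^\alpha\wedge\theta^{\bar\beta}$ and $\overline\partial_bu\equiv\nabla_{\bar\beta}u_{\bar\sigma}\theta^{\bar\beta}\wedge\theta^{\bar\sigma}$. On $\mathscr R^{1,0}$: $\overline\partial_bv\equiv-(\nabla_{\bar\beta}v_\alpha-\frac12h_{\alpha\bar\beta}\nabla^\mu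 v_\mu)\theta^\alpha\wedge\theta^{\bar\beta}$. On $\mathscr R^{1,1}$: $\overline\partial_bw=i(\nabla_{\bar\beta}\nabla^\mu w_{\mu\bar\sigma}-iA_{\bar\beta}{}^\mu w_{\mu\bar\sigma})\theta\wedge\theta^{\bar\beta}\wedge\theta^{\bar\sigma}$. On $\mathscr R^{1,2}$: $\partial_bc=i\nabla^{\bar\nu}c_{\bar\nu\bar\beta}\theta\wedge\theta^{\bar\beta}\wedge d\theta$. On $\mathscr R^{2,1}$: $\overline\partial_bw=-i\nabla^\mu w_{\mu\bar\beta}\theta\wedge\theta^{\bar\beta}\wedge d\theta$ and $\partial_bw=-i\nabla^{\bar\nu}w_{\alpha\bar\nu}\theta\wedge\theta^\alpha\wedge d\theta$. The Hodge star is $\star\omega=-i\theta\wedge\omega\wedge d\theta$ on $\mathscr R^{0,1}$, $i\theta\wedge\omega\wedge d\theta$ on $\mathscr R^{1,0}$, $-\theta\wedge\omega$ on $\mathscr R^{1,1}$, with $\star^2=1$; and $\partial_b^\ast=(-1)^{p+q}\star\overline\partial_b\star$, $\overline\partial_b^\ast=(-1)^{p+q}\star\partial_b\star$ on $\mathscr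 R^{p,q}$. The product of $\omega\in\mathscr R^{p,q}$ and $\tau\in\mathscr R^{r,s}$ is $\omega\bullet\tau:=\pi^{p+r,q+s}\pi(\omega\wedge\tau)\in\mathscr R^{p+r,q+s}$, where $\pi^{p,q}$ is the projection onto $\mathscr R^{p,q}$ and $\pi=1-d\Gamma-\Gamma d$; on $k$-forms, $\Gamma\omega=\theta\wedge\xi$ with $\theta\wedge\omega\wedge d\theta^{3-k}=\theta\wedge\xi\wedge d\theta^{4-k}$ if $k\le2$, and $\Gamma\omega=\theta\wedge\xi\wedge d\theta^{k-3}$ with $\theta\wedge\omega=\theta\wedge\xi\wedge d\theta^{k-2}$ if $k\ge3$. The Lee form is $\ell^\theta\equiv-iE_{\alpha\bar\beta}\theta^\alpha\wedge\theta^{\bar\beta}$ in $\mathscr R^{1,1}$. **Theorem 1.1.** For $\omega\in\mathscr R^{0,1}$ the formula $$(Q_{0,1}^{\overline\partial_b})^\theta\omega:=\star\partial_b^\ast\Bigl(\partial_b\partial_b^\ast+\overline\partial_b\overline\partial_b^\ast+\tfrac R6\bullet\Bigr)\partial_b\omega+2\,\ell^\theta\bullet\partial_b\omega-\partial_b(\omega\bullet\ell^\theta)$$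 gives a well-defined operator $\mathscr R^{0,1}\to\mathscr R^{2,2}$: admissible coframes exist near every point, and the result does not depend on the coframe; neither does $L_{0,1}^{\overline\partial_b}\omega:=i\partial_b\overline\partial_b\partial_b\omega$. Moreover, for every real $\Upsilon\in C^\infty(M)$ and every $\omega\in\mathscr R^{0,1}$ with $\overline\partial_b\omega=0$, $$(Q_{0,1}^{\overline\partial_b})^{e^\Upsilon\theta}\omega=(Q_{0,1}^{\overline\partial_b})^\theta\omega+L_{0,1}^{\overline\partial_b}(\Upsilon\omega),$$ where $\Upsilon\omega$ denotes $\Upsilon\bullet\omega=\pi(\Upsilon\omega)$, the element of $\mathscr R^{0,1}$ with components $\Upsilon u_{\bar\beta}$. -/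

import Mathlib

open scoped Manifold ContDiff TensorProduct

noncomputable section

namespace CRQ

/-! ### Exterior algebra of complex-valued forms on a real vector space -/

section LinearAlgebra

variable {V : Type*} [AddCommGroup V] [Module ℝ V]

/-- Real part of a complexified vector. -/
def reC (v : ℂ ⊗[ℝ] V) : V := TensorProduct.lid ℝ V (Complex.reLm.rTensor V v)

/-- Imaginary part of a complexified vector. -/
def imC (v : ℂ ⊗[ℝ] V) : V := TensorProduct.lid ℝ V (Complex.imLm.rTensor V v)

/-- Complex conjugation on `ℂ ⊗ V`. -/
def conjC (v : ℂ ⊗[ℝ] V) : ℂ ⊗[ℝ] V := Complex.conjAe.toLinearMap.rTensor V v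

/-- The complexified vector `X + iY`. -/
def mkC (X Y : V) : ℂ ⊗[ℝ] V := (1 : ℂ) ⊗ₜ[ℝ] X + Complex.I ⊗ₜ[ℝ] Y

variable [TopologicalSpace V]

/-- The `ℂ`-multilinear extension of a complex-valued `k`-form on `V`, evaluated on complexified
vectors: expand each argument as `re + i im`. -/
def evalC {k : ℕ} (η : V [⋀^Fin k]→L[ℝ] ℂ) (v : Fin k → ℂ ⊗[ℝ] V) : ℂ :=
  ∑ s : Finset (Fin k),
    Complex.I ^ s.card * η (fun j => if j ∈ s then imC (v j) else reC (v j))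

/-- The multilinear map `(v₁, …, v_{k+l}) ↦ η(v₁, …, v_k) τ(v_{k+1}, …, v_{k+l})`. -/
def tensorForm {k l : ℕ} (η : V [⋀^Fin k]→L[ℝ] ℂ) (τ : V [⋀^Fin l]→L[ℝ] ℂ) :
    ContinuousMultilinearMap ℝ (fun _ : Fin (k + l) => V) ℂ where
  toMultilinearMap :=
    ((LinearMap.mul' ℝ ℂ).compMultilinearMap
      (MultilinearMap.domCoprod η.toMultilinearMap τ.toMultilinearMap)).domDomCongr finSumFinEquiv
  cont := by
    have h : Continuous fun v : Fin (k + l) → V =>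
        η (fun i => v (Fin.castAdd l i)) * τ (fun j => v (Fin.natAdd k j)) :=
      (η.cont.comp (continuous_pi fun i => continuous_apply _)).mul
        (τ.cont.comp (continuous_pi fun i => continuous_apply _))
    exact h

theorem tensorForm_apply {k l : ℕ} (η : V [⋀^Fin k]→L[ℝ] ℂ) (τ : V [⋀^Fin l]→L[ℝ] ℂ)
    (v : Fin (k + l) → V) :
    tensorForm η τ v = η (fun i => v (Fin.castAdd l i)) * τ (fun j => v (Fin.natAdd k j)) :=
  rfl

/-- Exterior product, normalized so that `(α ∧ β)(u, v) = α(u) β(v) - α(v) β(u)` for one-forms. -/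
def wedge {k l : ℕ} (η : V [⋀^Fin k]→L[ℝ] ℂ) (τ : V [⋀^Fin l]→L[ℝ] ℂ) :
    V [⋀^Fin (k + l)]→L[ℝ] ℂ :=
  ((k.factorial : ℂ) * (l.factorial : ℂ))⁻¹ •
    ContinuousMultilinearMap.alternatization (tensorForm η τ)

/-- Complex conjugate of a complex-valued form. -/
def conjForm {k : ℕ} (η : V [⋀^Fin k]→L[ℝ] ℂ) : V [⋀^Fin k]→L[ℝ] ℂ :=
  (Complex.conjCLE : ℂ →L[ℝ] ℂ).compContinuousAlternatingMap η

end LinearAlgebra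

infixl:70 " ⋏ " => wedge

/-! ### Complex-valued forms and complex vector fields on a five-manifold -/

/-- The model space. -/
abbrev E5 : Type := EuclideanSpace ℝ (Fin 5)

section Manifold

variable {M : Type*} [TopologicalSpace M] [ChartedSpace E5 M] [IsManifold (𝓡 5) ∞ M]

variable (M) in
/-- A (not necessarily smooth) complex-valued differential `k`-form on `M`. -/
abbrev Form (k : ℕ) : Type _ := (x : M) → (TangentSpace (𝓡 5) x) [⋀^Fin k]→L[ℝ] ℂ

/-- The fibre of `TM ⊗ ℂ`. -/
abbrev CTangent (x : M) : Type := ℂ ⊗[ℝ] TangentSpace (𝓡 5) x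

variable (M) in
/-- A (not necessarily smooth) section of `TM ⊗ ℂ`. -/
abbrev CVectorField : Type _ := (x : M) → CTangent x

/-- The expression of a form in the preferred chart at `x`. -/
def chartRep {k : ℕ} (η : Form M k) (x : M) (y : E5) : E5 [⋀^Fin k]→L[ℝ] ℂ :=
  (η ((extChartAt (𝓡 5) x).symm y)).compContinuousLinearMap
    (mfderiv (𝓡 5) (𝓡 5) (extChartAt (𝓡 5) x).symm y)

/-- Smoothness of a form on a set (used for open sets). -/
def SmoothForm {k : ℕ} (η : Form M k) (U : Set M) : Prop :=
  ∀ x ∈ U, ContDiffAt ℝ ∞ (chartRep η x) (extChartAt (𝓡 5) x x)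

/-- Exterior derivative. -/
def extD {k : ℕ} (η : Form M k) : Form M (k + 1) := fun x =>
  (extDeriv (chartRep η x) (extChartAt (𝓡 5) x x)).compContinuousLinearMap
    (mfderiv (𝓡 5) (𝓡 5) (extChartAt (𝓡 5) x) x)

/-- Smoothness of a complex-valued function on a set. -/
def SmoothFun (f : M → ℂ) (U : Set M) : Prop := ContMDiffOn (𝓡 5) 𝓘(ℝ, ℂ) ∞ f U

/-- Smoothness of a real vector field on a set. -/
def SmoothVF (X : (x : M) → TangentSpace (𝓡 5) x) (U : Set M) : Prop :=
  ContMDiffOn (𝓡 5) (𝓡 5).tangent ∞ (fun x => (⟨x, X x⟩ : TangentBundle (𝓡 5) M)) U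

/-- Smoothness of a complex vector field on a set. -/
def SmoothCVF (Z : CVectorField M) (U : Set M) : Prop :=
  SmoothVF (fun x => reC (Z x)) U ∧ SmoothVF (fun x => imC (Z x)) U

/-- The `ℂ`-bilinear extension of the Lie bracket to complex vector fields. -/
def cBracket (Z W : CVectorField M) : CVectorField M := fun x =>
  let X := fun y => reC (Z y)
  let Y := fun y => imC (Z y)
  let X' := fun y => reC (W y)
  let Y' := fun y => imC (W y)
  mkC (VectorField.mlieBracket (𝓡 5) X X' x - VectorField.mlieBracket (𝓡 5) Y Y' x)
    (VectorField.mlieBracket (𝓡 5) X Y' x + VectorField.mlieBracket (𝓡 5) Y X' x)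

/-- The differential of a complex-valued function. -/
def diffFun (f : M → ℂ) (x : M) : TangentSpace (𝓡 5) x →L[ℝ] ℂ := mfderiv (𝓡 5) 𝓘(ℝ, ℂ) f x

/-- The derivative of a complex-valued function at `x` along a complexified tangent vector. -/
def derivC (f : M → ℂ) (x : M) (v : CTangent x) : ℂ :=
  diffFun f x (reC v) + Complex.I * diffFun f x (imC v)

/-! ### CR structures and contact forms -/

/-- `θ` is a contact form for `T10`: a smooth real one-form with kernel
`H = Re (T10 ⊕ conj T10)`. -/
structure IsContactForm (T10 : (x : M) → Submodule ℂ (CTangent x)) (θ : Form M 1) : Prop where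
  smooth : SmoothForm θ Set.univ
  real : ∀ x, conjForm (θ x) = θ x
  ker : ∀ (x : M) (v : TangentSpace (𝓡 5) x),
    θ x ![v] = 0 ↔ ∃ Z ∈ T10 x, mkC v 0 = Z + conjC Z

/-- The Levi form `(Z, W) ↦ -i dθ(Z, conj W)`. -/
def leviForm (θ : Form M 1) (x : M) (Z W : CTangent x) : ℂ :=
  -Complex.I * evalC (extD θ x) ![Z, conjC W]

variable (M) in
/-- A nondegenerate CR structure of hypersurface type on the five-manifold `M`. -/
structure CRStructure where
  T10 : (x : M) → Submodule ℂ (CTangent x)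
  locally_framed : ∀ x, ∃ U : Set M, IsOpen U ∧ x ∈ U ∧ ∃ Z : Fin 2 → CVectorField M,
    (∀ α, SmoothCVF (Z α) U) ∧ ∀ y ∈ U, LinearIndependent ℂ (fun α => Z α y) ∧
      Submodule.span ℂ (Set.range fun α => Z α y) = T10 y
  transverse : ∀ x, ∀ Z ∈ T10 x, conjC Z ∈ T10 x → Z = 0
  involutive : ∀ U : Set M, IsOpen U → ∀ Z W : CVectorField M, SmoothCVF Z U → SmoothCVF W U →
    (∀ x ∈ U, Z x ∈ T10 x) → (∀ x ∈ U, W x ∈ T10 x) → ∀ x ∈ U, cBracket Z W x ∈ T10 x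
  nondegenerate : ∀ θ : Form M 1, IsContactForm T10 θ → ∀ x, ∀ Z ∈ T10 x,
    (∀ W ∈ T10 x, leviForm θ x Z W = 0) → Z = 0

/-- The one-form `e^Υ θ`. -/
def rescale (Υ : M → ℝ) (θ : Form M 1) : Form M 1 := fun x => (Real.exp (Υ x) : ℂ) • θ x

/-! ### The projection onto the Rumin complex

`Γ` is the pointwise map determined by `θ ∧ η ∧ dθ^(3-k) = Γη ∧ dθ^(4-k)` for `k ≤ 2` and by
`θ ∧ η = θ ∧ ξ ∧ dθ^(k-2)`, `Γη = θ ∧ ξ ∧ dθ^(k-3)`, for `k ≥ 3`.  It vanishes for `k ≤ 1` and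
for `k = 5`. -/

section Projection

variable (θ : Form M 1)

open Classical in
/-- `Γ` on two-forms. -/
def gamma2 (η : Form M 2) : Form M 1 := fun x =>
  if h : ∃ f : ℂ, θ x ⋏ η x ⋏ extD θ x = f • (θ x ⋏ extD θ x ⋏ extD θ x) then
    h.choose • θ x else 0

open Classical in
/-- `Γ` on three-forms. -/
def gamma3 (η : Form M 3) : Form M 2 := fun x =>
  if h : ∃ ξ : (TangentSpace (𝓡 5) x) [⋀^Fin 1]→L[ℝ] ℂ, θ x ⋏ η x = θ x ⋏ ξ ⋏ extD θ x then
    θ x ⋏ h.choose else 0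

open Classical in
/-- `Γ` on four-forms. -/
def gamma4 (η : Form M 4) : Form M 3 := fun x =>
  if h : ∃ f : ℂ, θ x ⋏ η x = f • (θ x ⋏ extD θ x ⋏ extD θ x) then
    h.choose • (θ x ⋏ extD θ x) else 0

/-- `π = 1 - dΓ - Γd` on one-forms. -/
def pi1 (η : Form M 1) : Form M 1 := η - gamma2 θ (extD η)

/-- `π = 1 - dΓ - Γd` on two-forms. -/
def pi2 (η : Form M 2) : Form M 2 := η - extD (gamma2 θ η) - gamma3 θ (extD η)

/-- `π = 1 - dΓ - Γd` on three-forms. -/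
def pi3 (η : Form M 3) : Form M 3 := η - extD (gamma3 θ η) - gamma4 θ (extD η)

/-- `π = 1 - dΓ - Γd` on four-forms. -/
def pi4 (η : Form M 4) : Form M 4 := η - extD (gamma4 θ η)

end Projection

/-! ### Admissible coframes and the Tanaka–Webster connection -/

/-- An admissible coframe `θ^α = φ α` on an open set `U`, with its dual frame `Z α` of `T10` and
the Reeb vector field `T`. -/
structure AdmissibleCoframe (S : CRStructure M) (θ : Form M 1) where
  U : Set M
  isOpen_U : IsOpen U
  T : (x : M) → TangentSpace (𝓡 5) x
  T_smooth : SmoothVF T U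
  theta_T : ∀ x ∈ U, θ x ![T x] = 1
  dtheta_T : ∀ x ∈ U, ∀ v : TangentSpace (𝓡 5) x, extD θ x ![T x, v] = 0
  φ : Fin 2 → Form M 1
  φ_smooth : ∀ α, SmoothForm (φ α) U
  φ_T : ∀ α, ∀ x ∈ U, φ α x ![T x] = 0
  φ_conj : ∀ α, ∀ x ∈ U, ∀ W ∈ S.T10 x, evalC (φ α x) ![conjC W] = 0
  Z : Fin 2 → CVectorField M
  Z_smooth : ∀ α, SmoothCVF (Z α) U
  Z_mem : ∀ α, ∀ x ∈ U, Z α x ∈ S.T10 x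
  φ_Z : ∀ α β, ∀ x ∈ U, evalC (φ α x) ![Z β x] = if α = β then 1 else 0

/-- An admissible coframe together with the quantities that it determines: the Levi matrix
`h x α β = h_{αβ̄}`, the connection forms `conn α γ = ω_α{}^γ` and the torsion
`tors α β = A^α{}_{β̄}`, characterized by the structure equations. -/
structure PHFrame (S : CRStructure M) (θ : Form M 1) extends AdmissibleCoframe S θ where
  h : M → Matrix (Fin 2) (Fin 2) ℂ
  h_smooth : ∀ α β, SmoothFun (fun x => h x α β) U
  dtheta_eq : ∀ x ∈ U,
    extD θ x = ∑ α, ∑ β, (Complex.I * h x α β) • (φ α x ⋏ conjForm (φ β x))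
  conn : Fin 2 → Fin 2 → Form M 1
  conn_smooth : ∀ α γ, SmoothForm (conn α γ) U
  tors : Fin 2 → Fin 2 → M → ℂ
  tors_smooth : ∀ α β, SmoothFun (tors α β) U
  dφ_eq : ∀ α, ∀ x ∈ U, extD (φ α) x =
    ∑ μ, φ μ x ⋏ conn μ α x + ∑ β, tors α β x • (θ x ⋏ conjForm (φ β x))
  dh_eq : ∀ α β, ∀ x ∈ U, ∀ v : TangentSpace (𝓡 5) x,
    diffFun (fun y => h y α β) x v =
      ∑ γ, h x γ β * conn α γ x ![v] + ∑ γ, h x α γ * conjForm (conn β γ x) ![v]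
  tors_symm : ∀ β γ, ∀ x ∈ U, ∑ α, h x α γ * tors α β x = ∑ α, h x α β * tors α γ x

namespace PHFrame

variable {S : CRStructure M} {θ : Form M 1} (F : PHFrame S θ)

/-! Components of tensors are functions of indices in `Fin 2`.  An index of differentiation is
`Sum.inl α` for `α` and `Sum.inr α` for `ᾱ`. -/

/-- The frame field `Z_α` or `Z_ᾱ`. -/
def frame (c : Fin 2 ⊕ Fin 2) : CVectorField M :=
  Sum.elim F.Z (fun α x => conjC (F.Z α x)) c

/-- `h^{μν̄}`, so that `∑ ν, h^{μν̄} h_{γν̄} = δ^μ_γ`. -/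
def hInv (μ ν : Fin 2) (x : M) : ℂ := (F.h x)⁻¹ ν μ

/-- `ω_α{}^μ(Z_c)`. -/
def chr (c : Fin 2 ⊕ Fin 2) (α μ : Fin 2) (x : M) : ℂ :=
  evalC (F.conn α μ x) ![F.frame c x]

/-- `ω_ᾱ{}^μ̄(Z_c)`, where `ω_ᾱ{}^μ̄` is the conjugate of `ω_α{}^μ`. -/
def chrBar (c : Fin 2 ⊕ Fin 2) (α μ : Fin 2) (x : M) : ℂ :=
  evalC (conjForm (F.conn α μ x)) ![F.frame c x]

/-- `∇_c v_α`. -/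
def cov10 (v : Fin 2 → M → ℂ) (c : Fin 2 ⊕ Fin 2) (α : Fin 2) (x : M) : ℂ :=
  derivC (v α) x (F.frame c x) - ∑ μ, F.chr c α μ x * v μ x

/-- `∇_c u_β̄`. -/
def cov01 (u : Fin 2 → M → ℂ) (c : Fin 2 ⊕ Fin 2) (β : Fin 2) (x : M) : ℂ :=
  derivC (u β) x (F.frame c x) - ∑ μ, F.chrBar c β μ x * u μ x

/-- `∇_c w_{αβ̄}`. -/
def cov11 (w : Fin 2 → Fin 2 → M → ℂ) (c : Fin 2 ⊕ Fin 2) (α β : Fin 2) (x : M) : ℂ :=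
  derivC (w α β) x (F.frame c x) - ∑ μ, F.chr c α μ x * w μ β x
    - ∑ μ, F.chrBar c β μ x * w α μ x

/-- `∇_c w_{ᾱβ̄}`. -/
def cov02 (w : Fin 2 → Fin 2 → M → ℂ) (c : Fin 2 ⊕ Fin 2) (α β : Fin 2) (x : M) : ℂ :=
  derivC (w α β) x (F.frame c x) - ∑ μ, F.chrBar c α μ x * w μ β x
    - ∑ μ, F.chrBar c β μ x * w α μ x

/-- `∇^μ v_μ`. -/
def div10 (v : Fin 2 → M → ℂ) (x : M) : ℂ :=
  ∑ μ, ∑ ν, F.hInv μ ν x * F.cov10 v (.inr ν) μ x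

/-- `∇^ν̄ u_ν̄`. -/
def div01 (u : Fin 2 → M → ℂ) (x : M) : ℂ :=
  ∑ μ, ∑ ν, F.hInv μ ν x * F.cov01 u (.inl μ) ν x

/-- `∇^μ w_{μβ̄}`. -/
def div11 (w : Fin 2 → Fin 2 → M → ℂ) (β : Fin 2) (x : M) : ℂ :=
  ∑ μ, ∑ ν, F.hInv μ ν x * F.cov11 w (.inr ν) μ β x

/-- `∇^ν̄ w_{αν̄}`. -/
def divBar11 (w : Fin 2 → Fin 2 → M → ℂ) (α : Fin 2) (x : M) : ℂ :=
  ∑ μ, ∑ ν, F.hInv μ ν x * F.cov11 w (.inl μ) α ν x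

/-- `∇^ν̄ w_{ν̄β̄}`. -/
def divBar02 (w : Fin 2 → Fin 2 → M → ℂ) (β : Fin 2) (x : M) : ℂ :=
  ∑ μ, ∑ ν, F.hInv μ ν x * F.cov02 w (.inl μ) ν β x

/-! #### Curvature -/

/-- The curvature form `Ω_α{}^γ = dω_α{}^γ - ω_α{}^μ ∧ ω_μ{}^γ`. -/
def curvForm (α γ : Fin 2) : Form M 2 := fun x =>
  extD (F.conn α γ) x - ∑ μ, F.conn α μ x ⋏ F.conn μ γ x

/-- `R_α{}^γ{}_{ρσ̄}`, the coefficient of `θ^ρ ∧ θ^σ̄` in `Ω_α{}^γ`. -/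
def curv (α γ ρ σ : Fin 2) (x : M) : ℂ :=
  evalC (F.curvForm α γ x) ![F.Z ρ x, conjC (F.Z σ x)]

/-- The pseudohermitian Ricci tensor `R_{αβ̄} = R_{αβ̄μ}{}^μ`. -/
def ricci (α β : Fin 2) (x : M) : ℂ :=
  ∑ γ, ∑ μ, ∑ ν, F.h x γ β * F.curv α γ μ ν x * F.hInv μ ν x

/-- The pseudohermitian scalar curvature. -/
def scal (x : M) : ℂ := ∑ α, ∑ β, F.hInv α β x * F.ricci α β x

/-- `E_{αβ̄} = (R_{αβ̄} - (R/2) h_{αβ̄}) / 4`. -/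
def tfRicci (α β : Fin 2) (x : M) : ℂ :=
  (1 / 4) * (F.ricci α β x - F.scal x / 2 * F.h x α β)

/-- Components of the Lee form `ℓ^θ ≡ -i E_{αβ̄} θ^α ∧ θ^β̄` in `R^{1,1}`. -/
def lee (α β : Fin 2) (x : M) : ℂ := -Complex.I * F.tfRicci α β x

/-! #### Elements of the bigraded Rumin complex with given components -/

/-- `θ^β̄`. -/
def φbar (β : Fin 2) : Form M 1 := fun x => conjForm (F.φ β x)

/-- `u_β̄ θ^β̄ + (i/2) ∇^ν̄ u_ν̄ θ`, the element of `R^{0,1}` with components `u`. -/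
def form01 (u : Fin 2 → M → ℂ) : Form M 1 := fun x =>
  ∑ β, u β x • F.φbar β x + (Complex.I / 2 * F.div01 u x) • θ x

/-- `w_{αβ̄} θ^α ∧ θ^β̄ - i ∇^μ w_{μβ̄} θ ∧ θ^β̄ - i ∇^ν̄ w_{αν̄} θ ∧ θ^α`, the element of `R^{1,1}`
with (trace-free) components `w`. -/
def form11 (w : Fin 2 → Fin 2 → M → ℂ) : Form M 2 := fun x =>
  ∑ α, ∑ β, w α β x • (F.φ α x ⋏ F.φbar β x)
    - ∑ β, (Complex.I * F.div11 w β x) • (θ x ⋏ F.φbar β x)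
    - ∑ α, (Complex.I * F.divBar11 w α x) • (θ x ⋏ F.φ α x)

/-- `c_β̄ θ ∧ θ^β̄ ∧ dθ`, the element of `R^{2,2}` with components `c`. -/
def form22 (c : Fin 2 → M → ℂ) : Form M 4 := fun x =>
  ∑ β, c β x • (θ x ⋏ F.φbar β x ⋏ extD θ x)

/-- The `(0,1)`-components `σ(Z_β̄)` of a one-form. -/
def comp01 (σ : Form M 1) (β : Fin 2) (x : M) : ℂ := evalC (σ x) ![conjC (F.Z β x)]

/-- The `(1,1)`-components `σ(Z_α, Z_β̄)` of a two-form. -/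
def comp11 (σ : Form M 2) (α β : Fin 2) (x : M) : ℂ :=
  evalC (σ x) ![F.Z α x, conjC (F.Z β x)]

/-- The components `c_{ᾱβ̄}` of the part `(1/2) c_{ᾱβ̄} θ ∧ θ^ᾱ ∧ θ^β̄` in `R^{1,2}` of an element
of `R^3`. -/
def comp12 (σ : Form M 3) (α β : Fin 2) (x : M) : ℂ :=
  evalC (σ x) ![mkC (F.T x) 0, conjC (F.Z α x), conjC (F.Z β x)]

/-- The components `c_β̄` of the part `c_β̄ θ ∧ θ^β̄ ∧ dθ` in `R^{2,2}` of an element of `R^4`,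
i.e. of a sum `a_α θ ∧ θ^α ∧ dθ + c_β̄ θ ∧ θ^β̄ ∧ dθ`.  Here
`(θ ∧ θ^σ̄ ∧ dθ)(T, Z_β̄, Z_μ, Z_ν̄) = i δ^σ_β h_{μν̄} - i δ^σ_ν h_{μβ̄}`, whose trace over `μ, ν`
is `i δ^σ_β`. -/
def comp22 (σ : Form M 4) (β : Fin 2) (x : M) : ℂ :=
  -Complex.I * ∑ μ, ∑ ν, F.hInv μ ν x *
    evalC (σ x) ![mkC (F.T x) 0, conjC (F.Z β x), F.Z μ x, conjC (F.Z ν x)]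

/-! #### The operators of the bigraded Rumin complex, in components

Components of `R^{0,2}`, `R^{2,1}`, `R^{1,2}` and `R^{3,1}` refer to
`(1/2) c_{ᾱβ̄} θ^ᾱ ∧ θ^β̄` (modulo `θ`), `w_{αβ̄} θ ∧ θ^α ∧ θ^β̄`,
`(1/2) c_{ᾱβ̄} θ ∧ θ^ᾱ ∧ θ^β̄` and `v_α θ ∧ θ^α ∧ dθ`. -/

/-- `∂_b : R^{0,1} → R^{1,1}`. -/
def db01 (u : Fin 2 → M → ℂ) (α β : Fin 2) (x : M) : ℂ :=
  F.cov01 u (.inl α) β x - 1 / 2 * F.h x α β * F.div01 u x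

/-- `∂̄_b : R^{0,1} → R^{0,2}`. -/
def dbbar01 (u : Fin 2 → M → ℂ) (β σ : Fin 2) (x : M) : ℂ :=
  F.cov01 u (.inr β) σ x - F.cov01 u (.inr σ) β x

/-- `∂̄_b : R^{1,0} → R^{1,1}`. -/
def dbbar10 (v : Fin 2 → M → ℂ) (α β : Fin 2) (x : M) : ℂ :=
  -(F.cov10 v (.inr β) α x - 1 / 2 * F.h x α β * F.div10 v x)

/-- `∇_β̄ ∇^μ w_{μσ̄} - i A_β̄{}^μ w_{μσ̄}`; here `A_β̄{}^μ = A^μ{}_β̄` by symmetry. -/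
def dbbar11Aux (w : Fin 2 → Fin 2 → M → ℂ) (β σ : Fin 2) (x : M) : ℂ :=
  F.cov01 (F.div11 w) (.inr β) σ x - Complex.I * ∑ μ, F.tors μ β x * w μ σ x

/-- `∂̄_b : R^{1,1} → R^{1,2}`,
`w ↦ i (∇_β̄ ∇^μ w_{μσ̄} - i A_β̄{}^μ w_{μσ̄}) θ ∧ θ^β̄ ∧ θ^σ̄`. -/
def dbbar11 (w : Fin 2 → Fin 2 → M → ℂ) (β σ : Fin 2) (x : M) : ℂ :=
  Complex.I * (F.dbbar11Aux w β σ x - F.dbbar11Aux w σ β x)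

/-- `∂_b : R^{1,2} → R^{2,2}`. -/
def db12 (c : Fin 2 → Fin 2 → M → ℂ) (β : Fin 2) (x : M) : ℂ := Complex.I * F.divBar02 c β x

/-- `∂̄_b : R^{2,1} → R^{2,2}`. -/
def dbbar21 (w : Fin 2 → Fin 2 → M → ℂ) (β : Fin 2) (x : M) : ℂ := -Complex.I * F.div11 w β x

/-- `∂_b : R^{2,1} → R^{3,1}`. -/
def db21 (w : Fin 2 → Fin 2 → M → ℂ) (α : Fin 2) (x : M) : ℂ := -Complex.I * F.divBar11 w α x

/-! The Hodge star operator is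
`⋆η = (-1)^(k(k+1)/2) / (2-k)! θ ∧ Jη ∧ dθ^(2-k)`, `J = i^(q-p)`, on `R^{p,q}` with `k = p+q ≤ 2`,
and its inverse on `R^{p,q}` with `p+q ≥ 3`. -/

/-- `⋆η = -i θ ∧ η ∧ dθ`, from `R^{0,1}` to `R^{2,2}`. -/
def star01 (u : Fin 2 → M → ℂ) (β : Fin 2) (x : M) : ℂ := -Complex.I * u β x

/-- The inverse of `⋆ : R^{0,1} → R^{2,2}`. -/
def star22 (c : Fin 2 → M → ℂ) (β : Fin 2) (x : M) : ℂ := Complex.I * c β x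

/-- `⋆η = -θ ∧ η`, from `R^{1,1}` to `R^{2,1}`. -/
def star11 (w : Fin 2 → Fin 2 → M → ℂ) (α β : Fin 2) (x : M) : ℂ := -w α β x

/-- The inverse of `⋆ : R^{1,0} → R^{3,1}`, `⋆η = i θ ∧ η ∧ dθ`. -/
def star31 (v : Fin 2 → M → ℂ) (α : Fin 2) (x : M) : ℂ := -Complex.I * v α x

/-- `∂_b^* = (-1)^(p+q) ⋆ ∂̄_b ⋆ : R^{1,1} → R^{0,1}`. -/
def dbStar11 (w : Fin 2 → Fin 2 → M → ℂ) : Fin 2 → M → ℂ := star22 (F.dbbar21 (star11 w))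

/-- `∂̄_b^* = (-1)^(p+q) ⋆ ∂_b ⋆ : R^{1,1} → R^{1,0}`. -/
def dbbarStar11 (w : Fin 2 → Fin 2 → M → ℂ) : Fin 2 → M → ℂ := star31 (F.db21 (star11 w))

/-! The product of `η ∈ R^{p,q}` and `τ ∈ R^{r,s}` in `R^{p+r,q+s}` is the part of type
`(p+r, q+s)` of `π(η ∧ τ)`. -/

/-- The product `R^{0,0} × R^{1,1} → R^{1,1}`. -/
def prod00_11 (f : M → ℂ) (w : Fin 2 → Fin 2 → M → ℂ) : Fin 2 → Fin 2 → M → ℂ :=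
  F.comp11 (pi2 θ fun x => f x • F.form11 w x)

/-- The product `R^{0,1} × R^{1,1} → R^{1,2}`. -/
def prod01_11 (u : Fin 2 → M → ℂ) (w : Fin 2 → Fin 2 → M → ℂ) : Fin 2 → Fin 2 → M → ℂ :=
  F.comp12 (pi3 θ fun x => F.form01 u x ⋏ F.form11 w x)

/-- The product `R^{1,1} × R^{1,1} → R^{2,2}`. -/
def prod11_11 (w w' : Fin 2 → Fin 2 → M → ℂ) : Fin 2 → M → ℂ :=
  F.comp22 (pi4 θ fun x => F.form11 w x ⋏ F.form11 w' x)

/-- Components of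
`⋆ ∂_b^* (∂_b ∂_b^* + ∂̄_b ∂̄_b^* + R/6) ∂_b η + 2 ℓ^θ · ∂_b η - ∂_b (η · ℓ^θ)` for the form
`η ∈ R^{0,1}` with components `u`. -/
def qComp (u : Fin 2 → M → ℂ) : Fin 2 → M → ℂ :=
  let w := F.db01 u
  star01 (F.dbStar11 (F.db01 (F.dbStar11 w) + F.dbbar10 (F.dbbarStar11 w)
      + F.prod00_11 (fun x => F.scal x / 6) w))
    + (2 : ℂ) • F.prod11_11 F.lee w - F.db12 (F.prod01_11 u F.lee)

/-- Components of `i ∂_b ∂̄_b ∂_b η` for the form `η ∈ R^{0,1}` with components `u`. -/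
def lComp (u : Fin 2 → M → ℂ) : Fin 2 → M → ℂ :=
  Complex.I • F.db12 (F.dbbar11 (F.db01 u))

end PHFrame

/-! ### Global objects -/

/-- `η` belongs to `R^{0,1}`. -/
def IsR01 (S : CRStructure M) (θ : Form M 1) (η : Form M 1) : Prop :=
  ∀ F : PHFrame S θ, ∃ u : Fin 2 → M → ℂ,
    (∀ β, SmoothFun (u β) F.U) ∧ ∀ x ∈ F.U, η x = F.form01 u x

/-- `η` belongs to `R^{2,2}`. -/
def IsR22 (S : CRStructure M) (θ : Form M 1) (η : Form M 4) : Prop :=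
  ∀ F : PHFrame S θ, ∃ c : Fin 2 → M → ℂ,
    (∀ β, SmoothFun (c β) F.U) ∧ ∀ x ∈ F.U, η x = F.form22 c x

/-- `∂̄_b η = 0` for `η ∈ R^{0,1}`. -/
def IsDbbarClosed (S : CRStructure M) (θ : Form M 1) (η : Form M 1) : Prop :=
  ∀ F : PHFrame S θ, ∀ x ∈ F.U, ∀ β σ, F.dbbar01 (F.comp01 η) β σ x = 0

open Classical in
/-- The form whose value at `x` is computed in an admissible coframe near `x`. -/
def globalize {k : ℕ} (S : CRStructure M) (θ : Form M 1) (f : PHFrame S θ → Form M k) :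
    Form M k := fun x =>
  if h : ∃ F : PHFrame S θ, x ∈ F.U then f h.choose x else 0

/-- The operator `Q_{0,1}^{∂̄_b} : R^{0,1} → R^{2,2}` of `θ`. -/
def Q01 (S : CRStructure M) (θ : Form M 1) (η : Form M 1) : Form M 4 :=
  globalize S θ fun F => F.form22 (F.qComp (F.comp01 η))

/-- The operator `L_{0,1}^{∂̄_b} = i ∂_b ∂̄_b ∂_b : R^{0,1} → R^{2,2}`. -/
def L01 (S : CRStructure M) (θ : Form M 1) (η : Form M 1) : Form M 4 :=
  globalize S θ fun F => F.form22 (F.lComp (F.comp01 η))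

/-- The product `π(Υη)` of a function with an element of `R^{0,1}`. -/
def mul01 (θ : Form M 1) (Υ : M → ℝ) (η : Form M 1) : Form M 1 :=
  pi1 θ fun x => (Υ x : ℂ) • η x

end Manifold

end CRQ

end

open scoped Manifold ContDiff TensorProduct

noncomputable section

namespace CRQ

set_option linter.unusedSectionVars false

open Complex (I exp I_mul_I I_ne_zero I_sq conj_I exp_add)
open Derivation (leibniz)
open TopologicalSpace (Opens)

local notation "ι" => Fin 2
local notation "ff" => false
local notation "tt" => true
local notation "TM" => TangentSpace (𝓡 5)
local notation "χ" => extChartAt (𝓡 5)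

lemma sum_two {A : Type*} [AddCommMonoid A] (f : ι → A) : ∑ i, f i = f 0 + f 1 :=
  Fin.sum_univ_two f

lemma leib {A : Type*} [CommRing A] [Algebra ℂ A] (D : Derivation ℂ A A) (a b : A) :
    D (a * b) = a * D b + b * D a := D.leibniz a b

/-- `θ` is a contact form of the CR structure `S`. -/
abbrev CRStructure.Contact {M : Type*} [TopologicalSpace M] [ChartedSpace E5 M]
    [IsManifold (𝓡 5) ∞ M] (S : CRStructure M) (θ : Form M 1) : Prop := IsContactForm S.T10 θ

/-! ### Covariant derivatives of component functions, algebraically -/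

section Algebra

variable {A : Type*} [CommRing A]

/-- The action of the connection matrix `g` on an upper (`tt`) or lower (`ff`) index. -/
def kap (s : Bool) (g : ι → ι → A) (i m : ι) : A :=
  match s with
  | true => g m i
  | false => -g i m

lemma kap_true (g : ι → ι → A) (i m : ι) : kap tt g i m = g m i := rfl

lemma kap_false (g : ι → ι → A) (i m : ι) : kap ff g i m = -g i m := rfl

/-- Kronecker symbol. -/
def dl (i j : ι) : A := if i = j then 1 else 0

lemma dl_comm (i j : ι) : (dl i j : A) = dl j i := by simp [dl, eq_comm]

lemma dl_00 : (dl 0 0 : A) = 1 := rfl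
lemma dl_11 : (dl 1 1 : A) = 1 := rfl
lemma dl_01 : (dl 0 1 : A) = 0 := rfl
lemma dl_10 : (dl 1 0 : A) = 0 := rfl

variable [Algebra ℂ A]

/-- Covariant derivative along `X` of a tensor with one index, on which the connection acts through
the matrix `k`. -/
def c1 (X : Derivation ℂ A A) (k : ι → ι → A) (u : ι → A) (i : ι) : A :=
  X (u i) + ∑ m, k i m * u m

/-- Covariant derivative of a tensor with two indices. -/
def c2 (X : Derivation ℂ A A) (k l : ι → ι → A) (w : ι → ι → A) (i j : ι) : A :=
  X (w i j) + ∑ m, k i m * w m j + ∑ m, l j m * w i m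

/-- Covariant derivative of a tensor with three indices. -/
def c3 (X : Derivation ℂ A A) (k l r : ι → ι → A) (w : ι → ι → ι → A)
    (i j n : ι) : A :=
  X (w i j n) + ∑ m, k i m * w m j n + ∑ m, l j m * w i m n + ∑ m, r n m * w i j m

variable (A) in
/-- The imaginary unit of a complex algebra. -/
def jj : A := algebraMap ℂ A I

variable (A) in
/-- One half in a complex algebra. -/
def hh : A := algebraMap ℂ A (1 / 2)

lemma two_mul_cancel_of_algebra {x y : A} (h : 2 * x = 2 * y) : x = y := by
  have h2 : algebraMap ℂ A (1 / 2) * 2 = 1 := by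
    rw [← map_ofNat (algebraMap ℂ A) 2, ← map_mul]; norm_num
  linear_combination (algebraMap ℂ A (1 / 2)) * h - (x - y) * h2

lemma two_mul_hh : 2 * hh A = 1 := by
  rw [hh, ← map_ofNat (algebraMap ℂ A) 2, ← map_mul]; norm_num

lemma jj_mul_jj : jj A * jj A = -1 := by
  rw [jj, ← map_mul, I_mul_I]; simp

@[simp] theorem derivation_jj (X : Derivation ℂ A A) : X (jj A) = 0 := X.map_algebraMap _
@[simp] theorem derivation_hh (X : Derivation ℂ A A) : X (hh A) = 0 := X.map_algebraMap _

@[simp] theorem derivation_dl (X : Derivation ℂ A A) (i j : ι) : X (dl i j : A) = 0 := by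
  unfold dl; split_ifs <;> simp

variable (A) in
/-- The torsion coefficient of two frame fields in the direction of the Reeb field. -/
def tp (a b : Bool) (i j : ι) : A :=
  match a, b with
  | false, true => -jj A * dl i j
  | true, false => jj A * dl i j
  | _, _ => 0

variable (A) in
/-- A frame of derivations `E ff i = Z_i`, `E tt i = Z^i`, `T` together with the coefficients
of a connection and torsion obeying the structure equations of a pseudohermitian structure, with
all indices referred to `Z_i`. -/
structure Web where
  E : Bool → ι → Derivation ℂ A A
  T : Derivation ℂ A A
  G : Bool → ι → ι → ι → A
  Gt : ι → ι → A
  Tor : Bool → ι → ι → A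
  Tor_symm : ∀ a i j, Tor a i j = Tor a j i
  comm : ∀ a b i j f, E a i (E b j f) - E b j (E a i f) =
    -(∑ k, kap b (G a i) j k * E b k f) + ∑ k, kap a (G b j) i k * E a k f + tp A a b i j * T f
  commT : ∀ a i f, T (E a i f) - E a i (T f) =
    -(∑ k, kap a Gt i k * E a k f) - ∑ k, Tor a i k * E (!a) k f
  indep : ∀ (x y : ι → A) (z : A),
    (∀ f, ∑ k, x k * E ff k f + ∑ k, y k * E tt k f + z * T f = 0) →
      (∀ k, x k = 0) ∧ (∀ k, y k = 0) ∧ z = 0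

namespace Web

variable (W : Web A)

/-- `∇_{a,i}` of a tensor with one index of type `s`. -/
def d1 (s a : Bool) (i : ι) (u : ι → A) (n : ι) : A :=
  c1 (W.E a i) (kap s (W.G a i)) u n

/-- `∇_{a,i}` of a tensor with two indices of types `s, t`. -/
def d2 (s t a : Bool) (i : ι) (w : ι → ι → A) (m n : ι) : A :=
  c2 (W.E a i) (kap s (W.G a i)) (kap t (W.G a i)) w m n

/-- `∇_{a,i}` of a tensor with three indices of types `s, t, r`. -/
def d3 (s t r a : Bool) (i : ι) (w : ι → ι → ι → A) (l m n : ι) : A :=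
  c3 (W.E a i) (kap s (W.G a i)) (kap t (W.G a i)) (kap r (W.G a i)) w l m n

/-- `∇_T` of a tensor with one index. -/
def t1 (s : Bool) (u : ι → A) (n : ι) : A := c1 W.T (kap s W.Gt) u n

/-- `∇_T` of a tensor with two indices. -/
def t2 (s t : Bool) (w : ι → ι → A) (m n : ι) : A :=
  c2 W.T (kap s W.Gt) (kap t W.Gt) w m n

/-- Curvature on a pair of frame fields. -/
def Om (a : Bool) (i : ι) (b : Bool) (j : ι) (α γ : ι) : A :=
  W.E a i (W.G b j α γ) - W.E b j (W.G a i α γ)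
    - (-(∑ k, kap b (W.G a i) j k * W.G b k α γ) + ∑ k, kap a (W.G b j) i k * W.G a k α γ
      + tp A a b i j * W.Gt α γ)
    - ∑ μ, (W.G a i α μ * W.G b j μ γ - W.G b j α μ * W.G a i μ γ)

/-- Curvature on the Reeb field and a frame field. -/
def OmT (a : Bool) (i : ι) (α γ : ι) : A :=
  W.T (W.G a i α γ) - W.E a i (W.Gt α γ)
    - (-(∑ k, kap a W.Gt i k * W.G a k α γ) - ∑ k, W.Tor a i k * W.G (!a) k α γ)
    - ∑ μ, (W.Gt α μ * W.G a i μ γ - W.G a i α μ * W.Gt μ γ)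

lemma comm0 (a b : Bool) (i j : ι) (f : A) :
    W.d1 b a i (fun m => W.E b m f) j - W.d1 a b j (fun m => W.E a m f) i
      = tp A a b i j * W.T f := by
  have h := W.comm a b i j f
  simp only [d1, c1]
  linear_combination h

lemma commT0 (a : Bool) (i : ι) (f : A) :
    W.t1 a (fun m => W.E a m f) i - W.E a i (W.T f) = -∑ k, W.Tor a i k * W.E (!a) k f := by
  have h := W.commT a i f
  simp only [t1, c1]
  linear_combination h

lemma comm1 (s a b : Bool) (i j : ι) (u : ι → A) (n : ι) :
    W.d2 b s a i (fun m => W.d1 s b m u) j n - W.d2 a s b j (fun m => W.d1 s a m u) i n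
      = tp A a b i j * W.t1 s u n + ∑ m, kap s (W.Om a i b j) n m * u m := by
  have h := W.comm a b i j (u n)
  simp only [d2, d1, c1, c2, t1, sum_two, map_add, leib] at h ⊢
  cases s <;> simp only [kap_true, kap_false, map_neg, Om, sum_two] <;>
    linear_combination h

lemma comm2 (s t a b : Bool) (i j : ι) (w : ι → ι → A) (m n : ι) :
    W.d3 b s t a i (fun r => W.d2 s t b r w) j m n - W.d3 a s t b j (fun r => W.d2 s t a r w) i m n
      = tp A a b i j * W.t2 s t w m n + ∑ r, kap s (W.Om a i b j) m r * w r n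
        + ∑ r, kap t (W.Om a i b j) n r * w m r := by
  have h := W.comm a b i j (w m n)
  simp only [d2, d3, c3, c2, t2, sum_two, map_add, leib] at h ⊢
  cases s <;> cases t <;> simp only [kap_true, kap_false, map_neg, Om, sum_two] <;>
    linear_combination h

lemma commT1 (s a : Bool) (i : ι) (u : ι → A) (n : ι) :
    W.t2 a s (fun m => W.d1 s a m u) i n - W.d1 s a i (W.t1 s u) n
      = -∑ k, W.Tor a i k * W.d1 s (!a) k u n + ∑ m, kap s (W.OmT a i) n m * u m := by
  have h := W.commT a i (u n)
  simp only [t2, d1, c1, c2, t1, sum_two, map_add, leib] at h ⊢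
  cases s <;> simp only [kap_true, kap_false, map_neg, OmT, sum_two] <;>
    linear_combination h

/-! #### Linearity and product rules -/

end Web

section Rules

variable (X : Derivation ℂ A A) (k l r : ι → ι → A)

lemma c1_add (u v : ι → A) (i : ι) :
    c1 X k (fun n => u n + v n) i = c1 X k u i + c1 X k v i := by
  simp only [c1, map_add, sum_two]; ring

lemma c1_sub (u v : ι → A) (i : ι) :
    c1 X k (fun n => u n - v n) i = c1 X k u i - c1 X k v i := by
  simp only [c1, map_sub, sum_two]; ring

lemma c1_mul (f : A) (u : ι → A) (i : ι) :
    c1 X k (fun n => f * u n) i = X f * u i + f * c1 X k u i := by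
  simp only [c1, leib, sum_two]; ring

lemma c2_add (u v : ι → ι → A) (i j : ι) :
    c2 X k l (fun m n => u m n + v m n) i j = c2 X k l u i j + c2 X k l v i j := by
  simp only [c2, map_add, sum_two]; ring

lemma c2_sub (u v : ι → ι → A) (i j : ι) :
    c2 X k l (fun m n => u m n - v m n) i j = c2 X k l u i j - c2 X k l v i j := by
  simp only [c2, map_sub, sum_two]; ring

lemma c2_neg (u : ι → ι → A) (i j : ι) :
    c2 X k l (fun m n => -u m n) i j = -c2 X k l u i j := by
  simp only [c2, map_neg, sum_two]; ring

lemma c2_mul (f : A) (u : ι → ι → A) (i j : ι) :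
    c2 X k l (fun m n => f * u m n) i j = X f * u i j + f * c2 X k l u i j := by
  simp only [c2, leib, sum_two]; ring

lemma c2_tensor (u v : ι → A) (i j : ι) :
    c2 X k l (fun m n => u m * v n) i j = c1 X k u i * v j + u i * c1 X l v j := by
  simp only [c1, c2, leib, sum_two]; ring

lemma c2_swap (w : ι → ι → A) (i j : ι) :
    c2 X k l (fun m n => w n m) i j = c2 X l k w j i := by
  simp only [c2, sum_two]; ring

variable (g : ι → ι → A)

lemma c1_contract (u : ι → A) (w : ι → ι → A) (j : ι) :
    c1 X l (fun n => ∑ m, u m * w m n) j =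
      ∑ m, (c1 X (kap tt g) u m * w m j + u m * c2 X (kap ff g) l w m j) := by
  simp only [c1, c2, kap, leib, sum_two, map_add]; ring

lemma c1_contract' (u : ι → A) (w : ι → ι → A) (j : ι) :
    c1 X l (fun n => ∑ m, u m * w n m) j =
      ∑ m, (c1 X (kap ff g) u m * w j m + u m * c2 X l (kap tt g) w j m) := by
  simp only [c1, c2, kap, leib, sum_two, map_add]; ring

lemma c2_contract (u : ι → A) (w : ι → ι → ι → A) (i j : ι) :
    c2 X k l (fun a b => ∑ m, u m * w a m b) i j =
      ∑ m, (c1 X (kap tt g) u m * w i m j + u m * c3 X k (kap ff g) l w i m j) := by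
  simp only [c1, c2, c3, kap, leib, sum_two, map_add]; ring

lemma c2_contract' (u : ι → A) (w : ι → ι → ι → A) (i j : ι) :
    c2 X k l (fun a b => ∑ m, u m * w b a m) i j =
      ∑ m, (c1 X (kap ff g) u m * w j i m + u m * c3 X l k (kap tt g) w j i m) := by
  simp only [c1, c2, c3, kap, leib, sum_two, map_add]; ring

lemma derivation_trace (w : ι → ι → A) :
    X (∑ m, w m m) = ∑ m, c2 X (kap ff g) (kap tt g) w m m := by
  simp only [c2, kap, sum_two, map_add]; ring

lemma c1_trace (w : ι → ι → ι → A) (j : ι) :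
    c1 X l (fun n => ∑ m, w m n m) j = ∑ m, c3 X (kap ff g) l (kap tt g) w m j m := by
  simp only [c1, c3, kap, sum_two, map_add]; ring

lemma c1_trace' (w : ι → ι → ι → A) (j : ι) :
    c1 X l (fun n => ∑ m, w m m n) j = ∑ m, c3 X (kap tt g) (kap ff g) l w m m j := by
  simp only [c1, c3, kap, sum_two, map_add]; ring

lemma c2_matmul (y w : ι → ι → A) (i j : ι) :
    c2 X k l (fun a b => ∑ m, y a m * w m b) i j =
      ∑ m, (c2 X k (kap tt g) y i m * w m j + y i m * c2 X (kap ff g) l w m j) := by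
  simp only [c2, kap, leib, sum_two, map_add]; ring

lemma c3_swap (w : ι → ι → ι → A) (a b c : ι) :
    c3 X k l r (fun i j n => w j i n) a b c = c3 X l k r w b a c := by
  simp only [c3, sum_two]; ring

lemma c3_add (u v : ι → ι → ι → A) (a b c : ι) :
    c3 X k l r (fun i j n => u i j n + v i j n) a b c = c3 X k l r u a b c + c3 X k l r v a b c := by
  simp only [c3, map_add, sum_two]; ring

lemma c3_sub (u v : ι → ι → ι → A) (a b c : ι) :
    c3 X k l r (fun i j n => u i j n - v i j n) a b c = c3 X k l r u a b c - c3 X k l r v a b c := by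
  simp only [c3, map_sub, sum_two]; ring

lemma c3_delta (q : ι → A) (a b c : ι) :
    c3 X (kap ff g) l (kap tt g) (fun i j n => dl i n * q j) a b c = dl a c * c1 X l q b := by
  simp only [c3, c1, kap, leib, derivation_dl, sum_two]
  fin_cases a <;> fin_cases c <;> simp [dl] <;> ring

lemma c2_delta (f : A) (i j : ι) :
    c2 X (kap ff g) (kap tt g) (fun m n => dl m n * f) i j = dl i j * X f := by
  simp only [c2, kap, leib, derivation_dl, sum_two]
  fin_cases i <;> fin_cases j <;> simp [dl]

lemma derivation_trace_mul (w w' : ι → ι → A) :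
    X (∑ m, ∑ n, w m n * w' n m) =
      ∑ m, ∑ n, (c2 X (kap ff g) (kap tt g) w m n * w' n m
        + w m n * c2 X (kap ff g) (kap tt g) w' n m) := by
  simp only [c2, kap, leib, sum_two, map_add]; ring

end Rules

end Algebra

section Algebra

variable {A : Type*} [CommRing A] [Algebra ℂ A]

namespace Web

variable (W : Web A)

/-! #### Bianchi identities -/

lemma Om_antisymm (a b : Bool) (i j α γ : ι) : W.Om b j a i α γ = -W.Om a i b j α γ := by
  have : tp A b a j i = -tp A a b i j := by
    by_cases h : i = j
    · subst h; cases a <;> cases b <;> simp [tp]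
    · have h' : ¬ j = i := fun e => h e.symm
      cases a <;> cases b <;> simp [tp, dl, h, h']
  simp only [Om, this, sum_two]; ring

lemma hess_swap (X : Derivation ℂ A A) (g : ι → ι → A) (f : A) (i j : ι) :
    c2 X (kap ff g) (kap tt g) (fun m => W.d1 tt ff m (fun r => W.E tt r f)) i j =
      c2 X (kap tt g) (kap ff g) (fun m => W.d1 ff tt m (fun r => W.E ff r f)) j i
        - jj A * dl i j * X (W.T f) := by
  have h : (fun m => W.d1 tt ff m (fun r => W.E tt r f)) = fun m n =>
      (W.d1 ff tt n (fun r => W.E ff r f) m) - dl m n * (jj A * W.T f) := by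
    funext m n
    have := W.comm0 ff tt m n f
    simp only [tp] at this
    linear_combination this
  rw [h, c2_sub, c2_swap, c2_delta]
  simp only [leibniz, derivation_jj, smul_eq_mul, mul_zero, add_zero]
  ring

lemma hess_symm (a : Bool) (X : Derivation ℂ A A) (g : ι → ι → A) (f : A) (i j : ι) :
    c2 X (kap a g) (kap a g) (fun m => W.d1 a a m (fun r => W.E a r f)) i j =
      c2 X (kap a g) (kap a g) (fun m => W.d1 a a m (fun r => W.E a r f)) j i := by
  have h : (fun m => W.d1 a a m (fun r => W.E a r f)) = fun m n =>
      (W.d1 a a n (fun r => W.E a r f) m) := by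
    funext m n
    have := W.comm0 a a m n f
    have h0 : tp A a a m n = 0 := by cases a <;> rfl
    rw [h0] at this
    linear_combination this
  conv_lhs => rw [h]
  rw [c2_swap]

lemma bianchi_llu (ρ μ σ : ι) :
    (∀ γ, W.Om ff ρ tt σ μ γ = W.Om ff μ tt σ ρ γ) ∧
    (∀ κ, W.Om ff ρ ff μ κ σ =
      jj A * (dl ρ σ * W.Tor ff μ κ - dl μ σ * W.Tor ff ρ κ)) := by
  have key := W.indep (fun γ => W.Om ff ρ tt σ μ γ - W.Om ff μ tt σ ρ γ)
    (fun κ => W.Om ff ρ ff μ κ σ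
      - jj A * (dl ρ σ * W.Tor ff μ κ - dl μ σ * W.Tor ff ρ κ)) 0 ?_
  · exact ⟨fun γ => sub_eq_zero.1 (key.1 γ), fun κ => sub_eq_zero.1 (key.2.1 κ)⟩
  intro f
  have h1 := W.comm1 tt ff ff ρ μ (fun m => W.E tt m f) σ
  have s1 := W.hess_swap (W.E ff μ) (W.G ff μ) f ρ σ
  have s2 := W.hess_swap (W.E ff ρ) (W.G ff ρ) f μ σ
  have h3 := W.comm1 ff ff tt μ σ (fun m => W.E ff m f) ρ
  have h4 := W.comm1 ff ff tt ρ σ (fun m => W.E ff m f) μ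
  have s3 := W.hess_symm ff (W.E tt σ) (W.G tt σ) f μ ρ
  have t1 := W.commT0 ff μ f
  have t2 := W.commT0 ff ρ f
  simp only [d2, tp, kap_true, kap_false, sum_two, Bool.not_false] at *
  linear_combination -h1 - s1 + s2 - h3 + h4 - s3 - jj A * dl ρ σ * t1 + jj A * dl μ σ * t2

lemma bianchi_uul (σ τ ρ : ι) :
    (∀ κ, W.Om tt σ tt τ ρ κ =
      jj A * (dl ρ σ * W.Tor tt τ κ - dl ρ τ * W.Tor tt σ κ)) ∧
    (∀ κ, W.Om ff ρ tt σ κ τ = W.Om ff ρ tt τ κ σ) := by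
  have key := W.indep (fun κ => W.Om tt σ tt τ ρ κ
      - jj A * (dl ρ σ * W.Tor tt τ κ - dl ρ τ * W.Tor tt σ κ))
    (fun κ => W.Om ff ρ tt τ κ σ - W.Om ff ρ tt σ κ τ) 0 ?_
  · exact ⟨fun γ => sub_eq_zero.1 (key.1 γ), fun κ => (sub_eq_zero.1 (key.2.1 κ)).symm⟩
  intro f
  have h1 := W.comm1 ff tt tt σ τ (fun m => W.E ff m f) ρ
  have s1 := W.hess_swap (W.E tt τ) (W.G tt τ) f ρ σ
  have s2 := W.hess_swap (W.E tt σ) (W.G tt σ) f ρ τ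
  have h3 := W.comm1 tt tt ff τ ρ (fun m => W.E tt m f) σ
  have h4 := W.comm1 tt tt ff σ ρ (fun m => W.E tt m f) τ
  have s3 := W.hess_symm tt (W.E ff ρ) (W.G ff ρ) f τ σ
  have t1 := W.commT0 tt τ f
  have t2 := W.commT0 tt σ f
  simp only [d2, tp, kap_true, kap_false, sum_two, Bool.not_true,
    W.Om_antisymm ff tt ρ, dl_comm _ ρ] at *
  linear_combination h1 - s1 + s2 + h3 - h4 + s3 - jj A * dl ρ σ * t1 + jj A * dl ρ τ * t2

lemma bianchi_T (α β : ι) :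
    (∀ κ, W.OmT tt β α κ = W.d2 tt tt ff α (W.Tor tt) β κ) ∧
    (∀ κ, W.OmT ff α κ β = -W.d2 ff ff tt β (W.Tor ff) α κ) := by
  have key := W.indep (fun κ => W.OmT tt β α κ - W.d2 tt tt ff α (W.Tor tt) β κ)
    (fun κ => W.OmT ff α κ β + W.d2 ff ff tt β (W.Tor ff) α κ) 0 ?_
  · exact ⟨fun γ => sub_eq_zero.1 (key.1 γ), fun κ => eq_neg_of_add_eq_zero_left (key.2.1 κ)⟩
  intro f
  have h1 := W.commT1 tt ff α (fun m => W.E tt m f) β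
  have h2 := W.commT1 ff tt β (fun m => W.E ff m f) α
  have s1 := W.hess_swap W.T W.Gt f α β
  have c0 := W.comm0 ff tt α β (W.T f)
  have e1 : W.t1 tt (fun m => W.E tt m f) = fun n =>
      W.E tt n (W.T f) - ∑ k, W.E ff k f * W.Tor tt n k := by
    funext n
    have := W.commT0 tt n f
    simp only [sum_two, Bool.not_true] at this ⊢
    linear_combination this
  have e2 : W.t1 ff (fun m => W.E ff m f) = fun n =>
      W.E ff n (W.T f) - ∑ k, W.E tt k f * W.Tor ff n k := by
    funext n
    have := W.commT0 ff n f
    simp only [sum_two, Bool.not_false] at this ⊢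
    linear_combination this
  have e3 : (fun n => ∑ k, W.E tt k f * W.Tor ff n k) =
      fun n => ∑ k, W.E tt k f * W.Tor ff k n := by
    funext n; simp only [W.Tor_symm ff n]
  have f1 : W.d1 tt ff α (W.t1 tt (fun m => W.E tt m f)) β =
      W.d1 tt ff α (fun n => W.E tt n (W.T f)) β -
      ∑ m, (W.d1 ff ff α (fun m => W.E ff m f) m * W.Tor tt β m +
        W.E ff m f * W.d2 tt tt ff α (W.Tor tt) β m) := by
    rw [e1]; simp only [d1, d2]; rw [c1_sub, c1_contract' _ _ (W.G ff α)]
  have f2 : W.d1 ff tt β (W.t1 ff (fun m => W.E ff m f)) α =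
      W.d1 ff tt β (fun n => W.E ff n (W.T f)) α -
      ∑ m, (W.d1 tt tt β (fun m => W.E tt m f) m * W.Tor ff m α +
        W.E tt m f * W.d2 ff ff tt β (W.Tor ff) m α) := by
    rw [e2]; simp only [d1, d2]; rw [c1_sub, e3, c1_contract _ _ (W.G tt β)]
  have g1 : ∀ m, W.d1 ff ff α (fun m => W.E ff m f) m =
      W.d1 ff ff m (fun m => W.E ff m f) α := by
    intro m; have := W.comm0 ff ff α m f; simp only [tp] at this; linear_combination this
  have g2 : ∀ m, W.d1 tt tt β (fun m => W.E tt m f) m =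
      W.d1 tt tt m (fun m => W.E tt m f) β := by
    intro m; have := W.comm0 tt tt β m f; simp only [tp] at this; linear_combination this
  have g3 : ∀ m, W.d2 ff ff tt β (W.Tor ff) m α =
      W.d2 ff ff tt β (W.Tor ff) α m := by
    intro m
    have : W.Tor ff = fun a b => W.Tor ff b a := by funext a b; exact W.Tor_symm _ _ _
    simp only [d2]; conv_lhs => rw [this]
    rw [c2_swap]
  rw [f1] at h1
  rw [f2] at h2
  simp only [t2, tp, kap_true, kap_false, sum_two, Bool.not_true, Bool.not_false, g1, g2, g3,
    W.Tor_symm ff _ α] at *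
  linear_combination -h1 + h2 + s1 - c0

/-! #### Operators with raised indices -/

/-- `∇_m u^m`. -/
def divV (u : ι → A) : A := ∑ m, W.d1 tt ff m u m

/-- `∇^m v_m`. -/
def divC (v : ι → A) : A := ∑ m, W.d1 ff tt m v m

/-- The trace-free part of `∇_α u^β`. -/
def wOf (u : ι → A) (α β : ι) : A :=
  W.d1 tt ff α u β - dl α β * (hh A * W.divV u)

/-- The trace-free part of `∇^β v_α`. -/
def tfU (v : ι → A) (α β : ι) : A :=
  W.d1 ff tt β v α - dl α β * (hh A * W.divC v)

/-- `∇^m w_m^β`. -/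
def divU (w : ι → ι → A) (β : ι) : A := ∑ m, W.d2 ff tt tt m w m β

/-- `∇_m w_α^m`. -/
def divL (w : ι → ι → A) (α : ι) : A := ∑ m, W.d2 ff tt ff m w α m

/-- The product of two trace-free tensors. -/
def prodHW (H w : ι → ι → A) (β : ι) : A :=
  ∑ α, W.divU H α * w α β + ∑ α, W.divU w α * H α β
    + hh A * W.E tt β (∑ m, ∑ n, H m n * w n m)

/-- The product of a vector and a trace-free tensor. -/
def prodUH (u : ι → A) (H : ι → ι → A) (γ β : ι) : A :=
  jj A * (u γ * W.divU H β - u β * W.divU H γ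
    + W.d1 tt tt γ (fun σ => ∑ α, u α * H α σ) β
    - W.d1 tt tt β (fun σ => ∑ α, u α * H α σ) γ)

/-- `i ∇_ν c^{νβ}`. -/
def db12 (c : ι → ι → A) (β : ι) : A := jj A * ∑ ν, W.d2 tt tt ff ν c ν β

/-- `∇^γ ∇^m w_m^β - i A^{γm} w_m^β`. -/
def aux11 (w : ι → ι → A) (γ β : ι) : A :=
  W.d1 tt tt γ (W.divU w) β - jj A * ∑ m, W.Tor tt γ m * w m β

/-- `∂̄_b` on trace-free tensors. -/
def dbb11 (w : ι → ι → A) (γ β : ι) : A :=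
  jj A * (W.aux11 w γ β - W.aux11 w β γ)

/-- `∂_b ∂_b^* + ∂̄_b ∂̄_b^* + r`. -/
def lapl (r : A) (w : ι → ι → A) (α β : ι) : A :=
  -W.wOf (W.divU w) α β - W.tfU (W.divL w) α β + r * w α β

/-- The fourth order operator, with potential terms `r` and `l`. -/
def Qop (r : A) (l : ι → ι → A) (u : ι → A) (β : ι) : A :=
  jj A * W.divU (W.lapl r (W.wOf u)) β + 2 * W.prodHW l (W.wOf u) β - W.db12 (W.prodUH u l) β

/-- `i ∂_b ∂̄_b ∂_b`. -/
def Lop (u : ι → A) (β : ι) : A := jj A * W.db12 (W.dbb11 (W.wOf u)) β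

lemma wOf_trace (u : ι → A) : W.wOf u 0 0 + W.wOf u 1 1 = 0 := by
  simp only [wOf, divV, sum_two, dl_00, dl_11]
  linear_combination (-(W.d1 tt ff 0 u 0) - W.d1 tt ff 1 u 1) * two_mul_hh (A := A)

lemma d2_trace {w : ι → ι → A} (hw : w 0 0 + w 1 1 = 0) (a : Bool) (i : ι) :
    W.d2 ff tt a i w 0 0 + W.d2 ff tt a i w 1 1 = 0 := by
  have := derivation_trace (W.E a i) (W.G a i) w
  simp only [sum_two, hw, map_zero] at this
  exact this.symm

lemma anti_upper {w : ι → ι → A} (hw : w 0 0 + w 1 1 = 0) (ν β α : ι) :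
    W.d2 ff tt tt ν w α β - W.d2 ff tt tt β w α ν =
      dl α ν * W.divU w β - dl α β * W.divU w ν := by
  have h0 := W.d2_trace hw tt 0
  have h1 := W.d2_trace hw tt 1
  simp only [divU, sum_two]
  fin_cases α <;> fin_cases β <;> fin_cases ν <;>
    simp only [Fin.zero_eta, Fin.mk_one, Fin.isValue, dl_00, dl_01, dl_10, dl_11] <;>
    first | ring1 | linear_combination h0 | linear_combination h1 | linear_combination -h0 | linear_combination -h1

lemma anti_lower {w : ι → ι → A} (hw : w 0 0 + w 1 1 = 0) (α μ β : ι) :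
    W.d2 ff tt ff α w μ β - W.d2 ff tt ff μ w α β =
      dl α β * W.divL w μ - dl μ β * W.divL w α := by
  have h0 := W.d2_trace hw ff 0
  have h1 := W.d2_trace hw ff 1
  simp only [divL, sum_two]
  fin_cases α <;> fin_cases β <;> fin_cases μ <;>
    simp only [Fin.zero_eta, Fin.mk_one, Fin.isValue, dl_00, dl_01, dl_10, dl_11] <;>
    first | ring1 | linear_combination h0 | linear_combination h1 | linear_combination -h0 | linear_combination -h1

/-- A vector corresponding to a `∂̄_b`-closed form. -/
def Closed (u : ι → A) : Prop := ∀ i j, W.d1 tt tt i u j = W.d1 tt tt j u i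

lemma closed_grad (f : A) : W.Closed (fun m => W.E tt m f) := by
  intro i j
  have := W.comm0 tt tt i j f
  simp only [tp] at this
  linear_combination this

lemma d2_wOf (u : ι → A) (a : Bool) (i α β : ι) :
    W.d2 ff tt a i (W.wOf u) α β =
      W.d2 ff tt a i (fun m => W.d1 tt ff m u) α β - dl α β * (hh A * W.E a i (W.divV u)) := by
  have : W.wOf u = fun α β => W.d1 tt ff α u β - dl α β * (hh A * W.divV u) := rfl
  simp only [d2]
  rw [this, c2_sub, c2_delta]
  simp only [leibniz, derivation_hh, smul_eq_mul, mul_zero, add_zero]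

lemma E_divV (u : ι → A) (a : Bool) (i : ι) :
    W.E a i (W.divV u) = W.d2 ff tt a i (fun m => W.d1 tt ff m u) 0 0 +
      W.d2 ff tt a i (fun m => W.d1 tt ff m u) 1 1 := by
  rw [divV, derivation_trace _ (W.G a i) (fun m => W.d1 tt ff m u), sum_two]; rfl

lemma Closed.d2_symm {W : Web A} {u : ι → A} (hu : W.Closed u) (a : Bool) (i m n : ι) :
    W.d2 tt tt a i (fun m => W.d1 tt tt m u) m n =
      W.d2 tt tt a i (fun m => W.d1 tt tt m u) n m := by
  have : (fun m => W.d1 tt tt m u) = fun m n => W.d1 tt tt n u m := by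
    funext m n; exact hu m n
  simp only [d2]
  conv_lhs => rw [this]
  rw [c2_swap]

lemma divU_wOf {u : ι → A} (hu : W.Closed u) (β : ι) :
    W.divU (W.wOf u) β = jj A * W.t1 tt u β + hh A * W.E tt β (W.divV u) := by
  simp only [divU, sum_two, d2_wOf]
  have e := W.E_divV u tt β
  have h := fun ν α => W.comm1 tt tt ff ν α u β
  have h' := fun α => W.comm1 tt tt ff β α u α
  have s := fun α ν => hu.d2_symm ff α ν β
  have r := fun ν α m => (W.bianchi_uul ν β α).2 m
  have c0 := W.comm1 tt tt ff 0 0 u β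
  have c1 := W.comm1 tt tt ff 1 1 u β
  have c2 := h' 0
  have c3 := h' 1
  have s0 := s 0 0
  have s1 := s 1 1
  have k := two_mul_hh (A := A)
  simp only [tp, kap_true, sum_two, W.Om_antisymm ff tt, r] at *
  fin_cases β <;> simp only [Fin.zero_eta, Fin.mk_one, Fin.isValue, dl_00, dl_01, dl_10, dl_11] at *
  · linear_combination c1 - c3 + s1 - e - k * (W.E tt 0 (W.divV u)) 
  · linear_combination c0 - c2 + s0 - e - k * (W.E tt 1 (W.divV u)) 

lemma divL_wOf (u : ι → A) (μ : ι) :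
    W.divL (W.wOf u) μ = hh A * W.E ff μ (W.divV u) + jj A * ∑ κ, W.Tor ff μ κ * u κ := by
  simp only [divL, sum_two, d2_wOf]
  have e := W.E_divV u ff μ
  have c0 := W.comm1 tt ff ff 0 μ u 0
  have c1 := W.comm1 tt ff ff 1 μ u 1
  have r0 := fun κ => (W.bianchi_llu 0 μ 0).2 κ
  have r1 := fun κ => (W.bianchi_llu 1 μ 1).2 κ
  have k := two_mul_hh (A := A)
  simp only [tp, kap_true, sum_two, r0, r1] at *
  fin_cases μ <;> simp only [Fin.zero_eta, Fin.mk_one, Fin.isValue, dl_00, dl_01, dl_10, dl_11] at *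
  · linear_combination c0 + c1 - e - k * (W.E ff 0 (W.divV u)) 
  · linear_combination c0 + c1 - e - k * (W.E ff 1 (W.divV u)) 

lemma d1_add (s a : Bool) (i : ι) (u v : ι → A) (n : ι) :
    W.d1 s a i (fun m => u m + v m) n = W.d1 s a i u n + W.d1 s a i v n := c1_add ..

lemma d1_mul (s a : Bool) (i : ι) (f : A) (v : ι → A) (n : ι) :
    W.d1 s a i (fun m => f * v m) n = W.E a i f * v n + f * W.d1 s a i v n := c1_mul ..

/-- `∂̄_b ∂_b u = 0` when `∂̄_b u = 0`. -/
lemma dbb11_wOf {u : ι → A} (hu : W.Closed u) (ν β : ι) :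
    W.aux11 (W.wOf u) ν β = W.aux11 (W.wOf u) β ν := by
  have hp : W.divU (W.wOf u) = fun β => jj A * W.t1 tt u β + hh A * W.E tt β (W.divV u) :=
    funext (W.divU_wOf hu)
  have c := W.closed_grad (W.divV u) ν β
  have h1 := W.commT1 tt tt ν u β
  have h2 := W.commT1 tt tt β u ν
  have hs : W.t2 tt tt (fun m => W.d1 tt tt m u) ν β =
      W.t2 tt tt (fun m => W.d1 tt tt m u) β ν := by
    have : (fun m => W.d1 tt tt m u) = fun m n => W.d1 tt tt n u m := by
      funext m n; exact hu m n
    simp only [t2]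
    conv_lhs => rw [this]
    rw [c2_swap]
  have hT : ∀ m, W.OmT tt ν m β = W.OmT tt β m ν := by
    intro m
    rw [(W.bianchi_T m ν).1, (W.bianchi_T m β).1]
    have : W.Tor tt = fun a b => W.Tor tt b a := by funext a b; exact W.Tor_symm _ _ _
    simp only [d2]; conv_lhs => rw [this]
    rw [c2_swap]
  have hA := W.Tor_symm tt 0 1
  simp only [aux11, hp, d1_add, d1_mul, derivation_jj, derivation_hh]
  simp only [wOf, kap_true, sum_two, hT, Bool.not_true] at *
  fin_cases ν <;> fin_cases β <;>
    simp only [Fin.zero_eta, Fin.mk_one, Fin.isValue, dl_00, dl_01, dl_10, dl_11] at * <;>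
    first
    | linear_combination jj A * hs - jj A * h1 + jj A * h2 + hh A * c - jj A * (hh A * W.divV u) * hA
    | linear_combination jj A * hs - jj A * h1 + jj A * h2 + hh A * c + jj A * (hh A * W.divV u) * hA

/-- The component of type `(1,1)` of `d² u = 0` when `∂̄_b u = 0`. -/
lemma t2_wOf {u : ι → A} (hu : W.Closed u) (μ β : ι) :
    W.d1 tt ff μ (W.divU (W.wOf u)) β - W.d1 ff tt β (W.divL (W.wOf u)) μ =
      jj A * W.t2 ff tt (W.wOf u) μ β := by
  have hp : W.divU (W.wOf u) = fun β => jj A * W.t1 tt u β + hh A * W.E tt β (W.divV u) :=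
    funext (W.divU_wOf hu)
  have hq : W.divL (W.wOf u) = fun μ => hh A * W.E ff μ (W.divV u)
      + jj A * ∑ κ, u κ * W.Tor ff κ μ := by
    funext μ; rw [W.divL_wOf]; simp only [sum_two, W.Tor_symm ff μ]; ring
  have c := W.comm0 ff tt μ β (W.divV u)
  have h1 := W.commT1 tt ff μ u β
  have hT := fun m => (W.bianchi_T μ β).2 m
  have hw : W.wOf u = fun α β => W.d1 tt ff α u β - dl α β * (hh A * W.divV u) := rfl
  have hs : ∀ m, W.d2 ff ff tt β (W.Tor ff) μ m =
      W.d2 ff ff tt β (W.Tor ff) m μ := by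
    intro m
    have : W.Tor ff = fun a b => W.Tor ff b a := by funext a b; exact W.Tor_symm _ _ _
    simp only [d2]; conv_lhs => rw [this]
    rw [c2_swap]
  have ht : W.t2 ff tt (W.wOf u) μ β = W.t2 ff tt (fun m => W.d1 tt ff m u) μ β
      - dl μ β * (hh A * W.T (W.divV u)) := by
    simp only [t2]
    rw [hw, c2_sub, c2_delta]
    simp only [leibniz, derivation_hh, smul_eq_mul, mul_zero, add_zero]
  have hc : W.d1 ff tt β (fun μ => ∑ κ, u κ * W.Tor ff κ μ) μ =
      ∑ m, (W.d1 tt tt β u m * W.Tor ff m μ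
        + u m * W.d2 ff ff tt β (W.Tor ff) m μ) := c1_contract _ _ _ _ _ _
  rw [ht, hp, hq]
  simp only [d1_add, d1_mul, derivation_jj, derivation_hh, hc]
  simp only [tp, kap_true, sum_two, hT, Bool.not_false, hs, hu β, W.Tor_symm ff _ μ] at *
  linear_combination -jj A * h1 + hh A * c

/-! #### The identity behind the transformation law -/

lemma d1_sub (s a : Bool) (i : ι) (u v : ι → A) (n : ι) :
    W.d1 s a i (fun m => u m - v m) n = W.d1 s a i u n - W.d1 s a i v n := c1_sub ..

lemma d2_add (s t a : Bool) (i : ι) (u v : ι → ι → A) (m n : ι) :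
    W.d2 s t a i (fun m n => u m n + v m n) m n = W.d2 s t a i u m n + W.d2 s t a i v m n := c2_add ..

lemma d2_sub (s t a : Bool) (i : ι) (u v : ι → ι → A) (m n : ι) :
    W.d2 s t a i (fun m n => u m n - v m n) m n = W.d2 s t a i u m n - W.d2 s t a i v m n := c2_sub ..

lemma d2_neg (s t a : Bool) (i : ι) (u : ι → ι → A) (m n : ι) :
    W.d2 s t a i (fun m n => -u m n) m n = -W.d2 s t a i u m n := c2_neg ..

lemma d2_mul (s t a : Bool) (i : ι) (f : A) (v : ι → ι → A) (m n : ι) :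
    W.d2 s t a i (fun m n => f * v m n) m n = W.E a i f * v m n + f * W.d2 s t a i v m n := c2_mul ..

lemma d2_tensor (s t a : Bool) (i : ι) (u v : ι → A) (m n : ι) :
    W.d2 s t a i (fun m n => u m * v n) m n =
      W.d1 s a i u m * v n + u m * W.d1 t a i v n := c2_tensor ..

lemma d2_swap (s t a : Bool) (i : ι) (u : ι → ι → A) (m n : ι) :
    W.d2 s t a i (fun m n => u n m) m n = W.d2 t s a i u n m := c2_swap ..

lemma d2_matmul (s t a : Bool) (i : ι) (y w : ι → ι → A) (m n : ι) :
    W.d2 s t a i (fun m n => ∑ r, y m r * w r n) m n =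
      ∑ r, (W.d2 s tt a i y m r * w r n + y m r * W.d2 ff t a i w r n) := c2_matmul ..

lemma d2_contract (s t a : Bool) (i : ι) (u : ι → A) (w : ι → ι → ι → A)
    (m n : ι) :
    W.d2 s t a i (fun m n => ∑ r, u r * w m r n) m n =
      ∑ r, (W.d1 tt a i u r * w m r n + u r * W.d3 s ff t a i w m r n) := c2_contract ..

lemma d2_contract' (s t a : Bool) (i : ι) (u : ι → A) (w : ι → ι → ι → A)
    (m n : ι) :
    W.d2 s t a i (fun m n => ∑ r, u r * w n m r) m n =
      ∑ r, (W.d1 ff a i u r * w n m r + u r * W.d3 t s tt a i w n m r) := c2_contract' ..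

lemma d1_contract (t a : Bool) (i : ι) (u : ι → A) (w : ι → ι → A) (n : ι) :
    W.d1 t a i (fun n => ∑ r, u r * w r n) n =
      ∑ r, (W.d1 tt a i u r * w r n + u r * W.d2 ff t a i w r n) := c1_contract ..

lemma d1_contract' (t a : Bool) (i : ι) (u : ι → A) (w : ι → ι → A) (n : ι) :
    W.d1 t a i (fun n => ∑ r, u r * w n r) n =
      ∑ r, (W.d1 ff a i u r * w n r + u r * W.d2 t tt a i w n r) := c1_contract' ..

variable (f : A)

/-- The two expressions of the trace-free Hessian. -/
lemma wOf_grad (α β : ι) :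
    W.wOf (fun m => W.E tt m f) α β = W.tfU (fun m => W.E ff m f) α β := by
  have h := W.comm0 ff tt α β f
  have h0 := W.comm0 ff tt 0 0 f
  have h1 := W.comm0 ff tt 1 1 f
  have k := two_mul_hh (A := A)
  simp only [wOf, tfU, divV, divC, tp, sum_two, dl_00, dl_11] at *
  linear_combination h - dl α β * hh A * (h0 + h1) + dl α β * jj A * W.T f * k

lemma divU_hess (β : ι) :
    W.divU (W.wOf (fun m => W.E tt m f)) β =
      hh A * W.E tt β (W.divC (fun m => W.E ff m f))
        - jj A * ∑ κ, W.Tor tt β κ * W.E ff κ f := by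
  set n : ι → A := fun m => W.E ff m f with hn
  have hH : W.wOf (fun m => W.E tt m f) =
      fun α β => W.d1 ff tt β n α - dl α β * (hh A * W.divC n) := by
    funext α β; exact W.wOf_grad f α β
  have e : W.E tt β (W.divC n) = W.d2 tt ff tt β (fun m => W.d1 ff tt m n) 0 0 +
      W.d2 tt ff tt β (fun m => W.d1 ff tt m n) 1 1 := by
    have := derivation_trace (W.E tt β) (W.G tt β) (fun m r => W.d1 ff tt r n m)
    simp only [sum_two] at this
    simp only [divC, sum_two, this]
    exact congrArg₂ (· + ·) (c2_swap ..) (c2_swap ..)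
  have hd : ∀ i α β, W.d2 ff tt tt i (W.wOf (fun m => W.E tt m f)) α β =
      W.d2 tt ff tt i (fun m => W.d1 ff tt m n) β α
        - dl α β * (hh A * W.E tt i (W.divC n)) := by
    intro i α β
    rw [hH]
    simp only [d2]
    rw [c2_sub, c2_delta, c2_swap]
    simp only [leibniz, derivation_hh, smul_eq_mul, mul_zero, add_zero]
  have c0 := W.comm1 ff tt tt 0 β n 0
  have c1 := W.comm1 ff tt tt 1 β n 1
  have r0 := fun κ => (W.bianchi_uul 0 β 0).1 κ
  have r1 := fun κ => (W.bianchi_uul 1 β 1).1 κ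
  have k := two_mul_hh (A := A)
  simp only [divU, sum_two, hd, tp, kap_false, r0, r1] at *
  fin_cases β <;> simp only [Fin.zero_eta, Fin.mk_one, Fin.isValue, dl_00, dl_01, dl_10, dl_11] at *
  · linear_combination c0 + c1 - e - k * W.E tt 0 (W.divC n)
  · linear_combination c0 + c1 - e - k * W.E tt 1 (W.divC n)

lemma closed_aux {u : ι → A} (hu : W.Closed u) (ν β : ι) :
    (W.aux11 (W.wOf (fun m => f * u m)) ν β - W.aux11 (W.wOf (fun m => f * u m)) β ν)
      + (u ν * W.divU (W.wOf (fun m => W.E tt m f)) β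
        - u β * W.divU (W.wOf (fun m => W.E tt m f)) ν
        + W.d1 tt tt ν (fun σ => ∑ α, u α * W.wOf (fun m => W.E tt m f) α σ) β
        - W.d1 tt tt β (fun σ => ∑ α, u α * W.wOf (fun m => W.E tt m f) α σ) ν)
    = W.E tt ν f * W.divU (W.wOf u) β - W.E tt β f * W.divU (W.wOf u) ν
      + W.d1 tt tt ν (fun σ => ∑ α, W.E tt α f * W.wOf u α σ) β
      - W.d1 tt tt β (fun σ => ∑ α, W.E tt α f * W.wOf u α σ) ν := by
  set n : ι → A := fun m => W.E ff m f with hn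
  set v : ι → A := fun m => W.E tt m f with hv
  have hw' : W.wOf (fun m => f * u m) = fun α β =>
      n α * u β + f * W.wOf u α β - dl α β * (hh A * ∑ m, u m * n m) := by
    funext α β
    simp only [wOf, divV, d1_mul, sum_two, hn]; ring
  have hp' : W.divU (W.wOf (fun m => f * u m)) = fun β =>
      W.divC n * u β + (∑ m, n m * W.d1 tt tt β u m) + (∑ m, v m * W.wOf u m β)
      + f * W.divU (W.wOf u) β - hh A * W.E tt β (∑ m, u m * n m) := by
    funext β
    have : ∀ i α β, W.d2 ff tt tt i (W.wOf (fun m => f * u m)) α β =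
        W.d1 ff tt i n α * u β + n α * W.d1 tt tt i u β + (v i * W.wOf u α β
          + f * W.d2 ff tt tt i (W.wOf u) α β)
          - dl α β * (hh A * W.E tt i (∑ m, u m * n m)) := by
      intro i α β
      rw [hw']
      have e1 := W.d2_sub ff tt tt i (fun α β => n α * u β + f * W.wOf u α β)
        (fun α β => dl α β * (hh A * ∑ m, u m * n m)) α β
      rw [e1, d2_add, d2_tensor, d2_mul]
      congr 1
      simp only [d2]
      rw [c2_delta]
      simp only [leibniz, derivation_hh, smul_eq_mul, mul_zero, add_zero]
    simp only [divU, this, divC, sum_two, hu β]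
    fin_cases β <;> simp only [Fin.zero_eta, Fin.mk_one, Fin.isValue, dl_00, dl_01, dl_10, dl_11] <;>
      ring
  have hDp : ∀ ν β, W.d1 tt tt ν (W.divU (W.wOf (fun m => f * u m))) β =
      (W.E tt ν (W.divC n) * u β + W.divC n * W.d1 tt tt ν u β)
      + (∑ m, (W.d1 ff tt ν n m * W.d1 tt tt β u m
          + n m * W.d2 tt tt tt ν (fun m => W.d1 tt tt m u) β m))
      + W.d1 tt tt ν (fun σ => ∑ α, v α * W.wOf u α σ) β
      + (v ν * W.divU (W.wOf u) β + f * W.d1 tt tt ν (W.divU (W.wOf u)) β)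
      - hh A * W.d1 tt tt ν (fun r => W.E tt r (∑ m, u m * n m)) β := by
    intro ν β
    rw [hp', d1_sub, d1_add, d1_add, d1_add, d1_mul, d1_mul, d1_mul,
      W.d1_contract' tt tt ν n (fun m => W.d1 tt tt m u)]
    simp only [derivation_hh]; ring
  have sc := W.closed_grad (∑ m, u m * n m) ν β
  have hH : ∀ α β, W.wOf v α β = W.d1 ff tt β n α - dl α β * (hh A * W.divC n) :=
    W.wOf_grad f
  have hP := W.divU_hess f
  have htr := W.wOf_trace v
  have ha := fun α => W.anti_upper htr ν β α
  have hcl := W.dbb11_wOf hu ν β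
  have cm := fun m => W.comm1 tt tt tt ν β u m
  have r := fun m κ => (W.bianchi_uul ν β m).1 κ
  have e1 := W.d1_contract tt tt ν u (W.wOf v) β
  have e2 := W.d1_contract tt tt β u (W.wOf v) ν
  have k := two_mul_hh (A := A)
  simp only [aux11, hDp] at hcl ⊢
  rw [e1, e2]
  simp only [hw']
  have cm0 := cm 0
  have cm1 := cm 1
  have ha0 := ha 0
  have ha1 := ha 1
  have hcu := hu ν β
  have hA := W.Tor_symm tt 0 1
  have hu01 := hu 0 1
  have hP0 := hP 0
  have hP1 := hP 1
  clear cm ha hDp hp' hw' e1 e2 hP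
  simp only [tp, kap_true, sum_two, r] at *
  simp only [hH]
  fin_cases ν <;> fin_cases β <;>
    simp only [Fin.zero_eta, Fin.mk_one, Fin.isValue, dl_00, dl_01, dl_10, dl_11] at *
  · ring
  · linear_combination f * hcl - hh A * sc + n 0 * cm0 + n 1 * cm1 + u 0 * ha0 + u 1 * ha1
      + 2 * u 0 * hP1 - 2 * u 1 * hP0 + (u 0 * W.E tt 1 (W.divC n) - u 1 * W.E tt 0 (W.divC n)) * k
      + W.divC n * (1 - hh A) * hcu + hh A * jj A * (u 0 * n 0 + u 1 * n 1) * hA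
  · linear_combination f * hcl - hh A * sc + n 0 * cm0 + n 1 * cm1 + u 0 * ha0 + u 1 * ha1
      - 2 * u 0 * hP1 + 2 * u 1 * hP0 - (u 0 * W.E tt 1 (W.divC n) - u 1 * W.E tt 0 (W.divC n)) * k
      + W.divC n * (1 - hh A) * hcu - hh A * jj A * (u 0 * n 0 + u 1 * n 1) * hA
  · ring

end Web

end Algebra

section Algebra

variable {A : Type*} [CommRing A] [Algebra ℂ A]

namespace Web

variable (W : Web A)

lemma d1_divU (a : Bool) (i : ι) (w : ι → ι → A) (β : ι) :
    W.d1 tt a i (W.divU w) β =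
      W.d3 tt ff tt a i (fun r => W.d2 ff tt tt r w) 0 0 β +
      W.d3 tt ff tt a i (fun r => W.d2 ff tt tt r w) 1 1 β := by
  have := c1_trace' (W.E a i) (kap tt (W.G a i)) (W.G a i) (fun r => W.d2 ff tt tt r w) β
  rw [sum_two] at this
  exact this

lemma d1_divL (a : Bool) (i : ι) (w : ι → ι → A) (α : ι) :
    W.d1 ff a i (W.divL w) α =
      W.d3 ff ff tt a i (fun r => W.d2 ff tt ff r w) 0 α 0 +
      W.d3 ff ff tt a i (fun r => W.d2 ff tt ff r w) 1 α 1 := by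
  have := c1_trace (W.E a i) (kap ff (W.G a i)) (W.G a i) (fun r => W.d2 ff tt ff r w) α
  rw [sum_two] at this
  exact this

lemma t2_trace {w : ι → ι → A} (hw : w 0 0 + w 1 1 = 0) :
    W.t2 ff tt w 0 0 + W.t2 ff tt w 1 1 = 0 := by
  have := derivation_trace W.T W.Gt w
  simp only [sum_two, hw, map_zero] at this
  exact this.symm

lemma R_l (σ γ : ι) : W.Om ff 1 tt σ 0 γ = W.Om ff 0 tt σ 1 γ :=
  (W.bianchi_llu 1 0 σ).1 γ

lemma R_u (ρ κ : ι) : W.Om ff ρ tt 1 κ 0 = W.Om ff ρ tt 0 κ 1 :=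
  (W.bianchi_uul 1 0 ρ).2 κ

lemma R_ul (i j α γ : ι) : W.Om tt j ff i α γ = -W.Om ff i tt j α γ :=
  W.Om_antisymm ..

lemma divV_divU {w : ι → ι → A} (hw : w 0 0 + w 1 1 = 0) :
    W.divV (W.divU w) = W.divC (W.divL w) := by
  have ht := W.t2_trace hw
  have h00 := W.comm2 ff tt ff tt 0 0 w 0 0
  have h01 := W.comm2 ff tt ff tt 0 1 w 1 0
  have h10 := W.comm2 ff tt ff tt 1 0 w 0 1
  have h11 := W.comm2 ff tt ff tt 1 1 w 1 1
  simp only [divV, divC, sum_two, d1_divU, d1_divL]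
  simp only [tp, kap_true, kap_false, sum_two, dl_00, dl_01, dl_10, dl_11, R_l, R_u] at *
  linear_combination h00 + h01 + h10 + h11 - jj A * ht

lemma lapl_upper {w : ι → ι → A} (hw : w 0 0 + w 1 1 = 0) (μ β : ι) :
    W.d3 ff ff tt tt 0 (fun r => W.d2 ff tt ff r w) 0 μ β +
    W.d3 ff ff tt tt 1 (fun r => W.d2 ff tt ff r w) 1 μ β =
      W.d1 tt ff μ (W.divU w) β + jj A * W.t2 ff tt w μ β
        + ∑ α, (∑ r, kap ff (W.Om tt α ff μ) α r * w r β
          + ∑ r, kap tt (W.Om tt α ff μ) β r * w α r)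
        + W.d1 ff tt β (W.divL w) μ - dl μ β * W.divC (W.divL w) := by
  have hf : (fun r => W.d2 ff tt ff r w) = fun a m b =>
      (fun m a b => W.d2 ff tt ff m w a b) m a b
        + (dl a b * W.divL w m - (fun i j n => dl i n * W.divL w j) m a b) := by
    funext a m b
    have := W.anti_lower hw a m b
    linear_combination this
  have h3 : ∀ i a, W.d3 ff ff tt tt i (fun r => W.d2 ff tt ff r w) a μ β =
      W.d3 ff ff tt tt i (fun r => W.d2 ff tt ff r w) μ a β +
      (dl a β * W.d1 ff tt i (W.divL w) μ - dl μ β * W.d1 ff tt i (W.divL w) a) := by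
    intro i a
    conv_lhs => rw [hf]
    simp only [d3, d1]
    have e1 := c3_swap (W.E tt i) (kap ff (W.G tt i)) (kap ff (W.G tt i))
      (kap tt (W.G tt i)) (fun i j n => dl i n * W.divL w j) a μ β
    have e2 := c3_swap (W.E tt i) (kap ff (W.G tt i)) (kap ff (W.G tt i))
      (kap tt (W.G tt i)) (fun m a b => W.d2 ff tt ff m w a b) a μ β
    rw [c3_delta] at e1
    rw [c3_add, c3_sub, c3_delta, e1, e2]
  have c0 := W.comm2 ff tt tt ff 0 μ w 0 β
  have c1 := W.comm2 ff tt tt ff 1 μ w 1 β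
  have e := W.d1_divU ff μ w β
  rw [h3, h3]
  simp only [divC, tp, sum_two] at *
  fin_cases μ <;> fin_cases β <;>
    simp only [Fin.zero_eta, Fin.mk_one, Fin.isValue, dl_00, dl_01, dl_10, dl_11] at * <;>
    linear_combination c0 + c1 - e

variable (f : A)

/-- The variation of `∂_b ∂_b^* + ∂̄_b ∂̄_b^* + R/6` under `θ ↦ e^f θ`. -/
def brk (w : ι → ι → A) (α β : ι) : A :=
  -(∑ r, W.E tt r f * W.d2 ff tt ff α w r β)
    + W.divL w α * W.E tt β f + W.E ff α f * W.divU w β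
    - ∑ r, W.E ff r f * W.d2 ff tt tt β w α r
    - (W.divC (fun m => W.E ff m f) + W.divV (fun m => W.E tt m f)) * w α β

lemma anti_vw {w : ι → ι → A} (hw : w 0 0 + w 1 1 = 0) (v : ι → A) (ν β : ι) :
    v ν * W.divU w β - v β * W.divU w ν
      + W.d1 tt tt ν (fun σ => ∑ α, v α * w α σ) β
      - W.d1 tt tt β (fun σ => ∑ α, v α * w α σ) ν =
    2 * (v ν * W.divU w β) - 2 * (W.divU w ν * v β) + (∑ r, W.d1 tt tt ν v r * w r β)
      - ∑ r, W.d1 tt tt β v r * w r ν := by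
  have h0 := W.anti_upper hw ν β 0
  have h1 := W.anti_upper hw ν β 1
  rw [d1_contract, d1_contract]
  simp only [sum_two]
  fin_cases ν <;> fin_cases β <;>
    simp only [Fin.zero_eta, Fin.mk_one, Fin.isValue, dl_00, dl_01, dl_10, dl_11] at * <;>
    linear_combination v 0 * h0 + v 1 * h1

lemma divU_brk {u : ι → A} (hu : W.Closed u) (β : ι) :
    W.divU (W.brk f (W.wOf u)) β + 2 * W.prodHW (W.wOf (fun m => W.E tt m f)) (W.wOf u) β
      + ∑ ν, W.d2 tt tt ff ν (fun ν β =>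
        W.E tt ν f * W.divU (W.wOf u) β - W.E tt β f * W.divU (W.wOf u) ν
        + W.d1 tt tt ν (fun σ => ∑ α, W.E tt α f * W.wOf u α σ) β
        - W.d1 tt tt β (fun σ => ∑ α, W.E tt α f * W.wOf u α σ) ν) ν β = 0 := by
  set n : ι → A := fun m => W.E ff m f with hn
  set v : ι → A := fun m => W.E tt m f with hv
  have hE0 : ∀ m, W.E ff m f = n m := fun _ => rfl
  have hE1 : ∀ m, W.E tt m f = v m := fun _ => rfl
  have hv' : W.Closed v := W.closed_grad f
  have htr := W.wOf_trace u
  have hcl := W.dbb11_wOf hu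
  have ht2 := W.t2_wOf hu
  set w := W.wOf u with hw
  have hanti : (fun ν β => v ν * W.divU w β - v β * W.divU w ν
        + W.d1 tt tt ν (fun σ => ∑ α, v α * w α σ) β
        - W.d1 tt tt β (fun σ => ∑ α, v α * w α σ) ν) = fun ν β =>
      2 * (v ν * W.divU w β) - 2 * (W.divU w ν * v β) + (∑ r, W.d1 tt tt ν v r * w r β)
      - (fun β ν => ∑ r, W.d1 tt tt β v r * w r ν) β ν := by
    funext ν β; exact W.anti_vw htr v ν β
  have hX2 : ∀ (i : ι), W.E ff i (2 : A) = 0 := by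
    intro i; rw [← map_ofNat (algebraMap ℂ A) 2]; exact Derivation.map_algebraMap _ _
  have hC : ∀ i ν β, W.d2 tt tt ff i (fun ν β => v ν * W.divU w β - v β * W.divU w ν
        + W.d1 tt tt ν (fun σ => ∑ α, v α * w α σ) β
        - W.d1 tt tt β (fun σ => ∑ α, v α * w α σ) ν) ν β =
      2 * (W.d1 tt ff i v ν * W.divU w β + v ν * W.d1 tt ff i (W.divU w) β)
      - 2 * (W.d1 tt ff i (W.divU w) ν * v β + W.divU w ν * W.d1 tt ff i v β)
      + ∑ r, (W.d2 tt tt ff i (fun m => W.d1 tt tt m v) ν r * w r β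
          + W.d1 tt tt ν v r * W.d2 ff tt ff i w r β)
      - ∑ r, (W.d2 tt tt ff i (fun m => W.d1 tt tt m v) β r * w r ν
          + W.d1 tt tt β v r * W.d2 ff tt ff i w r ν) := by
    intro i ν β
    have hm := fun m n => W.d2_matmul tt tt ff i (fun m => W.d1 tt tt m v) w m n
    have hs := W.d2_swap tt tt ff i (fun β ν => ∑ r, W.d1 tt tt β v r * w r ν) ν β
    rw [hm] at hs
    rw [hanti, d2_sub, d2_add, d2_sub, d2_mul, d2_mul, d2_tensor, d2_tensor, hs, hm, hX2]
    ring
  have hB : ∀ i α β, W.d2 ff tt tt i (W.brk f w) α β =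
      -(∑ r, (W.d1 tt tt i v r * W.d2 ff tt ff α w r β
          + v r * W.d3 ff ff tt tt i (fun r => W.d2 ff tt ff r w) α r β))
      + (W.d1 ff tt i (W.divL w) α * v β + W.divL w α * W.d1 tt tt i v β)
      + (W.d1 ff tt i n α * W.divU w β + n α * W.d1 tt tt i (W.divU w) β)
      - ∑ r, (W.d1 ff tt i n r * W.d2 ff tt tt β w α r
          + n r * W.d3 tt ff tt tt i (fun r => W.d2 ff tt tt r w) β α r)
      - ((W.E tt i (W.divC n) + W.E tt i (W.divV v)) * w α β
          + (W.divC n + W.divV v) * W.d2 ff tt tt i w α β) := by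
    intro i α β
    have : W.brk f w = fun α β => -(∑ r, v r * (fun α r β => W.d2 ff tt ff α w r β) α r β)
      + W.divL w α * v β + n α * W.divU w β
      - (∑ r, n r * (fun β α r => W.d2 ff tt tt β w α r) β α r)
      - (W.divC n + W.divV v) * w α β := rfl
    rw [this, d2_sub, d2_sub, d2_add, d2_add, d2_neg, d2_contract, d2_contract', d2_tensor,
      d2_tensor, d2_mul, map_add]
  have hP := W.divU_hess f
  have hH : ∀ α β, W.wOf v α β = W.d1 tt ff α v β - dl α β * (hh A * W.divV v) :=
    fun _ _ => rfl
  have hH' : ∀ α β, W.wOf v α β = W.d1 ff tt β n α - dl α β * (hh A * W.divC n) :=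
    W.wOf_grad f
  have hDtr := derivation_trace_mul (W.E tt β) (W.G tt β) (W.wOf v) w
  have hDH : ∀ m n, c2 (W.E tt β) (kap ff (W.G tt β)) (kap tt (W.G tt β)) (W.wOf v) m n
      = W.d2 ff tt tt β (fun m => W.d1 tt ff m v) m n
        - dl m n * (hh A * W.E tt β (W.divV v)) := fun m n => W.d2_wOf v tt β m n
  have hDw : ∀ m n, c2 (W.E tt β) (kap ff (W.G tt β)) (kap tt (W.G tt β)) w m n
      = W.d2 ff tt tt β w m n := fun _ _ => rfl
  have hz := W.divV_divU htr
  have hL0 := W.lapl_upper htr 0 β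
  have hL1 := W.lapl_upper htr 1 β
  have dtr := W.d2_trace htr tt β
  -- commutators
  have a1 := W.comm2 ff tt tt tt 0 β w 0 0
  have a2 := W.comm2 ff tt tt tt 1 β w 1 0
  have a3 := W.comm2 ff tt tt tt 0 β w 0 1
  have a4 := W.comm2 ff tt tt tt 1 β w 1 1
  have p0 := W.d1_divU tt β w 0
  have p1 := W.d1_divU tt β w 1
  have hcl0 := hcl 0 β
  have hcl1 := hcl 1 β
  have x0 := W.comm1 tt ff tt 0 0 v 0
  have x1 := W.comm1 tt ff tt 1 0 v 1
  have x2 := W.comm1 tt ff tt 0 1 v 0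
  have x3 := W.comm1 tt ff tt 1 1 v 1
  have y00 := W.comm1 tt tt ff β 0 v 0
  have y01 := W.comm1 tt tt ff β 0 v 1
  have y10 := W.comm1 tt tt ff β 1 v 0
  have y11 := W.comm1 tt tt ff β 1 v 1
  have e0 := W.E_divV v tt 0
  have e1 := W.E_divV v tt 1
  have s0 := hv'.d2_symm ff 0 0 1
  have s1 := hv'.d2_symm ff 1 1 0
  have t20 := ht2 0 β
  have t21 := ht2 1 β
  have q0 := hv' 0 β
  have q1 := hv' 1 β
  have r1 := fun a b c k => (W.bianchi_uul a b c).1 k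
  have k := two_mul_hh (A := A)
  have hA := W.Tor_symm tt 0 1
  have hP0 := hP 0
  have hP1 := hP 1
  clear hP
  have hB0 := hB 0 0 β
  have hB1 := hB 1 1 β
  have hC0 := hC 0 0 β
  have hC1 := hC 1 1 β
  clear hB hC hanti hX2
  have hdB : W.divU (W.brk f w) β = W.d2 ff tt tt 0 (W.brk f w) 0 β
    + W.d2 ff tt tt 1 (W.brk f w) 1 β := by rw [divU, sum_two]
  have hp : ∀ b, W.divU w b = W.d2 ff tt tt 0 w 0 b + W.d2 ff tt tt 1 w 1 b := by
    intro b; rw [divU, sum_two]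
  have hq : ∀ b, W.divL w b = W.d2 ff tt ff 0 w b 0 + W.d2 ff tt ff 1 w b 1 := by
    intro b; rw [divL, sum_two]
  have hp0 := hp β
  have hq0 := hq 0
  have hq1 := hq 1
  rw [hdB, sum_two, prodHW, hB0, hB1, hC0, hC1]
  clear hB0 hB1 hC0 hC1 hdB hp hq
  have g0 := hH 0 β
  have g1 := hH 1 β
  have g00 := hH' 0 0
  have g01 := hH' 0 1
  have g10 := hH' 1 0
  have g11 := hH' 1 1
  generalize W.E tt β (∑ m, ∑ n, W.wOf v m n * w n m) = TR at *
  simp only [hDH, hDw, sum_two] at hDtr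
  simp only [hE0, hE1] at *
  simp only [aux11, divV, divC, tp, kap_true, kap_false, sum_two, r1, R_l, R_u, R_ul] at *
  linear_combination (norm := skip) -n 0 * (a1 + a2) - n 1 * (a3 + a4) + n 0 * (p0 + hcl0)
    + n 1 * (p1 + hcl1) - v 0 * (hL0 - t20) - v 1 * (hL1 - t21) - 2 * v β * hz + 2 * w 0 β * hP0
    + 2 * w 1 β * hP1 + TR * k + hDtr + w 0 0 * y00 + w 1 0 * y01 + w 0 1 * y10 + w 1 1 * y11
    + w 0 β * (x0 + x1 + s1 - e0) + w 1 β * (x2 + x3 + s0 - e1)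
    + 2 * W.divU w 0 * g0 + 2 * W.divU w 1 * g1
    + W.d2 ff tt tt β w 0 0 * g00 + W.d2 ff tt tt β w 1 0 * g01
    + W.d2 ff tt tt β w 0 1 * g10 + W.d2 ff tt tt β w 1 1 * g11
    + W.d1 tt tt β v 0 * hq0 + W.d1 tt tt β v 1 * hq1
    + (W.d1 ff tt 0 n 0 + W.d1 ff tt 1 n 1 + W.d1 tt ff 0 v 0
      + W.d1 tt ff 1 v 1) * hp0
    - hh A * (W.d1 ff tt 0 n 0 + W.d1 ff tt 1 n 1) * dtr
    + (w 0 β * W.E tt 0 (W.d1 ff tt 0 n 0 + W.d1 ff tt 1 n 1)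
      + w 1 β * W.E tt 1 (W.d1 ff tt 0 n 0 + W.d1 ff tt 1 n 1)
      - W.divU w β * (W.d1 tt ff 0 v 0 + W.d1 tt ff 1 v 1)) * k
    - hh A * W.E tt β (W.d1 tt ff 0 v 0 + W.d1 tt ff 1 v 1) * htr
    + W.divL w 0 * q0 + W.divL w 1 * q1
    - jj A * (n 0 * W.Tor tt β 0 + n 1 * W.Tor tt β 1) * htr
    + jj A * (n 0 * w 1 β - n 1 * w 0 β) * hA
  fin_cases β <;>
    simp only [Fin.zero_eta, Fin.mk_one, Fin.isValue, dl_00, dl_01, dl_10, dl_11, R_u] <;> ring1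

/-- The linear identity that gives the transformation law of the fourth order operator. -/
lemma brk_identity {u : ι → A} (hu : W.Closed u) (β : ι) :
    jj A * W.divU (W.brk f (W.wOf u)) β
      + 2 * (jj A * W.prodHW (W.wOf (fun m => W.E tt m f)) (W.wOf u) β)
      - jj A * W.db12 (W.prodUH u (W.wOf (fun m => W.E tt m f))) β = W.Lop (fun m => f * u m) β := by
  have h := W.divU_brk f hu β
  have h2 : (fun ν β => W.E tt ν f * W.divU (W.wOf u) β - W.E tt β f * W.divU (W.wOf u) ν
        + W.d1 tt tt ν (fun σ => ∑ α, W.E tt α f * W.wOf u α σ) β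
        - W.d1 tt tt β (fun σ => ∑ α, W.E tt α f * W.wOf u α σ) ν) =
      fun ν β => (-jj A) * (W.dbb11 (W.wOf (fun m => f * u m)) ν β
        + W.prodUH u (W.wOf (fun m => W.E tt m f)) ν β) := by
    funext ν β
    rw [← W.closed_aux f hu ν β, dbb11, prodUH]
    linear_combination (-(W.aux11 (W.wOf (fun m => f * u m)) ν β
      - W.aux11 (W.wOf (fun m => f * u m)) β ν)
      - (u ν * W.divU (W.wOf (fun m => W.E tt m f)) β
        - u β * W.divU (W.wOf (fun m => W.E tt m f)) ν
        + W.d1 tt tt ν (fun σ => ∑ α, u α * W.wOf (fun m => W.E tt m f) α σ) β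
        - W.d1 tt tt β (fun σ => ∑ α, u α * W.wOf (fun m => W.E tt m f) α σ) ν)) *
      (- jj_mul_jj (A := A))
  rw [h2] at h
  simp only [d2_mul, d2_add, map_neg, derivation_jj, sum_two] at h
  simp only [Lop, db12, sum_two]
  linear_combination jj A * h

end Web

end Algebra

section Algebra

variable {A : Type*} [CommRing A] [Algebra ℂ A]

namespace Web

variable (W : Web A)

/-! #### Ricci curvature -/

/-- The pseudohermitian Ricci tensor, with one index raised. -/
def ric (α γ : ι) : A := ∑ μ, W.Om ff μ tt μ α γ

/-- The pseudohermitian scalar curvature. -/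
def rsc : A := ∑ α, W.ric α α

/-- The components of the Lee form, with one index raised. -/
def leeU (α γ : ι) : A := -jj A * (hh A * hh A * (W.ric α γ - hh A * W.rsc * dl α γ))

/-- The trace of the connection. -/
def Gtr (a : Bool) (i : ι) : A := ∑ k, W.G a i k k

lemma ric_eq (α γ : ι) : W.ric α γ = W.E ff α (W.Gtr tt γ) - W.E tt γ (W.Gtr ff α)
    + ∑ k, W.G ff α k γ * W.Gtr tt k + ∑ k, W.G tt γ α k * W.Gtr ff k
    + jj A * dl α γ * ∑ k, W.Gt k k := by
  have h : W.ric α γ = ∑ μ, W.Om ff α tt γ μ μ := by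
    refine Finset.sum_congr rfl fun μ _ => ?_
    rw [(W.bianchi_llu μ α μ).1 γ, (W.bianchi_uul μ γ α).2 μ]
  rw [h]
  simp only [Om, Gtr, sum_two, kap_true, kap_false, tp, map_add]
  ring

/-- `W'` is the structure obtained from `W` by multiplying the contact form by the exponential of
`f`; here `ε` is the exponential of `-f`. -/
structure Conf (W W' : Web A) (f ε : A) : Prop where
  E_false : ∀ i g, W'.E ff i g = W.E ff i g
  E_true : ∀ i g, W'.E tt i g = ε * W.E tt i g
  T_eq : ∃ x y : ι → A, ∀ g, W'.T g =
    ε * (W.T g + ∑ k, x k * W.E ff k g + ∑ k, y k * W.E tt k g)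
  E_eps : ∀ a i, W.E a i ε = -(ε * W.E a i f)
  unit : IsUnit ε

namespace Conf

variable {W} {W' : Web A} {f ε : A}

lemma coeff_eq {x y : ι → A} {z : A} {x' y' : ι → A} {z' : A}
    (h : ∀ g, ∑ k, x k * W.E ff k g + ∑ k, y k * W.E tt k g + z * W.T g =
      ∑ k, x' k * W.E ff k g + ∑ k, y' k * W.E tt k g + z' * W.T g) :
    (∀ k, x k = x' k) ∧ (∀ k, y k = y' k) ∧ z = z' := by
  have := W.indep (fun k => x k - x' k) (fun k => y k - y' k) (z - z') (fun g => by
    have := h g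
    simp only [sum_two] at this ⊢
    linear_combination this)
  exact ⟨fun k => sub_eq_zero.1 (this.1 k), fun k => sub_eq_zero.1 (this.2.1 k),
    sub_eq_zero.1 this.2.2⟩

lemma connection_raw (C : Conf W W' f ε) : ∃ x y : ι → A,
    (∀ g, W'.T g = ε * (W.T g + ∑ k, x k * W.E ff k g + ∑ k, y k * W.E tt k g)) ∧
    (∀ i j k, W'.G ff i k j = W.G ff i k j + dl j k * W.E ff i f - jj A * dl i j * y k) ∧
    (∀ i j k, W'.G tt j i k = ε * (W.G tt j i k - jj A * dl i j * x k)) := by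
  obtain ⟨x, y, hT⟩ := C.T_eq
  have key : ∀ i j, (∀ k, W'.G tt j i k = ε * (W.G tt j i k - jj A * dl i j * x k)) ∧
      (∀ k, ε * W'.G ff i k j =
        ε * (W.G ff i k j + dl j k * W.E ff i f - jj A * dl i j * y k)) ∧ (0 : A) = 0 := by
    intro i j
    refine coeff_eq (W := W) fun g => ?_
    have h := W.comm ff tt i j g
    have h' := W'.comm ff tt i j g
    have e := C.E_eps ff i
    simp only [C.E_false, C.E_true, hT, leib, kap_true, kap_false, tp,
      sum_two] at h h' ⊢
    fin_cases j <;> simp only [Fin.zero_eta, Fin.mk_one, Fin.isValue, dl_00, dl_01, dl_10, dl_11]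
      at *
    · linear_combination h' - ε * h - W.E tt 0 g * e
    · linear_combination h' - ε * h - W.E tt 1 g * e
  refine ⟨x, y, hT, fun i j k => ?_, fun i j k => (key i j).1 k⟩
  exact C.unit.mul_left_cancel ((key i j).2.1 k)

lemma connection (C : Conf W W' f ε) :
    (∀ g, W'.T g = ε * (W.T g - ∑ k, jj A * W.E tt k f * W.E ff k g
      + ∑ k, jj A * W.E ff k f * W.E tt k g)) ∧
    (∀ i j k, W'.G ff i k j =
      W.G ff i k j + dl j k * W.E ff i f + dl i j * W.E ff k f) ∧
    (∀ i j k, W'.G tt j i k = ε * (W.G tt j i k - dl i j * W.E tt k f)) := by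
  obtain ⟨x, y, hT, h0, h1⟩ := C.connection_raw
  have J := jj_mul_jj (A := A)
  have hy : ∀ i j, i ≠ j → y i = jj A * W.E ff i f := by
    intro i j hij
    have key := (coeff_eq (W := W) (x := fun k => W'.G ff i j k - W'.G ff j i k)
      (y := 0) (z := 0) (x' := fun k => W.G ff i j k - W.G ff j i k)
      (y' := 0) (z' := 0) fun g => by
        have h := W.comm ff ff i j g
        have h' := W'.comm ff ff i j g
        simp only [C.E_false, kap_false, tp, sum_two, Pi.zero_apply] at h h' ⊢
        linear_combination h - h').1 j
    simp only [h0] at key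
    simp only [dl, hij, hij.symm, if_true, if_false] at key
    linear_combination (-jj A) * key + y i * J
  have hx : ∀ i j, i ≠ j → x i = -jj A * W.E tt i f := by
    intro i j hij
    have key := (coeff_eq (W := W) (x := 0)
      (y := fun k => ε * (-W'.G tt i k j + W'.G tt j k i)) (z := 0) (x' := 0)
      (y' := fun k => ε * ε * (-W.G tt i k j + W.G tt j k i - W.E tt i f * dl j k
        + W.E tt j f * dl i k)) (z' := 0) fun g => by
        have h := W.comm tt tt i j g
        have h' := W'.comm tt tt i j g
        have e := C.E_eps tt i
        have e' := C.E_eps tt j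
        simp only [C.E_true, kap_true, tp, sum_two, Pi.zero_apply, leibniz,
          smul_eq_mul] at h h' ⊢
        have k0 : W.E tt j g = dl j 0 * W.E tt 0 g + dl j 1 * W.E tt 1 g := by
          fin_cases j <;> simp [dl]
        have k1 : W.E tt i g = dl i 0 * W.E tt 0 g + dl i 1 * W.E tt 1 g := by
          fin_cases i <;> simp [dl]
        linear_combination ε * ε * h - h' + ε * W.E tt j g * e - ε * W.E tt i g * e'
          - ε * ε * W.E tt i f * k0 + ε * ε * W.E tt j f * k1).2.1 j
    simp only [h1, dl, hij, hij.symm, if_true, if_false] at key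
    have k2 := (C.unit.mul C.unit).mul_left_cancel (b := jj A * x i) (c := W.E tt i f)
      (by linear_combination -key)
    linear_combination (-jj A) * k2 + x i * J
  have hy' : ∀ i, y i = jj A * W.E ff i f := fun i => by
    fin_cases i
    · exact hy 0 1 (by decide)
    · exact hy 1 0 (by decide)
  have hx' : ∀ i, x i = -jj A * W.E tt i f := fun i => by
    fin_cases i
    · exact hx 0 1 (by decide)
    · exact hx 1 0 (by decide)
  refine ⟨fun g => ?_, fun i j k => ?_, fun i j k => ?_⟩
  · rw [hT]; simp only [hx', hy', sum_two]; ring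
  · rw [h0, hy']; linear_combination (-dl i j * W.E ff k f) * J
  · rw [h1, hx']; linear_combination (ε * dl i j * W.E tt k f) * J

lemma Gtr_false (C : Conf W W' f ε) (i : ι) :
    W'.Gtr ff i = W.Gtr ff i + 3 * W.E ff i f := by
  simp only [Gtr, sum_two, C.connection.2.1, dl_00, dl_11]
  fin_cases i <;> simp [dl] <;> ring

lemma Gtr_true (C : Conf W W' f ε) (j : ι) :
    W'.Gtr tt j = ε * (W.Gtr tt j - W.E tt j f) := by
  simp only [Gtr, sum_two, C.connection.2.2]
  fin_cases j <;> simp [dl] <;> ring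

lemma Gt_trace (C : Conf W W' f ε) : ∑ k, W'.Gt k k = ε * (∑ k, W.Gt k k
    - jj A * ∑ k, W.E tt k f * (W.Gtr ff k + W.E ff k f)
    + jj A * ∑ k, W.E ff k f * W.Gtr tt k
    + jj A * W.divV (fun m => W.E tt m f)) := by
  obtain ⟨hT, h0, h1⟩ := C.connection
  have J := jj_mul_jj (A := A)
  set n : ι → A := fun m => W.E ff m f with hn
  set v : ι → A := fun m => W.E tt m f with hv
  have key : ∀ i k, W'.Gt i k = ε * (W.Gt i k - jj A * n i * v k
      - jj A * ∑ m, v m * (W.G ff m i k - W.G ff i m k) + jj A * W.E ff i (v k)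
      + jj A * ∑ m, n m * W.G tt m i k) := by
    intro i k
    have := (coeff_eq (W := W) (x := fun k => W'.Gt i k)
      (x' := fun k => ε * (W.Gt i k - jj A * n i * v k
      - jj A * ∑ m, v m * (W.G ff m i k - W.G ff i m k) + jj A * W.E ff i (v k)
      + jj A * ∑ m, n m * W.G tt m i k))
      (y := fun k => - ε * W'.Tor ff i k)
      (y' := fun k => ε * (jj A * n i * n k - W.Tor ff i k - jj A * W.E ff i (n k)
        + jj A * ∑ m, n m * W.G ff i k m)) (z := 0) (z' := 0)
      fun g => by
        have c := W.commT ff i g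
        have c' := W'.commT ff i g
        have e := C.E_eps ff i
        have a0 := W.comm ff ff i 0 g
        have a1 := W.comm ff ff i 1 g
        have b0 := W.comm ff tt i 0 g
        have b1 := W.comm ff tt i 1 g
        simp only [C.E_true, C.E_false, hT, kap_true, kap_false, tp, sum_two,
          leib, derivation_jj, map_add, map_sub, Bool.not_false,
          ← hn, ← hv] at *
        fin_cases i <;>
          simp only [Fin.zero_eta, Fin.mk_one, Fin.isValue, dl_00, dl_01, dl_10, dl_11] at *
        · linear_combination -c' + ε * c + ε * jj A * (v 0 * a0 + v 1 * a1)
            - ε * jj A * (n 0 * b0 + n 1 * b1) + ε * n 0 * W.T g * J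
            - (W.T g - (jj A * v 0 * W.E ff 0 g + jj A * v 1 * W.E ff 1 g)
              + (jj A * n 0 * W.E tt 0 g + jj A * n 1 * W.E tt 1 g)) * e
        · linear_combination -c' + ε * c + ε * jj A * (v 0 * a0 + v 1 * a1)
            - ε * jj A * (n 0 * b0 + n 1 * b1) + ε * n 1 * W.T g * J
            - (W.T g - (jj A * v 0 * W.E ff 0 g + jj A * v 1 * W.E ff 1 g)
              + (jj A * n 0 * W.E tt 0 g + jj A * n 1 * W.E tt 1 g)) * e).1 k
    exact this
  simp only [key, sum_two, Gtr, divV, d1, c1, kap_true]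
  ring

lemma ric (C : Conf W W' f ε) (α γ : ι) : W'.ric α γ = ε * (W.ric α γ
    - W.d1 tt ff α (fun m => W.E tt m f) γ - 3 * W.d1 ff tt γ (fun m => W.E ff m f) α
    - dl α γ * (3 * (∑ k, W.E ff k f * W.E tt k f) + W.divV (fun m => W.E tt m f))) := by
  obtain ⟨hT, h0, h1⟩ := C.connection
  have J := jj_mul_jj (A := A)
  have e := C.E_eps ff α
  have h3 : ∀ X : Derivation ℂ A A, X (3 : A) = 0 := fun X => by
    rw [← map_ofNat (algebraMap ℂ A) 3]; exact X.map_algebraMap _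
  have hJ : ε * ((∑ k, (W.Gtr tt k * W.E ff k f - W.E tt k f * W.E ff k f
      - W.E tt k f * W.Gtr ff k)) + W.divV (fun m => W.E tt m f)) * (jj A * jj A + 1) = 0 := by
    rw [J]; ring
  rw [sum_two] at hJ
  rw [ric_eq, ric_eq, C.Gt_trace]
  simp only [C.Gtr_false, C.Gtr_true, C.E_true, C.E_false, h0, h1, sum_two, d1, c1,
    kap_true, kap_false, leib, map_add, map_sub, h3]
  fin_cases α <;> fin_cases γ <;>
    simp only [Fin.zero_eta, Fin.mk_one, Fin.isValue, dl_00, dl_01, dl_10, dl_11] at *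
  · linear_combination (W.Gtr tt 0 - W.E tt 0 f) * e + hJ
  · linear_combination (W.Gtr tt 1 - W.E tt 1 f) * e
  · linear_combination (W.Gtr tt 0 - W.E tt 0 f) * e
  · linear_combination (W.Gtr tt 1 - W.E tt 1 f) * e + hJ

end Conf

end Web

end Algebra

section Algebra

variable {A : Type*} [CommRing A] [Algebra ℂ A]

namespace Web

namespace Conf

variable {W W' : Web A} {f ε : A}

lemma rsc (C : Conf W W' f ε) : W'.rsc = ε * (W.rsc
    - 3 * (W.divC (fun m => W.E ff m f) + W.divV (fun m => W.E tt m f))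
    - 6 * ∑ k, W.E ff k f * W.E tt k f) := by
  simp only [Web.rsc, C.ric, divC, divV, sum_two, dl_00, dl_11]; ring

lemma leeU (C : Conf W W' f ε) (α γ : ι) :
    W'.leeU α γ = ε * (W.leeU α γ + jj A * W.wOf (fun m => W.E tt m f) α γ) := by
  have h1 := W.wOf_grad f α γ
  have k := two_mul_hh (A := A)
  have h4 : 4 * (hh A * hh A) = 1 := by linear_combination (2 * hh A + 1) * k
  rw [Web.leeU, Web.leeU, C.ric, C.rsc]
  simp only [wOf, tfU] at h1 ⊢
  linear_combination (-3 * jj A * ε * hh A * hh A) * h1 + (jj A * ε * (W.d1 tt ff α (fun m => W.E tt m f) γ - hh A * dl α γ * W.divV (fun m => W.E tt m f))) * h4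
    - (jj A * hh A * hh A * ε * dl α γ * (3 * (∑ k, W.E ff k f * W.E tt k f)
      + W.divV (fun m => W.E tt m f))) * k

lemma d1_lower_upper (C : Conf W W' f ε) (u : ι → A) (i β : ι) :
    W'.d1 tt ff i (fun m => ε * u m) β =
      ε * (W.d1 tt ff i u β + dl i β * ∑ m, W.E ff m f * u m) := by
  have e := C.E_eps ff i
  simp only [d1, c1, kap_true, C.E_false, C.connection.2.1, leib,
    sum_two]
  linear_combination (norm := skip) u β * e
  fin_cases β <;> simp only [Fin.zero_eta, Fin.mk_one, Fin.isValue, dl_00, dl_01, dl_10, dl_11] <;>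
    ring1

lemma wOf (C : Conf W W' f ε) (u : ι → A) (α β : ι) :
    W'.wOf (fun m => ε * u m) α β = ε * W.wOf u α β := by
  have k := two_mul_hh (A := A)
  simp only [Web.wOf, divV, C.d1_lower_upper, sum_two, dl_00, dl_11]
  linear_combination (-ε * dl α β * (W.E ff 0 f * u 0 + W.E ff 1 f * u 1)) * k

lemma divU (C : Conf W W' f ε) {w : ι → ι → A} (hw : w 0 0 + w 1 1 = 0) (β : ι) :
    W'.divU (fun a b => ε * w a b) β =
      ε * ε * (W.divU w β + ∑ m, W.E tt m f * w m β) := by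
  have e0 := C.E_eps tt 0
  have e1 := C.E_eps tt 1
  simp only [Web.divU, d2, c2, kap_true, kap_false, C.E_true, C.connection.2.2, leib, sum_two, dl_00, dl_01, dl_10, dl_11]
  linear_combination ε * w 0 β * e0 + ε * w 1 β * e1 - ε * ε * W.E tt β f * hw

lemma divL (C : Conf W W' f ε) {w : ι → ι → A} (hw : w 0 0 + w 1 1 = 0) (α : ι) :
    W'.divL (fun a b => ε * w a b) α = ε * (W.divL w α + ∑ m, W.E ff m f * w α m) := by
  have e0 := C.E_eps ff 0
  have e1 := C.E_eps ff 1
  simp only [Web.divL, d2, c2, kap_true, kap_false, C.E_false, C.connection.2.1, leib, sum_two, dl_00, dl_01, dl_10, dl_11]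
  linear_combination (norm := skip) w α 0 * e0 + w α 1 * e1 - ε * W.E ff α f * hw
  fin_cases α <;> simp only [Fin.zero_eta, Fin.mk_one, Fin.isValue, dl_00, dl_01, dl_10, dl_11] <;>
    ring1

lemma tfU (C : Conf W W' f ε) (q : ι → A) (α β : ι) :
    W'.tfU (fun m => ε * q m) α β = ε * ε * (W.tfU q α β - W.E tt β f * q α
      + dl α β * (hh A * ∑ m, W.E tt m f * q m)) := by
  have k := two_mul_hh (A := A)
  have e := C.E_eps tt β
  have e0 := C.E_eps tt 0
  have e1 := C.E_eps tt 1
  simp only [Web.tfU, divC, d1, c1, kap_false, C.E_true, C.connection.2.2, leib, sum_two, dl_00, dl_11]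
  linear_combination ε * q α * e - dl α β * hh A * ε * (q 0 * e0 + q 1 * e1)
    - dl α β * ε * ε * (W.E tt 0 f * q 0 + W.E tt 1 f * q 1) * k

lemma wOf_sq (C : Conf W W' f ε) (p : ι → A) (α β : ι) :
    W'.wOf (fun m => ε * ε * p m) α β = ε * ε * (W.wOf p α β - W.E ff α f * p β
      + dl α β * (hh A * ∑ m, W.E ff m f * p m)) := by
  have h : (fun m => ε * ε * p m) = fun m => ε * (ε * p m) := by funext m; ring
  have e := C.E_eps ff α
  have e0 := C.E_eps ff 0
  have e1 := C.E_eps ff 1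
  rw [h, C.wOf]
  simp only [Web.wOf, divV, d1_mul, sum_two]
  linear_combination ε * p β * e - dl α β * hh A * ε * (p 0 * e0 + p 1 * e1)

lemma lapl (C : Conf W W' f ε) {w : ι → ι → A} (hw : w 0 0 + w 1 1 = 0) (α β : ι) :
    W'.lapl (hh A * algebraMap ℂ A (1 / 3) * W'.rsc) (fun a b => ε * w a b) α β =
      ε * ε * (W.lapl (hh A * algebraMap ℂ A (1 / 3) * W.rsc) w α β + W.brk f w α β) := by
  have h3 : 3 * algebraMap ℂ A (1 / 3) = 1 := by
    rw [← map_ofNat (algebraMap ℂ A) 3, ← map_mul]; norm_num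
  have k := two_mul_hh (A := A)
  have hp := funext (C.divU hw)
  have hq := funext (C.divL hw)
  have hH := W.wOf_grad f
  rw [Web.lapl, Web.lapl, hp, hq, C.wOf_sq, C.tfU, C.rsc]
  clear hp hq
  set n : ι → A := fun m => W.E ff m f with hn
  set v : ι → A := fun m => W.E tt m f with hv
  have hE0 : ∀ m, W.E ff m f = n m := fun _ => rfl
  have hE1 : ∀ m, W.E tt m f = v m := fun _ => rfl
  have hw1 : w 1 1 = - w 0 0 := by linear_combination hw
  have dv : ∀ i β, W.d1 tt ff i (fun β => W.divU w β + ∑ m, v m * w m β) β =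
      W.d1 tt ff i (W.divU w) β +
      ∑ r, (W.d1 tt ff i v r * w r β + v r * W.d2 ff tt ff i w r β) := fun i β => by
    rw [← W.d1_contract tt ff i v w β]; exact W.d1_add ..
  have dn : ∀ i α, W.d1 ff tt i (fun α => W.divL w α + ∑ m, n m * w α m) α =
      W.d1 ff tt i (W.divL w) α +
      ∑ r, (W.d1 ff tt i n r * w α r + n r * W.d2 ff tt tt i w α r) := fun i β => by
    rw [← W.d1_contract' ff tt i n w β]; exact W.d1_add ..
  have tr0 := W.d2_trace hw tt 0
  have tr1 := W.d2_trace hw tt 1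
  have tl0 := W.d2_trace hw ff 0
  have tl1 := W.d2_trace hw ff 1
  have h00 := hH 0 0
  have h01 := hH 0 1
  have h10 := hH 1 0
  have h11 := hH 1 1
  have hp : ∀ b, W.divU w b = W.d2 ff tt tt 0 w 0 b + W.d2 ff tt tt 1 w 1 b := by
    intro b; rw [Web.divU, sum_two]
  have hq : ∀ b, W.divL w b = W.d2 ff tt ff 0 w b 0 + W.d2 ff tt ff 1 w b 1 := by
    intro b; rw [Web.divL, sum_two]
  have hp0 := hp 0
  have hp1 := hp 1
  have hq0 := hq 0
  have hq1 := hq 1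
  simp only [Web.wOf, Web.tfU, divV, divC, sum_two, dl_00, dl_01, dl_10, dl_11]
    at h00 h01 h10 h11
  generalize algebraMap ℂ A (1 / 3) = t at *
  have z3 := congrArg (HMul.hMul (hh A * (W.d1 ff tt 0 n 0 + W.d1 ff tt 1 n 1
    + W.d1 tt ff 0 v 0 + W.d1 tt ff 1 v 1 + 2 * (n 0 * v 0 + n 1 * v 1)))) h3
  have z2 := congrArg (HMul.hMul (n 0 * v 0 + n 1 * v 1
    + (W.d1 ff tt 0 n 0 + W.d1 ff tt 1 n 1))) k
  simp only [hE0, hE1, brk, Web.wOf, Web.tfU, divV, divC]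
  simp only [dv, dn]
  simp only [sum_two]
  fin_cases α <;> fin_cases β <;>
    simp only [Fin.zero_eta, Fin.mk_one, Fin.isValue, dl_00, dl_01, dl_10, dl_11, hw1]
  · linear_combination ε * ε * (w 0 0 * h00 + w 0 1 * h10)
      - ε * ε * hh A * (w 0 0 * h00 + w 0 1 * h10 + w 1 0 * h01 - w 0 0 * h11)
      - ε * ε * w 0 0 * z3
      - ε * ε * hh A * (v 0 * hq0 + v 1 * hq1 + n 0 * hp0 + n 1 * hp1)
      + ε * ε * (W.d1 tt ff 0 v 0 * w 0 0 - 2 * w 0 0 * v 0 * n 0 - w 0 0 * W.d1 tt ff 1 v 1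
        - w 0 0 * (W.d1 ff tt 0 n 0 + W.d1 ff tt 1 n 1) - v 0 * w 0 1 * n 1
        + W.d1 tt ff 0 v 1 * w 1 0 - w 1 0 * v 1 * n 0 + W.d1 tt ff 1 v 0 * w 0 1) * k
  · linear_combination ε * ε * (w 0 0 * h01 + w 0 1 * h11)
      - ε * ε * w 0 1 * z3
      - ε * ε * w 0 1 * z2
  · linear_combination ε * ε * (w 1 0 * h00 - w 0 0 * h10)
      - ε * ε * w 1 0 * z3
      - ε * ε * w 1 0 * z2
  · linear_combination ε * ε * (w 1 0 * h01 - w 0 0 * h11)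
      - ε * ε * hh A * (w 0 0 * h00 + w 0 1 * h10 + w 1 0 * h01 - w 0 0 * h11)
      + ε * ε * w 0 0 * z3
      - ε * ε * hh A * (v 0 * hq0 + v 1 * hq1 + n 0 * hp0 + n 1 * hp1)
      + ε * ε * (W.d1 tt ff 1 v 0 * w 0 1 - w 0 1 * v 0 * n 1 - W.d1 tt ff 1 v 1 * w 0 0
        + 2 * w 0 0 * v 1 * n 1 + w 0 0 * W.d1 tt ff 0 v 0
        + w 0 0 * (W.d1 ff tt 0 n 0 + W.d1 ff tt 1 n 1) - v 1 * w 1 0 * n 0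
        + W.d1 tt ff 0 v 1 * w 1 0) * k

lemma divU_sq (C : Conf W W' f ε) {w : ι → ι → A} (hw : w 0 0 + w 1 1 = 0) (β : ι) :
    W'.divU (fun a b => ε * ε * w a b) β = ε * ε * ε * W.divU w β := by
  have h : (fun a b => ε * ε * w a b) = fun a b => ε * (fun a b => ε * w a b) a b := by
    funext a b; ring
  have e0 := C.E_eps tt 0
  have e1 := C.E_eps tt 1
  rw [h, C.divU (w := fun a b => ε * w a b) (by linear_combination ε * hw)]
  simp only [Web.divU, d2_mul, sum_two]
  linear_combination ε * ε * (w 0 β * e0 + w 1 β * e1)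

lemma prodHW (C : Conf W W' f ε) {H w : ι → ι → A} (hH : H 0 0 + H 1 1 = 0)
    (hw : w 0 0 + w 1 1 = 0) (β : ι) :
    W'.prodHW (fun a b => ε * H a b) (fun a b => ε * w a b) β = ε * ε * ε * W.prodHW H w β := by
  have e := C.E_eps tt β
  have k := two_mul_hh (A := A)
  have hs : (∑ m, ∑ n, ε * H m n * (ε * w n m)) = ε * (ε * ∑ m, ∑ n, H m n * w n m) := by
    simp only [sum_two]; ring
  simp only [Web.prodHW, C.divU hH, C.divU hw, C.E_true, hs, leib]
  generalize W.E tt β (∑ m, ∑ n, H m n * w n m) = TR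
  have hH1 : H 1 1 = - H 0 0 := by linear_combination hH
  have hw1 : w 1 1 = - w 0 0 := by linear_combination hw
  simp only [sum_two]
  linear_combination (norm := skip) ε * ε * (2 * H 0 0 * w 0 0 + H 0 1 * w 1 0 + H 1 0 * w 0 1) *
    (2 * hh A * e - ε * W.E tt β f * k)
  fin_cases β <;> simp only [Fin.zero_eta, Fin.mk_one, Fin.isValue, hH1, hw1] <;> ring1

lemma prodUH (C : Conf W W' f ε) {H : ι → ι → A} (hH : H 0 0 + H 1 1 = 0)
    (u : ι → A) (γ β : ι) :
    W'.prodUH (fun a => ε * u a) (fun a b => ε * H a b) γ β = ε * ε * ε * W.prodUH u H γ β := by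
  have hs : (fun σ => ∑ α, ε * u α * (ε * H α σ)) = fun σ => ε * ε * ∑ α, u α * H α σ := by
    funext σ; simp only [sum_two]; ring
  have hd : ∀ (z : ι → A) γ β, W'.d1 tt tt γ (fun σ => ε * ε * z σ) β =
      ε * ε * ε * (W.d1 tt tt γ z β - 2 * W.E tt γ f * z β - W.E tt β f * z γ) := by
    intro z γ β
    have e := C.E_eps tt γ
    simp only [d1, c1, kap_true, C.E_true, C.connection.2.2, leib,
      sum_two]
    fin_cases γ <;> simp only [Fin.zero_eta, Fin.mk_one, Fin.isValue, dl_00, dl_01, dl_10, dl_11]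
      at * <;> linear_combination 2 * ε * ε * z β * e
  simp only [Web.prodUH, C.divU hH, hs, hd]
  generalize W.d1 tt tt γ (fun σ => ∑ α, u α * H α σ) β = D1
  generalize W.d1 tt tt β (fun σ => ∑ α, u α * H α σ) γ = D2
  simp only [sum_two]
  have hH1 : H 1 1 = - H 0 0 := by linear_combination hH
  fin_cases γ <;> fin_cases β <;> simp only [Fin.zero_eta, Fin.mk_one, Fin.isValue, hH1] <;> ring

lemma db12 (C : Conf W W' f ε) {c : ι → ι → A} (hc : ∀ i j, c i j = -c j i) (β : ι) :
    W'.db12 (fun a b => ε * ε * ε * c a b) β = ε * ε * ε * W.db12 c β := by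
  have e0 := C.E_eps ff 0
  have e1 := C.E_eps ff 1
  have h10 := hc 1 0
  have h0 : c 0 0 = 0 := two_mul_cancel_of_algebra (by linear_combination hc 0 0)
  have h1 : c 1 1 = 0 := two_mul_cancel_of_algebra (by linear_combination hc 1 1)
  simp only [Web.db12, d2, c2, kap_true, C.E_false, C.connection.2.1, leib,
    sum_two, dl_00, dl_01, dl_10, dl_11]
  fin_cases β <;> simp only [Fin.zero_eta, Fin.mk_one, Fin.isValue, dl_00, dl_01, dl_10, dl_11,
    h0, h1, h10, map_zero, map_neg]
  · linear_combination -(jj A * 3 * ε * ε * c 0 1) * e1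
  · linear_combination (jj A * 3 * ε * ε * c 0 1) * e0

/-- The transformation law of the fourth order operator. -/
lemma Qop (C : Conf W W' f ε) {u : ι → A} (hu : W.Closed u) (β : ι) :
    W'.Qop (hh A * algebraMap ℂ A (1 / 3) * W'.rsc) W'.leeU (fun m => ε * u m) β =
      ε * ε * ε * (W.Qop (hh A * algebraMap ℂ A (1 / 3) * W.rsc) W.leeU u β
        + W.Lop (fun m => f * u m) β) := by
  set w := W.wOf u with hwdef
  set H := W.wOf (fun m => W.E tt m f) with hHdef
  have hw : w 0 0 + w 1 1 = 0 := W.wOf_trace u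
  have hH : H 0 0 + H 1 1 = 0 := W.wOf_trace _
  have k := two_mul_hh (A := A)
  have hl : W.leeU 0 0 + W.leeU 1 1 = 0 := by
    simp only [Web.leeU, Web.rsc, sum_two, dl_00, dl_11]
    linear_combination (jj A * hh A * hh A * (W.ric 0 0 + W.ric 1 1)) * k
  have h1 : W'.wOf (fun m => ε * u m) = fun a b => ε * w a b := by
    funext a b; exact C.wOf u a b
  let K := fun a b => W.leeU a b + jj A * H a b
  have h2 : W'.leeU = fun a b => ε * K a b := by
    funext a b; exact C.leeU a b
  have h3 := funext fun a => funext fun b => C.lapl hw a b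
  set r := hh A * algebraMap ℂ A (1 / 3) * W.rsc
  have htr : (W.lapl r w 0 0 + W.brk f w 0 0)
      + (W.lapl r w 1 1 + W.brk f w 1 1) = 0 := by
    have e1 := W.wOf_trace (W.divU w)
    have e2 : W.tfU (W.divL w) 0 0 + W.tfU (W.divL w) 1 1 = 0 := by
      simp only [Web.tfU, divC, sum_two, dl_00, dl_11]
      linear_combination -(W.d1 ff tt 0 (W.divL w) 0 + W.d1 ff tt 1 (W.divL w) 1) * k
    have e3 : W.brk f w 0 0 + W.brk f w 1 1 = 0 := by
      simp only [brk, Web.divU, Web.divL, sum_two]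
      linear_combination -(W.divC (fun m => W.E ff m f) + W.divV (fun m => W.E tt m f)) * hw
    simp only [Web.lapl]
    linear_combination -e1 - e2 + e3 + r * hw
  have hl' : (W.leeU 0 0 + jj A * H 0 0) + (W.leeU 1 1 + jj A * H 1 1) = 0 := by
    linear_combination hl + jj A * hH
  have h4 := W.brk_identity f hu β
  have h5 := C.prodHW (H := K) hl' hw β
  have h6 := funext fun a => funext fun b => C.prodUH (H := K)
    hl' u a b
  have h7 : ∀ a b, W.prodUH u K a b =
      W.prodUH u W.leeU a b + jj A * W.prodUH u H a b := by
    intro a b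
    have e1 : (fun σ => ∑ α, u α * (W.leeU α σ + jj A * H α σ)) =
        fun σ => (fun σ => ∑ α, u α * W.leeU α σ) σ + jj A * (fun σ => ∑ α, u α * H α σ) σ := by
      funext σ; simp only [sum_two]; ring
    simp only [Web.prodUH, K]
    rw [e1]
    simp only [Web.divU, d2_add, d2_mul, d1_add, d1_mul, derivation_jj, sum_two]
    ring
  have h8 : W.prodHW K w β =
      W.prodHW W.leeU w β + jj A * W.prodHW H w β := by
    have e1 : (∑ m, ∑ n, (W.leeU m n + jj A * H m n) * w n m) =
        (∑ m, ∑ n, W.leeU m n * w n m) + jj A * ∑ m, ∑ n, H m n * w n m := by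
      simp only [sum_two]; ring
    simp only [Web.prodHW, K]
    rw [e1]
    simp only [Web.divU, d2_add, d2_mul, derivation_jj, map_add, leib,
      sum_two]
    ring
  have h9 := C.db12 (c := W.prodUH u K)
    (by intro i j; simp only [Web.prodUH]; ring) β
  have h10 : W.db12 (W.prodUH u K) β =
      W.db12 (W.prodUH u W.leeU) β + jj A * W.db12 (W.prodUH u H) β := by
    rw [funext fun a => funext fun b => h7 a b]
    simp only [Web.db12, d2_add, d2_mul, derivation_jj, sum_two]
    ring
  have h11 : W.divU (fun a b => W.lapl r w a b + W.brk f w a b) β = W.divU (W.lapl r w) β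
      + W.divU (W.brk f w) β := by
    simp only [Web.divU, d2_add, sum_two]; ring
  have h12 := C.divU_sq (w := fun a b => W.lapl r w a b + W.brk f w a b) htr β
  rw [Web.Qop, Web.Qop, h1, h2, h3, h12, h5, h6, h9, h8, h10, h11, ← h4]
  ring

end Conf

end Web

end Algebra

section Algebra

variable {A : Type*} [CommRing A] [Algebra ℂ A]

variable (A) in
/-- The data used to write down the operators in components referred to an arbitrary frame: the
frame fields `Z_i` (`ff`) and `Z_ī` (`tt`), the connection matrices acting on the two types of
indices, the Levi matrix, its inverse and the torsion. -/
structure FrameData where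
  X : Bool → ι → Derivation ℂ A A
  K : Bool → ι → Bool → ι → ι → A
  hI : ι → ι → A
  h : ι → ι → A
  tau : ι → ι → A

namespace FrameData

variable (D : FrameData A)

/-- The covariant derivative of a tensor with one index of type `s`. -/
def cov1 (s a : Bool) (i : ι) (u : ι → A) (n : ι) : A := c1 (D.X a i) (D.K a i s) u n

/-- The covariant derivative of a tensor with two indices of types `s`, `t`. -/
def cov2 (s t a : Bool) (i : ι) (w : ι → ι → A) (m n : ι) : A :=
  c2 (D.X a i) (D.K a i s) (D.K a i t) w m n

/-- Contraction of an index of type `ff` with an index of type `tt`. -/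
def con (t : ι → ι → A) : A := ∑ μ, ∑ ν, D.hI μ ν * t μ ν

/-- The trace-free part of `∇_α u_β̄`. -/
def wOf (u : ι → A) (α β : ι) : A :=
  D.cov1 tt ff α u β - D.h α β * (hh A * D.con fun μ ν => D.cov1 tt ff μ u ν)

/-- The trace-free part of `∇_β̄ v_α`. -/
def tfU (v : ι → A) (α β : ι) : A :=
  D.cov1 ff tt β v α - D.h α β * (hh A * D.con fun μ ν => D.cov1 ff tt ν v μ)

/-- `∇^μ w_{μβ̄}`. -/
def divU (w : ι → ι → A) (β : ι) : A :=
  D.con fun μ ν => D.cov2 ff tt tt ν w μ β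

/-- `∇^ν̄ w_{αν̄}`. -/
def divL (w : ι → ι → A) (α : ι) : A :=
  D.con fun μ ν => D.cov2 ff tt ff μ w α ν

/-- The product of two trace-free tensors. -/
def prodHW (H w : ι → ι → A) (β : ι) : A :=
  (D.con fun α ν => w α β * D.divU H ν) + (D.con fun α ν => H α β * D.divU w ν)
    + hh A * D.X tt β (D.con fun m n => D.con fun m' n' => H m n' * w m' n)

/-- The product of a `(0,1)`-form and a trace-free tensor. -/
def prodUH (u : ι → A) (H : ι → ι → A) (γ β : ι) : A :=
  jj A * (u γ * D.divU H β - u β * D.divU H γ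
    + D.cov1 tt tt γ (fun σ => D.con fun α ν => u ν * H α σ) β
    - D.cov1 tt tt β (fun σ => D.con fun α ν => u ν * H α σ) γ)

/-- `i ∇^ν̄ c_{ν̄β̄}`. -/
def db12 (c : ι → ι → A) (β : ι) : A :=
  jj A * D.con fun μ ν => D.cov2 tt tt ff μ c ν β

/-- `∇_γ̄ ∇^m w_{mβ̄} - i A_γ̄^m w_{mβ̄}`. -/
def aux11 (w : ι → ι → A) (γ β : ι) : A :=
  D.cov1 tt tt γ (D.divU w) β - jj A * ∑ m, D.tau γ m * w m β

/-- `∂̄_b` on trace-free tensors. -/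
def dbb11 (w : ι → ι → A) (γ β : ι) : A :=
  jj A * (D.aux11 w γ β - D.aux11 w β γ)

/-- `∂_b ∂_b^* + ∂̄_b ∂̄_b^* + r`. -/
def lapl (r : A) (w : ι → ι → A) (α β : ι) : A :=
  -D.wOf (D.divU w) α β - D.tfU (D.divL w) α β + r * w α β

/-- The fourth order operator, with potential terms `r` and `l`. -/
def Qop (r : A) (l : ι → ι → A) (u : ι → A) (β : ι) : A :=
  jj A * D.divU (D.lapl r (D.wOf u)) β + 2 * D.prodHW l (D.wOf u) β - D.db12 (D.prodUH u l) β

/-- `i ∂_b ∂̄_b ∂_b`. -/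
def Lop (u : ι → A) (β : ι) : A := jj A * D.db12 (D.dbb11 (D.wOf u)) β

/-! #### Change of frame -/

/-- Components of a covector in a new frame. -/
def tr1 (m : ι → ι → A) (u : ι → A) (n : ι) : A := ∑ q, m n q * u q

/-- Components of a tensor in a new frame. -/
def tr2 (m m' : ι → ι → A) (w : ι → ι → A) (i j : ι) : A :=
  ∑ p, ∑ q, m i p * m' j q * w p q

/-- `D'` is obtained from `D` by the change of frame with matrices `m ff`, `m tt`. -/
structure Gauge (D D' : FrameData A) (m : Bool → ι → ι → A) : Prop where
  X : ∀ a i f, D'.X a i f = ∑ p, m a i p * D.X a p f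
  K : ∀ a i s j k, D'.X a i (m s j k) + ∑ l, D'.K a i s j l * m s l k =
    ∑ p, m a i p * ∑ l, m s j l * D.K a p s l k
  hI : ∀ p q, ∑ μ, ∑ ν, D'.hI μ ν * (m ff μ p * m tt ν q) = D.hI p q
  h : ∀ α β, D'.h α β = ∑ p, ∑ q, m ff α p * m tt β q * D.h p q
  tau : ∀ γ p, ∑ μ, D'.tau γ μ * m ff μ p = ∑ γ', m tt γ γ' * D.tau γ' p

namespace Gauge

variable {D} {D' : FrameData A} {m : Bool → ι → ι → A} 

lemma con (C : Gauge D D' m) (t : ι → ι → A) :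
    D'.con (tr2 (m ff) (m tt) t) = D.con t := by
  have h00 := C.hI 0 0
  have h01 := C.hI 0 1
  have h10 := C.hI 1 0
  have h11 := C.hI 1 1
  simp only [FrameData.con, tr2, sum_two] at *
  linear_combination t 0 0 * h00 + t 0 1 * h01 + t 1 0 * h10 + t 1 1 * h11

lemma cov1 (C : Gauge D D' m) (s a : Bool) (i : ι) (u : ι → A) (n : ι) :
    D'.cov1 s a i (tr1 (m s) u) n = tr2 (m a) (m s) (fun p => D.cov1 s a p u) i n := by
  have h0 := C.K a i s n 0
  have h1 := C.K a i s n 1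
  have x0 := C.X a i (u 0)
  have x1 := C.X a i (u 1)
  simp only [FrameData.cov1, c1, tr1, tr2, map_add, leib,
    sum_two] at *
  linear_combination u 0 * h0 + u 1 * h1 + m s n 0 * x0 + m s n 1 * x1

lemma cov2 (C : Gauge D D' m) (s t a : Bool) (i : ι) (w : ι → ι → A) (k n : ι) :
    D'.cov2 s t a i (tr2 (m s) (m t) w) k n =
      ∑ p, m a i p * tr2 (m s) (m t) (D.cov2 s t a p w) k n := by
  have h0 := C.K a i s k 0
  have h1 := C.K a i s k 1
  have g0 := C.K a i t n 0
  have g1 := C.K a i t n 1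
  have x00 := C.X a i (w 0 0)
  have x01 := C.X a i (w 0 1)
  have x10 := C.X a i (w 1 0)
  have x11 := C.X a i (w 1 1)
  simp only [FrameData.cov2, c2, tr2, map_add, leib,
    sum_two] at *
  linear_combination (m t n 0 * w 0 0 + m t n 1 * w 0 1) * h0
    + (m t n 0 * w 1 0 + m t n 1 * w 1 1) * h1
    + (m s k 0 * w 0 0 + m s k 1 * w 1 0) * g0 + (m s k 0 * w 0 1 + m s k 1 * w 1 1) * g1
    + m s k 0 * m t n 0 * x00 + m s k 0 * m t n 1 * x01
    + m s k 1 * m t n 0 * x10 + m s k 1 * m t n 1 * x11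

lemma wOf (C : Gauge D D' m) (u : ι → A) :
    D'.wOf (tr1 (m tt) u) = tr2 (m ff) (m tt) (D.wOf u) := by
  funext α β
  have h1 : (fun μ ν => D'.cov1 tt ff μ (tr1 (m tt) u) ν) =
      tr2 (m ff) (m tt) (fun p => D.cov1 tt ff p u) := by
    funext μ ν; exact C.cov1 tt ff μ u ν
  rw [FrameData.wOf, h1, C.con, C.cov1, C.h]
  simp only [tr2, FrameData.wOf, sum_two]; ring

lemma tfU (C : Gauge D D' m) (u : ι → A) :
    D'.tfU (tr1 (m ff) u) = tr2 (m ff) (m tt) (D.tfU u) := by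
  funext α β
  have h1 : (fun μ ν => D'.cov1 ff tt ν (tr1 (m ff) u) μ) =
      tr2 (m ff) (m tt) (fun p q => D.cov1 ff tt q u p) := by
    funext μ ν; rw [C.cov1 ff tt ν u μ]; simp only [tr2, sum_two]; ring
  rw [FrameData.tfU, h1, C.con, C.cov1, C.h]
  simp only [tr2, FrameData.tfU, sum_two]; ring

lemma divU (C : Gauge D D' m) (w : ι → ι → A) :
    D'.divU (tr2 (m ff) (m tt) w) = tr1 (m tt) (D.divU w) := by
  funext β
  have h1 : (fun μ ν => D'.cov2 ff tt tt ν (tr2 (m ff) (m tt) w) μ β) =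
      tr2 (m ff) (m tt) (fun p q => ∑ r, m tt β r * D.cov2 ff tt tt q w p r) := by
    funext μ ν; rw [C.cov2]; simp only [tr2, sum_two]; ring
  rw [FrameData.divU, h1, C.con]
  simp only [tr1, FrameData.divU, FrameData.con, sum_two]; ring

lemma divL (C : Gauge D D' m) (w : ι → ι → A) :
    D'.divL (tr2 (m ff) (m tt) w) = tr1 (m ff) (D.divL w) := by
  funext α
  have h1 : (fun μ ν => D'.cov2 ff tt ff μ (tr2 (m ff) (m tt) w) α ν) =
      tr2 (m ff) (m tt) (fun p q => ∑ r, m ff α r * D.cov2 ff tt ff p w r q) := by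
    funext μ ν; rw [C.cov2]; simp only [tr2, sum_two]; ring
  rw [FrameData.divL, h1, C.con]
  simp only [tr1, FrameData.divL, FrameData.con, sum_two]; ring

lemma con_tr1 (C : Gauge D D' m) (w : ι → ι → A) (u : ι → A) (β : ι) :
    (D'.con fun α ν => tr2 (m ff) (m tt) w α β * tr1 (m tt) u ν) =
      tr1 (m tt) (fun σ => D.con fun α ν => w α σ * u ν) β := by
  have h1 : (fun α ν => tr2 (m ff) (m tt) w α β * tr1 (m tt) u ν) =
      tr2 (m ff) (m tt) (fun p q => ∑ r, m tt β r * (w p r * u q)) := by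
    funext μ ν; simp only [tr1, tr2, sum_two]; ring
  rw [h1, C.con]
  simp only [tr1, FrameData.con, sum_two]; ring

lemma prodHW (C : Gauge D D' m) (H w : ι → ι → A) :
    D'.prodHW (tr2 (m ff) (m tt) H) (tr2 (m ff) (m tt) w) = tr1 (m tt) (D.prodHW H w) := by
  funext β
  have h1 : ∀ k n, (D'.con fun m' n' => tr2 (m ff) (m tt) H k n' * tr2 (m ff) (m tt) w m' n)
      = tr2 (m ff) (m tt) (fun k n => D.con fun m' n' => H k n' * w m' n) k n := by
    intro k n
    have h : (fun m' n' => tr2 (m ff) (m tt) H k n' * tr2 (m ff) (m tt) w m' n) =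
        tr2 (m ff) (m tt) (fun p q => ∑ r, ∑ s, m ff k r * m tt n s * (H r q * w p s)) := by
      funext μ ν; simp only [tr2, sum_two]; ring
    rw [h, C.con]
    simp only [tr2, FrameData.con, sum_two]; ring
  simp only [FrameData.prodHW, C.divU, C.con_tr1]
  rw [funext fun k => funext fun n => h1 k n, C.con, C.X]
  simp only [tr1, FrameData.prodHW, sum_two]; ring

lemma prodUH (C : Gauge D D' m) (u : ι → A) (H : ι → ι → A) :
    D'.prodUH (tr1 (m tt) u) (tr2 (m ff) (m tt) H) =
      tr2 (m tt) (m tt) (D.prodUH u H) := by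
  funext γ β
  have h1 : (fun σ => D'.con fun α ν => tr1 (m tt) u ν * tr2 (m ff) (m tt) H α σ) =
      tr1 (m tt) (fun σ => D.con fun α ν => u ν * H α σ) := by
    funext σ
    have := C.con_tr1 H u σ
    simp only [mul_comm (tr1 (m tt) u _), mul_comm (u _)]
    exact this
  simp only [FrameData.prodUH, C.divU, h1, C.cov1]
  simp only [tr2, FrameData.prodUH]
  generalize (fun σ => D.con fun α ν => u ν * H α σ) = y
  simp only [tr1, sum_two]; ring

lemma db12 (C : Gauge D D' m) (c : ι → ι → A) :
    D'.db12 (tr2 (m tt) (m tt) c) = tr1 (m tt) (D.db12 c) := by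
  funext β
  have h1 : (fun μ ν => D'.cov2 tt tt ff μ (tr2 (m tt) (m tt) c) ν β) =
      tr2 (m ff) (m tt) (fun p q => ∑ r, m tt β r * D.cov2 tt tt ff p c q r) := by
    funext μ ν; rw [C.cov2]; simp only [tr2, sum_two]; ring
  rw [FrameData.db12, h1, C.con]
  simp only [tr1, FrameData.db12, FrameData.con, sum_two]; ring

lemma dbb11 (C : Gauge D D' m) (w : ι → ι → A) :
    D'.dbb11 (tr2 (m ff) (m tt) w) = tr2 (m tt) (m tt) (D.dbb11 w) := by
  have h1 : D'.aux11 (tr2 (m ff) (m tt) w) = tr2 (m tt) (m tt) (D.aux11 w) := by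
    funext γ β
    have t0 := C.tau γ 0
    have t1 := C.tau γ 1
    rw [FrameData.aux11, C.divU, C.cov1]
    simp only [tr2, FrameData.aux11, sum_two] at *
    linear_combination -jj A * (m tt β 0 * w 0 0 + m tt β 1 * w 0 1) * t0
      - jj A * (m tt β 0 * w 1 0 + m tt β 1 * w 1 1) * t1
  funext γ β
  simp only [FrameData.dbb11, h1]
  simp only [tr2, FrameData.dbb11, sum_two]; ring

lemma lapl (C : Gauge D D' m) (r : A) (w : ι → ι → A) :
    D'.lapl r (tr2 (m ff) (m tt) w) = tr2 (m ff) (m tt) (D.lapl r w) := by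
  funext α β
  rw [FrameData.lapl, C.divU, C.divL, C.wOf, C.tfU]
  simp only [tr2, FrameData.lapl, sum_two]; ring

lemma Qop (C : Gauge D D' m) (r : A) (l : ι → ι → A) (u : ι → A) :
    D'.Qop r (tr2 (m ff) (m tt) l) (tr1 (m tt) u) = tr1 (m tt) (D.Qop r l u) := by
  funext β
  rw [FrameData.Qop, C.wOf, C.lapl, C.divU, C.prodHW, C.prodUH, C.db12]
  simp only [tr1, FrameData.Qop, sum_two]; ring

lemma Lop (C : Gauge D D' m) (u : ι → A) :
    D'.Lop (tr1 (m tt) u) = tr1 (m tt) (D.Lop u) := by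
  funext β
  rw [FrameData.Lop, C.wOf, C.dbb11, C.db12]
  simp only [tr1, FrameData.Lop, sum_two]; ring

end Gauge

end FrameData

namespace Web

variable (W : Web A)

/-- The operators of a web as operators in components. -/
def toFrameData : FrameData A where
  X := W.E
  K := fun a i s => kap s (W.G a i)
  hI := dl
  h := dl
  tau := W.Tor tt

lemma toFrameData_con (t : ι → ι → A) : W.toFrameData.con t = ∑ μ, t μ μ := by
  simp [FrameData.con, toFrameData, dl]

lemma toFrameData_wOf (u : ι → A) : W.toFrameData.wOf u = W.wOf u := by
  funext α β; rw [FrameData.wOf, toFrameData_con]; rfl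

lemma toFrameData_tfU (u : ι → A) : W.toFrameData.tfU u = W.tfU u := by
  funext α β; rw [FrameData.tfU, toFrameData_con]; rfl

lemma toFrameData_divU (w : ι → ι → A) : W.toFrameData.divU w = W.divU w := by
  funext β; rw [FrameData.divU, toFrameData_con]; rfl

lemma toFrameData_divL (w : ι → ι → A) : W.toFrameData.divL w = W.divL w := by
  funext β; rw [FrameData.divL, toFrameData_con]; rfl

lemma toFrameData_db12 (w : ι → ι → A) : W.toFrameData.db12 w = W.db12 w := by
  funext β; rw [FrameData.db12, toFrameData_con]; rfl

lemma toFrameData_dbb11 (w : ι → ι → A) : W.toFrameData.dbb11 w = W.dbb11 w := by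
  funext γ β; simp only [FrameData.dbb11, FrameData.aux11, toFrameData_divU]; rfl

lemma toFrameData_lapl (r : A) (w : ι → ι → A) : W.toFrameData.lapl r w = W.lapl r w := by
  funext γ β
  simp only [FrameData.lapl, toFrameData_divU, toFrameData_divL, toFrameData_wOf, toFrameData_tfU]
  rfl

lemma toFrameData_prodHW (H w : ι → ι → A) :
    W.toFrameData.prodHW H w = W.prodHW H w := by
  funext β
  simp only [FrameData.prodHW, toFrameData_con, toFrameData_divU, prodHW, mul_comm (W.divU _ _)]
  rfl

lemma toFrameData_prodUH (u : ι → A) (H : ι → ι → A) :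
    W.toFrameData.prodUH u H = W.prodUH u H := by
  funext γ β
  simp only [FrameData.prodUH, toFrameData_con, toFrameData_divU]
  rfl

lemma toFrameData_Qop (r : A) (l : ι → ι → A) (u : ι → A) :
    W.toFrameData.Qop r l u = W.Qop r l u := by
  funext β
  simp only [FrameData.Qop, toFrameData_divU, toFrameData_lapl, toFrameData_wOf,
    toFrameData_prodHW, toFrameData_prodUH, toFrameData_db12, Qop]

lemma toFrameData_Lop (u : ι → A) : W.toFrameData.Lop u = W.Lop u := by
  funext β
  simp only [FrameData.Lop, toFrameData_dbb11, toFrameData_wOf, toFrameData_db12, Lop]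

end Web

end Algebra

section Algebra

variable {A : Type*} [CommRing A] [Algebra ℂ A]

lemma intertwine_dual {X : Derivation ℂ A A} {a b k k' : ι → ι → A}
    (h1 : ∀ i j, ∑ l, a i l * b j l = dl i j) (h2 : ∀ i j, ∑ l, a l i * b l j = dl i j)
    (hb : ∀ i j, X (b i j) + ∑ l, k' i l * b l j = ∑ l, b i l * k l j) (i j : ι) :
    X (a i j) + ∑ l, -k' l i * a l j = ∑ l, a i l * -k j l := by
  have H : ∀ q, ∑ r, (X (a i r) * b q r + a i r * X (b q r)) = 0 := by
    intro q
    have := congrArg X (h1 i q)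
    simp only [derivation_dl, sum_two, map_add, leib] at this ⊢
    linear_combination this
  have H0 := H 0
  have H1 := H 1
  have b00 := hb 0 0
  have b01 := hb 0 1
  have b10 := hb 1 0
  have b11 := hb 1 1
  have d0 := h2 j 0
  have d1 := h2 j 1
  have e0 := h1 i 0
  have e1 := h1 i 1
  simp only [sum_two] at *
  fin_cases i <;> fin_cases j <;>
    simp only [Fin.zero_eta, Fin.mk_one, Fin.isValue, dl_00, dl_01, dl_10, dl_11] at *
  · linear_combination a 0 0 * H0 + a 1 0 * H1 - a 0 0 * a 0 0 * b00 - a 0 1 * a 0 0 * b01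
      - a 0 0 * a 1 0 * b10 - a 0 1 * a 1 0 * b11 - X (a 0 0) * d0 - X (a 0 1) * d1
      + (a 0 0 * k' 0 0 + a 1 0 * k' 1 0) * e0 + (a 0 0 * k' 0 1 + a 1 0 * k' 1 1) * e1
      - (a 0 0 * k 0 0 + a 0 1 * k 0 1) * d0 - (a 0 0 * k 1 0 + a 0 1 * k 1 1) * d1
  · linear_combination a 0 1 * H0 + a 1 1 * H1 - a 0 0 * a 0 1 * b00 - a 0 1 * a 0 1 * b01
      - a 0 0 * a 1 1 * b10 - a 0 1 * a 1 1 * b11 - X (a 0 0) * d0 - X (a 0 1) * d1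
      + (a 0 1 * k' 0 0 + a 1 1 * k' 1 0) * e0 + (a 0 1 * k' 0 1 + a 1 1 * k' 1 1) * e1
      - (a 0 0 * k 0 0 + a 0 1 * k 0 1) * d0 - (a 0 0 * k 1 0 + a 0 1 * k 1 1) * d1
  · linear_combination a 0 0 * H0 + a 1 0 * H1 - a 1 0 * a 0 0 * b00 - a 1 1 * a 0 0 * b01
      - a 1 0 * a 1 0 * b10 - a 1 1 * a 1 0 * b11 - X (a 1 0) * d0 - X (a 1 1) * d1
      + (a 0 0 * k' 0 0 + a 1 0 * k' 1 0) * e0 + (a 0 0 * k' 0 1 + a 1 0 * k' 1 1) * e1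
      - (a 1 0 * k 0 0 + a 1 1 * k 0 1) * d0 - (a 1 0 * k 1 0 + a 1 1 * k 1 1) * d1
  · linear_combination a 0 1 * H0 + a 1 1 * H1 - a 1 0 * a 0 1 * b00 - a 1 1 * a 0 1 * b01
      - a 1 0 * a 1 1 * b10 - a 1 1 * a 1 1 * b11 - X (a 1 0) * d0 - X (a 1 1) * d1
      + (a 0 1 * k' 0 0 + a 1 1 * k' 1 0) * e0 + (a 0 1 * k' 0 1 + a 1 1 * k' 1 1) * e1
      - (a 1 0 * k 0 0 + a 1 1 * k 0 1) * d0 - (a 1 0 * k 1 0 + a 1 1 * k 1 1) * d1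

namespace Web

/-- `W'` is obtained from `W` by a change of frame. -/
structure Change (W W' : Web A) (m : Bool → ι → ι → A) : Prop where
  E : ∀ a i f, W'.E a i f = ∑ p, m a i p * W.E a p f
  T : ∀ f, W'.T f = W.T f
  left : ∀ i j, ∑ l, m ff i l * m tt j l = dl i j
  right : ∀ i j, ∑ l, m ff l i * m tt l j = dl i j

namespace Change

variable {W W' : Web A} {m : Bool → ι → ι → A}

lemma intertwine_mixed (C : Change W W' m) (i j : ι) :
    (∀ l, W'.E tt j (m ff i l) + ∑ k, kap ff (W'.G tt j) i k * m ff k l =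
      ∑ p, m tt j p * ∑ k, m ff i k * kap ff (W.G tt p) k l) ∧
    (∀ l, W'.E ff i (m tt j l) + ∑ k, kap tt (W'.G ff i) j k * m tt k l =
      ∑ p, m ff i p * ∑ k, m tt j k * kap tt (W.G ff p) k l) := by
  have key := Conf.coeff_eq (W := W) (z := 0) (z' := 0)
    (x := fun l => W'.E tt j (m ff i l) + ∑ k, kap ff (W'.G tt j) i k * m ff k l)
    (x' := fun l => ∑ p, m tt j p * ∑ k, m ff i k * kap ff (W.G tt p) k l)
    (y' := fun l => W'.E ff i (m tt j l) + ∑ k, kap tt (W'.G ff i) j k * m tt k l)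
    (y := fun l => ∑ p, m ff i p * ∑ k, m tt j k * kap tt (W.G ff p) k l) ?_
  · exact ⟨key.1, fun l => (key.2.1 l).symm⟩
  intro f
  have h := W'.comm ff tt i j f
  have h00 := W.comm ff tt 0 0 f
  have h01 := W.comm ff tt 0 1 f
  have h10 := W.comm ff tt 1 0 f
  have h11 := W.comm ff tt 1 1 f
  have e := C.left i j
  simp only [C.E, C.T, kap_true, kap_false, tp, sum_two, map_add, leib, dl_00, dl_01, dl_10, dl_11] at *
  rw [← e] at h
  linear_combination -h + m ff i 0 * m tt j 0 * h00 + m ff i 0 * m tt j 1 * h01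
    + m ff i 1 * m tt j 0 * h10 + m ff i 1 * m tt j 1 * h11

lemma intertwine (C : Change W W' m) (a : Bool) (i : ι) (s : Bool) (j k : ι) :
    W'.E a i (m s j k) + ∑ l, kap s (W'.G a i) j l * m s l k =
      ∑ p, m a i p * ∑ l, m s j l * kap s (W.G a p) l k := by
  have hl : ∀ i j, ∑ l, m tt i l * m ff j l = dl i j := fun i j => by
    rw [dl_comm, ← C.left]; exact Finset.sum_congr rfl fun _ _ => mul_comm _ _
  have hr : ∀ i j, ∑ l, m tt l i * m ff l j = dl i j := fun i j => by
    rw [dl_comm, ← C.right]; exact Finset.sum_congr rfl fun _ _ => mul_comm _ _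
  cases a <;> cases s
  · have := intertwine_dual (X := W'.E ff i) (a := m ff) (b := m tt)
      (k' := kap tt (W'.G ff i)) (k := fun l j => ∑ p, m ff i p * kap tt (W.G ff p) l j)
      C.left C.right (fun j l => by
        rw [(C.intertwine_mixed i j).2 l]; simp only [sum_two]; ring) j k
    simp only [kap_true, kap_false, sum_two] at this ⊢
    linear_combination this
  · exact (C.intertwine_mixed i j).2 k
  · exact (C.intertwine_mixed j i).1 k
  · have := intertwine_dual (X := W'.E tt i) (a := m tt) (b := m ff)
      (k' := kap ff (W'.G tt i)) (k := fun l j => ∑ p, m tt i p * kap ff (W.G tt p) l j)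
      hl hr (fun j l => by
        rw [(C.intertwine_mixed j i).1 l]; simp only [sum_two]; ring) j k
    simp only [kap_true, kap_false, sum_two] at this ⊢
    linear_combination this

lemma intertwine_T (C : Change W W' m) (i : ι) :
    (∀ l, W.T (m tt i l) + ∑ k, kap tt W'.Gt i k * m tt k l =
      ∑ k, m tt i k * kap tt W.Gt k l) ∧
    (∀ l, ∑ k, W'.Tor tt i k * m ff k l = ∑ k, m tt i k * W.Tor tt k l) := by
  have key := Conf.coeff_eq (W := W) (z := 0) (z' := 0)
    (y := fun l => W.T (m tt i l) + ∑ k, kap tt W'.Gt i k * m tt k l)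
    (y' := fun l => ∑ k, m tt i k * kap tt W.Gt k l)
    (x := fun l => ∑ k, W'.Tor tt i k * m ff k l)
    (x' := fun l => ∑ k, m tt i k * W.Tor tt k l) ?_
  · exact ⟨key.2.1, key.1⟩
  intro f
  have h := W'.commT tt i f
  have h0 := W.commT tt 0 f
  have h1 := W.commT tt 1 f
  simp only [C.E, C.T, kap_true, sum_two, map_add, leib, Bool.not_true] at *
  linear_combination h - m tt i 0 * h0 - m tt i 1 * h1

lemma gauge (C : Change W W' m) : FrameData.Gauge W.toFrameData W'.toFrameData m where
  X := C.E
  K := C.intertwine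
  hI := fun p q => by
    simp only [toFrameData]
    rw [← C.right p q]
    simp [dl]
  h := fun p q => by
    simp only [toFrameData]
    rw [← C.left p q]
    simp [dl]
  tau := fun i => (C.intertwine_T i).2

lemma t1 (C : Change W W' m) (u : ι → A) (n : ι) :
    W'.t1 tt (FrameData.tr1 (m tt) u) n = FrameData.tr1 (m tt) (W.t1 tt u) n := by
  have h0 := (C.intertwine_T n).1 0
  have h1 := (C.intertwine_T n).1 1
  simp only [Web.t1, c1, FrameData.tr1, C.T, map_add, leib,
    sum_two] at *
  linear_combination u 0 * h0 + u 1 * h1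

lemma ric_contract (W : Web A) (u : ι → A) (n : ι) :
    ∑ p, W.ric p n * u p = 2 * jj A * W.t1 tt u n
      + W.toFrameData.con (fun μ ν =>
        W.toFrameData.cov2 tt tt ff μ (fun r => W.toFrameData.cov1 tt tt r u) ν n)
      - W.toFrameData.con (fun μ ν =>
        W.toFrameData.cov2 ff tt tt ν (fun r => W.toFrameData.cov1 tt ff r u) μ n) := by
  have h0 := W.comm1 tt ff tt 0 0 u n
  have h1 := W.comm1 tt ff tt 1 1 u n
  simp only [toFrameData_con, ric, tp, kap_true, sum_two, dl_00, dl_11] at *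
  have e : ∀ s t a i w k n, W.toFrameData.cov2 s t a i w k n = W.d2 s t a i w k n :=
    fun _ _ _ _ _ _ _ => rfl
  have e' : ∀ s a u, (fun r => W.toFrameData.cov1 s a r u) = fun r => W.d1 s a r u :=
    fun _ _ _ => rfl
  simp only [e, e']
  linear_combination -h0 - h1

lemma ric (C : Change W W' m) : W'.ric = FrameData.tr2 (m ff) (m tt) W.ric := by
  funext α n
  have G := C.gauge
  have hu : FrameData.tr1 (m tt) (m ff α) = fun j => (dl j α : A) := by
    funext j
    rw [FrameData.tr1, dl_comm, ← C.left]; exact Finset.sum_congr rfl fun _ _ => mul_comm _ _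
  have h := ric_contract W (m ff α)
  have h' := ric_contract W' (FrameData.tr1 (m tt) (m ff α)) n
  have e1 : (fun μ ν => W'.toFrameData.cov2 tt tt ff μ
      (fun r => W'.toFrameData.cov1 tt tt r (FrameData.tr1 (m tt) (m ff α))) ν n) =
      FrameData.tr2 (m ff) (m tt) (fun p q => ∑ r, m tt n r *
        W.toFrameData.cov2 tt tt ff p (fun r => W.toFrameData.cov1 tt tt r (m ff α)) q r) := by
    funext μ ν
    have : (fun r => W'.toFrameData.cov1 tt tt r (FrameData.tr1 (m tt) (m ff α))) =
      FrameData.tr2 (m tt) (m tt) (fun r => W.toFrameData.cov1 tt tt r (m ff α)) := by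
      funext r s; exact G.cov1 _ _ _ _ _
    rw [this, G.cov2]
    simp only [FrameData.tr2, sum_two]; ring
  have e2 : (fun μ ν => W'.toFrameData.cov2 ff tt tt ν
      (fun r => W'.toFrameData.cov1 tt ff r (FrameData.tr1 (m tt) (m ff α))) μ n) =
      FrameData.tr2 (m ff) (m tt) (fun p q => ∑ r, m tt n r *
        W.toFrameData.cov2 ff tt tt q (fun r => W.toFrameData.cov1 tt ff r (m ff α)) p r) := by
    funext μ ν
    have : (fun r => W'.toFrameData.cov1 tt ff r (FrameData.tr1 (m tt) (m ff α))) =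
      FrameData.tr2 (m ff) (m tt) (fun r => W.toFrameData.cov1 tt ff r (m ff α)) := by
      funext r s; exact G.cov1 _ _ _ _ _
    rw [this, G.cov2]
    simp only [FrameData.tr2, sum_two]; ring
  rw [e1, e2, G.con, G.con, C.t1, hu] at h'
  have hα : ∑ p, W'.ric p n * dl p α = W'.ric α n := by
    fin_cases α <;> simp [dl]
  rw [hα] at h'
  rw [h']
  have h0 := h 0
  have h1 := h 1
  simp only [FrameData.con, FrameData.tr1, FrameData.tr2, sum_two] at *
  linear_combination -m tt n 0 * h0 - m tt n 1 * h1

lemma rsc (C : Change W W' m) : W'.rsc = W.rsc := by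
  have h00 := C.right 0 0
  have h01 := C.right 0 1
  have h10 := C.right 1 0
  have h11 := C.right 1 1
  simp only [Web.rsc, C.ric, FrameData.tr2, sum_two, dl_00, dl_01, dl_10, dl_11] at *
  linear_combination W.ric 0 0 * h00 + W.ric 0 1 * h01 + W.ric 1 0 * h10 + W.ric 1 1 * h11

lemma leeU (C : Change W W' m) : W'.leeU = FrameData.tr2 (m ff) (m tt) W.leeU := by
  funext α γ
  have h := C.left α γ
  simp only [Web.leeU, C.rsc, C.ric]
  rw [← h]
  simp only [FrameData.tr2, Web.leeU, sum_two, dl_00, dl_01, dl_10, dl_11]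
  ring

end Change

end Web

end Algebra

/-! ### Exterior products of alternating maps in low degrees -/

section Wedge

variable {E : Type*} [AddCommGroup E] [Module ℂ E]

/-- If a signed sum of permuted copies of a multilinear map is alternating, it is a multiple of
the alternatization. -/
lemma alternatization_of_shuffle {n : ℕ} {J : Type*} [Fintype J]
    (m : MultilinearMap ℂ (fun _ : Fin n => E) ℂ) (g : E [⋀^Fin n]→ₗ[ℂ] ℂ)
    (σ : J → Equiv.Perm (Fin n))
    (hg : ∀ v, g v = ∑ j, (Equiv.Perm.sign (σ j) : ℤ) • m (fun i => v (σ j i))) (v : Fin n → E) :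
    (n.factorial : ℂ) * g v = Fintype.card J * MultilinearMap.alternatization m v := by
  have h1 : ∑ τ : Equiv.Perm (Fin n), (Equiv.Perm.sign τ : ℤ) • g (fun i => v (τ i)) =
      (n.factorial : ℂ) * g v := by
    have : ∀ τ : Equiv.Perm (Fin n), (Equiv.Perm.sign τ : ℤ) • g (fun i => v (τ i)) = g v := by
      intro τ
      have := g.map_perm v τ
      rw [show (fun i => v (τ i)) = v ∘ τ from rfl, this, Units.smul_def, smul_smul]
      simp [← Units.val_mul, Int.units_mul_self]
    simp only [this, Finset.sum_const, Finset.card_univ, Fintype.card_perm, Fintype.card_fin,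
      nsmul_eq_mul]
  rw [← h1, MultilinearMap.alternatization_apply]
  simp only [hg, Finset.smul_sum]
  rw [Finset.sum_comm]
  have h2 : ∀ j, ∑ τ : Equiv.Perm (Fin n), (Equiv.Perm.sign τ : ℤ) •
      (Equiv.Perm.sign (σ j) : ℤ) • m (fun i => v (τ (σ j i))) =
      ∑ τ : Equiv.Perm (Fin n), Equiv.Perm.sign τ • m (fun i => v (τ i)) := by
    intro j
    conv_rhs => rw [← Equiv.sum_comp (Equiv.mulRight (σ j))]
    refine Finset.sum_congr rfl fun τ _ => ?_
    simp only [Equiv.coe_mulRight, Equiv.Perm.sign_mul, Units.smul_def, smul_smul, Units.val_mul,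
      Equiv.Perm.coe_mul, Function.comp]
  simp only [h2, Finset.sum_const, Finset.card_univ, nsmul_eq_mul]
  rfl

/-- The multilinear map `v ↦ a(v₁, …) b(v_{k+1}, …)`. -/
def tensorM {k l : ℕ} (a : MultilinearMap ℂ (fun _ : Fin k => E) ℂ)
    (b : MultilinearMap ℂ (fun _ : Fin l => E) ℂ) : MultilinearMap ℂ (fun _ : Fin (k + l) => E) ℂ :=
  ((LinearMap.mul' ℂ ℂ).compMultilinearMap (MultilinearMap.domCoprod a b)).domDomCongr finSumFinEquiv

/-- The exterior product of complex alternating maps. -/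
def wedgeA {k l : ℕ} (a : E [⋀^Fin k]→ₗ[ℂ] ℂ) (b : E [⋀^Fin l]→ₗ[ℂ] ℂ) :
    E [⋀^Fin (k + l)]→ₗ[ℂ] ℂ :=
  ((k.factorial : ℂ) * (l.factorial : ℂ))⁻¹ •
    MultilinearMap.alternatization (tensorM a.toMultilinearMap b.toMultilinearMap)

lemma wedgeA_of_shuffle {k l : ℕ} {J : Type*} [Fintype J] (a : E [⋀^Fin k]→ₗ[ℂ] ℂ)
    (b : E [⋀^Fin l]→ₗ[ℂ] ℂ) (g : E [⋀^Fin (k + l)]→ₗ[ℂ] ℂ)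
    (σ : J → Equiv.Perm (Fin (k + l)))
    (hg : ∀ v, g v = ∑ j, (Equiv.Perm.sign (σ j) : ℤ) •
      (a (fun i => v (σ j (Fin.castAdd l i))) * b (fun i => v (σ j (Fin.natAdd k i)))))
    (hc : (Fintype.card J : ℂ) * (k.factorial * l.factorial) = (k + l).factorial) (v : Fin (k + l) → E) :
    wedgeA a b v = g v := by
  have h := alternatization_of_shuffle (tensorM a.toMultilinearMap b.toMultilinearMap) g σ hg v
  have hk : (k.factorial : ℂ) ≠ 0 := by exact_mod_cast k.factorial_ne_zero
  have hl : (l.factorial : ℂ) ≠ 0 := by exact_mod_cast l.factorial_ne_zero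
  have hJ : (Fintype.card J : ℂ) ≠ 0 := by
    intro h0
    rw [h0, zero_mul] at hc
    exact (Nat.factorial_ne_zero (k + l)) (by exact_mod_cast hc.symm)
  change ((k.factorial : ℂ) * (l.factorial : ℂ))⁻¹ * _ = _
  rw [inv_mul_eq_iff_eq_mul₀ (mul_ne_zero hk hl)]
  apply mul_left_cancel₀ hJ
  refine h.symm.trans ?_
  rw [← hc]; ring

/-- The alternating map `v ↦ ∑ (-1)^i a(v_i) b(…, v̂_i, …)`. -/
def wedgeOne {k : ℕ} (a : E [⋀^Fin 1]→ₗ[ℂ] ℂ) (b : E [⋀^Fin k]→ₗ[ℂ] ℂ) : E [⋀^Fin (k + 1)]→ₗ[ℂ] ℂ :=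
  AlternatingMap.alternatizeUncurryFin
    (LinearMap.smulRight ((AlternatingMap.ofSubsingleton ℂ E ℂ (0 : Fin 1)).symm a) b)

lemma wedgeOne_apply {k : ℕ} (a : E [⋀^Fin 1]→ₗ[ℂ] ℂ) (b : E [⋀^Fin k]→ₗ[ℂ] ℂ)
    (v : Fin (k + 1) → E) :
    wedgeOne a b v = ∑ i : Fin (k + 1), (-1) ^ (i : ℕ) * (a ![v i] * b (i.removeNth v)) := by
  rw [wedgeOne, AlternatingMap.alternatizeUncurryFin_apply]
  refine Finset.sum_congr rfl fun i _ => ?_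
  have : a ![v i] = (AlternatingMap.ofSubsingleton ℂ E ℂ (0 : Fin 1)).symm a (v i) := by
    simp only [AlternatingMap.ofSubsingleton_symm_apply_apply]
    congr 1; funext j; fin_cases j; rfl
  simp only [LinearMap.smulRight_apply, AlternatingMap.smul_apply, this, smul_eq_mul, zsmul_eq_mul]
  push_cast; ring

lemma wedgeA_one {k : ℕ} (a : E [⋀^Fin 1]→ₗ[ℂ] ℂ) (b : E [⋀^Fin k]→ₗ[ℂ] ℂ)
    (v : Fin (1 + k) → E) :
    wedgeA a b v = ∑ i : Fin (k + 1), (-1) ^ (i : ℕ) * (a ![v (finCongr (Nat.add_comm k 1) i)] *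
      b (fun j => v (finCongr (Nat.add_comm k 1) (i.succAbove j)))) := by
  set c := finCongr (Nat.add_comm k 1)
  refine (wedgeA_of_shuffle a b ((wedgeOne a b).domDomCongr c)
    (fun j => c.permCongr (Fin.cycleRange j).symm) (fun v => ?_) ?_ v).trans (wedgeOne_apply a b _)
  · refine (wedgeOne_apply a b _).trans (Finset.sum_congr rfl fun j _ => ?_)
    have h0 : ∀ i, c.symm (Fin.castAdd k i) = 0 := fun i => by fin_cases i; rfl
    have h1 : ∀ i, c.symm (Fin.natAdd 1 i) = i.succ := fun i => by
      ext; simp [c]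
    have h2 : (fun _ : Fin 1 => v (c j)) = ![v (c j)] := by funext i; fin_cases i; rfl
    simp only [Equiv.Perm.sign_permCongr, Equiv.Perm.sign_symm, Fin.sign_cycleRange,
      Equiv.permCongr_apply, h0, h1, Fin.cycleRange_symm_zero, Fin.cycleRange_symm_succ,
      zsmul_eq_mul, h2]
    push_cast
    rfl
  · rw [Fintype.card_fin, show (1 + k).factorial = (k + 1) * k.factorial by
      rw [Nat.add_comm, Nat.factorial_succ]]
    push_cast [Nat.factorial_one]; ring

lemma vec_one (a : E [⋀^Fin 1]→ₗ[ℂ] ℂ) (f : Fin 1 → E) : a f = a ![f 0] := by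
  congr 1; funext i; fin_cases i; rfl

lemma vec_two (a : E [⋀^ι]→ₗ[ℂ] ℂ) (f : ι → E) : a f = a ![f 0, f 1] := by
  congr 1; funext i; fin_cases i <;> rfl

lemma vec_three (a : E [⋀^Fin 3]→ₗ[ℂ] ℂ) (f : Fin 3 → E) : a f = a ![f 0, f 1, f 2] := by
  congr 1; funext i; fin_cases i <;> rfl

lemma vec_four (a : E [⋀^Fin 4]→ₗ[ℂ] ℂ) (f : Fin 4 → E) : a f = a ![f 0, f 1, f 2, f 3] := by
  congr 1; funext i; fin_cases i <;> rfl

lemma wedgeA_one_one (a b : E [⋀^Fin 1]→ₗ[ℂ] ℂ) (v : ι → E) :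
    wedgeA a b v = a ![v 0] * b ![v 1] - a ![v 1] * b ![v 0] := by
  refine (wedgeA_one a b v).trans ?_
  rw [Finset.sum_congr rfl fun _ _ => by rw [vec_one b], sum_two]
  change (-1) ^ 0 * (a ![v 0] * b ![v 1]) + (-1) ^ 1 * (a ![v 1] * b ![v 0]) = _
  ring

lemma wedgeA_one_two (a : E [⋀^Fin 1]→ₗ[ℂ] ℂ) (b : E [⋀^ι]→ₗ[ℂ] ℂ) (v : Fin 3 → E) :
    wedgeA a b v = a ![v 0] * b ![v 1, v 2] - a ![v 1] * b ![v 0, v 2] + a ![v 2] * b ![v 0, v 1] := by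
  refine (wedgeA_one a b v).trans ?_
  rw [Finset.sum_congr rfl fun _ _ => by rw [vec_two b], Fin.sum_univ_three]
  change (-1) ^ 0 * (a ![v 0] * b ![v 1, v 2]) + (-1) ^ 1 * (a ![v 1] * b ![v 0, v 2])
    + (-1) ^ 2 * (a ![v 2] * b ![v 0, v 1]) = _
  ring

lemma wedgeA_one_three (a : E [⋀^Fin 1]→ₗ[ℂ] ℂ) (b : E [⋀^Fin 3]→ₗ[ℂ] ℂ) (v : Fin 4 → E) :
    wedgeA a b v = a ![v 0] * b ![v 1, v 2, v 3] - a ![v 1] * b ![v 0, v 2, v 3]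
      + a ![v 2] * b ![v 0, v 1, v 3] - a ![v 3] * b ![v 0, v 1, v 2] := by
  refine (wedgeA_one a b v).trans ?_
  rw [Finset.sum_congr rfl fun _ _ => by rw [vec_three b], Fin.sum_univ_four]
  change (-1) ^ 0 * (a ![v 0] * b ![v 1, v 2, v 3]) + (-1) ^ 1 * (a ![v 1] * b ![v 0, v 2, v 3])
    + (-1) ^ 2 * (a ![v 2] * b ![v 0, v 1, v 3]) + (-1) ^ 3 * (a ![v 3] * b ![v 0, v 1, v 2]) = _
  ring

lemma wedgeA_one_four (a : E [⋀^Fin 1]→ₗ[ℂ] ℂ) (b : E [⋀^Fin 4]→ₗ[ℂ] ℂ) (v : Fin 5 → E) :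
    wedgeA a b v = a ![v 0] * b ![v 1, v 2, v 3, v 4] - a ![v 1] * b ![v 0, v 2, v 3, v 4]
      + a ![v 2] * b ![v 0, v 1, v 3, v 4] - a ![v 3] * b ![v 0, v 1, v 2, v 4]
      + a ![v 4] * b ![v 0, v 1, v 2, v 3] := by
  refine (wedgeA_one a b v).trans ?_
  rw [Finset.sum_congr rfl fun _ _ => by rw [vec_four b], Fin.sum_univ_five]
  change (-1) ^ 0 * (a ![v 0] * b ![v 1, v 2, v 3, v 4])
    + (-1) ^ 1 * (a ![v 1] * b ![v 0, v 2, v 3, v 4])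
    + (-1) ^ 2 * (a ![v 2] * b ![v 0, v 1, v 3, v 4])
    + (-1) ^ 3 * (a ![v 3] * b ![v 0, v 1, v 2, v 4])
    + (-1) ^ 4 * (a ![v 4] * b ![v 0, v 1, v 2, v 3]) = _
  ring

lemma alt2_swap (a : E [⋀^ι]→ₗ[ℂ] ℂ) (x y : E) : a ![y, x] = -a ![x, y] := by
  have := a.map_swap ![x, y] (i := 0) (j := 1) (by decide)
  rw [← this]; congr 1; funext i; fin_cases i <;> rfl

lemma alt2_self (a : E [⋀^ι]→ₗ[ℂ] ℂ) (x : E) : a ![x, x] = 0 :=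
  a.map_eq_zero_of_eq ![x, x] (i := 0) (j := 1) rfl (by decide)

/-- A permutation given by its table of values. -/
def permOf {n : ℕ} (f g : Fin n → Fin n) (h : ∀ i, g (f i) = i := by decide)
    (h' : ∀ i, f (g i) = i := by decide) : Equiv.Perm (Fin n) := ⟨f, g, h, h'⟩

/-- Shuffles of type `(2,1)`. -/
def shuffle21 : Fin 3 → Equiv.Perm (Fin 3) :=
  ![permOf ![0, 1, 2] ![0, 1, 2],
    permOf ![0, 2, 1] ![0, 2, 1],
    permOf ![1, 2, 0] ![2, 0, 1]]

/-- Shuffles of type `(2,2)`. -/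
def shuffle22 : Fin 6 → Equiv.Perm (Fin 4) :=
  ![permOf ![0, 1, 2, 3] ![0, 1, 2, 3],
    permOf ![0, 2, 1, 3] ![0, 2, 1, 3],
    permOf ![0, 3, 1, 2] ![0, 2, 3, 1],
    permOf ![1, 2, 0, 3] ![2, 0, 1, 3],
    permOf ![1, 3, 0, 2] ![2, 0, 3, 1],
    permOf ![2, 3, 0, 1] ![2, 3, 0, 1]]

/-- Shuffles of type `(3,2)`. -/
def shuffle32 : Fin 10 → Equiv.Perm (Fin 5) :=
  ![permOf ![0, 1, 2, 3, 4] ![0, 1, 2, 3, 4],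
    permOf ![0, 1, 3, 2, 4] ![0, 1, 3, 2, 4],
    permOf ![0, 1, 4, 2, 3] ![0, 1, 3, 4, 2],
    permOf ![0, 2, 3, 1, 4] ![0, 3, 1, 2, 4],
    permOf ![0, 2, 4, 1, 3] ![0, 3, 1, 4, 2],
    permOf ![0, 3, 4, 1, 2] ![0, 3, 4, 1, 2],
    permOf ![1, 2, 3, 0, 4] ![3, 0, 1, 2, 4],
    permOf ![1, 2, 4, 0, 3] ![3, 0, 1, 4, 2],
    permOf ![1, 3, 4, 0, 2] ![3, 0, 4, 1, 2],
    permOf ![2, 3, 4, 0, 1] ![3, 4, 0, 1, 2]]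

lemma wedgeA_two_one (a : E [⋀^ι]→ₗ[ℂ] ℂ) (b : E [⋀^Fin 1]→ₗ[ℂ] ℂ) (v : Fin 3 → E) :
    wedgeA a b v = a ![v 0, v 1] * b ![v 2] - a ![v 0, v 2] * b ![v 1] + a ![v 1, v 2] * b ![v 0] := by
  refine (wedgeA_of_shuffle a b (@wedgeA E _ _ 1 2 b a) shuffle21 (fun v => ?_)
    (by norm_num [Nat.factorial]) v).trans ((wedgeA_one_two b a v).trans (by ring))
  refine (wedgeA_one_two b a v).trans (Eq.trans ?_ (Fin.sum_univ_three _).symm)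
  have s : ∀ j, (Equiv.Perm.sign (shuffle21 j) : ℤ) = ![1, -1, 1] j := by decide
  simp only [s, vec_two a (fun i => v _), vec_one b (fun i => v _)]
  simp only [shuffle21, permOf, Matrix.cons_val, Equiv.coe_fn_mk, one_smul, neg_smul]
  change _ = a ![v 0, v 1] * b ![v 2] + -(a ![v 0, v 2] * b ![v 1]) + a ![v 1, v 2] * b ![v 0]
  ring

/-- The sum over `(2,2)`-shuffles defining the exterior product of two alternating bilinear maps. -/
def shuffleSum (a b : E [⋀^ι]→ₗ[ℂ] ℂ) (v : Fin 4 → E) : ℂ :=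
  a ![v 0, v 1] * b ![v 2, v 3] - a ![v 0, v 2] * b ![v 1, v 3]
    + a ![v 0, v 3] * b ![v 1, v 2] + a ![v 1, v 2] * b ![v 0, v 3]
    - a ![v 1, v 3] * b ![v 0, v 2] + a ![v 2, v 3] * b ![v 0, v 1]

lemma shuffle22_sum (a b : E [⋀^ι]→ₗ[ℂ] ℂ) (v : Fin 4 → E) :
    ∑ j, (Equiv.Perm.sign (shuffle22 j) : ℤ) • (a (fun i => v (shuffle22 j (Fin.castAdd 2 i)))
      * b (fun i => v (shuffle22 j (Fin.natAdd 2 i)))) = shuffleSum a b v := by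
  have s : ∀ j, (Equiv.Perm.sign (shuffle22 j) : ℤ) = ![1, -1, 1, 1, -1, 1] j := by decide
  have e : ∀ j, (fun i => v (shuffle22 j (Fin.castAdd 2 i))) =
    ![v (shuffle22 j 0), v (shuffle22 j 1)] := fun j => by funext i; fin_cases i <;> rfl
  have e' : ∀ j, (fun i => v (shuffle22 j (Fin.natAdd 2 i))) =
    ![v (shuffle22 j 2), v (shuffle22 j 3)] := fun j => by funext i; fin_cases i <;> rfl
  simp only [Fin.sum_univ_six, s, e, e', shuffleSum]
  simp only [shuffle22, permOf, Matrix.cons_val, Equiv.coe_fn_mk, one_smul, neg_smul]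
  ring

lemma shuffle22_map (a b : E [⋀^ι]→ₗ[ℂ] ℂ) (v : Fin 4 → E) :
    (∑ j, (Equiv.Perm.sign (shuffle22 j) : ℤ) • (@tensorM E _ _ 2 2 a.toMultilinearMap
      b.toMultilinearMap).domDomCongr (shuffle22 j)) v = shuffleSum a b v := by
  rw [sum_apply, ← shuffle22_sum]; rfl

/-- The exterior product of two alternating bilinear maps. -/
def wedgeTwo (a b : E [⋀^ι]→ₗ[ℂ] ℂ) : E [⋀^Fin 4]→ₗ[ℂ] ℂ where
  toMultilinearMap := ∑ j, (Equiv.Perm.sign (shuffle22 j) : ℤ) •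
    (@tensorM E _ _ 2 2 a.toMultilinearMap b.toMultilinearMap).domDomCongr (shuffle22 j)
  map_eq_zero_of_eq' := by
    intro v i j hv hij
    refine (shuffle22_map a b v).trans ?_
    have key : ∀ i j : Fin 4, i < j → v i = v j → shuffleSum a b v = 0 := by
      intro i j hij hv
      fin_cases i <;> fin_cases j <;> first | exact absurd hij (by decide) | skip
      all_goals
        simp only [Fin.zero_eta, Fin.mk_one, Fin.isValue, Fin.reduceFinMk] at hv
        simp only [shuffleSum, ← hv, alt2_self, alt2_swap _ (v 0) (v 1), alt2_swap _ (v 0) (v 2),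
          alt2_swap _ (v 1) (v 2)]
        ring
    rcases lt_or_gt_of_ne hij with h | h
    · exact key i j h hv
    · exact key j i h hv.symm

lemma wedgeA_two_two (a b : E [⋀^ι]→ₗ[ℂ] ℂ) (v : Fin 4 → E) :
    wedgeA a b v = a ![v 0, v 1] * b ![v 2, v 3] - a ![v 0, v 2] * b ![v 1, v 3]
      + a ![v 0, v 3] * b ![v 1, v 2] + a ![v 1, v 2] * b ![v 0, v 3]
      - a ![v 1, v 3] * b ![v 0, v 2] + a ![v 2, v 3] * b ![v 0, v 1] :=
  (wedgeA_of_shuffle a b (wedgeTwo a b) shuffle22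
    (fun v => (shuffle22_map a b v).trans (shuffle22_sum a b v).symm)
    (by norm_num [Nat.factorial]) v).trans (shuffle22_map a b v)

/-- Associativity of the exterior product, for a one-form and two two-forms. -/
lemma wedgeA_assoc (t : E [⋀^Fin 1]→ₗ[ℂ] ℂ) (a b : E [⋀^ι]→ₗ[ℂ] ℂ) (v : Fin 5 → E) :
    @wedgeA E _ _ 3 2 (@wedgeA E _ _ 1 2 t a) b v = @wedgeA E _ _ 1 4 t (@wedgeA E _ _ 2 2 a b) v := by
  have hc : (Fintype.card (Fin 10) : ℂ) * (Nat.factorial 3 * Nat.factorial 2) =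
      Nat.factorial (3 + 2) := by norm_num [Nat.factorial]
  have key := fun hg => wedgeA_of_shuffle (k := 3) (l := 2) (@wedgeA E _ _ 1 2 t a) b
    (@wedgeA E _ _ 1 4 t (@wedgeA E _ _ 2 2 a b)) shuffle32 hg hc v
  refine key fun v => ?_
  refine (wedgeA_one_four t (wedgeA a b) v).trans ?_
  have s : ∀ j, (Equiv.Perm.sign (shuffle32 j) : ℤ) = ![1, -1, 1, 1, -1, 1, -1, 1, -1, 1] j := by
    decide
  have e : ∀ j, (fun i => v (shuffle32 j (Fin.castAdd 2 i))) =
    ![v (shuffle32 j 0), v (shuffle32 j 1), v (shuffle32 j 2)] :=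
      fun j => by funext i; fin_cases i <;> rfl
  have e' : ∀ j, (fun i => v (shuffle32 j (Fin.natAdd 3 i))) =
    ![v (shuffle32 j 3), v (shuffle32 j 4)] := fun j => by funext i; fin_cases i <;> rfl
  have w1 : ∀ x y z, wedgeA t a ![x, y, z] = t ![x] * a ![y, z] - t ![y] * a ![x, z]
    + t ![z] * a ![x, y] := fun x y z => wedgeA_one_two t a ![x, y, z]
  have w2 : ∀ x y z w, wedgeA a b ![x, y, z, w] = a ![x, y] * b ![z, w] - a ![x, z] * b ![y, w]
      + a ![x, w] * b ![y, z] + a ![y, z] * b ![x, w]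
      - a ![y, w] * b ![x, z] + a ![z, w] * b ![x, y] := fun x y z w => wedgeA_two_two a b ![x, y, z, w]
  simp only [Fin.sum_univ_succ, Fin.sum_univ_zero]
  simp only [Fin.succ_zero_eq_one, Fin.succ_one_eq_two, Fin.isValue, Fin.reduceSucc, s, e, e']
  simp only [shuffle32, permOf, Matrix.cons_val, Equiv.coe_fn_mk, one_smul, neg_smul]
  rw [w2, w2, w2, w2, w2]
  simp only [w1]
  ring

end Wedge

/-! ### Complexified vectors and complexified forms -/

section LinearAlgebra

variable {V : Type*} [AddCommGroup V] [Module ℝ V]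

/-- The real part, as a linear map. -/
def reL : ℂ ⊗[ℝ] V →ₗ[ℝ] V := (TensorProduct.lid ℝ V).toLinearMap ∘ₗ Complex.reLm.rTensor V

/-- The imaginary part, as a linear map. -/
def imL : ℂ ⊗[ℝ] V →ₗ[ℝ] V := (TensorProduct.lid ℝ V).toLinearMap ∘ₗ Complex.imLm.rTensor V

@[simp] theorem reC_tmul (c : ℂ) (v : V) : reC (c ⊗ₜ[ℝ] v) = c.re • v := by simp [reC]
@[simp] theorem imC_tmul (c : ℂ) (v : V) : imC (c ⊗ₜ[ℝ] v) = c.im • v := by simp [imC]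

@[simp] theorem reC_add (v w : ℂ ⊗[ℝ] V) : reC (v + w) = reC v + reC w := map_add reL v w
@[simp] theorem imC_add (v w : ℂ ⊗[ℝ] V) : imC (v + w) = imC v + imC w := map_add imL v w
@[simp] theorem reC_sub (v w : ℂ ⊗[ℝ] V) : reC (v - w) = reC v - reC w := map_sub reL v w
@[simp] theorem imC_sub (v w : ℂ ⊗[ℝ] V) : imC (v - w) = imC v - imC w := map_sub imL v w
@[simp] theorem reC_neg (v : ℂ ⊗[ℝ] V) : reC (-v) = -reC v := map_neg reL v
@[simp] theorem reC_zero : reC (0 : ℂ ⊗[ℝ] V) = 0 := map_zero reL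
@[simp] theorem imC_zero : imC (0 : ℂ ⊗[ℝ] V) = 0 := map_zero imL

@[simp] theorem reC_smul (c : ℂ) (v : ℂ ⊗[ℝ] V) : reC (c • v) = c.re • reC v - c.im • imC v := by
  induction v with
  | zero => simp
  | tmul d v => simp [TensorProduct.smul_tmul', smul_smul, sub_smul]
  | add v w hv hw => simp only [smul_add, reC_add, imC_add, hv, hw]; abel

@[simp] theorem imC_smul (c : ℂ) (v : ℂ ⊗[ℝ] V) : imC (c • v) = c.re • imC v + c.im • reC v := by
  induction v with
  | zero => simp
  | tmul d v => simp [TensorProduct.smul_tmul', smul_smul, add_smul]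
  | add v w hv hw => simp only [smul_add, reC_add, imC_add, hv, hw]; abel

@[simp] theorem reC_mkC (v w : V) : reC (mkC v w) = v := by simp [mkC]
@[simp] theorem imC_mkC (v w : V) : imC (mkC v w) = w := by simp [mkC]

lemma mkC_re_im (v : ℂ ⊗[ℝ] V) : mkC (reC v) (imC v) = v := by
  induction v with
  | zero => simp [mkC]
  | tmul c v =>
    simp only [mkC, reC_tmul, imC_tmul, TensorProduct.tmul_smul]
    rw [TensorProduct.smul_tmul', TensorProduct.smul_tmul', ← TensorProduct.add_tmul]
    congr 1
    apply Complex.ext <;> simp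
  | add v w hv hw =>
    have e : mkC (reC v + reC w) (imC v + imC w) =
        mkC (reC v) (imC v) + mkC (reC w) (imC w) := by
      simp only [mkC, TensorProduct.tmul_add]; abel
    rw [reC_add, imC_add, e, hv, hw]

lemma ext_re_im {v w : ℂ ⊗[ℝ] V} (h1 : reC v = reC w) (h2 : imC v = imC w) : v = w := by
  rw [← mkC_re_im v, ← mkC_re_im w, h1, h2]

@[simp] theorem reC_conjC (v : ℂ ⊗[ℝ] V) : reC (conjC v) = reC v := by
  induction v with
  | zero => simp [conjC]
  | tmul c v => simp [conjC]
  | add v w hv hw =>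
    have : conjC (v + w) = conjC v + conjC w := map_add _ _ _
    rw [this, reC_add, reC_add, hv, hw]

@[simp] theorem imC_conjC (v : ℂ ⊗[ℝ] V) : imC (conjC v) = -imC v := by
  induction v with
  | zero => simp [conjC]
  | tmul c v => simp [conjC]
  | add v w hv hw =>
    have : conjC (v + w) = conjC v + conjC w := map_add _ _ _
    rw [this, imC_add, imC_add, hv, hw]; abel

@[simp] theorem conjC_conjC (v : ℂ ⊗[ℝ] V) : conjC (conjC v) = v := by
  apply ext_re_im <;> simp

@[simp] theorem conjC_add (v w : ℂ ⊗[ℝ] V) : conjC (v + w) = conjC v + conjC w := map_add _ _ _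

@[simp] theorem conjC_smul (c : ℂ) (v : ℂ ⊗[ℝ] V) :
    conjC (c • v) = (starRingEnd ℂ c) • conjC v := by
  apply ext_re_im
  · simp
  · simp; abel

lemma conjC_mkC_zero (v : V) : conjC (mkC v 0) = mkC v 0 := by
  apply ext_re_im <;> simp

/-- Complex multilinear maps which agree on real vectors are equal. -/
lemma multilinear_ext_real [Module.Finite ℝ V] {k : ℕ}
    {f g : MultilinearMap ℂ (fun _ : Fin k => ℂ ⊗[ℝ] V) ℂ}
    (h : ∀ v : Fin k → V, f (fun i => mkC (v i) 0) = g (fun i => mkC (v i) 0)) : f = g := by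
  let b := Module.Free.chooseBasis ℝ V
  refine Module.Basis.ext_multilinear (fun _ => b.baseChange ℂ) fun v => ?_
  have := h (fun i => b (v i))
  simpa [mkC] using this

variable [TopologicalSpace V]

lemma evalC_real {k : ℕ} (η : V [⋀^Fin k]→L[ℝ] ℂ) (v : Fin k → V) :
    evalC η (fun i => mkC (v i) 0) = η v := by
  rw [evalC, Finset.sum_eq_single ∅]
  · simp
  · intro s _ hs
    obtain ⟨j, hj⟩ := Finset.nonempty_iff_ne_empty.2 hs
    have : η (fun j => if j ∈ s then imC (mkC (v j) 0) else reC (mkC (v j) 0)) = 0 :=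
      η.map_coord_zero j (by simp [hj])
    rw [this, mul_zero]
  · simp

lemma evalC_perm {k : ℕ} (η : V [⋀^Fin k]→L[ℝ] ℂ) (v : Fin k → ℂ ⊗[ℝ] V)
    (σ : Equiv.Perm (Fin k)) :
    evalC η (fun i => v (σ i)) = (Equiv.Perm.sign σ : ℤ) • evalC η v := by
  rw [evalC, evalC, Finset.smul_sum]
  conv_rhs => rw [← Equiv.sum_comp (Equiv.finsetCongr σ)]
  refine Finset.sum_congr rfl fun s _ => ?_
  have h := η.toAlternatingMap.map_perm
    (fun j => if j ∈ (Equiv.finsetCongr σ) s then imC (v j) else reC (v j)) σ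
  have h' : (fun j => if j ∈ s then imC (v (σ j)) else reC (v (σ j))) =
      (fun j => if j ∈ (Equiv.finsetCongr σ) s then imC (v j) else reC (v j)) ∘ σ := by
    funext j
    simp [Equiv.finsetCongr_apply]
  rw [h']
  have h2 : (Equiv.finsetCongr σ s).card = s.card := by simp [Equiv.finsetCongr_apply]
  rw [h2]
  change I ^ s.card * η.toAlternatingMap _ = _
  rw [h, Units.smul_def, mul_smul_comm]
  rfl

lemma evalC_update_add {k : ℕ} (η : V [⋀^Fin k]→L[ℝ] ℂ) (v : Fin k → ℂ ⊗[ℝ] V) (i : Fin k)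
    (x y : ℂ ⊗[ℝ] V) :
    evalC η (Function.update v i (x + y)) =
      evalC η (Function.update v i x) + evalC η (Function.update v i y) := by
  simp only [evalC, ← Finset.sum_add_distrib, ← mul_add]
  refine Finset.sum_congr rfl fun s _ => ?_
  congr 1
  have h : ∀ z, (fun j => if j ∈ s then imC (Function.update v i z j) else
      reC (Function.update v i z j)) =
      Function.update (fun j => if j ∈ s then imC (v j) else reC (v j)) i
        (if i ∈ s then imC z else reC z) := by
    intro z; funext j
    by_cases hj : j = i
    · subst hj; simp
    · simp [Function.update_of_ne hj]
  rw [h, h, h, ← η.map_update_add]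
  congr 2
  split_ifs <;> simp

lemma evalC_update_smul {k : ℕ} (η : V [⋀^Fin k]→L[ℝ] ℂ) (v : Fin k → ℂ ⊗[ℝ] V) (i : Fin k)
    (c : ℂ) (x : ℂ ⊗[ℝ] V) :
    evalC η (Function.update v i (c • x)) = c * evalC η (Function.update v i x) := by
  have hu : (Finset.univ : Finset (Finset (Fin k))) =
      (insert i (Finset.univ.erase i)).powerset := by
    rw [Finset.insert_erase (Finset.mem_univ i), Finset.powerset_univ]
  simp only [evalC]
  rw [hu, Finset.sum_powerset_insert (Finset.notMem_erase i _),
    Finset.sum_powerset_insert (Finset.notMem_erase i _), ← Finset.sum_add_distrib,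
    ← Finset.sum_add_distrib, Finset.mul_sum]
  refine Finset.sum_congr rfl fun s hs => ?_
  have his : i ∉ s := fun h => (Finset.notMem_erase i _) (Finset.mem_powerset.1 hs h)
  have h : ∀ z, (fun j => if j ∈ s then imC (Function.update v i z j) else
      reC (Function.update v i z j)) =
      Function.update (fun j => if j ∈ s then imC (v j) else reC (v j)) i (reC z) := by
    intro z; funext j
    by_cases hj : j = i
    · subst hj; simp [his]
    · simp [Function.update_of_ne hj]
  have h' : ∀ z, (fun j => if j ∈ insert i s then imC (Function.update v i z j) else
      reC (Function.update v i z j)) =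
      Function.update (fun j => if j ∈ s then imC (v j) else reC (v j)) i (imC z) := by
    intro z; funext j
    by_cases hj : j = i
    · subst hj; simp
    · simp [hj]
  simp only [h, h', Finset.card_insert_of_notMem his, reC_smul, imC_smul]
  set w := (fun j => if j ∈ s then imC (v j) else reC (v j))
  have e1 : η (Function.update w i (c.re • reC x - c.im • imC x)) =
      (c.re : ℂ) * η (Function.update w i (reC x)) - c.im * η (Function.update w i (imC x)) := by
    rw [sub_eq_add_neg, η.map_update_add, ← neg_smul, η.map_update_smul, η.map_update_smul]
    simp [sub_eq_add_neg]
  have e2 : η (Function.update w i (c.re • imC x + c.im • reC x)) =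
      (c.re : ℂ) * η (Function.update w i (imC x)) + c.im * η (Function.update w i (reC x)) := by
    rw [η.map_update_add, η.map_update_smul, η.map_update_smul]
    simp
  rw [e1, e2, pow_succ]
  have hc : c = c.re + c.im * I := (Complex.re_add_im c).symm
  conv_rhs => rw [hc]
  linear_combination (I ^ s.card * c.im * η (Function.update w i (imC x))) * 
    (- I_mul_I)

/-- The complex alternating map extending a complex-valued form. -/
def evalA {k : ℕ} (η : V [⋀^Fin k]→L[ℝ] ℂ) : (ℂ ⊗[ℝ] V) [⋀^Fin k]→ₗ[ℂ] ℂ where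
  toFun := evalC η
  map_update_add' := by
    intro inst v i x y
    rw [Subsingleton.elim inst (instDecidableEqFin k)]
    exact evalC_update_add η v i x y
  map_update_smul' := by
    intro inst v i c x
    rw [Subsingleton.elim inst (instDecidableEqFin k)]
    exact evalC_update_smul η v i c x
  map_eq_zero_of_eq' := by
    intro v i j hv hij
    have h := evalC_perm η v (Equiv.swap i j)
    have h2 : (fun l => v (Equiv.swap i j l)) = v := by
      funext l
      by_cases h1 : l = i
      · subst h1; simp [hv]
      · by_cases h3 : l = j
        · subst h3; simp [hv]
        · rw [Equiv.swap_apply_of_ne_of_ne h1 h3]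
    rw [h2, Equiv.Perm.sign_swap hij] at h
    simp only [Units.val_neg, Units.val_one, neg_smul, one_smul] at h
    change evalC η v = 0
    have : (2 : ℂ) * evalC η v = 0 := by linear_combination h
    simpa using this

lemma evalA_apply {k : ℕ} (η : V [⋀^Fin k]→L[ℝ] ℂ) (v : Fin k → ℂ ⊗[ℝ] V) :
    evalA η v = evalC η v := rfl

lemma evalA_wedge [Module.Finite ℝ V] {k l : ℕ} (η : V [⋀^Fin k]→L[ℝ] ℂ)
    (τ : V [⋀^Fin l]→L[ℝ] ℂ) : evalA (η ⋏ τ) = wedgeA (evalA η) (evalA τ) := by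
  apply AlternatingMap.coe_multilinearMap_injective
  refine multilinear_ext_real fun v => ?_
  change evalC (η ⋏ τ) (fun i => mkC (v i) 0) = ((k.factorial : ℂ) * (l.factorial : ℂ))⁻¹ *
    MultilinearMap.alternatization (tensorM (evalA η).toMultilinearMap (evalA τ).toMultilinearMap)
      (fun i => mkC (v i) 0)
  rw [evalC_real, MultilinearMap.alternatization_apply]
  change ((k.factorial : ℂ) * (l.factorial : ℂ))⁻¹ *
    ContinuousMultilinearMap.alternatization (tensorForm η τ) v = _
  rw [ContinuousMultilinearMap.alternatization_apply_apply]
  congr 1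
  refine Finset.sum_congr rfl fun σ _ => ?_
  congr 1
  change _ = evalC η (fun i => mkC (v (σ (Fin.castAdd l i))) 0) *
    evalC τ (fun i => mkC (v (σ (Fin.natAdd k i))) 0)
  rw [evalC_real, evalC_real]
  rfl

lemma evalC_add {k : ℕ} (η τ : V [⋀^Fin k]→L[ℝ] ℂ) (v : Fin k → ℂ ⊗[ℝ] V) :
    evalC (η + τ) v = evalC η v + evalC τ v := by
  simp [evalC, mul_add, Finset.sum_add_distrib]

lemma evalC_smul {k : ℕ} (c : ℂ) (η : V [⋀^Fin k]→L[ℝ] ℂ) (v : Fin k → ℂ ⊗[ℝ] V) :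
    evalC (c • η) v = c * evalC η v := by
  simp only [evalC, Finset.mul_sum]
  refine Finset.sum_congr rfl fun s _ => ?_
  rw [ContinuousAlternatingMap.smul_apply, smul_eq_mul]
  ring

lemma evalC_zero {k : ℕ} (v : Fin k → ℂ ⊗[ℝ] V) :
    evalC (0 : V [⋀^Fin k]→L[ℝ] ℂ) v = 0 := by
  simp [evalC]

lemma evalC_sum {k : ℕ} {J : Type*} (s : Finset J) (η : J → V [⋀^Fin k]→L[ℝ] ℂ)
    (v : Fin k → ℂ ⊗[ℝ] V) : evalC (∑ i ∈ s, η i) v = ∑ i ∈ s, evalC (η i) v := by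
  classical
  induction s using Finset.induction_on with
  | empty => simp [evalC_zero]
  | insert a s ha ih => rw [Finset.sum_insert ha, Finset.sum_insert ha, evalC_add, ih]

lemma evalC_sub {k : ℕ} (η τ : V [⋀^Fin k]→L[ℝ] ℂ) (v : Fin k → ℂ ⊗[ℝ] V) :
    evalC (η - τ) v = evalC η v - evalC τ v := by
  have h : evalC (η - τ + τ) v = evalC η v := by rw [sub_add_cancel]
  rw [evalC_add] at h; linear_combination h

lemma evalC_conj {k : ℕ} (η : V [⋀^Fin k]→L[ℝ] ℂ) (v : Fin k → ℂ ⊗[ℝ] V) :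
    evalC (conjForm η) (fun i => conjC (v i)) = starRingEnd ℂ (evalC η v) := by
  rw [evalC, evalC, map_sum]
  refine Finset.sum_congr rfl fun s _ => ?_
  have h : (fun j => if j ∈ s then imC (conjC (v j)) else reC (conjC (v j))) =
      fun j => (if j ∈ s then (-1 : ℝ) else 1) • (if j ∈ s then imC (v j) else reC (v j)) := by
    funext j; split_ifs <;> simp
  have h2 := (conjForm η).map_smul_univ (fun j => if j ∈ s then (-1 : ℝ) else 1)
    (fun j => if j ∈ s then imC (v j) else reC (v j))
  rw [h, h2, Finset.prod_ite, map_mul, map_pow, conj_I]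
  simp only [Finset.prod_const, one_pow, mul_one, Finset.filter_mem_eq_inter, Finset.univ_inter]
  have h3 : conjForm η (fun j => if j ∈ s then imC (v j) else reC (v j)) =
      starRingEnd ℂ (η (fun j => if j ∈ s then imC (v j) else reC (v j))) := rfl
  rw [h3]
  have h4 : (-I) ^ s.card = I ^ s.card * (-1) ^ s.card := by
    rw [← mul_pow]; congr 1; ring
  rw [h4]
  simp only [Complex.real_smul]
  push_cast
  ring

/-- Forms which agree on complexified vectors are equal. -/
lemma form_ext {k : ℕ} {η τ : V [⋀^Fin k]→L[ℝ] ℂ} (h : evalA η = evalA τ) : η = τ := by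
  ext v
  have := congrArg (fun f => f (fun i => mkC (v i) 0)) h
  simpa only [evalA_apply, evalC_real] using this

end LinearAlgebra

/-! ### Exterior calculus in charts -/

section Alternating

variable {V : Type*} [AddCommGroup V] [Module ℝ V] [TopologicalSpace V]

lemma evalA_real_one (η : V [⋀^Fin 1]→L[ℝ] ℂ) (x : V) : evalA η ![mkC x 0] = η ![x] := by
  rw [← evalC_real, evalA_apply]; congr 1; funext i; fin_cases i; rfl

lemma evalA_real_two (η : V [⋀^ι]→L[ℝ] ℂ) (x y : V) :
    evalA η ![mkC x 0, mkC y 0] = η ![x, y] := by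
  rw [← evalC_real, evalA_apply]; congr 1; funext i; fin_cases i <;> rfl

lemma evalA_real_three (η : V [⋀^Fin 3]→L[ℝ] ℂ) (x y z : V) :
    evalA η ![mkC x 0, mkC y 0, mkC z 0] = η ![x, y, z] := by
  rw [← evalC_real, evalA_apply]; congr 1; funext i; fin_cases i <;> rfl

lemma wedge_apply_sum {k l : ℕ} (a : V [⋀^Fin k]→L[ℝ] ℂ) (b : V [⋀^Fin l]→L[ℝ] ℂ)
    (v : Fin (k + l) → V) : (a ⋏ b) v = ((k.factorial : ℂ) * (l.factorial : ℂ))⁻¹ *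
      ∑ σ : Equiv.Perm (Fin (k + l)), (Equiv.Perm.sign σ : ℤ) •
        (a (fun i => v (σ (Fin.castAdd l i))) * b (fun i => v (σ (Fin.natAdd k i)))) := by
  change ((k.factorial : ℂ) * (l.factorial : ℂ))⁻¹ *
    ContinuousMultilinearMap.alternatization (tensorForm a b) v = _
  rw [ContinuousMultilinearMap.alternatization_apply_apply]
  rfl

variable [Module.Finite ℝ V]

lemma wedge_apply {k l : ℕ} (η : V [⋀^Fin k]→L[ℝ] ℂ) (τ : V [⋀^Fin l]→L[ℝ] ℂ)
    (v : Fin (k + l) → V) :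
    (η ⋏ τ) v = wedgeA (evalA η) (evalA τ) (fun i => mkC (v i) 0) := by
  rw [← evalA_wedge, evalA_apply, evalC_real]

lemma wedge_one_one (a b : V [⋀^Fin 1]→L[ℝ] ℂ) (v : ι → V) :
    (a ⋏ b) v = a ![v 0] * b ![v 1] - a ![v 1] * b ![v 0] := by
  refine (wedge_apply a b v).trans ((wedgeA_one_one _ _ _).trans ?_)
  simp only [evalA_real_one]

lemma wedge_one_two (a : V [⋀^Fin 1]→L[ℝ] ℂ) (b : V [⋀^ι]→L[ℝ] ℂ) (v : Fin 3 → V) :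
    (a ⋏ b) v = a ![v 0] * b ![v 1, v 2] - a ![v 1] * b ![v 0, v 2] + a ![v 2] * b ![v 0, v 1] := by
  refine (wedge_apply a b v).trans ((wedgeA_one_two _ _ _).trans ?_)
  simp only [evalA_real_one, evalA_real_two]

lemma wedge_two_one (a : V [⋀^ι]→L[ℝ] ℂ) (b : V [⋀^Fin 1]→L[ℝ] ℂ) (v : Fin 3 → V) :
    (a ⋏ b) v = a ![v 0, v 1] * b ![v 2] - a ![v 0, v 2] * b ![v 1] + a ![v 1, v 2] * b ![v 0] := by
  refine (wedge_apply a b v).trans ((wedgeA_two_one _ _ _).trans ?_)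
  simp only [evalA_real_one, evalA_real_two]

lemma wedge_two_two (a b : V [⋀^ι]→L[ℝ] ℂ) (v : Fin 4 → V) :
    (a ⋏ b) v = a ![v 0, v 1] * b ![v 2, v 3] - a ![v 0, v 2] * b ![v 1, v 3]
      + a ![v 0, v 3] * b ![v 1, v 2] + a ![v 1, v 2] * b ![v 0, v 3]
      - a ![v 1, v 3] * b ![v 0, v 2] + a ![v 2, v 3] * b ![v 0, v 1] := by
  refine (wedge_apply a b v).trans ((wedgeA_two_two _ _ _).trans ?_)
  simp only [evalA_real_two]

lemma wedge_one_three (a : V [⋀^Fin 1]→L[ℝ] ℂ) (b : V [⋀^Fin 3]→L[ℝ] ℂ) (v : Fin 4 → V) :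
    (a ⋏ b) v = a ![v 0] * b ![v 1, v 2, v 3] - a ![v 1] * b ![v 0, v 2, v 3]
      + a ![v 2] * b ![v 0, v 1, v 3] - a ![v 3] * b ![v 0, v 1, v 2] := by
  refine (wedge_apply a b v).trans ((wedgeA_one_three _ _ _).trans ?_)
  simp only [evalA_real_one, evalA_real_three]

end Alternating

section Euclidean

/-- A family of alternating maps is smooth if its values are. -/
lemma contDiffAt_alternating {k : ℕ} {n : WithTop ℕ∞} {η : E5 → E5 [⋀^Fin k]→L[ℝ] ℂ} {p : E5}
    (h : ∀ v : Fin k → E5, ContDiffAt ℝ n (fun y => η y v) p) : ContDiffAt ℝ n η p := by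
  let b := Module.Free.chooseBasis ℝ E5
  let L : (E5 [⋀^Fin k]→L[ℝ] ℂ) →ₗ[ℝ] ((Fin k → Module.Free.ChooseBasisIndex ℝ E5) → ℂ) :=
    { toFun := fun η j => η (fun i => b (j i))
      map_add' := fun _ _ => rfl
      map_smul' := fun _ _ => rfl }
  have hL : Function.Injective L := by
    intro η τ hητ
    apply ContinuousAlternatingMap.toAlternatingMap_injective
    apply AlternatingMap.coe_multilinearMap_injective
    refine Module.Basis.ext_multilinear (fun _ => b) fun v => ?_
    exact congrFun hητ v
  obtain ⟨g, hg⟩ := L.exists_leftInverse_of_injective (LinearMap.ker_eq_bot.2 hL)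
  have h1 : ContDiffAt ℝ n (fun y => L (η y)) p := contDiffAt_pi.2 fun j => h _
  have h2 : ContDiffAt ℝ n (fun y => g.toContinuousLinearMap (L (η y))) p :=
    g.toContinuousLinearMap.contDiff.contDiffAt.comp p h1
  refine h2.congr_of_eventuallyEq (.of_forall fun y => ?_)
  exact (LinearMap.congr_fun hg (η y)).symm

lemma contDiffAt_alternating_apply {k : ℕ} {n : WithTop ℕ∞} {η : E5 → E5 [⋀^Fin k]→L[ℝ] ℂ} {p : E5}
    (h : ContDiffAt ℝ n η p) (v : Fin k → E5) : ContDiffAt ℝ n (fun y => η y v) p :=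
  (ContinuousAlternatingMap.apply ℝ E5 ℂ v).contDiff.contDiffAt.comp p h

/-- Evaluation of a smooth family of alternating maps on smooth vectors. -/
lemma contDiffAt_alternating_apply_vec {k : ℕ} {n : WithTop ℕ∞} {η : E5 → E5 [⋀^Fin k]→L[ℝ] ℂ}
    {p : E5} (h : ContDiffAt ℝ n η p) {X : Fin k → E5 → E5} (hX : ∀ i, ContDiffAt ℝ n (X i) p) :
    ContDiffAt ℝ n (fun y => η y (fun i => X i y)) p := by
  classical
  let b := Module.Free.chooseBasis ℝ E5
  have e : ∀ y, η y (fun i => X i y) = ∑ j : Fin k → Module.Free.ChooseBasisIndex ℝ E5,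
      (∏ i, b.repr (X i y) (j i)) • η y (fun i => b (j i)) := by
    intro y
    have h1 : (fun i => X i y) = fun i => ∑ j, b.repr (X i y) j • b j := by
      funext i; rw [b.sum_repr]
    conv_lhs => rw [h1]
    rw [← ContinuousAlternatingMap.coe_toAlternatingMap, ← AlternatingMap.coe_multilinearMap,
      MultilinearMap.map_sum]
    refine Finset.sum_congr rfl fun j _ => ?_
    rw [MultilinearMap.map_smul_univ]
  refine ContDiffAt.congr_of_eventuallyEq ?_ (.of_forall e)
  refine ContDiffAt.sum fun j _ => ContDiffAt.fun_smul ?_ (contDiffAt_alternating_apply h _)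
  refine contDiffAt_prod fun i _ => ?_
  have : ContDiffAt ℝ n (fun y => (b.coord (j i)).toContinuousLinearMap (X i y)) p :=
    (b.coord (j i)).toContinuousLinearMap.contDiff.contDiffAt.comp p (hX i)
  exact this

lemma extDeriv_one_apply {η : E5 → E5 [⋀^Fin 1]→L[ℝ] ℂ} {p : E5}
    (h : DifferentiableAt ℝ η p) (v : ι → E5) :
    extDeriv η p v = fderiv ℝ (fun y => η y ![v 1]) p (v 0) - fderiv ℝ (fun y => η y ![v 0]) p (v 1) := by
  have e0 : (0 : ι).removeNth v = ![v 1] := by funext i; fin_cases i; rfl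
  have e1 : (1 : ι).removeNth v = ![v 0] := by funext i; fin_cases i; rfl
  refine (extDeriv_apply h v).trans ((sum_two _).trans ?_)
  rw [e0, e1]; simp [sub_eq_add_neg]

lemma extDeriv_two_apply {η : E5 → E5 [⋀^ι]→L[ℝ] ℂ} {p : E5}
    (h : DifferentiableAt ℝ η p) (v : Fin 3 → E5) :
    extDeriv η p v = fderiv ℝ (fun y => η y ![v 1, v 2]) p (v 0)
      - fderiv ℝ (fun y => η y ![v 0, v 2]) p (v 1)
      + fderiv ℝ (fun y => η y ![v 0, v 1]) p (v 2) := by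
  have e0 : (0 : Fin 3).removeNth v = ![v 1, v 2] := by funext i; fin_cases i <;> rfl
  have e1 : (1 : Fin 3).removeNth v = ![v 0, v 2] := by funext i; fin_cases i <;> rfl
  have e2 : (2 : Fin 3).removeNth v = ![v 0, v 1] := by funext i; fin_cases i <;> rfl
  refine (extDeriv_apply h v).trans ((Fin.sum_univ_three _).trans ?_)
  rw [e0, e1, e2]; simp [sub_eq_add_neg]

lemma extDeriv_three_apply {η : E5 → E5 [⋀^Fin 3]→L[ℝ] ℂ} {p : E5}
    (h : DifferentiableAt ℝ η p) (v : Fin 4 → E5) :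
    extDeriv η p v = fderiv ℝ (fun y => η y ![v 1, v 2, v 3]) p (v 0)
      - fderiv ℝ (fun y => η y ![v 0, v 2, v 3]) p (v 1)
      + fderiv ℝ (fun y => η y ![v 0, v 1, v 3]) p (v 2)
      - fderiv ℝ (fun y => η y ![v 0, v 1, v 2]) p (v 3) := by
  have e0 : (0 : Fin 4).removeNth v = ![v 1, v 2, v 3] := by funext i; fin_cases i <;> rfl
  have e1 : (1 : Fin 4).removeNth v = ![v 0, v 2, v 3] := by funext i; fin_cases i <;> rfl
  have e2 : (2 : Fin 4).removeNth v = ![v 0, v 1, v 3] := by funext i; fin_cases i <;> rfl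
  have e3 : (3 : Fin 4).removeNth v = ![v 0, v 1, v 2] := by funext i; fin_cases i <;> rfl
  refine (extDeriv_apply h v).trans ((Fin.sum_univ_four _).trans ?_)
  rw [e0, e1, e2, e3]; simp [sub_eq_add_neg]

lemma contDiffAt_wedge {k l : ℕ} {n : WithTop ℕ∞} {a : E5 → E5 [⋀^Fin k]→L[ℝ] ℂ}
    {b : E5 → E5 [⋀^Fin l]→L[ℝ] ℂ} {p : E5} (ha : ContDiffAt ℝ n a p) (hb : ContDiffAt ℝ n b p) :
    ContDiffAt ℝ n (fun y => a y ⋏ b y) p := by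
  refine contDiffAt_alternating fun v => ?_
  have e := fun y => wedge_apply_sum (a y) (b y) v
  refine ContDiffAt.congr_of_eventuallyEq ?_ (.of_forall e)
  refine contDiffAt_const.mul (ContDiffAt.sum fun σ _ => ?_)
  simp only [zsmul_eq_mul]
  exact contDiffAt_const.mul ((contDiffAt_alternating_apply ha _).mul (contDiffAt_alternating_apply hb _))

/-- The differential of a function on `E5`, as a form. -/
def dE (f : E5 → ℂ) (p : E5) : E5 [⋀^Fin 1]→L[ℝ] ℂ :=
  ContinuousAlternatingMap.ofSubsingleton ℝ E5 ℂ (0 : Fin 1) (fderiv ℝ f p)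

lemma dE_apply (f : E5 → ℂ) (p v : E5) : dE f p ![v] = fderiv ℝ f p v := by
  simp [dE]

lemma extDeriv_smul_one {f : E5 → ℂ} {a : E5 → E5 [⋀^Fin 1]→L[ℝ] ℂ} {p : E5}
    (hf : ContDiffAt ℝ ∞ f p) (ha : ContDiffAt ℝ ∞ a p) :
    extDeriv (fun y => f y • a y) p = dE f p ⋏ a p + f p • extDeriv a p := by
  have hf' := hf.differentiableAt (by simp)
  have ha' := ha.differentiableAt (by simp)
  have hv : ∀ u : Fin 1 → E5, DifferentiableAt ℝ (fun y => a y u) p := fun u =>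
    (contDiffAt_alternating_apply ha u).differentiableAt (by simp)
  ext v
  have h1 : (dE f p ⋏ a p + f p • extDeriv a p) v =
    (dE f p ⋏ a p) v + f p * extDeriv a p v := rfl
  rw [h1, extDeriv_one_apply ((hf.fun_smul ha).differentiableAt (by simp)), wedge_one_one,
    extDeriv_one_apply ha', dE_apply, dE_apply]
  have e : ∀ u w, fderiv ℝ (fun y => (f y • a y) u) p w =
      f p * fderiv ℝ (fun y => a y u) p w + a p u * fderiv ℝ f p w := by
    intro u w
    have := fderiv_mul hf' (hv u)
    have h3 : (fun y => (f y • a y) u) = f * fun y => a y u := rfl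
    rw [h3, this]; simp
  rw [e, e]; ring

lemma extDeriv_wedge_one_one {a b : E5 → E5 [⋀^Fin 1]→L[ℝ] ℂ} {p : E5}
    (ha : ContDiffAt ℝ ∞ a p) (hb : ContDiffAt ℝ ∞ b p) :
    extDeriv (fun y => a y ⋏ b y) p = extDeriv a p ⋏ b p - a p ⋏ extDeriv b p := by
  have ha' := ha.differentiableAt (by simp)
  have hb' := hb.differentiableAt (by simp)
  have hva : ∀ u : Fin 1 → E5, DifferentiableAt ℝ (fun y => a y u) p := fun u =>
    (contDiffAt_alternating_apply ha u).differentiableAt (by simp)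
  have hvb : ∀ u : Fin 1 → E5, DifferentiableAt ℝ (fun y => b y u) p := fun u =>
    (contDiffAt_alternating_apply hb u).differentiableAt (by simp)
  ext v
  have h1 : (extDeriv a p ⋏ b p - a p ⋏ extDeriv b p) v =
    (extDeriv a p ⋏ b p) v - (a p ⋏ extDeriv b p) v := rfl
  have h2 := extDeriv_two_apply ((contDiffAt_wedge ha hb).differentiableAt (by simp)) v
  have e : ∀ u w, fderiv ℝ (fun y => (a y ⋏ b y) u) p w =
      (a p ![u 0] * fderiv ℝ (fun y => b y ![u 1]) p w
        + b p ![u 1] * fderiv ℝ (fun y => a y ![u 0]) p w)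
      - (a p ![u 1] * fderiv ℝ (fun y => b y ![u 0]) p w
        + b p ![u 0] * fderiv ℝ (fun y => a y ![u 1]) p w) := by
    intro u w
    have h3 : (fun y => (a y ⋏ b y) u) = (fun y => a y ![u 0]) * (fun y => b y ![u 1]) -
        (fun y => a y ![u 1]) * (fun y => b y ![u 0]) := by
      funext y; exact wedge_one_one _ _ _
    rw [h3, fderiv_sub ((hva _).mul (hvb _)) ((hva _).mul (hvb _)), fderiv_mul (hva _) (hvb _),
      fderiv_mul (hva _) (hvb _)]
    simp
  refine h2.trans ?_
  rw [h1, wedge_two_one, wedge_one_two]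
  simp only [extDeriv_one_apply ha', extDeriv_one_apply hb', e]
  simp
  ring

lemma extDeriv_wedge_one_two {a : E5 → E5 [⋀^Fin 1]→L[ℝ] ℂ} {b : E5 → E5 [⋀^ι]→L[ℝ] ℂ}
    {p : E5} (ha : ContDiffAt ℝ ∞ a p) (hb : ContDiffAt ℝ ∞ b p) :
    extDeriv (fun y => a y ⋏ b y) p = extDeriv a p ⋏ b p - a p ⋏ extDeriv b p := by
  have ha' := ha.differentiableAt (by simp)
  have hb' := hb.differentiableAt (by simp)
  have hva : ∀ u : Fin 1 → E5, DifferentiableAt ℝ (fun y => a y u) p := fun u =>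
    (contDiffAt_alternating_apply ha u).differentiableAt (by simp)
  have hvb : ∀ u : ι → E5, DifferentiableAt ℝ (fun y => b y u) p := fun u =>
    (contDiffAt_alternating_apply hb u).differentiableAt (by simp)
  ext v
  have h1 : (extDeriv a p ⋏ b p - a p ⋏ extDeriv b p) v =
    (extDeriv a p ⋏ b p) v - (a p ⋏ extDeriv b p) v := rfl
  have h2 := extDeriv_three_apply ((contDiffAt_wedge ha hb).differentiableAt (by simp)) v
  have e : ∀ u w, fderiv ℝ (fun y => (a y ⋏ b y) u) p w =
      (a p ![u 0] * fderiv ℝ (fun y => b y ![u 1, u 2]) p w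
        + b p ![u 1, u 2] * fderiv ℝ (fun y => a y ![u 0]) p w)
      - (a p ![u 1] * fderiv ℝ (fun y => b y ![u 0, u 2]) p w
        + b p ![u 0, u 2] * fderiv ℝ (fun y => a y ![u 1]) p w)
      + (a p ![u 2] * fderiv ℝ (fun y => b y ![u 0, u 1]) p w
        + b p ![u 0, u 1] * fderiv ℝ (fun y => a y ![u 2]) p w) := by
    intro u w
    have h3 : (fun y => (a y ⋏ b y) u) = (fun y => a y ![u 0]) * (fun y => b y ![u 1, u 2]) -
        (fun y => a y ![u 1]) * (fun y => b y ![u 0, u 2])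
        + (fun y => a y ![u 2]) * (fun y => b y ![u 0, u 1]) := by
      funext y; exact wedge_one_two _ _ _
    rw [h3, fderiv_add (((hva _).mul (hvb _)).sub ((hva _).mul (hvb _))) ((hva _).mul (hvb _)),
      fderiv_sub ((hva _).mul (hvb _)) ((hva _).mul (hvb _)), fderiv_mul (hva _) (hvb _),
      fderiv_mul (hva _) (hvb _), fderiv_mul (hva _) (hvb _)]
    simp
  refine h2.trans ?_
  rw [h1, wedge_two_two, wedge_one_three]
  simp only [extDeriv_one_apply ha', extDeriv_two_apply hb', e]
  simp
  ring

end Euclidean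

section Manifold

variable {k : ℕ} {M : Type*} {x : M} {U : Set M} {f : M → ℂ} [TopologicalSpace M] [ChartedSpace E5 M]
 

/-- The derivative of the preferred chart at `x`. -/
def cD (x y : M) : E5 →L[ℝ] E5 := mfderiv (𝓡 5) (𝓡 5) (χ x) y

/-- The derivative of the inverse of the preferred chart at `x`. -/
def cS (x : M) (p : E5) : E5 →L[ℝ] E5 := mfderiv (𝓡 5) (𝓡 5) (χ x).symm p

/-- A form, with the tangent spaces identified with the model space. -/
def fE (η : Form M k) (x : M) : E5 [⋀^Fin k]→L[ℝ] ℂ := η x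

lemma chartRep_eq (η : Form M k) (x : M) (p : E5) :
    chartRep η x p = (fE η ((χ x).symm p)).compContinuousLinearMap (cS x p) := rfl

lemma chartRep_apply (η : Form M k) (x : M) (p : E5) (v : Fin k → E5) :
    chartRep η x p v = fE η ((χ x).symm p) (fun i => cS x p (v i)) := rfl

lemma chart_target_mem_nhds (x : M) {p : E5} (hp : p ∈ (χ x).target) :
    (χ x).target ∈ nhds p :=
  (isOpen_extChartAt_target x).mem_nhds hp

variable [IsManifold (𝓡 5) ∞ M]

instance isManifold_one : IsManifold (𝓡 5) 1 M := IsManifold.of_le (n := ∞) (by simp)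

lemma cD_cS (x : M) {p : E5} (hp : p ∈ (χ x).target) (v : E5) :
    cD x ((χ x).symm p) (cS x p v) = v := by
  have h := mfderiv_extChartAt_comp_mfderivWithin_extChartAt_symm (I := 𝓡 5) hp
  rw [ModelWithCorners.range_eq_univ, mfderivWithin_univ] at h
  exact congrArg (fun L : E5 →L[ℝ] E5 => L v) h

lemma cS_cD (x : M) {y : M} (hy : y ∈ (χ x).source) (v : E5) :
    cS x (χ x y) (cD x y v) = v := by
  have h := mfderivWithin_extChartAt_symm_comp_mfderiv_extChartAt' (I := 𝓡 5) hy
  rw [ModelWithCorners.range_eq_univ, mfderivWithin_univ] at h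
  exact congrArg (fun L : E5 →L[ℝ] E5 => L v) h

lemma cD_self (x : M) : cD x x = ContinuousLinearMap.id ℝ E5 := mfderiv_extChartAt_self (I := 𝓡 5)

lemma cS_self (x : M) : cS x (χ x x) = ContinuousLinearMap.id ℝ E5 := by
  ext1 v
  have := cS_cD x (mem_extChartAt_source x) v
  rwa [cD_self] at this

lemma chartRep_self (η : Form M k) (x : M) :
    chartRep η x (χ x x) = fE η x := by
  rw [chartRep_eq, cS_self, (χ x).left_inv (mem_extChartAt_source x)]
  rfl

lemma extD_eq (η : Form M k) (x : M) :
    fE (extD η) x = extDeriv (chartRep η x) (χ x x) := by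
  have h : fE (extD η) x =
    (extDeriv (chartRep η x) (χ x x)).compContinuousLinearMap (cD x x) := rfl
  rw [h, cD_self]; rfl

/-- The evaluation of a form at a point of the chart domain, in the chart. -/
lemma fE_apply_of_mem (η : Form M k) (x : M) {y : M} (hy : y ∈ (χ x).source)
    (v : Fin k → E5) :
    fE η y v = chartRep η x (χ x y) (fun i => cD x y (v i)) := by
  rw [chartRep_apply, (χ x).left_inv hy]
  congr 1; funext i; rw [cS_cD x hy]

/-- Smoothness of a map to a normed space is smoothness in the preferred chart. -/
lemma smoothAt_iff {G : Type*} [NormedAddCommGroup G] [NormedSpace ℝ G] (f : M → G) (x : M) :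
    ContMDiffAt (𝓡 5) 𝓘(ℝ, G) ∞ f x ↔
      ContDiffAt ℝ ∞ (f ∘ (χ x).symm) (χ x x) := by
  rw [contMDiffAt_iff]
  simp only [ModelWithCorners.range_eq_univ, contDiffWithinAt_univ, extChartAt_model_space_eq_id,
    PartialEquiv.refl_coe, Function.id_comp]
  refine ⟨fun h => h.2, fun h => ⟨?_, h⟩⟩
  have h1 : ContinuousAt ((f ∘ (χ x).symm) ∘ χ x) x :=
    ContinuousAt.comp h.continuousAt (continuousAt_extChartAt x)
  refine h1.congr ?_
  filter_upwards [extChartAt_source_mem_nhds (I := 𝓡 5) x] with y hy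
  exact congrArg f ((χ x).left_inv hy)

lemma smoothFun_iff (hU : IsOpen U) : SmoothFun f U ↔
    ∀ x ∈ U, ContDiffAt ℝ ∞ (f ∘ (χ x).symm) (χ x x) := by
  refine ⟨fun h x hx => (smoothAt_iff f x).1 (h.contMDiffAt (hU.mem_nhds hx)),
    fun h x hx => ((smoothAt_iff f x).2 (h x hx)).contMDiffWithinAt⟩

lemma diffFun_eq (hf : ContMDiffAt (𝓡 5) 𝓘(ℝ, ℂ) ∞ f x) :
    (diffFun f x : E5 →L[ℝ] ℂ) = fderiv ℝ (f ∘ (χ x).symm) (χ x x) := by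
  have h := (hf.mdifferentiableAt (by simp)).mfderiv
  rw [ModelWithCorners.range_eq_univ, fderivWithin_univ] at h
  exact h

/-- The differential at a point of the chart domain, in the chart. -/
lemma diffFun_of_mem {x y : M} (hy : y ∈ (χ x).source)
    (hf : ContMDiffAt (𝓡 5) 𝓘(ℝ, ℂ) ∞ f y) (v : E5) :
    (diffFun f y : E5 →L[ℝ] ℂ) v =
      fderiv ℝ (f ∘ (χ x).symm) (χ x y) (cD x y v) := by
  have h1 : MDifferentiableAt (𝓡 5) 𝓘(ℝ, ℂ) f ((χ x).symm (χ x y)) := by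
    rw [(χ x).left_inv hy]; exact hf.mdifferentiableAt (by simp)
  have h2 : MDifferentiableAt (𝓡 5) (𝓡 5) (χ x).symm (χ x y) :=
    ((contMDiffOn_extChartAt_symm (n := 1) x).mdifferentiableOn (by simp)).mdifferentiableAt
      (chart_target_mem_nhds x ((χ x).map_source hy))
  have h3 := mfderiv_comp (χ x y) h1 h2
  rw [mfderiv_eq_fderiv] at h3
  rw [h3]
  have h4 : (mfderiv (𝓡 5) 𝓘(ℝ, ℂ) f ((χ x).symm (χ x y)) : E5 →L[ℝ] ℂ)
      = mfderiv (𝓡 5) 𝓘(ℝ, ℂ) f y := by rw [(χ x).left_inv hy]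
  change _ = (mfderiv (𝓡 5) 𝓘(ℝ, ℂ) f ((χ x).symm (χ x y)) : E5 →L[ℝ] ℂ)
    (cS x (χ x y) (cD x y v))
  rw [h4, cS_cD x hy]; rfl

/-- A vector field, with the tangent spaces identified with the model space. -/
def vE (X : (x : M) → TM x) (x : M) : E5 := X x

/-- The expression of a vector field in the preferred chart at `x`. -/
def vRep (X : (x : M) → TM x) (x : M) (p : E5) : E5 :=
  cD x ((χ x).symm p) (vE X ((χ x).symm p))

lemma vRep_self (X : (x : M) → TM x) (x : M) :
    vRep X x (χ x x) = vE X x := by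
  rw [vRep, (χ x).left_inv (mem_extChartAt_source x), cD_self]; rfl

lemma contDiffAt_vRep_iff {X : (x : M) → TM x} :
    ContMDiffAt (𝓡 5) (𝓡 5).tangent ∞ (fun x => (⟨x, X x⟩ : TangentBundle (𝓡 5) M)) x ↔
      ContDiffAt ℝ ∞ (vRep X x) (χ x x) := by
  rw [Bundle.contMDiffAt_section x, smoothAt_iff]
  have e : ((fun y => (trivializationAt E5 (TM) x ⟨y, X y⟩).2) ∘
      (χ x).symm) =ᶠ[nhds (χ x x)] vRep X x := by
    filter_upwards [extChartAt_target_mem_nhds (I := 𝓡 5) x] with p hp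
    have hy := (χ x).map_target hp
    rw [extChartAt_source] at hy
    have h3 := TangentBundle.continuousLinearMapAt_trivializationAt (I := 𝓡 5) hy
    have h5 := (trivializationAt E5 (TM) x).coe_linearMapAt_of_mem (R := ℝ)
      (b := (χ x).symm p) (by simpa using hy)
    have h6 := congrArg (fun L : E5 →L[ℝ] E5 => L (X ((χ x).symm p))) h3
    have h7 := congrFun h5 (X ((χ x).symm p))
    exact h7.symm.trans h6
  exact ⟨fun h => h.congr_of_eventuallyEq e.symm, fun h => h.congr_of_eventuallyEq e⟩

lemma smoothVF_iff {X : (x : M) → TM x} (hU : IsOpen U) :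
    SmoothVF X U ↔ ∀ x ∈ U, ContDiffAt ℝ ∞ (vRep X x) (χ x x) :=
  ⟨fun h x hx => contDiffAt_vRep_iff.1 (h.contMDiffAt (hU.mem_nhds hx)),
    fun h x hx => (contDiffAt_vRep_iff.2 (h x hx)).contMDiffWithinAt⟩

lemma eventually_mem_chart (hU : IsOpen U) (hx : x ∈ U) :
    ∀ᶠ p in nhds (χ x x), p ∈ (χ x).target ∧
      (χ x).symm p ∈ U := by
  refine Filter.Eventually.and (extChartAt_target_mem_nhds (I := 𝓡 5) x) ?_
  have h := continuousAt_extChartAt_symm (I := 𝓡 5) x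
  refine h (hU.mem_nhds ?_)
  rwa [(χ x).left_inv (mem_extChartAt_source x)]

lemma smoothFun_apply {η : Form M k} {X : Fin k → (x : M) → TM x} (hU : IsOpen U) (hη : SmoothForm η U) (hX : ∀ i, SmoothVF (X i) U) :
    SmoothFun (fun x => η x (fun i => X i x)) U := by
  rw [smoothFun_iff hU]
  intro x hx
  have h := contDiffAt_alternating_apply_vec (hη x hx)
    (X := fun i => vRep (X i) x) (fun i => (smoothVF_iff hU).1 (hX i) x hx)
  refine h.congr_of_eventuallyEq ?_
  filter_upwards [eventually_mem_chart hU hx] with p hp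
  have := fE_apply_of_mem η x ((χ x).map_target hp.1)
    (fun i => vE (X i) ((χ x).symm p))
  rw [(χ x).right_inv hp.1] at this
  exact this

/-- The differential of a function, as a form. -/
def diffForm (f : M → ℂ) : Form M 1 := fun x =>
  ContinuousAlternatingMap.ofSubsingleton ℝ (TM x) ℂ (0 : Fin 1) (diffFun f x)

lemma diffForm_apply (f : M → ℂ) (x : M) (v : TM x) :
    diffForm f x ![v] = diffFun f x v := by
  simp [diffForm]

lemma chartRep_diffForm (hU : IsOpen U) (hf : SmoothFun f U)
    (hx : x ∈ U) : chartRep (diffForm f) x =ᶠ[nhds (χ x x)]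
      dE (f ∘ (χ x).symm) := by
  filter_upwards [eventually_mem_chart hU hx] with p hp
  ext v
  have h := diffFun_of_mem ((χ x).map_target hp.1)
    (hf.contMDiffAt (hU.mem_nhds hp.2)) (cS x p (v 0))
  rw [(χ x).right_inv hp.1, cD_cS x hp.1] at h
  exact h

lemma dE_eq_extDeriv (f : E5 → ℂ) :
    dE f = extDeriv (fun p => ContinuousAlternatingMap.constOfIsEmpty ℝ E5 (Fin 0) (f p)) := by
  funext p; rw [extDeriv_constOfIsEmpty]; rfl

lemma contDiffAt_dE {f : E5 → ℂ} {p : E5} (hf : ContDiffAt ℝ ∞ f p) : ContDiffAt ℝ ∞ (dE f) p := by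
  refine contDiffAt_alternating fun v => ?_
  have h := hf.fderiv_right (m := ∞) (by simp)
  exact h.clm_apply contDiffAt_const

lemma smoothForm_diffForm (hU : IsOpen U) (hf : SmoothFun f U) :
    SmoothForm (diffForm f) U := fun x hx =>
  (contDiffAt_dE ((smoothFun_iff hU).1 hf x hx)).congr_of_eventuallyEq (chartRep_diffForm hU hf hx)

lemma two_le_infty : minSmoothness ℝ 2 ≤ ∞ := by
  rw [minSmoothness_of_isRCLikeNormedField]
  exact WithTop.coe_le_coe.2 (le_top : (2 : ℕ∞) ≤ ⊤)

lemma extD_diffForm (hU : IsOpen U) (hf : SmoothFun f U)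
    (hx : x ∈ U) : extD (diffForm f) x = 0 := by
  refine (extD_eq (diffForm f) x).trans ?_
  rw [(chartRep_diffForm hU hf hx).extDeriv_eq, dE_eq_extDeriv]
  refine extDeriv_extDeriv_apply (r := ∞) ?_ two_le_infty
  refine contDiffAt_alternating fun v => ?_
  exact (smoothFun_iff hU).1 hf x hx

lemma fderiv_transition {x z : M} {q : E5} (hq : q ∈ (χ z).target)
    (hy : (χ z).symm q ∈ (χ x).source) (v : E5) :
    fderiv ℝ (χ x ∘ (χ z).symm) q v =
      cD x ((χ z).symm q) (cS z q v) := by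
  have h1 : MDifferentiableAt (𝓡 5) (𝓡 5) (χ x) ((χ z).symm q) :=
    mdifferentiableAt_extChartAt (by rwa [extChartAt_source] at hy)
  have h2 : MDifferentiableAt (𝓡 5) (𝓡 5) (χ z).symm q :=
    ((contMDiffOn_extChartAt_symm (n := 1) z).mdifferentiableOn (by simp)).mdifferentiableAt
      (chart_target_mem_nhds z hq)
  have h3 := mfderiv_comp q h1 h2
  rw [mfderiv_eq_fderiv] at h3
  rw [h3]; rfl

lemma contDiffAt_transition {x z : M} {q : E5} (hq : q ∈ (χ z).target)
    (hy : (χ z).symm q ∈ (χ x).source) :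
    ContDiffAt ℝ ∞ (χ x ∘ (χ z).symm) q := by
  have h1 : ContMDiffAt (𝓡 5) (𝓡 5) ∞ (χ x) ((χ z).symm q) :=
    contMDiffAt_extChartAt' (by rwa [extChartAt_source] at hy)
  have h2 : ContMDiffAt (𝓡 5) (𝓡 5) ∞ (χ z).symm q :=
    (contMDiffOn_extChartAt_symm z).contMDiffAt (chart_target_mem_nhds z hq)
  exact (h1.comp q h2).contDiffAt

/-- Exterior differentiation commutes with passing to the preferred chart. -/
lemma chartRep_extD {η : Form M k} (hU : IsOpen U) (hη : SmoothForm η U) (hx : x ∈ U) : chartRep (extD η) x =ᶠ[nhds (χ x x)]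
      extDeriv (chartRep η x) := by
  have hd : ∀ᶠ p in nhds (χ x x), ContDiffAt ℝ 1 (chartRep η x) p :=
    ((hη x hx).of_le (by exact_mod_cast (le_top : (1 : ℕ∞) ≤ ⊤))).eventually (by simp)
  filter_upwards [eventually_mem_chart hU hx, hd] with p hp hdp
  have hs := (χ x).map_target hp.1
  have hr := (χ x).right_inv hp.1
  rw [chartRep_eq, extD_eq]
  generalize hz : (χ x).symm p = z at *
  have hq := mem_extChartAt_target (I := 𝓡 5) z
  have hl := (χ z).left_inv (mem_extChartAt_source z)
  have hev : ∀ᶠ q in nhds (χ z z), q ∈ (χ z).target ∧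
      (χ z).symm q ∈ (χ x).source :=
    eventually_mem_chart (isOpen_extChartAt_source x) hs
  have e1 : chartRep η z =ᶠ[nhds (χ z z)] fun q =>
      (chartRep η x ((χ x ∘ (χ z).symm) q)).compContinuousLinearMap
        (fderiv ℝ (χ x ∘ (χ z).symm) q) := by
    filter_upwards [hev] with q hq
    ext v
    rw [chartRep_apply, fE_apply_of_mem η x hq.2]
    rw [ContinuousAlternatingMap.compContinuousLinearMap_apply]
    congr 1; funext i
    exact (fderiv_transition hq.1 hq.2 (v i)).symm
  have hψ : (χ x ∘ (χ z).symm) (χ z z) = p := by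
    rw [Function.comp_apply, hl, hr]
  have hs' : (χ z).symm (χ z z) ∈ (χ x).source := by
    rwa [hl]
  rw [e1.extDeriv_eq, extDeriv_pullback (r := ∞) _ (contDiffAt_transition hq hs') two_le_infty, hψ]
  · ext v
    simp only [ContinuousAlternatingMap.compContinuousLinearMap_apply]
    congr 1; funext i
    have h1 := fderiv_transition hq hs' (cS x p (v i))
    refine h1.trans ?_
    rw [hl, cS_self]
    have h2 := cD_cS x hp.1 (v i)
    rwa [hz] at h2
  · rw [hψ]; exact hdp.differentiableAt (by simp)

lemma smoothForm_extD {η : Form M k} (hU : IsOpen U) (hη : SmoothForm η U) :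
    SmoothForm (extD η) U := by
  intro x hx
  refine ContDiffAt.congr_of_eventuallyEq ?_ (chartRep_extD hU hη hx)
  have h := (hη x hx).fderiv_right (m := ∞) (by simp)
  exact (ContinuousAlternatingMap.alternatizeUncurryFinCLM ℝ E5 ℂ).contDiff.contDiffAt.comp _ h

lemma extD_extD {η : Form M k} (hU : IsOpen U) (hη : SmoothForm η U) (hx : x ∈ U) : extD (extD η) x = 0 := by
  refine (extD_eq (extD η) x).trans ?_
  rw [(chartRep_extD hU hη hx).extDeriv_eq]
  exact extDeriv_extDeriv_apply (r := ∞) (hη x hx) two_le_infty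

/-! #### Algebraic operations -/

lemma chartRep_wedge {k l : ℕ} (a : Form M k) (b : Form M l) (x : M) (p : E5) :
    chartRep (fun y => a y ⋏ b y) x p = chartRep a x p ⋏ chartRep b x p := by
  ext v
  have h1 := wedge_apply_sum (fE a ((χ x).symm p)) (fE b ((χ x).symm p))
    (fun i => cS x p (v i))
  have h2 := wedge_apply_sum (chartRep a x p) (chartRep b x p) v
  exact h1.trans h2.symm

lemma smoothForm_wedge {k l : ℕ} {a : Form M k} {b : Form M l}
    (ha : SmoothForm a U) (hb : SmoothForm b U) : SmoothForm (fun y => a y ⋏ b y) U := fun x hx =>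
  (contDiffAt_wedge (ha x hx) (hb x hx)).congr_of_eventuallyEq
    (.of_forall (chartRep_wedge a b x))

lemma smoothForm_add {a b : Form M k}
    (ha : SmoothForm a U) (hb : SmoothForm b U) : SmoothForm (fun y => a y + b y) U := fun x hx =>
  ContDiffAt.add (ha x hx) (hb x hx)

lemma smoothForm_smul {a : Form M k} (hU : IsOpen U)
    (hf : SmoothFun f U) (ha : SmoothForm a U) : SmoothForm (fun y => f y • a y) U := fun x hx =>
  ContDiffAt.fun_smul ((smoothFun_iff hU).1 hf x hx) (ha x hx)

lemma smoothForm_zero : SmoothForm (fun y => (0 : (TM y) [⋀^Fin k]→L[ℝ] ℂ)) U := fun x hx => by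
  have : chartRep (fun y : M => (0 : (TM y) [⋀^Fin k]→L[ℝ] ℂ)) x = fun _ => 0 := rfl
  rw [this]; exact contDiffAt_const

lemma smoothForm_sum {J : Type*} (s : Finset J) {a : J → Form M k}
    (ha : ∀ i, SmoothForm (a i) U) : SmoothForm (fun y => ∑ i ∈ s, a i y) U := by
  classical
  induction s using Finset.induction_on with
  | empty => simpa using smoothForm_zero
  | insert i s hi ih =>
    simp only [Finset.sum_insert hi]
    exact smoothForm_add (ha i) ih

lemma smoothForm_conj {a : Form M k} (ha : SmoothForm a U) :
    SmoothForm (fun y => conjForm (a y)) U := fun x hx => by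
  refine contDiffAt_alternating fun v => ?_
  exact (Complex.conjCLE : ℂ →L[ℝ] ℂ).contDiff.contDiffAt.comp _
    (contDiffAt_alternating_apply (ha x hx) v)

lemma smoothForm_congr {a b : Form M k} (hU : IsOpen U)
    (h : ∀ x ∈ U, a x = b x) (ha : SmoothForm a U) : SmoothForm b U := fun x hx => by
  refine (ha x hx).congr_of_eventuallyEq ?_
  filter_upwards [eventually_mem_chart hU hx] with p hp
  rw [chartRep_eq, chartRep_eq, fE, fE, h _ hp.2]

lemma extD_congr {a b : Form M k} (hU : IsOpen U)
    (h : ∀ x ∈ U, a x = b x) (hx : x ∈ U) : extD a x = extD b x := by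
  refine (extD_eq a x).trans (Eq.trans ?_ (extD_eq b x).symm)
  apply Filter.EventuallyEq.extDeriv_eq
  filter_upwards [eventually_mem_chart hU hx] with p hp
  rw [chartRep_eq, chartRep_eq, fE, fE, h _ hp.2]

lemma extD_add {a b : Form M k} (ha : SmoothForm a U) (hb : SmoothForm b U) (hx : x ∈ U) : extD (fun y => a y + b y) x = extD a x + extD b x := by
  refine (extD_eq _ x).trans ?_
  refine (extDeriv_fun_add ((ha x hx).differentiableAt (by simp))
    ((hb x hx).differentiableAt (by simp))).trans ?_
  rw [← extD_eq, ← extD_eq]; rfl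

lemma extD_zero (x : M) :
    extD (fun y : M => (0 : (TM y) [⋀^Fin k]→L[ℝ] ℂ)) x = 0 := by
  refine (extD_eq _ x).trans ?_
  have : chartRep (fun y : M => (0 : (TM y) [⋀^Fin k]→L[ℝ] ℂ)) x = fun _ => 0 := rfl
  rw [this]
  have h := extDeriv_smul (𝕜 := ℝ) (x := χ x x) 0 (fun _ : E5 => (0 : E5 [⋀^Fin k]→L[ℝ] ℂ))
  rw [zero_smul, zero_smul] at h
  exact h

lemma extD_sum {J : Type*} (s : Finset J) {a : J → Form M k}
    (ha : ∀ i, SmoothForm (a i) U) (hx : x ∈ U) :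
    extD (fun y => ∑ i ∈ s, a i y) x = ∑ i ∈ s, extD (a i) x := by
  classical
  induction s using Finset.induction_on with
  | empty => simpa using extD_zero x
  | insert i s hi ih =>
    simp only [Finset.sum_insert hi]
    rw [extD_add (ha i) (smoothForm_sum s ha) hx, ih]

lemma extD_smul_one {a : Form M 1} (hU : IsOpen U)
    (hf : SmoothFun f U) (ha : SmoothForm a U) (hx : x ∈ U) :
    extD (fun y => f y • a y) x = diffForm f x ⋏ a x + f x • extD a x := by
  refine (extD_eq _ x).trans ?_
  refine (extDeriv_smul_one ((smoothFun_iff hU).1 hf x hx) (ha x hx)).trans ?_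
  rw [← extD_eq, ← (chartRep_diffForm hU hf hx).self_of_nhds, chartRep_self, chartRep_self,
    Function.comp_apply, (χ x).left_inv (mem_extChartAt_source x)]
  rfl

lemma extD_wedge_one_one {a b : Form M 1} (ha : SmoothForm a U) (hb : SmoothForm b U) (hx : x ∈ U) :
    extD (fun y => a y ⋏ b y) x = extD a x ⋏ b x - a x ⋏ extD b x := by
  refine (extD_eq _ x).trans ?_
  rw [show chartRep (fun y => a y ⋏ b y) x = fun p => chartRep a x p ⋏ chartRep b x p from
    funext (chartRep_wedge a b x)]
  refine (extDeriv_wedge_one_one (ha x hx) (hb x hx)).trans ?_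
  rw [← extD_eq, ← extD_eq, chartRep_self, chartRep_self]
  rfl

lemma extD_wedge_one_two {a : Form M 1} {b : Form M 2} (ha : SmoothForm a U)
    (hb : SmoothForm b U) (hx : x ∈ U) :
    extD (fun y => a y ⋏ b y) x = extD a x ⋏ b x - a x ⋏ extD b x := by
  refine (extD_eq _ x).trans ?_
  rw [show chartRep (fun y => a y ⋏ b y) x = fun p => chartRep a x p ⋏ chartRep b x p from
    funext (chartRep_wedge a b x)]
  refine (extDeriv_wedge_one_two (ha x hx) (hb x hx)).trans ?_
  rw [← extD_eq, ← extD_eq, chartRep_self, chartRep_self]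
  rfl

lemma extD_conj {a : Form M k} (ha : SmoothForm a U) (hx : x ∈ U) :
    extD (fun y => conjForm (a y)) x = conjForm (extD a x) := by
  refine (extD_eq _ x).trans ?_
  have hd := (ha x hx).differentiableAt (by simp)
  have hd' : DifferentiableAt ℝ (chartRep (fun y => conjForm (a y)) x) (χ x x) :=
    (smoothForm_conj ha x hx).differentiableAt (by simp)
  refine ContinuousAlternatingMap.ext fun v => ?_
  change extDeriv (chartRep (fun y => conjForm (a y)) x) (χ x x) v =
    starRingEnd ℂ (fE (extD a) x v)
  rw [extDeriv_apply hd', extD_eq, extDeriv_apply hd, map_sum]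
  refine Finset.sum_congr rfl fun i _ => ?_
  have hv := (contDiffAt_alternating_apply (ha x hx) (i.removeNth v)).differentiableAt (by simp)
  have h3 := (Complex.conjCLE : ℂ →L[ℝ] ℂ).hasFDerivAt.comp _ hv.hasFDerivAt
  have h4 := h3.fderiv
  simp only [zsmul_eq_mul, map_mul]
  congr 1
  · simp
  · exact congrArg (fun L : E5 →L[ℝ] ℂ => L (v i)) h4

end Manifold

section LinearAlgebra

variable {V : Type*} [AddCommGroup V] [Module ℝ V] [TopologicalSpace V]

lemma evalC_one (η : V [⋀^Fin 1]→L[ℝ] ℂ) (v : ℂ ⊗[ℝ] V) :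
    evalC η ![v] = η ![reC v] + I * η ![imC v] := by
  have hu : (Finset.univ : Finset (Finset (Fin 1))) = {∅, {0}} := by decide
  rw [evalC, hu, Finset.sum_pair (by decide)]
  have e1 : (fun j : Fin 1 => if j ∈ (∅ : Finset (Fin 1)) then imC (![v] j) else reC (![v] j)) =
      ![reC v] := by funext j; fin_cases j; simp
  have e2 : (fun j : Fin 1 => if j ∈ ({0} : Finset (Fin 1)) then imC (![v] j) else reC (![v] j)) =
      ![imC v] := by funext j; fin_cases j; simp
  rw [e1, e2]; simp

/-- A complexified one-form as a linear form. -/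
def lin1 (η : V [⋀^Fin 1]→L[ℝ] ℂ) : ℂ ⊗[ℝ] V →ₗ[ℂ] ℂ :=
  (AlternatingMap.ofSubsingleton ℂ (ℂ ⊗[ℝ] V) ℂ (0 : Fin 1)).symm (evalA η)

lemma lin1_apply (η : V [⋀^Fin 1]→L[ℝ] ℂ) (v : ℂ ⊗[ℝ] V) : lin1 η v = evalC η ![v] := by
  change evalC η (fun _ => v) = _
  congr 1; funext i; fin_cases i; rfl

/-- A complexified two-form as a bilinear form. -/
def lin2 (η : V [⋀^ι]→L[ℝ] ℂ) (w : ℂ ⊗[ℝ] V) : ℂ ⊗[ℝ] V →ₗ[ℂ] ℂ :=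
  (evalA η).toMultilinearMap.toLinearMap ![0, w] 0

lemma lin2_apply (η : V [⋀^ι]→L[ℝ] ℂ) (v w : ℂ ⊗[ℝ] V) : lin2 η w v = evalC η ![v, w] := by
  change evalC η (Function.update ![0, w] 0 v) = _
  congr 1; funext i; fin_cases i <;> simp

lemma evalC_swap (η : V [⋀^ι]→L[ℝ] ℂ) (v w : ℂ ⊗[ℝ] V) :
    evalC η ![w, v] = -evalC η ![v, w] := alt2_swap (evalA η) v w

lemma evalC_wedge_one_one [Module.Finite ℝ V] (a b : V [⋀^Fin 1]→L[ℝ] ℂ) (v w : ℂ ⊗[ℝ] V) :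
    evalC (a ⋏ b) ![v, w] = evalC a ![v] * evalC b ![w] - evalC a ![w] * evalC b ![v] := by
  have h := congrArg (fun f => f ![v, w]) (evalA_wedge a b)
  exact h.trans (wedgeA_one_one _ _ _)

lemma evalC_conj_one (η : V [⋀^Fin 1]→L[ℝ] ℂ) (v : ℂ ⊗[ℝ] V) :
    evalC (conjForm η) ![conjC v] = starRingEnd ℂ (evalC η ![v]) := by
  rw [← evalC_conj]; congr 1; funext i; fin_cases i; rfl

lemma evalC_conj_two (η : V [⋀^ι]→L[ℝ] ℂ) (v w : ℂ ⊗[ℝ] V) :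
    evalC (conjForm η) ![conjC v, conjC w] = starRingEnd ℂ (evalC η ![v, w]) := by
  rw [← evalC_conj]; congr 1; funext i; fin_cases i <;> rfl

lemma evalC_real_one (η : V [⋀^Fin 1]→L[ℝ] ℂ) (v : V) : evalC η ![mkC v 0] = η ![v] :=
  evalA_real_one η v

lemma form_one_ext {η τ : V [⋀^Fin 1]→L[ℝ] ℂ} (h : ∀ v, η ![v] = τ ![v]) : η = τ := by
  ext v
  have e : v = ![v 0] := by funext i; fin_cases i; rfl
  rw [e]; exact h _

end LinearAlgebra

section Manifold

variable {k : ℕ} {M : Type*} {x : M} {U : Set M} {f : M → ℂ} [TopologicalSpace M] [ChartedSpace E5 M]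
  [IsManifold (𝓡 5) ∞ M]

instance finite_tangent (x : M) : Module.Finite ℝ (TM x) :=
  inferInstanceAs (Module.Finite ℝ E5)

lemma derivC_eq (f : M → ℂ) (x : M) (v : CTangent x) : derivC f x v = evalC (diffForm f x) ![v] := by
  rw [evalC_one, diffForm_apply, diffForm_apply]; rfl

lemma smoothFun_const (c : ℂ) (U : Set M) : SmoothFun (fun _ => c) U := contMDiffOn_const

lemma SmoothFun.add {f g : M → ℂ} (hf : SmoothFun f U) (hg : SmoothFun g U) :
    SmoothFun (fun x => f x + g x) U := ContMDiffOn.add hf hg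

lemma SmoothFun.mul {f g : M → ℂ} (hU : IsOpen U) (hf : SmoothFun f U)
    (hg : SmoothFun g U) : SmoothFun (fun x => f x * g x) U := by
  rw [smoothFun_iff hU] at *
  exact fun x hx => (hf x hx).mul (hg x hx)

lemma SmoothFun.congr {f g : M → ℂ} (hf : SmoothFun f U) (h : ∀ x ∈ U, g x = f x) :
    SmoothFun g U := ContMDiffOn.congr hf h

lemma SmoothFun.mono {U V : Set M} (hf : SmoothFun f U) (h : V ⊆ U) :
    SmoothFun f V := ContMDiffOn.mono hf h

lemma smoothFun_sum {J : Type*} (s : Finset J) {f : J → M → ℂ}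
    (hf : ∀ i, SmoothFun (f i) U) : SmoothFun (fun x => ∑ i ∈ s, f i x) U := by
  classical
  induction s using Finset.induction_on with
  | empty => simpa using smoothFun_const 0 U
  | insert i s hi ih =>
    simp only [Finset.sum_insert hi]
    exact (hf i).add ih

lemma SmoothFun.neg (hf : SmoothFun f U) :
    SmoothFun (fun x => -f x) U := ContMDiffOn.neg hf

lemma SmoothFun.sub {f g : M → ℂ} (hf : SmoothFun f U) (hg : SmoothFun g U) :
    SmoothFun (fun x => f x - g x) U := ContMDiffOn.sub hf hg

lemma SmoothFun.inv (hU : IsOpen U) (hf : SmoothFun f U)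
    (h0 : ∀ x ∈ U, f x ≠ 0) : SmoothFun (fun x => (f x)⁻¹) U := by
  rw [smoothFun_iff hU] at *
  refine fun x hx => (hf x hx).inv ?_
  rw [Function.comp_apply, (χ x).left_inv (mem_extChartAt_source x)]
  exact h0 x hx

lemma SmoothFun.conj (hU : IsOpen U) (hf : SmoothFun f U) :
    SmoothFun (fun x => starRingEnd ℂ (f x)) U := by
  rw [smoothFun_iff hU] at *
  exact fun x hx => (Complex.conjCLE : ℂ →L[ℝ] ℂ).contDiff.contDiffAt.comp _ (hf x hx)

lemma smoothFun_evalC {η : Form M k} {Z : Fin k → CVectorField M}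
    (hU : IsOpen U) (hη : SmoothForm η U) (hZ : ∀ i, SmoothCVF (Z i) U) :
    SmoothFun (fun x => evalC (η x) (fun i => Z i x)) U := by
  refine smoothFun_sum _ fun s => (smoothFun_const _ U).mul hU ?_
  have h := smoothFun_apply (η := η)
    (X := fun j x => if j ∈ s then imC (Z j x) else reC (Z j x)) hU hη (fun i => by
    by_cases h : i ∈ s
    · simpa [h] using (hZ i).2
    · simpa [h] using (hZ i).1)
  exact h

lemma smoothFun_evalC_one {η : Form M 1} {Z : CVectorField M}
    (hU : IsOpen U) (hη : SmoothForm η U) (hZ : SmoothCVF Z U) :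
    SmoothFun (fun x => evalC (η x) ![Z x]) U := by
  refine (smoothFun_evalC (Z := fun _ => Z) hU hη fun _ => hZ).congr fun x _ => ?_
  congr 1; funext i; fin_cases i; rfl

lemma smoothFun_evalC_two {η : Form M 2} {Z W : CVectorField M}
    (hU : IsOpen U) (hη : SmoothForm η U) (hZ : SmoothCVF Z U) (hW : SmoothCVF W U) :
    SmoothFun (fun x => evalC (η x) ![Z x, W x]) U := by
  refine (smoothFun_evalC (Z := fun i x => ![Z x, W x] i) hU hη fun i => ?_).congr fun x _ => rfl
  fin_cases i
  · exact hZ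
  · exact hW

lemma smoothVF_neg {X : (x : M) → TM x} (hU : IsOpen U)
    (hX : SmoothVF X U) : SmoothVF (fun x => -X x) U := by
  rw [smoothVF_iff hU] at *
  intro x hx
  refine (hX x hx).neg.congr_of_eventuallyEq (.of_forall fun p => ?_)
  exact map_neg (cD x _) (vE X _)

lemma smoothVF_zero (hU : IsOpen U) :
    SmoothVF (fun x => (0 : TM x)) U := by
  rw [smoothVF_iff hU]
  intro x hx
  refine (contDiffAt_const (c := 0)).congr_of_eventuallyEq (.of_forall fun p => ?_)
  exact map_zero (cD x _)

lemma smoothCVF_conj {Z : CVectorField M} (hU : IsOpen U) (hZ : SmoothCVF Z U) :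
    SmoothCVF (fun x => conjC (Z x)) U := by
  refine ⟨?_, ?_⟩
  · simp only [reC_conjC]; exact hZ.1
  · simp only [imC_conjC]; exact smoothVF_neg hU hZ.2

lemma smoothCVF_real {X : (x : M) → TM x} (hU : IsOpen U)
    (hX : SmoothVF X U) : SmoothCVF (fun x => mkC (X x) 0) U := by
  refine ⟨?_, ?_⟩
  · simp only [reC_mkC]; exact hX
  · simp only [imC_mkC]; exact smoothVF_zero hU

lemma SmoothCVF.mono {Z : CVectorField M} {U V : Set M} (hZ : SmoothCVF Z U) (h : V ⊆ U) :
    SmoothCVF Z V := ⟨ContMDiffOn.mono hZ.1 h, ContMDiffOn.mono hZ.2 h⟩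

lemma SmoothForm.mono {η : Form M k} {U V : Set M} (hη : SmoothForm η U) (h : V ⊆ U) :
    SmoothForm η V := fun x hx => hη x (h hx)

lemma smoothFun_derivC {Z : CVectorField M}
    (hU : IsOpen U) (hf : SmoothFun f U) (hZ : SmoothCVF Z U) :
    SmoothFun (fun x => derivC f x (Z x)) U := by
  simp only [derivC_eq]
  exact smoothFun_evalC_one hU (smoothForm_diffForm hU hf) hZ

lemma diffFun_congr {f g : M → ℂ} (hU : IsOpen U) (h : ∀ x ∈ U, f x = g x)
    (hx : x ∈ U) : diffFun f x = diffFun g x := by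
  have he : f =ᶠ[nhds x] g := by
    filter_upwards [hU.mem_nhds hx] with y hy using h y hy
  exact he.mfderiv_eq

lemma derivC_congr {f g : M → ℂ} (hU : IsOpen U) (h : ∀ x ∈ U, f x = g x)
    (hx : x ∈ U) (v : CTangent x) : derivC f x v = derivC g x v := by
  rw [derivC, derivC, diffFun_congr hU h hx]

lemma derivC_add {f g : M → ℂ} (hU : IsOpen U) (hf : SmoothFun f U)
    (hg : SmoothFun g U) (hx : x ∈ U) (v : CTangent x) :
    derivC (fun y => f y + g y) x v = derivC f x v + derivC g x v := by
  have hf' := (hf.contMDiffAt (hU.mem_nhds hx)).mdifferentiableAt (by simp)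
  have hg' := (hg.contMDiffAt (hU.mem_nhds hx)).mdifferentiableAt (by simp)
  have h : ∀ w : TM x, diffFun (fun y => f y + g y) x w =
      diffFun f x w + diffFun g x w := fun w =>
    congrArg (fun L : E5 →L[ℝ] ℂ => L w) (mfderiv_add hf' hg')
  simp only [derivC, h]; ring

lemma derivC_mul {f g : M → ℂ} (hU : IsOpen U) (hf : SmoothFun f U)
    (hg : SmoothFun g U) (hx : x ∈ U) (v : CTangent x) :
    derivC (fun y => f y * g y) x v = f x * derivC g x v + g x * derivC f x v := by
  have hf' := ((smoothFun_iff hU).1 hf x hx).differentiableAt (by simp)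
  have hg' := ((smoothFun_iff hU).1 hg x hx).differentiableAt (by simp)
  have h : ∀ w : TM x, diffFun (fun y => f y * g y) x w =
      f x * diffFun g x w + g x * diffFun f x w := fun w => by
    have h1 := congrArg (fun L : E5 →L[ℝ] ℂ => L w)
      (diffFun_eq ((hf.mul hU hg).contMDiffAt (hU.mem_nhds hx)))
    have h2 := congrArg (fun L : E5 →L[ℝ] ℂ => L w) (diffFun_eq (hf.contMDiffAt (hU.mem_nhds hx)))
    have h3 := congrArg (fun L : E5 →L[ℝ] ℂ => L w) (diffFun_eq (hg.contMDiffAt (hU.mem_nhds hx)))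
    have h4 := congrArg (fun L : E5 →L[ℝ] ℂ => L w) (fderiv_mul hf' hg')
    have h5 : (χ x).symm (χ x x) = x :=
      (χ x).left_inv (mem_extChartAt_source x)
    refine h1.trans (h4.trans ?_)
    simp only [Function.comp_apply, h5]
    exact congrArg₂ (fun p q => f x * p + g x * q) h3.symm h2.symm
  simp only [derivC, h]; ring

lemma derivC_const (c : ℂ) (x : M) (v : CTangent x) : derivC (fun _ : M => c) x v = 0 := by
  have h : ∀ w : TM x, diffFun (fun _ : M => c) x w = 0 := fun w =>
    congrArg (fun L : E5 →L[ℝ] ℂ => L w) mfderiv_const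
  simp [derivC, h]

/-! #### Frames -/

/-- A local frame of the complexified tangent bundle and its dual frame. -/
structure CFrame (J : Type) [Fintype J] [DecidableEq J] (U : Set M) where
  X : J → CVectorField M
  e : J → Form M 1
  X_smooth : ∀ i, SmoothCVF (X i) U
  e_smooth : ∀ i, SmoothForm (e i) U
  dual : ∀ i j, ∀ x ∈ U, evalC (e i x) ![X j x] = if i = j then 1 else 0
  expand : ∀ x ∈ U, ∀ v : CTangent x, v = ∑ i, evalC (e i x) ![v] • X i x

variable {J : Type} [Fintype J] [DecidableEq J] {U : Set M}

lemma CFrame.form_eq (C : CFrame J U) (η : Form M 1) (hx : x ∈ U) :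
    η x = ∑ i, evalC (η x) ![C.X i x] • C.e i x := by
  refine form_one_ext fun v => ?_
  rw [← evalC_real_one, ← evalC_real_one]
  conv_lhs => rw [C.expand x hx (mkC v 0), ← lin1_apply, map_sum]
  rw [evalC_sum]
  refine Finset.sum_congr rfl fun i _ => ?_
  rw [map_smul, evalC_smul, lin1_apply, smul_eq_mul, mul_comm]

lemma CFrame.extD_apply (C : CFrame J U) (hU : IsOpen U) {η : Form M 1} (hη : SmoothForm η U) (hx : x ∈ U) (a b : J) :
    evalC (extD η x) ![C.X a x, C.X b x] =
      derivC (fun y => evalC (η y) ![C.X b y]) x (C.X a x)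
      - derivC (fun y => evalC (η y) ![C.X a y]) x (C.X b x)
      + ∑ i, evalC (η x) ![C.X i x] * evalC (extD (C.e i) x) ![C.X a x, C.X b x] := by
  have hs : ∀ i, SmoothFun (fun y => evalC (η y) ![C.X i y]) U := fun i =>
    smoothFun_evalC_one hU hη (C.X_smooth i)
  have h1 : extD η x = ∑ i, extD (fun y => evalC (η y) ![C.X i y] • C.e i y) x := by
    rw [← extD_sum Finset.univ (fun i => smoothForm_smul hU (hs i) (C.e_smooth i)) hx]
    exact extD_congr hU (fun y hy => C.form_eq η hy) hx
  have h2 : ∀ i, evalC (extD (fun y => evalC (η y) ![C.X i y] • C.e i y) x) ![C.X a x, C.X b x] =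
      derivC (fun y => evalC (η y) ![C.X i y]) x (C.X a x) * (if i = b then 1 else 0)
      - derivC (fun y => evalC (η y) ![C.X i y]) x (C.X b x) * (if i = a then 1 else 0)
      + evalC (η x) ![C.X i x] * evalC (extD (C.e i) x) ![C.X a x, C.X b x] := by
    intro i
    rw [extD_smul_one hU (hs i) (C.e_smooth i) hx, evalC_add, evalC_smul, evalC_wedge_one_one,
      C.dual i b x hx, C.dual i a x hx, ← derivC_eq, ← derivC_eq]
  rw [h1, evalC_sum, Finset.sum_congr rfl fun i _ => h2 i, Finset.sum_add_distrib,
    Finset.sum_sub_distrib]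
  simp

/-- The commutator of two frame fields. -/
lemma CFrame.comm (C : CFrame J U) (hU : IsOpen U) (hf : SmoothFun f U) (hx : x ∈ U) (a b : J) :
    derivC (fun y => derivC f y (C.X b y)) x (C.X a x)
      - derivC (fun y => derivC f y (C.X a y)) x (C.X b x) =
      -∑ i, derivC f x (C.X i x) * evalC (extD (C.e i) x) ![C.X a x, C.X b x] := by
  have h := C.extD_apply hU (smoothForm_diffForm hU hf) hx a b
  rw [extD_diffForm hU hf hx, evalC_zero] at h
  simp only [← derivC_eq] at h
  linear_combination -h

end Manifold

/-! ### The algebra of smooth functions on an open set -/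

section Manifold

variable {k : ℕ} {M : Type*} {x : M} {U : Set M} {f : M → ℂ} [TopologicalSpace M] [ChartedSpace E5 M]
  [IsManifold (𝓡 5) ∞ M]

open Classical in
/-- Extension of a function by zero. -/
def extZ {V : Opens M} (a : V → ℂ) (x : M) : ℂ :=
  if h : x ∈ V then a ⟨x, h⟩ else 0

lemma extZ_apply {V : Opens M} (a : V → ℂ) (x : V) : extZ a x = a x := by
  simp [extZ]

lemma extZ_of_mem {V : Opens M} (a : V → ℂ) (hx : x ∈ V) :
    extZ a x = a ⟨x, hx⟩ := by
  simp [extZ, hx]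

/-- Smooth complex-valued functions on `V`. -/
def smoothAlg (V : Opens M) : Subalgebra ℂ (V → ℂ) where
  carrier := {a | SmoothFun (extZ a) V}
  mul_mem' {a b} ha hb := by
    refine (SmoothFun.mul V.isOpen ha hb).congr fun x hx => ?_
    rw [extZ_of_mem _ hx, extZ_of_mem _ hx, extZ_of_mem _ hx]; rfl
  add_mem' {a b} ha hb := by
    refine (SmoothFun.add ha hb).congr fun x hx => ?_
    rw [extZ_of_mem _ hx, extZ_of_mem _ hx, extZ_of_mem _ hx]; rfl
  algebraMap_mem' c := by
    refine (smoothFun_const c _).congr fun x hx => ?_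
    rw [extZ_of_mem _ hx]; rfl

variable {V : Opens M}

/-- Evaluation at a point. -/
def ev (x : V) : smoothAlg V →ₐ[ℂ] ℂ := (Pi.evalAlgHom ℂ (fun _ : V => ℂ) x).comp (smoothAlg V).val

lemma ev_ext {a b : smoothAlg V} (h : ∀ x, ev x a = ev x b) : a = b :=
  Subtype.ext (funext h)

lemma ev_eq (a : smoothAlg V) (x : V) : ev x a = extZ a.1 x := (extZ_apply a.1 x).symm

lemma smooth_extZ (a : smoothAlg V) : SmoothFun (extZ a.1) V := a.2

/-- Restriction of a function to `V`. -/
def res (f : M → ℂ) (hf : SmoothFun f V) : smoothAlg V :=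
  ⟨fun x => f x, hf.congr fun x hx => by rw [extZ_of_mem _ hx]⟩

@[simp] theorem ev_res (f : M → ℂ) (hf : SmoothFun f V) (x : V) : ev x (res f hf) = f x := rfl

lemma extZ_res (f : M → ℂ) (hf : SmoothFun f V) (hx : x ∈ V) :
    extZ (res f hf).1 x = f x := extZ_of_mem _ hx

/-- The derivative of a smooth function along a smooth complex vector field. -/
def dvFun (Z : CVectorField M) (hZ : SmoothCVF Z V) (a : smoothAlg V) : smoothAlg V :=
  res (fun x => derivC (extZ a.1) x (Z x)) (smoothFun_derivC V.isOpen (smooth_extZ a) hZ)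

lemma ev_dvFun (Z : CVectorField M) (hZ : SmoothCVF Z V) (a : smoothAlg V) (x : V) :
    ev x (dvFun Z hZ a) = derivC (extZ a.1) x (Z x) := rfl

/-- The derivation given by a smooth complex vector field. -/
def dv (Z : CVectorField M) (hZ : SmoothCVF Z V) : Derivation ℂ (smoothAlg V) (smoothAlg V) :=
  Derivation.mk'
    { toFun := dvFun Z hZ
      map_add' := fun a b => by
        refine ev_ext fun x => ?_
        rw [map_add, ev_dvFun, ev_dvFun, ev_dvFun,
          ← derivC_add V.isOpen (smooth_extZ a) (smooth_extZ b) x.2]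
        refine derivC_congr V.isOpen (fun y hy => ?_) x.2 _
        rw [extZ_of_mem _ hy, extZ_of_mem _ hy, extZ_of_mem _ hy]; rfl
      map_smul' := fun c a => by
        refine ev_ext fun x => ?_
        have h := derivC_mul V.isOpen (smoothFun_const c _) (smooth_extZ a) x.2 (Z x)
        rw [derivC_const, mul_zero, add_zero] at h
        rw [RingHom.id_apply, map_smul, ev_dvFun, ev_dvFun, smul_eq_mul, ← h]
        refine derivC_congr V.isOpen (fun y hy => ?_) x.2 _
        rw [extZ_of_mem _ hy, extZ_of_mem _ hy]; rfl }
    (fun a b => by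
      change dvFun Z hZ (a * b) = a * dvFun Z hZ b + b * dvFun Z hZ a
      refine ev_ext fun x => ?_
      have h := derivC_mul V.isOpen (smooth_extZ a) (smooth_extZ b) x.2 (Z x)
      rw [map_add, map_mul, map_mul, ev_dvFun, ev_dvFun, ev_dvFun, ev_eq a, ev_eq b, ← h]
      refine derivC_congr V.isOpen (fun y hy => ?_) x.2 _
      rw [extZ_of_mem _ hy, extZ_of_mem _ hy, extZ_of_mem _ hy]; rfl)

lemma ev_dv (Z : CVectorField M) (hZ : SmoothCVF Z V) (a : smoothAlg V) (x : V) :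
    ev x (dv Z hZ a) = derivC (extZ a.1) x (Z x) := rfl

lemma ev_dv_res (Z : CVectorField M) (hZ : SmoothCVF Z V) (f : M → ℂ) (hf : SmoothFun f V)
    (x : V) : ev x (dv Z hZ (res f hf)) = derivC f x (Z x) := by
  rw [ev_dv]
  exact derivC_congr V.isOpen (fun y hy => extZ_res f hf hy) x.2 _

lemma ev_dv_dv (Z W : CVectorField M) (hZ : SmoothCVF Z V) (hW : SmoothCVF W V) (a : smoothAlg V)
    (x : V) : ev x (dv Z hZ (dv W hW a)) = derivC (fun y => derivC (extZ a.1) y (W y)) x (Z x) := by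
  rw [ev_dv]
  exact derivC_congr V.isOpen (fun y hy => extZ_of_mem _ hy) x.2 _

@[simp] theorem ev_jj (x : V) : ev x (jj (smoothAlg V)) = I := by
  rw [jj, AlgHom.commutes]; rfl

@[simp] theorem ev_hh (x : V) : ev x (hh (smoothAlg V)) = 1 / 2 := by
  rw [hh, AlgHom.commutes]; rfl

@[simp] theorem ev_dl (x : V) (i j : ι) : ev x (dl i j : smoothAlg V) = if i = j then 1 else 0 := by
  unfold dl; split_ifs <;> simp

/-- On the domain of a chart, a complex tangent vector is determined by its action on functions. -/
lemma eq_zero_of_derivC {x₀ : M} (hV : (V : Set M) ⊆ (χ x₀).source) (x : V)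
    (v : CTangent (x : M)) (h : ∀ a : smoothAlg V, derivC (extZ a.1) x v = 0) : v = 0 := by
  have key : ∀ L : E5 →L[ℝ] ℂ, L (cD x₀ x (reC v)) + I * L (cD x₀ x (imC v)) = 0 := by
    intro L
    have hs : SmoothFun (fun y => L (χ x₀ y)) V := by
      intro y hy
      have h1 : ContMDiffAt (𝓡 5) (𝓡 5) ∞ (χ x₀) y :=
        contMDiffAt_extChartAt' (by have := hV hy; rwa [extChartAt_source] at this)
      exact (L.contDiff.contMDiff.contMDiffAt.comp y h1).contMDiffWithinAt
    have h1 := h (res _ hs)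
    rw [derivC_congr V.isOpen (fun y hy => extZ_res _ hs hy) x.2] at h1
    have h2 : ∀ w : E5, (diffFun (fun y => L (χ x₀ y)) (x : M) : E5 →L[ℝ] ℂ) w =
        L (cD x₀ x w) := by
      intro w
      rw [diffFun_of_mem (hV x.2) (hs.contMDiffAt (V.isOpen.mem_nhds x.2))]
      have e : (fun y => L (χ x₀ y)) ∘ (χ x₀).symm
          =ᶠ[nhds (χ x₀ x)] L := by
        filter_upwards [chart_target_mem_nhds x₀ ((χ x₀).map_source (hV x.2))] with p hp
        exact congrArg L ((χ x₀).right_inv hp)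
      rw [e.fderiv_eq, L.fderiv]
    exact (congrArg₂ (fun p q => p + I * q) (h2 (reC v)) (h2 (imC v))).symm.trans h1
  have key2 : ∀ l : E5 →L[ℝ] ℝ, l (cD x₀ x (reC v)) = 0 ∧ l (cD x₀ x (imC v)) = 0 := by
    intro l
    have h1 := key (Complex.ofRealCLM.comp l)
    have hr := congrArg Complex.re h1
    have hi := congrArg Complex.im h1
    simp at hr hi
    exact ⟨hr, hi⟩
  have inj : ∀ w : E5, (∀ l : E5 →L[ℝ] ℝ, l (cD x₀ x w) = 0) → w = 0 := by
    intro w hw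
    have h0 : cD x₀ x w = 0 := by
      ext i
      simpa using hw (EuclideanSpace.proj i)
    have := cS_cD x₀ (hV x.2) w
    rw [h0, map_zero] at this
    exact this.symm
  apply ext_re_im
  · rw [reC_zero]; exact inj _ fun l => (key2 l).1
  · rw [imC_zero]; exact inj _ fun l => (key2 l).2

end Manifold

/-! ### Frames adapted to a contact form -/

section Manifold

variable {k : ℕ} {M : Type*} {x : M} {U : Set M} {f : M → ℂ} [TopologicalSpace M] [ChartedSpace E5 M]
  [IsManifold (𝓡 5) ∞ M]
variable {S : CRStructure M} {θ : Form M 1}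

lemma mkC_smul_two {V : Type*} [AddCommGroup V] [Module ℝ V] (Z : ℂ ⊗[ℝ] V) :
    mkC ((2 : ℝ) • reC Z) 0 = Z + conjC Z := by
  apply ext_re_im
  · simp [two_smul]
  · simp

lemma form_one_smul {V : Type*} [AddCommGroup V] [Module ℝ V] [TopologicalSpace V]
    (η : V [⋀^Fin 1]→L[ℝ] ℂ) (c : ℝ) (v : V) : η ![c • v] = c * η ![v] := by
  have h := η.map_update_smul ![v] 0 c v
  have e1 : Function.update ![v] 0 (c • v) = ![c • v] := by funext i; fin_cases i; simp
  have e2 : Function.update ![v] 0 v = ![v] := by funext i; fin_cases i; simp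
  rw [e1, e2] at h
  rw [h]; simp

lemma IsContactForm.theta_reC (hθ : S.Contact θ) {Z : CTangent x}
    (hZ : Z ∈ S.T10 x) : θ x ![reC Z] = 0 := by
  have h := (hθ.ker x ((2 : ℝ) • reC Z)).2 ⟨Z, hZ, mkC_smul_two Z⟩
  rw [form_one_smul] at h
  simpa using h

lemma IsContactForm.theta_mem (hθ : S.Contact θ) {Z : CTangent x}
    (hZ : Z ∈ S.T10 x) : evalC (θ x) ![Z] = 0 := by
  have h1 := hθ.theta_reC hZ
  have h2 := hθ.theta_reC ((S.T10 x).smul_mem (-I) hZ)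
  have h3 : reC (-I • Z) = imC Z := by simp
  rw [h3] at h2
  rw [evalC_one, h1, h2]; simp

lemma IsContactForm.theta_conj (hθ : S.Contact θ) {Z : CTangent x}
    (hZ : Z ∈ S.T10 x) : evalC (θ x) ![conjC Z] = 0 := by
  have h := evalC_conj_one (θ x) Z
  rw [hθ.real, hθ.theta_mem hZ, map_zero] at h
  exact h

lemma IsContactForm.exists_real (hθ : S.Contact θ) (v : TM x) :
    ∃ t : ℝ, θ x ![v] = t := by
  have h := congrArg (fun η => η ![v]) (hθ.real x)
  have h2 : starRingEnd ℂ (θ x ![v]) = θ x ![v] := h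
  exact ⟨(θ x ![v]).re, (Complex.conj_eq_iff_re.1 h2).symm⟩

lemma IsContactForm.decompose (hθ : S.Contact θ) {T : TM x}
    (hT : θ x ![T] = 1) (v : TM x) :
    ∃ t : ℝ, ∃ Z ∈ S.T10 x, mkC v 0 = (t : ℂ) • mkC T 0 + Z + conjC Z := by
  obtain ⟨t, ht⟩ := hθ.exists_real v
  have h0 : θ x ![v - t • T] = 0 := by
    have h1 := lin1_apply (θ x) (mkC (v - t • T) 0)
    rw [evalC_real_one] at h1
    rw [← h1]
    have h2 : mkC (v - t • T) 0 = mkC v 0 - (t : ℂ) • mkC T 0 := by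
      apply ext_re_im <;> simp [-Complex.coe_smul]
    rw [h2, map_sub, map_smul, lin1_apply, lin1_apply, evalC_real_one, evalC_real_one, ht, hT]
    simp
  obtain ⟨Z, hZ, hv⟩ := (hθ.ker x _).1 h0
  refine ⟨t, Z, hZ, ?_⟩
  have h4 : mkC v 0 = (t : ℂ) • mkC T 0 + mkC (v - t • T) 0 := by
    apply ext_re_im <;> simp [-Complex.coe_smul]
  rw [h4, hv, add_assoc]

lemma finrank_T10 (S : CRStructure M) (x : M) : Module.finrank ℂ (S.T10 x) = 2 := by
  obtain ⟨U, -, hx, Z, -, hZ⟩ := S.locally_framed x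
  obtain ⟨hli, hsp⟩ := hZ x hx
  rw [← hsp, finrank_span_eq_card hli]; rfl

lemma span_eq_T10 (S : CRStructure M) {Z : ι → CTangent x}
    (hZ : ∀ α, Z α ∈ S.T10 x) (hli : LinearIndependent ℂ Z) :
    Submodule.span ℂ (Set.range Z) = S.T10 x := by
  apply Submodule.eq_of_le_of_finrank_eq
  · rw [Submodule.span_le]; rintro _ ⟨α, rfl⟩; exact hZ α
  · rw [finrank_span_eq_card hli, finrank_T10]; rfl

namespace AdmissibleCoframe

variable (F : AdmissibleCoframe S θ)

lemma linearIndependent (hx : x ∈ F.U) : LinearIndependent ℂ (fun α => F.Z α x) := by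
  rw [Fintype.linearIndependent_iff]
  intro g hg β
  have h := congrArg (lin1 (F.φ β x)) hg
  rw [map_sum, map_zero] at h
  simp only [map_smul, lin1_apply, F.φ_Z _ _ x hx] at h
  simpa using h

lemma mem_T10 (hx : x ∈ F.U) {Z : CTangent x} (hZ : Z ∈ S.T10 x) :
    Z = ∑ α, evalC (F.φ α x) ![Z] • F.Z α x := by
  rw [← span_eq_T10 S (fun α => F.Z_mem α x hx) (F.linearIndependent hx)] at hZ
  obtain ⟨c, rfl⟩ := (Submodule.mem_span_range_iff_exists_fun ℂ).1 hZ
  refine Finset.sum_congr rfl fun α _ => ?_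
  congr 1
  rw [← lin1_apply, map_sum]
  simp only [map_smul, lin1_apply, F.φ_Z _ _ x hx]
  simp

/-- The frame `T, Z_α, Z_ᾱ`. -/
def fr (c : Option (ι ⊕ ι)) : CVectorField M :=
  match c with
  | none => fun x => mkC (F.T x) 0
  | some (.inl α) => F.Z α
  | some (.inr α) => fun x => conjC (F.Z α x)

/-- The coframe `θ, θ^α, θ^ᾱ`. -/
def cofr (c : Option (ι ⊕ ι)) : Form M 1 :=
  match c with
  | none => θ
  | some (.inl α) => F.φ α
  | some (.inr α) => fun x => conjForm (F.φ α x)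

variable (hθ : S.Contact θ)

lemma φ_T' (α : ι) (hx : x ∈ F.U) : evalC (F.φ α x) ![mkC (F.T x) 0] = 0 := by
  rw [evalC_real_one]; exact F.φ_T α x hx

lemma φ_conj' (α β : ι) (hx : x ∈ F.U) : evalC (F.φ α x) ![conjC (F.Z β x)] = 0 :=
  F.φ_conj α x hx _ (F.Z_mem β x hx)

lemma φbar_T (α : ι) (hx : x ∈ F.U) :
    evalC (conjForm (F.φ α x)) ![mkC (F.T x) 0] = 0 := by
  have h := evalC_conj_one (F.φ α x) (mkC (F.T x) 0)
  rw [conjC_mkC_zero, F.φ_T' α hx, map_zero] at h; exact h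

lemma φbar_Z (α β : ι) (hx : x ∈ F.U) :
    evalC (conjForm (F.φ α x)) ![F.Z β x] = 0 := by
  have h := evalC_conj_one (F.φ α x) (conjC (F.Z β x))
  rw [conjC_conjC, F.φ_conj' α β hx, map_zero] at h; exact h

lemma φbar_conj (α β : ι) (hx : x ∈ F.U) :
    evalC (conjForm (F.φ α x)) ![conjC (F.Z β x)] = if α = β then 1 else 0 := by
  rw [evalC_conj_one, F.φ_Z α β x hx]; split_ifs <;> simp

lemma theta_T' (hx : x ∈ F.U) : evalC (θ x) ![mkC (F.T x) 0] = 1 := by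
  rw [evalC_real_one]; exact F.theta_T x hx

lemma dual (hθ : S.Contact θ) (i j : Option (ι ⊕ ι)) (hx : x ∈ F.U) :
    evalC (F.cofr i x) ![F.fr j x] = if i = j then 1 else 0 := by
  rcases i with _ | α | α <;> rcases j with _ | β | β
  · exact (F.theta_T' hx).trans (by simp)
  · exact (hθ.theta_mem (F.Z_mem β x hx)).trans (by simp)
  · exact (hθ.theta_conj (F.Z_mem β x hx)).trans (by simp)
  · exact (F.φ_T' α hx).trans (by simp)
  · exact (F.φ_Z α β x hx).trans (by simp)
  · exact (F.φ_conj' α β hx).trans (by simp)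
  · exact (F.φbar_T α hx).trans (by simp)
  · exact (F.φbar_Z α β hx).trans (by simp)
  · exact (F.φbar_conj α β hx).trans (by simp)

lemma expand_real (hθ : S.Contact θ) (hx : x ∈ F.U) (v : TM x) :
    mkC v 0 ∈ Submodule.span ℂ (Set.range fun i => F.fr i x) := by
  have hfr : ∀ i, F.fr i x ∈ Submodule.span ℂ (Set.range fun i => F.fr i x) := fun i =>
    Submodule.subset_span ⟨i, rfl⟩
  obtain ⟨t, Z, hZ, h3⟩ := hθ.decompose (F.theta_T x hx) v
  rw [h3, F.mem_T10 hx hZ]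
  refine Submodule.add_mem _ (Submodule.add_mem _ (Submodule.smul_mem _ _ (hfr none)) ?_) ?_
  · exact Submodule.sum_mem _ fun α _ => Submodule.smul_mem _ _ (hfr (some (.inl α)))
  · rw [sum_two, conjC_add, conjC_smul, conjC_smul]
    exact Submodule.add_mem _ (Submodule.smul_mem _ _ (hfr (some (.inr 0))))
      (Submodule.smul_mem _ _ (hfr (some (.inr 1))))

lemma expand (hθ : S.Contact θ) (hx : x ∈ F.U) (v : CTangent x) :
    v = ∑ i, evalC (F.cofr i x) ![v] • F.fr i x := by
  have hv : v ∈ Submodule.span ℂ (Set.range fun i => F.fr i x) := by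
    have h : v = mkC (reC v) 0 + I • mkC (imC v) 0 := by
      apply ext_re_im <;> simp
    rw [h]
    exact Submodule.add_mem _ (F.expand_real hθ hx _) (Submodule.smul_mem _ _ (F.expand_real hθ hx _))
  obtain ⟨c, rfl⟩ := (Submodule.mem_span_range_iff_exists_fun ℂ).1 hv
  refine Finset.sum_congr rfl fun i _ => ?_
  congr 1
  rw [← lin1_apply, map_sum]
  simp only [map_smul, lin1_apply, F.dual hθ _ _ hx]
  simp

/-- The frame adapted to an admissible coframe. -/
def cframe (hθ : S.Contact θ) : CFrame (Option (ι ⊕ ι)) F.U where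
  X := F.fr
  e := F.cofr
  X_smooth i := by
    rcases i with _ | α | α
    · exact smoothCVF_real F.isOpen_U F.T_smooth
    · exact F.Z_smooth α
    · exact smoothCVF_conj F.isOpen_U (F.Z_smooth α)
  e_smooth i := by
    rcases i with _ | α | α
    · exact hθ.smooth.mono (Set.subset_univ _)
    · exact F.φ_smooth α
    · exact smoothForm_conj (F.φ_smooth α)
  dual i j x hx := F.dual hθ i j hx
  expand x hx v := F.expand hθ hx v

end AdmissibleCoframe

end Manifold

section Algebra

variable {A : Type*} [CommRing A] [Algebra ℂ A]

variable (A) in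
/-- The structure equations of a pseudohermitian structure in an arbitrary frame: frame fields
`Z_i` (`ff`), `Z_ī` (`tt`) and `T`, connection coefficients `K a i s α γ` on indices of type
`s`, the Levi matrix and its inverse, and the torsion. -/
structure FrameSys where
  X : Bool → ι → Derivation ℂ A A
  T : Derivation ℂ A A
  K : Bool → ι → Bool → ι → ι → A
  Kt : Bool → ι → ι → A
  h : ι → ι → A
  hI : ι → ι → A
  tor : Bool → ι → ι → A
  hI_h : ∀ μ γ, ∑ ν, hI μ ν * h γ ν = dl μ γ
  hI_h' : ∀ ν σ, ∑ μ, hI μ ν * h μ σ = dl ν σ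
  dh : ∀ a i α β, X a i (h α β) = ∑ γ, h γ β * K a i ff α γ + ∑ γ, h α γ * K a i tt β γ
  dhT : ∀ α β, T (h α β) = ∑ γ, h γ β * Kt ff α γ + ∑ γ, h α γ * Kt tt β γ
  comm_same : ∀ s i j f, X s i (X s j f) - X s j (X s i f) =
    ∑ α, (K s i s j α - K s j s i α) * X s α f
  comm_mixed : ∀ i j f, X ff i (X tt j f) - X tt j (X ff i f) =
    -∑ α, K tt j ff i α * X ff α f + ∑ α, K ff i tt j α * X tt α f
      - jj A * h i j * T f
  commT : ∀ s i f, T (X s i f) - X s i (T f) =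
    ∑ α, Kt s i α * X s α f - ∑ α, tor s α i * X (!s) α f
  tor_symm_true : ∀ β γ, ∑ α, h α γ * tor tt α β = ∑ α, h α β * tor tt α γ
  tor_symm_false : ∀ β γ, ∑ α, h γ α * tor ff α β = ∑ α, h β α * tor ff α γ
  indep : ∀ (x y : ι → A) (z : A),
    (∀ f, ∑ k, x k * X ff k f + ∑ k, y k * X tt k f + z * T f = 0) →
      (∀ k, x k = 0) ∧ (∀ k, y k = 0) ∧ z = 0

namespace FrameSys

variable (F : FrameSys A)

lemma deriv_inverse (D : Derivation ℂ A A) (k l : ι → ι → A)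
    (hD : ∀ α β, D (F.h α β) = ∑ γ, F.h γ β * k α γ + ∑ γ, F.h α γ * l β γ) (j ν : ι) :
    D (F.hI j ν) = -∑ μ, k μ j * F.hI μ ν - ∑ σ, l σ ν * F.hI j σ := by
  have key : ∀ γ, ∑ ν, (D (F.hI j ν) + ∑ μ, k μ j * F.hI μ ν + ∑ σ, l σ ν * F.hI j σ) * F.h γ ν = 0 := by
    intro γ
    have h1 := congrArg D (F.hI_h j γ)
    have h0 := F.hI_h 0 γ
    have h2 := F.hI_h 1 γ
    have hj0 := F.hI_h j 0
    have hj1 := F.hI_h j 1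
    have d0 := hD γ 0
    have d1 := hD γ 1
    have e0 : k 0 j * dl 0 γ + k 1 j * dl 1 γ = k γ 0 * dl j 0 + k γ 1 * dl j 1 := by
      fin_cases γ <;> fin_cases j <;> simp [dl]
    simp only [sum_two, map_add, leib, derivation_dl] at *
    linear_combination h1 + k 0 j * h0 + k 1 j * h2 - k γ 0 * hj0 - k γ 1 * hj1
      - F.hI j 0 * d0 - F.hI j 1 * d1 + e0
  have k0 := key 0
  have k1 := key 1
  have h0 := F.hI_h' ν 0
  have h1 := F.hI_h' ν 1
  simp only [sum_two] at *
  have e : ∀ y : ι → A, y 0 * dl ν 0 + y 1 * dl ν 1 = y ν := by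
    intro y; fin_cases ν <;> simp [dl]
  have e1 := e (fun ν => D (F.hI j ν) + (k 0 j * F.hI 0 ν + k 1 j * F.hI 1 ν)
    + (l 0 ν * F.hI j 0 + l 1 ν * F.hI j 1))
  linear_combination -e1 + F.hI 0 ν * k0 + F.hI 1 ν * k1
    - (D (F.hI j 0) + (k 0 j * F.hI 0 0 + k 1 j * F.hI 1 0)
    + (l 0 0 * F.hI j 0 + l 1 0 * F.hI j 1)) * h0
    - (D (F.hI j 1) + (k 0 j * F.hI 0 1 + k 1 j * F.hI 1 1)
    + (l 0 1 * F.hI j 0 + l 1 1 * F.hI j 1)) * h1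

/-- The frame `Z_i`, `Z^i`. -/
def EE (a : Bool) (i : ι) : Derivation ℂ A A :=
  match a with
  | false => F.X ff i
  | true => ∑ ν, F.hI i ν • F.X tt ν

lemma EE_false (i : ι) (f : A) : F.EE ff i f = F.X ff i f := rfl

lemma EE_true (i : ι) (f : A) : F.EE tt i f = F.hI i 0 * F.X tt 0 f + F.hI i 1 * F.X tt 1 f := by
  change (∑ ν, F.hI i ν • F.X tt ν) f = _
  rw [sum_two]; rfl

/-- Connection coefficients in the frame `Z_i`, `Z^i`. -/
def GG (a : Bool) (i α γ : ι) : A :=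
  match a with
  | false => F.K ff i ff α γ
  | true => ∑ ν, F.hI i ν * F.K tt ν ff α γ

/-- Torsion in the frame `Z_i`, `Z^i`. -/
def TT (a : Bool) (i k : ι) : A :=
  match a with
  | false => ∑ α, F.h k α * F.tor ff α i
  | true => ∑ ν, F.hI i ν * F.tor tt k ν

lemma X_true (i : ι) (f : A) : F.X tt i f = ∑ p, F.h p i * F.EE tt p f := by
  have h0 := F.hI_h' 0 i
  have h1 := F.hI_h' 1 i
  have e : dl 0 i * F.X tt 0 f + dl 1 i * F.X tt 1 f = F.X tt i f := by
    fin_cases i <;> simp [dl]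
  simp only [EE_true, sum_two] at *
  linear_combination -F.X tt 0 f * h0 - F.X tt 1 f * h1 - e

lemma TT_symm (a : Bool) (i j : ι) : F.TT a i j = F.TT a j i := by
  cases a
  · exact F.tor_symm_false i j
  · have s01 := F.tor_symm_true 0 1
    have e : ∀ k ν, F.tor tt k ν = ∑ γ, F.hI k γ * ∑ α, F.h α γ * F.tor tt α ν := by
      intro k ν
      have h0 := F.hI_h k 0
      have h1 := F.hI_h k 1
      have e : dl k 0 * F.tor tt 0 ν + dl k 1 * F.tor tt 1 ν = F.tor tt k ν := by
        fin_cases k <;> simp [dl]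
      simp only [sum_two] at *
      linear_combination -F.tor tt 0 ν * h0 - F.tor tt 1 ν * h1 - e
    simp only [TT]
    simp only [e i, e j, sum_two] at *
    linear_combination (F.hI i 0 * F.hI j 1 - F.hI i 1 * F.hI j 0) * s01

lemma deriv_hI (a : Bool) (i j ν : ι) : F.X a i (F.hI j ν) =
    -∑ μ, F.K a i ff μ j * F.hI μ ν - ∑ σ, F.K a i tt σ ν * F.hI j σ :=
  F.deriv_inverse (F.X a i) (F.K a i ff) (F.K a i tt) (F.dh a i) j ν

lemma EE_comm_false_true (i j : ι) (f : A) :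
    F.EE ff i (F.EE tt j f) - F.EE tt j (F.EE ff i f) =
      -(∑ k, F.GG ff i k j * F.EE tt k f) - ∑ k, F.GG tt j i k * F.EE ff k f
        - jj A * dl i j * F.T f := by
  have c0 := F.comm_mixed i 0 f
  have c1 := F.comm_mixed i 1 f
  have d0 := F.deriv_hI ff i j 0
  have d1 := F.deriv_hI ff i j 1
  have hh := F.hI_h j i
  rw [dl_comm] at hh
  simp only [GG, EE_true, EE_false, sum_two, map_add, leib] at *
  linear_combination F.hI j 0 * c0 + F.hI j 1 * c1 + F.X tt 0 f * d0 + F.X tt 1 f * d1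
    - jj A * F.T f * hh

lemma EE_comm_true_true (i j : ι) (f : A) :
    F.EE tt i (F.EE tt j f) - F.EE tt j (F.EE tt i f) =
      -(∑ k, F.GG tt i k j * F.EE tt k f) + ∑ k, F.GG tt j k i * F.EE tt k f := by
  have c := F.comm_same tt 0 1 f
  have d := fun ν j σ => F.deriv_hI tt ν j σ
  have d1 := d 0 j 0
  have d2 := d 0 j 1
  have d3 := d 1 j 0
  have d4 := d 1 j 1
  have e1 := d 0 i 0
  have e2 := d 0 i 1
  have e3 := d 1 i 0
  have e4 := d 1 i 1
  simp only [GG, EE_true, sum_two, map_add, leib] at *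
  linear_combination (F.hI i 0 * F.hI j 1 - F.hI i 1 * F.hI j 0) * c
    + F.hI i 0 * (F.X tt 0 f * d1 + F.X tt 1 f * d2)
    + F.hI i 1 * (F.X tt 0 f * d3 + F.X tt 1 f * d4)
    - F.hI j 0 * (F.X tt 0 f * e1 + F.X tt 1 f * e2)
    - F.hI j 1 * (F.X tt 0 f * e3 + F.X tt 1 f * e4)

/-- The structure equations referred to the frame `Z_i`, `Z^i`. -/
def web : Web A where
  E := F.EE
  T := F.T
  G := F.GG
  Gt := F.Kt ff
  Tor := F.TT
  Tor_symm := F.TT_symm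
  comm := by
    intro a b i j f
    cases a <;> cases b
    · have c := F.comm_same ff i j f
      simp only [kap_false, tp, GG, EE_false, sum_two] at *
      linear_combination c
    · have c := F.EE_comm_false_true i j f
      simp only [kap_false, kap_true, tp, sum_two] at *
      linear_combination c
    · have c := F.EE_comm_false_true j i f
      rw [dl_comm] at c
      simp only [kap_false, kap_true, tp, sum_two] at *
      linear_combination -c
    · have c := F.EE_comm_true_true i j f
      simp only [kap_true, tp, sum_two] at *
      linear_combination c
  commT := by
    intro a i f
    cases a
    · have c := F.commT ff i f
      have x0 := F.X_true 0 f
      have x1 := F.X_true 1 f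
      simp only [Bool.not_false] at *
      simp only [kap_false, TT, sum_two, EE_false] at *
      linear_combination c - F.tor ff 0 i * x0 - F.tor ff 1 i * x1
    · have c0 := F.commT tt 0 f
      have c1 := F.commT tt 1 f
      have d := F.deriv_inverse F.T (F.Kt ff) (F.Kt tt) F.dhT i
      have d0 := d 0
      have d1 := d 1
      simp only [Bool.not_true] at *
      simp only [kap_true, TT, sum_two, EE_false, EE_true, map_add, leibniz,
        smul_eq_mul] at *
      linear_combination F.hI i 0 * c0 + F.hI i 1 * c1 + F.X tt 0 f * d0 + F.X tt 1 f * d1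
  indep := by
    intro x y z hxy
    have key := F.indep x (fun ν => ∑ k, y k * F.hI k ν) z (fun f => by
      have h := hxy f
      simp only [sum_two, EE_false, EE_true] at *
      linear_combination h)
    refine ⟨key.1, fun k => ?_, key.2.2⟩
    have k0 := key.2.1 0
    have k1 := key.2.1 1
    have h0 := F.hI_h 0 k
    have h1 := F.hI_h 1 k
    have e : y 0 * dl 0 k + y 1 * dl 1 k = y k := by fin_cases k <;> simp [dl]
    simp only [sum_two] at *
    linear_combination F.h k 0 * k0 + F.h k 1 * k1 - y 0 * h0 - y 1 * h1 - e

/-- The operators in components. -/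
def toFD : FrameData A where
  X := F.X
  K := fun a i s n m => -F.K a i s n m
  hI := F.hI
  h := F.h
  tau := fun γ μ => F.tor tt μ γ

/-- Lowering an upper index. -/
def low (s : Bool) (ν α : ι) : A :=
  match s with
  | false => dl ν α
  | true => F.h α ν

lemma gauge : FrameData.Gauge F.web.toFrameData F.toFD F.low where
  X := by
    intro a i f
    cases a
    · change F.X ff i f = ∑ p, dl i p * F.X ff p f
      fin_cases i <;> simp [dl]
    · exact F.X_true i f
  K := by
    intro a i s j k
    have hG : ∀ j k, ∑ p, F.low a i p * F.GG a p j k = F.K a i ff j k := by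
      intro j k
      cases a
      · simp only [low, GG]; fin_cases i <;> simp [dl]
      · have h0 := F.hI_h' 0 i
        have h1 := F.hI_h' 1 i
        have e : dl 0 i * F.K tt 0 ff j k + dl 1 i * F.K tt 1 ff j k
          = F.K tt i ff j k := by fin_cases i <;> simp [dl]
        simp only [low, GG, sum_two] at *
        linear_combination F.K tt 0 ff j k * h0 + F.K tt 1 ff j k * h1 + e
    cases s
    · have h := hG j k
      change F.X a i (dl j k) + ∑ l, -F.K a i ff j l * dl l k =
        ∑ p, F.low a i p * ∑ l, dl j l * (-F.GG a p l k)
      have e1 : ∑ l, -F.K a i ff j l * dl l k = -F.K a i ff j k := by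
        fin_cases k <;> simp [dl]
      have e2 : ∀ p, ∑ l, dl j l * (-F.GG a p l k) = -F.GG a p j k := by
        intro p; fin_cases j <;> simp [dl]
      simp only [e1, e2, derivation_dl]
      rw [← h]; simp
    · have h0 := hG k 0
      have h1 := hG k 1
      have d := F.dh a i k j
      change F.X a i (F.h k j) + ∑ l, -F.K a i tt j l * F.h k l =
        ∑ p, F.low a i p * ∑ l, F.h l j * F.GG a p k l
      simp only [sum_two] at *
      linear_combination d - F.h 0 j * h0 - F.h 1 j * h1
  hI := by
    intro p q
    have h := F.hI_h p q
    change ∑ μ, ∑ ν, F.hI μ ν * (dl μ p * F.h q ν) = dl p q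
    rw [← h]
    fin_cases p <;> simp [dl]
  h := by
    intro α β
    change F.h α β = ∑ p, ∑ q, dl α p * F.h q β * dl p q
    fin_cases α <;> simp [dl]
  tau := by
    intro γ p
    have h0 := F.hI_h' 0 γ
    have h1 := F.hI_h' 1 γ
    change ∑ μ, F.tor tt μ γ * dl μ p = ∑ γ', F.h γ' γ * ∑ ν, F.hI γ' ν * F.tor tt p ν
    have e : ∑ μ, F.tor tt μ γ * dl μ p = F.tor tt p γ := by fin_cases p <;> simp [dl]
    have e' : dl 0 γ * F.tor tt p 0 + dl 1 γ * F.tor tt p 1 = F.tor tt p γ := by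
      fin_cases γ <;> simp [dl]
    rw [e]
    simp only [sum_two] at *
    linear_combination -F.tor tt p 0 * h0 - F.tor tt p 1 * h1 - e'

end FrameSys

end Algebra

section Algebra

variable {A : Type*} [CommRing A] [Algebra ℂ A]

namespace FrameSys

variable (F : FrameSys A)

/-- The coefficient of `θ^ρ ∧ θ^σ̄` in the curvature forms. -/
def curv (α γ ρ σ : ι) : A :=
  F.X ff ρ (F.K tt σ ff α γ) - F.X tt σ (F.K ff ρ ff α γ)
    - (-∑ κ, F.K tt σ ff ρ κ * F.K ff κ ff α γ
      + ∑ κ, F.K ff ρ tt σ κ * F.K tt κ ff α γ - jj A * F.h ρ σ * F.Kt ff α γ)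
    - ∑ μ, (F.K ff ρ ff α μ * F.K tt σ ff μ γ - F.K tt σ ff α μ * F.K ff ρ ff μ γ)

lemma web_Om (α γ μ m : ι) :
    F.web.Om ff μ tt m α γ = ∑ ν, F.hI m ν * F.curv α γ μ ν := by
  have d0 := F.deriv_hI ff μ m 0
  have d1 := F.deriv_hI ff μ m 1
  have hh := F.hI_h m μ
  rw [dl_comm] at hh
  change F.EE ff μ (F.GG tt m α γ) - F.EE tt m (F.GG ff μ α γ)
    - (-(∑ k, kap tt (F.GG ff μ) m k * F.GG tt k α γ)
      + ∑ k, kap ff (F.GG tt m) μ k * F.GG ff k α γ + tp A ff tt μ m * F.Kt ff α γ)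
    - ∑ k, (F.GG ff μ α k * F.GG tt m k γ - F.GG tt m α k * F.GG ff μ k γ) = _
  simp only [curv, GG, EE_true, EE_false, kap_true, kap_false, tp, sum_two, map_add,
    leib] at *
  linear_combination F.K tt 0 ff α γ * d0 + F.K tt 1 ff α γ * d1
    - jj A * F.Kt ff α γ * hh

lemma web_ric (α γ : ι) : F.web.ric α γ = ∑ μ, ∑ ν, F.hI μ ν * F.curv α γ μ ν :=
  Finset.sum_congr rfl fun μ _ => F.web_Om α γ μ μ

end FrameSys

end Algebra

section Manifold

variable {k : ℕ} {M : Type*} {x : M} {U : Set M} {f : M → ℂ} [TopologicalSpace M] [ChartedSpace E5 M]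
  [IsManifold (𝓡 5) ∞ M]
variable {S : CRStructure M} {θ : Form M 1}

lemma smoothFun_matrix_inv {H : M → Matrix (ι) (ι) ℂ} (hU : IsOpen U)
    (hH : ∀ α β, SmoothFun (fun x => H x α β) U) (h0 : ∀ x ∈ U, (H x).det ≠ 0) (ν μ : ι) :
    SmoothFun (fun x => (H x)⁻¹ ν μ) U := by
  have hdet : SmoothFun (fun x => (H x).det) U := by
    simp only [Matrix.det_fin_two]
    exact ((hH 0 0).mul hU (hH 1 1)).sub ((hH 0 1).mul hU (hH 1 0))
  have e : ∀ x, (H x)⁻¹ ν μ = ((H x).det)⁻¹ * (H x).adjugate ν μ := by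
    intro x
    rw [Matrix.inv_def, Ring.inverse_eq_inv']; rfl
  refine ((hdet.inv hU h0).mul hU (g := fun x => (H x).adjugate ν μ) ?_).congr fun x _ => e x
  simp only [Matrix.adjugate_fin_two]
  fin_cases μ <;> fin_cases ν
  · exact hH 1 1
  · exact (hH 1 0).neg
  · exact (hH 0 1).neg
  · exact hH 0 0

lemma IsContactForm.extD_real (hθ : S.Contact θ) (x : M) :
    conjForm (extD θ x) = extD θ x := by
  rw [← extD_conj hθ.smooth (Set.mem_univ x)]
  exact extD_congr isOpen_univ (fun y _ => hθ.real y) (Set.mem_univ x)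

lemma IsContactForm.levi_det (hθ : S.Contact θ) {Z : ι → CTangent x}
    (hZ : ∀ α, Z α ∈ S.T10 x) (hli : LinearIndependent ℂ Z) :
    (Matrix.of fun α β => leviForm θ x (Z α) (Z β)).det ≠ 0 := by
  intro h0
  obtain ⟨c, hc, hch⟩ := Matrix.exists_vecMul_eq_zero_iff.2 h0
  have hc' : ∀ β, ∑ α, c α * leviForm θ x (Z α) (Z β) = 0 := fun β => congrFun hch β
  refine hc (funext fun α => Fintype.linearIndependent_iff.1 hli c ?_ α)
  refine S.nondegenerate θ hθ x _ (Submodule.sum_mem _ fun α _ => Submodule.smul_mem _ _ (hZ α))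
    fun W hW => ?_
  rw [← span_eq_T10 S hZ hli] at hW
  obtain ⟨d, rfl⟩ := (Submodule.mem_span_range_iff_exists_fun ℂ).1 hW
  have h1 := hc' 0
  have h2 := hc' 1
  simp only [leviForm, sum_two, conjC_add, conjC_smul] at h1 h2 ⊢
  rw [evalC_swap, ← lin2_apply]
  simp only [map_add, map_smul, lin2_apply, smul_eq_mul]
  rw [evalC_swap, evalC_swap _ _ (conjC (Z 1)), ← lin2_apply, ← lin2_apply]
  simp only [map_add, map_smul, lin2_apply, smul_eq_mul]
  linear_combination starRingEnd ℂ (d 0) * h1 + starRingEnd ℂ (d 1) * h2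

/-- Restriction of a frame to a smaller set. -/
def CFrame.mono {J : Type} [Fintype J] [DecidableEq J] {U V : Set M} (C : CFrame J U) (h : V ⊆ U) :
    CFrame J V where
  X := C.X
  e := C.e
  X_smooth i := (C.X_smooth i).mono h
  e_smooth i := (C.e_smooth i).mono h
  dual i j x hx := C.dual i j x (h hx)
  expand x hx := C.expand x (h hx)

namespace PHFrame

variable (F : PHFrame S θ)

lemma evalC_dtheta (hx : x ∈ F.U) (v w : CTangent x) :
    evalC (extD θ x) ![v, w] = ∑ α, ∑ β, I * F.h x α β *
      (evalC (F.φ α x) ![v] * evalC (conjForm (F.φ β x)) ![w]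
        - evalC (F.φ α x) ![w] * evalC (conjForm (F.φ β x)) ![v]) := by
  rw [F.dtheta_eq x hx]
  simp only [evalC_sum, evalC_smul, evalC_wedge_one_one]

lemma evalC_dφ (α : ι) (hx : x ∈ F.U) (v w : CTangent x) :
    evalC (extD (F.φ α) x) ![v, w] = ∑ μ, (evalC (F.φ μ x) ![v] * evalC (F.conn μ α x) ![w]
        - evalC (F.φ μ x) ![w] * evalC (F.conn μ α x) ![v])
      + ∑ β, F.tors α β x * (evalC (θ x) ![v] * evalC (conjForm (F.φ β x)) ![w]
        - evalC (θ x) ![w] * evalC (conjForm (F.φ β x)) ![v]) := by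
  have h := congrArg (fun η => evalC η ![v, w]) (F.dφ_eq α x hx)
  refine h.trans ?_
  simp only [evalC_add, evalC_sum, evalC_smul, evalC_wedge_one_one]

lemma evalC_conjForm (η : Form M 1) (v : CTangent x) :
    evalC (conjForm (η x)) ![v] = starRingEnd ℂ (evalC (η x) ![conjC v]) := by
  rw [← evalC_conj_one, conjC_conjC]

lemma evalC_dφbar (hθ : S.Contact θ) (α : ι) (hx : x ∈ F.U)
    (v w : CTangent x) :
    evalC (extD (fun y => conjForm (F.φ α y)) x) ![v, w] =
      ∑ μ, (evalC (conjForm (F.φ μ x)) ![v] * evalC (conjForm (F.conn μ α x)) ![w]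
        - evalC (conjForm (F.φ μ x)) ![w] * evalC (conjForm (F.conn μ α x)) ![v])
      + ∑ β, starRingEnd ℂ (F.tors α β x) * (evalC (θ x) ![v] * evalC (F.φ β x) ![w]
        - evalC (θ x) ![w] * evalC (F.φ β x) ![v]) := by
  have h1 : ∀ v : CTangent x, starRingEnd ℂ (evalC (θ x) ![conjC v]) = evalC (θ x) ![v] := by
    intro v; rw [← evalC_conj_one, conjC_conjC, hθ.real]
  have h2 : ∀ (α) (v : CTangent x), starRingEnd ℂ (evalC (conjForm (F.φ α x)) ![conjC v]) =
      evalC (F.φ α x) ![v] := by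
    intro α v; rw [evalC_conjForm, conjC_conjC, Complex.conj_conj]
  have h3 := evalC_conj_two (extD (F.φ α) x) (conjC v) (conjC w)
  rw [conjC_conjC, conjC_conjC] at h3
  rw [extD_conj (F.φ_smooth α) hx, h3, F.evalC_dφ α hx]
  simp only [map_add, map_sum, map_mul, map_sub, h1, h2, ← evalC_conjForm]

lemma dtheta_Z_conj (hx : x ∈ F.U) (α β : ι) :
    evalC (extD θ x) ![F.Z α x, conjC (F.Z β x)] = I * F.h x α β := by
  rw [F.evalC_dtheta hx]
  simp only [F.φ_Z _ _ x hx, F.φ_conj' _ _ hx, F.φbar_conj _ _ hx, F.φbar_Z _ _ hx]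
  simp

/-- The Levi matrix is hermitian. -/
lemma h_conj (hθ : S.Contact θ) (hx : x ∈ F.U) (α β : ι) :
    starRingEnd ℂ (F.h x α β) = F.h x β α := by
  have h1 := evalC_conj_two (extD θ x) (F.Z α x) (conjC (F.Z β x))
  rw [hθ.extD_real, conjC_conjC, evalC_swap, F.dtheta_Z_conj hx, F.dtheta_Z_conj hx, map_mul,
    conj_I] at h1
  have h3 : I * (starRingEnd ℂ (F.h x α β) - F.h x β α) = 0 := by linear_combination h1
  rcases mul_eq_zero.1 h3 with h | h
  · exact absurd h I_ne_zero
  · exact sub_eq_zero.1 h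

/-- The Levi matrix is invertible. -/
lemma h_det (hθ : S.Contact θ) (hx : x ∈ F.U) : (F.h x).det ≠ 0 := by
  have h := hθ.levi_det (fun α => F.Z_mem α x hx) (F.linearIndependent hx)
  have e : F.h x = Matrix.of fun α β => leviForm θ x (F.Z α x) (F.Z β x) := by
    ext α β
    rw [Matrix.of_apply, leviForm, F.dtheta_Z_conj hx]
    linear_combination F.h x α β * I_mul_I
  rwa [e]

lemma hInv_h (hθ : S.Contact θ) (hx : x ∈ F.U) (μ γ : ι) :
    ∑ ν, F.hInv μ ν x * F.h x γ ν = if μ = γ then 1 else 0 := by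
  have h := congrFun (congrFun (Matrix.mul_nonsing_inv (F.h x) (isUnit_iff_ne_zero.2 (F.h_det hθ hx))) γ) μ
  rw [Matrix.mul_apply, Matrix.one_apply] at h
  have e : ∑ ν, F.hInv μ ν x * F.h x γ ν = ∑ j, F.h x γ j * (F.h x)⁻¹ j μ :=
    Finset.sum_congr rfl fun ν _ => mul_comm _ _
  rw [e, h]; simp [eq_comm]

lemma hInv_h' (hθ : S.Contact θ) (hx : x ∈ F.U) (ν σ : ι) :
    ∑ μ, F.hInv μ ν x * F.h x μ σ = if ν = σ then 1 else 0 := by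
  have h := congrFun (congrFun (Matrix.nonsing_inv_mul (F.h x) (isUnit_iff_ne_zero.2 (F.h_det hθ hx))) ν) σ
  rw [Matrix.mul_apply, Matrix.one_apply] at h
  exact h

lemma smooth_hInv (hθ : S.Contact θ) (μ ν : ι) : SmoothFun (F.hInv μ ν) F.U :=
  smoothFun_matrix_inv F.isOpen_U F.h_smooth (fun _ hx => F.h_det hθ hx) ν μ

end PHFrame

/-- The label of a frame field. -/
def ix (a : Bool) (i : ι) : ι ⊕ ι :=
  match a with
  | false => .inl i
  | true => .inr i

namespace PHFrame

variable (F : PHFrame S θ) {V : Opens M}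

/-- The connection forms `ω_α^γ` (`ff`) and their conjugates (`tt`). -/
def cn (s : Bool) (α γ : ι) : Form M 1 :=
  match s with
  | false => F.conn α γ
  | true => fun x => conjForm (F.conn α γ x)

lemma smooth_cn (s : Bool) (α γ : ι) : SmoothForm (F.cn s α γ) F.U := by
  cases s
  · exact F.conn_smooth α γ
  · exact smoothForm_conj (F.conn_smooth α γ)

/-- The torsion (`tt`) and its conjugate (`ff`). -/
def tr (s : Bool) (α β : ι) (x : M) : ℂ :=
  match s with
  | true => F.tors α β x
  | false => starRingEnd ℂ (F.tors α β x)

lemma smooth_tr (s : Bool) (α γ : ι) : SmoothFun (F.tr s α γ) F.U := by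
  cases s
  · exact (F.tors_smooth α γ).conj F.isOpen_U
  · exact F.tors_smooth α γ

lemma smooth_fr (hθ : S.Contact θ) (c : Option (ι ⊕ ι)) :
    SmoothCVF (F.fr c) F.U := (F.cframe hθ).X_smooth c

lemma smooth_cn_fr (hθ : S.Contact θ) (s : Bool) (α γ : ι)
    (c : Option (ι ⊕ ι)) : SmoothFun (fun x => evalC (F.cn s α γ x) ![F.fr c x]) F.U :=
  smoothFun_evalC_one F.isOpen_U (F.smooth_cn s α γ) (F.smooth_fr hθ c)

lemma derivC_h (α β : ι) (hx : x ∈ F.U) (v : CTangent x) :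
    derivC (fun y => F.h y α β) x v = ∑ γ, F.h x γ β * evalC (F.cn ff α γ x) ![v]
      + ∑ γ, F.h x α γ * evalC (F.cn tt β γ x) ![v] := by
  rw [derivC, F.dh_eq α β x hx, F.dh_eq α β x hx]
  simp only [cn, evalC_one, sum_two]; ring

/-- The commutators of the adapted frame, in terms of the structure equations. -/
lemma comm_fr (hθ : S.Contact θ) (hV : (V : Set M) ⊆ F.U)
    (hf : SmoothFun f V) (x : V) (a b : Option (ι ⊕ ι)) :
    derivC (fun y => derivC f y (F.fr b y)) x (F.fr a x)
      - derivC (fun y => derivC f y (F.fr a y)) x (F.fr b x) =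
      -(derivC f x (mkC (F.T x) 0) * evalC (extD θ x) ![F.fr a x, F.fr b x]
        + ((∑ i, derivC f x (F.Z i x) * evalC (extD (F.φ i) x) ![F.fr a x, F.fr b x])
        + ∑ i, derivC f x (conjC (F.Z i x)) *
          evalC (extD (fun y => conjForm (F.φ i y)) x) ![F.fr a x, F.fr b x])) := by
  have h := ((F.cframe hθ).mono hV).comm V.isOpen hf x.2 a b
  rw [Fintype.sum_option, Fintype.sum_sum_type] at h
  exact h

/-- The structure equations on an open subset of a chart. -/
def sys (hθ : S.Contact θ) (hV : (V : Set M) ⊆ F.U) {x₀ : M}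
    (hV' : (V : Set M) ⊆ (χ x₀).source) : FrameSys (smoothAlg V) where
  X a i := dv (F.fr (some (ix a i))) ((F.smooth_fr hθ _).mono hV)
  T := dv (F.fr none) ((F.smooth_fr hθ _).mono hV)
  K a i s α γ := res (fun x => evalC (F.cn s α γ x) ![F.fr (some (ix a i)) x])
    ((F.smooth_cn_fr hθ s α γ _).mono hV)
  Kt s α γ := res (fun x => evalC (F.cn s α γ x) ![F.fr none x]) ((F.smooth_cn_fr hθ s α γ _).mono hV)
  h α β := res (fun x => F.h x α β) ((F.h_smooth α β).mono hV)
  hI α β := res (F.hInv α β) ((F.smooth_hInv hθ α β).mono hV)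
  tor s α β := res (F.tr s α β) ((F.smooth_tr s α β).mono hV)
  hI_h μ γ := ev_ext fun x => by
    have := F.hInv_h hθ (hV x.2) μ γ
    simpa only [map_sum, map_mul, ev_res, ev_dl] using this
  hI_h' μ γ := ev_ext fun x => by
    have := F.hInv_h' hθ (hV x.2) μ γ
    simpa only [map_sum, map_mul, ev_res, ev_dl] using this
  dh a i α β := ev_ext fun x => by
    have := F.derivC_h α β (hV x.2) (F.fr (some (ix a i)) x)
    simpa only [map_sum, map_mul, map_add, ev_dv_res, ev_res] using this
  dhT α β := ev_ext fun x => by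
    have := F.derivC_h α β (hV x.2) (F.fr none x)
    simpa only [map_sum, map_mul, map_add, ev_dv_res, ev_res] using this
  comm_same s i j f := ev_ext fun x => by
    have hx := hV x.2
    have h := F.comm_fr hθ hV (smooth_extZ f) x (some (ix s i)) (some (ix s j))
    simp only [map_sub, map_sum, map_mul, ev_dv_dv, ev_res]
    rw [h]
    simp only [ev_dv]
    cases s
    · simp only [ix, AdmissibleCoframe.fr, cn, F.evalC_dtheta hx, F.evalC_dφ _ hx,
        F.evalC_dφbar hθ _ hx, F.φ_Z _ _ _ hx, F.φbar_Z _ _ hx, hθ.theta_mem (F.Z_mem _ _ hx)]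
      simp [Finset.sum_sub_distrib]
      ring
    · simp only [ix, AdmissibleCoframe.fr, cn, F.evalC_dtheta hx, F.evalC_dφ _ hx,
        F.evalC_dφbar hθ _ hx, F.φ_conj' _ _ hx, F.φbar_conj _ _ hx, hθ.theta_conj (F.Z_mem _ _ hx)]
      simp [Finset.sum_sub_distrib]
      ring
  comm_mixed i j f := ev_ext fun x => by
    have hx := hV x.2
    have h := F.comm_fr hθ hV (smooth_extZ f) x (some (ix ff i)) (some (ix tt j))
    simp only [map_sub, map_sum, map_mul, map_add, map_neg, ev_dv_dv, ev_res, ev_jj]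
    rw [h]
    simp only [ev_dv]
    simp only [ix, AdmissibleCoframe.fr, cn, F.evalC_dtheta hx, F.evalC_dφ _ hx,
        F.evalC_dφbar hθ _ hx, F.φ_conj' _ _ hx, F.φbar_conj _ _ hx, hθ.theta_conj (F.Z_mem _ _ hx),
        F.φ_Z _ _ _ hx, F.φbar_Z _ _ hx, hθ.theta_mem (F.Z_mem _ _ hx)]
    simp
    ring
  commT s i f := ev_ext fun x => by
    have hx := hV x.2
    have h := F.comm_fr hθ hV (smooth_extZ f) x none (some (ix s i))
    simp only [map_sub, map_sum, map_mul, ev_dv_dv, ev_res]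
    rw [h]
    simp only [ev_dv]
    cases s
    · simp only [ix, AdmissibleCoframe.fr, cn, tr, F.evalC_dtheta hx, F.evalC_dφ _ hx,
        F.evalC_dφbar hθ _ hx, F.φ_Z _ _ _ hx, F.φbar_Z _ _ hx, hθ.theta_mem (F.Z_mem _ _ hx),
        F.φ_T' _ hx, F.φbar_T _ hx, F.theta_T' hx]
      simp
      ring
    · simp only [ix, AdmissibleCoframe.fr, cn, tr, F.evalC_dtheta hx, F.evalC_dφ _ hx,
        F.evalC_dφbar hθ _ hx, F.φ_conj' _ _ hx, F.φbar_conj _ _ hx, hθ.theta_conj (F.Z_mem _ _ hx),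
        F.φ_T' _ hx, F.φbar_T _ hx, F.theta_T' hx]
      simp
      ring
  tor_symm_true β γ := ev_ext fun x => by
    have := F.tors_symm β γ x (hV x.2)
    simpa only [map_sum, map_mul, ev_res, tr] using this
  tor_symm_false β γ := ev_ext fun x => by
    have h := congrArg (starRingEnd ℂ) (F.tors_symm β γ x (hV x.2))
    simp only [map_sum, map_mul, F.h_conj hθ (hV x.2)] at h
    simpa only [map_sum, map_mul, ev_res, tr] using h
  indep a b c hab := by
    have key : ∀ x : V, (∀ k, ev x (a k) = 0) ∧ (∀ k, ev x (b k) = 0) ∧ ev x c = 0 := by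
      intro x
      have hx := hV x.2
      have hz : ∑ k, ev x (a k) • F.Z k x + ∑ k, ev x (b k) • conjC (F.Z k x)
          + ev x c • mkC (F.T x) 0 = 0 := by
        refine eq_zero_of_derivC hV' x _ fun f => ?_
        have h := congrArg (ev x) (hab f)
        simp only [map_sum, map_mul, map_add, map_zero, ev_dv] at h
        rw [derivC_eq, ← lin1_apply]
        simp only [map_add, map_sum, map_smul, lin1_apply, ← derivC_eq, smul_eq_mul]
        exact h
      refine ⟨fun k => ?_, fun k => ?_, ?_⟩
      · have h := congrArg (lin1 (F.φ k x)) hz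
        simp only [map_add, map_sum, map_smul, lin1_apply, F.φ_Z _ _ _ hx, F.φ_conj' _ _ hx,
          F.φ_T' _ hx, map_zero] at h
        simpa using h
      · have h := congrArg (lin1 (conjForm (F.φ k x))) hz
        simp only [map_add, map_sum, map_smul, lin1_apply, F.φbar_Z _ _ hx, F.φbar_conj _ _ hx,
          F.φbar_T _ hx, map_zero] at h
        simpa using h
      · have h := congrArg (lin1 (θ x)) hz
        simp only [map_add, map_sum, map_smul, lin1_apply, hθ.theta_mem (F.Z_mem _ _ hx),
          hθ.theta_conj (F.Z_mem _ _ hx), F.theta_T' hx, map_zero] at h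
        simpa using h
    refine ⟨fun k => ev_ext fun x => ?_, fun k => ev_ext fun x => ?_, ev_ext fun x => ?_⟩
    · rw [(key x).1 k, map_zero]
    · rw [(key x).2.1 k, map_zero]
    · rw [(key x).2.2, map_zero]

end PHFrame

end Manifold

section Manifold

variable {k : ℕ} {M : Type*} {x : M} {U : Set M} {f : M → ℂ} [TopologicalSpace M] [ChartedSpace E5 M]
  [IsManifold (𝓡 5) ∞ M]
variable {S : CRStructure M} {θ : Form M 1} {V : Opens M}

/-- `f` restricts to the element `a` of `smoothAlg V`. -/
def Rep (f : M → ℂ) (a : smoothAlg V) : Prop := ∀ x : V, f x = ev x a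

lemma rep_res (f : M → ℂ) (hf : SmoothFun f V) : Rep f (res f hf) := fun _ => rfl

lemma Rep.smooth {a : smoothAlg V} (h : Rep f a) : SmoothFun f V :=
  (smooth_extZ a).congr fun y hy => (h ⟨y, hy⟩).trans (extZ_of_mem a.1 hy).symm

lemma Rep.derivC {a : smoothAlg V} (h : Rep f a) (Z : CVectorField M)
    (hZ : SmoothCVF Z V) : Rep (fun x => derivC f x (Z x)) (dv Z hZ a) := fun x => by
  rw [ev_dv]
  exact derivC_congr V.isOpen (fun y hy => (h ⟨y, hy⟩).trans (extZ_of_mem a.1 hy).symm) x.2 _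

namespace PHFrame

variable (F : PHFrame S θ) (hθ : S.Contact θ) (hV : (V : Set M) ⊆ F.U) {x₀ : M}
  (hV' : (V : Set M) ⊆ (χ x₀).source)

lemma rep_deriv {a : smoothAlg V} (h : Rep f a) (s : Bool) (i : ι) :
    Rep (fun x => derivC f x (F.frame (ix s i) x)) ((F.sys hθ hV hV').toFD.X s i a) := by
  have := h.derivC (F.fr (some (ix s i))) ((F.smooth_fr hθ _).mono hV)
  intro x
  refine Eq.trans ?_ (this x)
  cases s <;> rfl

lemma rep_cov01 {u : ι → M → ℂ} {a : ι → smoothAlg V} (h : ∀ β, Rep (u β) (a β))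
    (s : Bool) (i β : ι) :
    Rep (F.cov01 u (ix s i) β) ((F.sys hθ hV hV').toFD.cov1 tt s i a β) := fun x => by
  have h1 := F.rep_deriv hθ hV hV' (h β) s i x
  have h2 : ∀ μ, F.chrBar (ix s i) β μ x = ev x ((F.sys hθ hV hV').K s i tt β μ) := by
    intro μ; cases s <;> rfl
  simp only [cov01, FrameData.cov1, c1, map_add, map_sum, map_mul, ← h1, ← h _ x, h2]
  simp only [FrameSys.toFD, map_neg, neg_mul, Finset.sum_neg_distrib, sub_eq_add_neg]

lemma rep_cov10 {u : ι → M → ℂ} {a : ι → smoothAlg V} (h : ∀ β, Rep (u β) (a β))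
    (s : Bool) (i β : ι) :
    Rep (F.cov10 u (ix s i) β) ((F.sys hθ hV hV').toFD.cov1 ff s i a β) := fun x => by
  have h1 := F.rep_deriv hθ hV hV' (h β) s i x
  have h2 : ∀ μ, F.chr (ix s i) β μ x = ev x ((F.sys hθ hV hV').K s i ff β μ) := by
    intro μ; cases s <;> rfl
  simp only [cov10, FrameData.cov1, c1, map_add, map_sum, map_mul, ← h1, ← h _ x, h2]
  simp only [FrameSys.toFD, map_neg, neg_mul, Finset.sum_neg_distrib, sub_eq_add_neg]

lemma rep_cov11 {w : ι → ι → M → ℂ} {a : ι → ι → smoothAlg V}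
    (h : ∀ α β, Rep (w α β) (a α β)) (s : Bool) (i α β : ι) :
    Rep (F.cov11 w (ix s i) α β) ((F.sys hθ hV hV').toFD.cov2 ff tt s i a α β) := fun x => by
  have h1 := F.rep_deriv hθ hV hV' (h α β) s i x
  have h2 : ∀ α μ, F.chrBar (ix s i) α μ x = ev x ((F.sys hθ hV hV').K s i tt α μ) := by
    intro α μ; cases s <;> rfl
  have h3 : ∀ α μ, F.chr (ix s i) α μ x = ev x ((F.sys hθ hV hV').K s i ff α μ) := by
    intro α μ; cases s <;> rfl
  simp only [cov11, FrameData.cov2, c2, map_add, map_sum, map_mul, ← h1, ← h _ _ x, h2, h3]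
  simp only [FrameSys.toFD, map_neg, neg_mul, Finset.sum_neg_distrib, sub_eq_add_neg]

lemma rep_cov02 {w : ι → ι → M → ℂ} {a : ι → ι → smoothAlg V}
    (h : ∀ α β, Rep (w α β) (a α β)) (s : Bool) (i α β : ι) :
    Rep (F.cov02 w (ix s i) α β) ((F.sys hθ hV hV').toFD.cov2 tt tt s i a α β) := fun x => by
  have h1 := F.rep_deriv hθ hV hV' (h α β) s i x
  have h2 : ∀ α μ, F.chrBar (ix s i) α μ x = ev x ((F.sys hθ hV hV').K s i tt α μ) := by
    intro α μ; cases s <;> rfl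
  simp only [cov02, FrameData.cov2, c2, map_add, map_sum, map_mul, ← h1, ← h _ _ x, h2]
  simp only [FrameSys.toFD, map_neg, neg_mul, Finset.sum_neg_distrib, sub_eq_add_neg]

lemma rep_con {t : ι → ι → M → ℂ} {a : ι → ι → smoothAlg V}
    (h : ∀ α β, Rep (t α β) (a α β)) :
    Rep (fun x => ∑ μ, ∑ ν, F.hInv μ ν x * t μ ν x) ((F.sys hθ hV hV').toFD.con a) := fun x => by
  simp only [FrameData.con, map_sum, map_mul, ← h _ _ x]
  rfl

lemma rep_div11 {w : ι → ι → M → ℂ} {a : ι → ι → smoothAlg V}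
    (h : ∀ α β, Rep (w α β) (a α β)) (β : ι) :
    Rep (F.div11 w β) ((F.sys hθ hV hV').toFD.divU a β) :=
  F.rep_con hθ hV hV' fun μ ν => F.rep_cov11 hθ hV hV' h tt ν μ β

lemma rep_divBar11 {w : ι → ι → M → ℂ} {a : ι → ι → smoothAlg V}
    (h : ∀ α β, Rep (w α β) (a α β)) (α : ι) :
    Rep (F.divBar11 w α) ((F.sys hθ hV hV').toFD.divL a α) :=
  F.rep_con hθ hV hV' fun μ ν => F.rep_cov11 hθ hV hV' h ff μ α ν

lemma rep_db12 {w : ι → ι → M → ℂ} {a : ι → ι → smoothAlg V}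
    (h : ∀ α β, Rep (w α β) (a α β)) (β : ι) :
    Rep (F.db12 w β) ((F.sys hθ hV hV').toFD.db12 a β) := fun x => by
  have := F.rep_con hθ hV hV' (fun μ ν => F.rep_cov02 hθ hV hV' h ff μ ν β) x
  simp only [FrameData.db12, map_mul, ← this, ev_jj]
  rfl

lemma rep_div01 {u : ι → M → ℂ} {a : ι → smoothAlg V} (h : ∀ β, Rep (u β) (a β)) :
    Rep (F.div01 u) ((F.sys hθ hV hV').toFD.con fun μ ν =>
      (F.sys hθ hV hV').toFD.cov1 tt ff μ a ν) :=
  F.rep_con hθ hV hV' fun μ ν => F.rep_cov01 hθ hV hV' h ff μ ν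

lemma rep_div10 {u : ι → M → ℂ} {a : ι → smoothAlg V} (h : ∀ β, Rep (u β) (a β)) :
    Rep (F.div10 u) ((F.sys hθ hV hV').toFD.con fun μ ν =>
      (F.sys hθ hV hV').toFD.cov1 ff tt ν a μ) :=
  F.rep_con hθ hV hV' fun μ ν => F.rep_cov10 hθ hV hV' h tt ν μ

lemma rep_db01 {u : ι → M → ℂ} {a : ι → smoothAlg V} (h : ∀ β, Rep (u β) (a β))
    (α β : ι) : Rep (F.db01 u α β) ((F.sys hθ hV hV').toFD.wOf a α β) := fun x => by
  have h1 := F.rep_cov01 hθ hV hV' h ff α β x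
  have h2 := F.rep_div01 hθ hV hV' h x
  simp only [FrameData.wOf, map_sub, map_mul, ← h1, ← h2, ev_hh]
  change _ = _ - F.h x α β * _
  rw [db01]; simp only [ix]; ring

lemma rep_dbbar10 {u : ι → M → ℂ} {a : ι → smoothAlg V} (h : ∀ β, Rep (u β) (a β))
    (α β : ι) : Rep (F.dbbar10 u α β) (-(F.sys hθ hV hV').toFD.tfU a α β) := fun x => by
  have h1 := F.rep_cov10 hθ hV hV' h tt β α x
  have h2 := F.rep_div10 hθ hV hV' h x
  simp only [FrameData.tfU, map_sub, map_neg, map_mul, ← h1, ← h2, ev_hh]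
  change _ = -(_ - F.h x α β * _)
  rw [dbbar10]; simp only [ix]; ring

lemma rep_dbbar11 {w : ι → ι → M → ℂ} {a : ι → ι → smoothAlg V}
    (h : ∀ α β, Rep (w α β) (a α β)) (γ β : ι) :
    Rep (F.dbbar11 w γ β) ((F.sys hθ hV hV').toFD.dbb11 a γ β) := fun x => by
  have h1 : ∀ γ β, F.dbbar11Aux w γ β x = ev x ((F.sys hθ hV hV').toFD.aux11 a γ β) := by
    intro γ β
    have h2 := F.rep_cov01 hθ hV hV' (F.rep_div11 hθ hV hV' h) tt γ β x
    simp only [FrameData.aux11, map_sub, map_mul, map_sum, ← h2, ev_jj, ← h _ _ x]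
    rfl
  simp only [FrameData.dbb11, map_sub, map_mul, ev_jj, ← h1]
  rfl

/-- `i ∂_b ∂̄_b ∂_b` in terms of the frame data. -/
lemma rep_lComp {u : ι → M → ℂ} {a : ι → smoothAlg V} (h : ∀ β, Rep (u β) (a β))
    (β : ι) : Rep (F.lComp u β) ((F.sys hθ hV hV').toFD.Lop a β) := fun x => by
  have h1 := F.rep_db12 hθ hV hV' (F.rep_dbbar11 hθ hV hV' (F.rep_db01 hθ hV hV' h)) β x
  simp only [FrameData.Lop, map_mul, ← h1, ev_jj]
  rfl

/-- The exterior derivative of a one-form on `Z_ρ`, `Z_σ̄`. -/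
lemma extD_mixed (hθ : S.Contact θ) {η : Form M 1} (hη : SmoothForm η F.U) (hx : x ∈ F.U) (ρ σ : ι) :
    evalC (extD η x) ![F.Z ρ x, conjC (F.Z σ x)] =
      derivC (fun y => evalC (η y) ![conjC (F.Z σ y)]) x (F.Z ρ x)
      - derivC (fun y => evalC (η y) ![F.Z ρ y]) x (conjC (F.Z σ x))
      + evalC (η x) ![mkC (F.T x) 0] * (I * F.h x ρ σ)
      + ∑ κ, evalC (η x) ![F.Z κ x] * F.chr (.inr σ) ρ κ x
      - ∑ κ, evalC (η x) ![conjC (F.Z κ x)] * F.chrBar (.inl ρ) σ κ x := by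
  have h1 := (F.cframe hθ).extD_apply F.isOpen_U hη hx (some (.inl ρ)) (some (.inr σ))
  rw [Fintype.sum_option, Fintype.sum_sum_type] at h1
  refine h1.trans ?_
  have e1 : evalC (extD θ x) ![F.Z ρ x, conjC (F.Z σ x)] = I * F.h x ρ σ :=
    F.dtheta_Z_conj hx ρ σ
  have e2 : ∀ κ, evalC (extD (F.φ κ) x) ![F.Z ρ x, conjC (F.Z σ x)] = F.chr (.inr σ) ρ κ x := by
    intro κ
    rw [F.evalC_dφ _ hx]
    simp only [F.φ_conj' _ _ hx, F.φbar_conj _ _ hx, hθ.theta_conj (F.Z_mem _ _ hx),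
        F.φ_Z _ _ _ hx, F.φbar_Z _ _ hx, hθ.theta_mem (F.Z_mem _ _ hx)]
    simp [chr, frame]
  have e3 : ∀ κ, evalC (extD (fun y => conjForm (F.φ κ y)) x) ![F.Z ρ x, conjC (F.Z σ x)] =
      -F.chrBar (.inl ρ) σ κ x := by
    intro κ
    rw [F.evalC_dφbar hθ _ hx]
    simp only [F.φ_conj' _ _ hx, F.φbar_conj _ _ hx, hθ.theta_conj (F.Z_mem _ _ hx),
        F.φ_Z _ _ _ hx, F.φbar_Z _ _ hx, hθ.theta_mem (F.Z_mem _ _ hx)]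
    simp [chrBar, frame]
  change derivC (fun y => evalC (η y) ![conjC (F.Z σ y)]) x (F.Z ρ x)
      - derivC (fun y => evalC (η y) ![F.Z ρ y]) x (conjC (F.Z σ x))
      + (evalC (η x) ![mkC (F.T x) 0] * evalC (extD θ x) ![F.Z ρ x, conjC (F.Z σ x)]
      + (∑ κ, evalC (η x) ![F.Z κ x] * evalC (extD (F.φ κ) x) ![F.Z ρ x, conjC (F.Z σ x)]
      + ∑ κ, evalC (η x) ![conjC (F.Z κ x)] *
        evalC (extD (fun y => conjForm (F.φ κ y)) x) ![F.Z ρ x, conjC (F.Z σ x)])) = _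
  simp only [e1, e2, e3, mul_neg, Finset.sum_neg_distrib]
  ring

/-- The exterior derivative of a one-form on `Z_γ̄`, `Z_β̄`. -/
lemma extD_anti (hθ : S.Contact θ) (hV : (V : Set M) ⊆ F.U) {η : Form M 1}
    (hη : SmoothForm η V) (hxV : x ∈ V) (γ β : ι) :
    evalC (extD η x) ![conjC (F.Z γ x), conjC (F.Z β x)] =
      F.cov01 (F.comp01 η) (.inr γ) β x - F.cov01 (F.comp01 η) (.inr β) γ x := by
  have hx := hV hxV
  have h1 := ((F.cframe hθ).mono hV).extD_apply V.isOpen hη hxV (some (.inr γ)) (some (.inr β))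
  rw [Fintype.sum_option, Fintype.sum_sum_type] at h1
  refine h1.trans ?_
  have e1 : evalC (extD θ x) ![conjC (F.Z γ x), conjC (F.Z β x)] = 0 := by
    rw [F.evalC_dtheta hx]
    simp [F.φ_conj' _ _ hx]
  have e2 : ∀ κ, evalC (extD (F.φ κ) x) ![conjC (F.Z γ x), conjC (F.Z β x)] = 0 := by
    intro κ
    rw [F.evalC_dφ _ hx]
    simp [F.φ_conj' _ _ hx, hθ.theta_conj (F.Z_mem _ _ hx)]
  have e3 : ∀ κ, evalC (extD (fun y => conjForm (F.φ κ y)) x) ![conjC (F.Z γ x), conjC (F.Z β x)] =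
      F.chrBar (.inr β) γ κ x - F.chrBar (.inr γ) β κ x := by
    intro κ
    rw [F.evalC_dφbar hθ _ hx]
    simp only [F.φ_conj' _ _ hx, F.φbar_conj _ _ hx, hθ.theta_conj (F.Z_mem _ _ hx)]
    simp [chrBar, frame]
  change derivC (F.comp01 η β) x (conjC (F.Z γ x)) - derivC (F.comp01 η γ) x (conjC (F.Z β x))
      + (evalC (η x) ![mkC (F.T x) 0] * evalC (extD θ x) ![conjC (F.Z γ x), conjC (F.Z β x)]
      + (∑ κ, evalC (η x) ![F.Z κ x] * evalC (extD (F.φ κ) x) ![conjC (F.Z γ x), conjC (F.Z β x)]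
      + ∑ κ, F.comp01 η κ x *
        evalC (extD (fun y => conjForm (F.φ κ y)) x) ![conjC (F.Z γ x), conjC (F.Z β x)])) = _
  simp only [e1, e2, e3, cov01, frame, Sum.elim_inr, sum_two]
  ring

/-- The curvature in terms of the structure equations. -/
lemma rep_curv (α γ ρ σ : ι) :
    Rep (F.curv α γ ρ σ) ((F.sys hθ hV hV').curv α γ ρ σ) := fun x => by
  have hx := hV x.2
  have h1 := F.extD_mixed hθ (F.conn_smooth α γ) hx ρ σ
  have a1 := (rep_res _ ((F.smooth_cn_fr hθ ff α γ (some (.inr σ))).mono hV)).derivC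
    (F.fr (some (.inl ρ))) ((F.smooth_fr hθ _).mono hV) x
  have a2 := (rep_res _ ((F.smooth_cn_fr hθ ff α γ (some (.inl ρ))).mono hV)).derivC
    (F.fr (some (.inr σ))) ((F.smooth_fr hθ _).mono hV) x
  have h2 : F.curv α γ ρ σ x = evalC (extD (F.conn α γ) x) ![F.Z ρ x, conjC (F.Z σ x)]
      - ∑ μ, (F.chr (.inl ρ) α μ x * F.chr (.inr σ) μ γ x
        - F.chr (.inr σ) α μ x * F.chr (.inl ρ) μ γ x) := by
    rw [curv, curvForm, evalC_sub, evalC_sum]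
    simp only [evalC_wedge_one_one]
    rfl
  rw [h2, h1]
  have b1 : ev x ((F.sys hθ hV hV').X ff ρ ((F.sys hθ hV hV').K tt σ ff α γ)) =
      derivC (fun y => evalC (F.conn α γ y) ![conjC (F.Z σ y)]) x (F.Z ρ x) := a1.symm
  have b2 : ev x ((F.sys hθ hV hV').X tt σ ((F.sys hθ hV hV').K ff ρ ff α γ)) =
      derivC (fun y => evalC (F.conn α γ y) ![F.Z ρ y]) x (conjC (F.Z σ x)) := a2.symm
  simp only [FrameSys.curv, map_sub, map_sum, map_mul, map_add, map_neg, ev_jj, b1, b2]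
  change _ = derivC (fun y => evalC (F.conn α γ y) ![conjC (F.Z σ y)]) x (F.Z ρ x)
    - derivC (fun y => evalC (F.conn α γ y) ![F.Z ρ y]) x (conjC (F.Z σ x))
    - (-∑ κ, F.chr (.inr σ) ρ κ x * F.chr (.inl κ) α γ x
      + ∑ κ, F.chrBar (.inl ρ) σ κ x * F.chr (.inr κ) α γ x
      - I * F.h x ρ σ * evalC (F.conn α γ x) ![mkC (F.T x) 0])
    - ∑ μ, (F.chr (.inl ρ) α μ x * F.chr (.inr σ) μ γ x
        - F.chr (.inr σ) α μ x * F.chr (.inl ρ) μ γ x)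
  simp only [sum_two]
  simp only [chr, frame, Sum.elim_inl, Sum.elim_inr]
  ring

lemma rep_ricci (α β : ι) : Rep (F.ricci α β)
    (FrameData.tr2 ((F.sys hθ hV hV').low ff) ((F.sys hθ hV hV').low tt)
      (F.sys hθ hV hV').web.ric α β) := fun x => by
  have h1 : ∀ α γ μ ν, F.curv α γ μ ν x = ev x ((F.sys hθ hV hV').curv α γ μ ν) := fun α γ μ ν =>
    F.rep_curv hθ hV hV' α γ μ ν x
  have h2 : ∀ μ ν, F.hInv μ ν x = ev x ((F.sys hθ hV hV').hI μ ν) := fun _ _ => rfl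
  have h3 : ∀ μ ν, F.h x μ ν = ev x ((F.sys hθ hV hV').h μ ν) := fun _ _ => rfl
  have h4 : ∀ α γ, ev x ((F.sys hθ hV hV').web.ric α γ) =
      ∑ μ, ∑ ν, F.hInv μ ν x * F.curv α γ μ ν x := by
    intro α γ
    rw [FrameSys.web_ric]
    simp only [map_sum, map_mul, h1, h2]
  simp only [FrameData.tr2, FrameSys.low, map_sum, map_mul, h4, ev_dl, ← h3, ricci]
  fin_cases α <;> simp <;> ring

lemma rep_scal : Rep F.scal (F.sys hθ hV hV').web.rsc := fun x => by
  have h := fun α β => F.rep_ricci hθ hV hV' α β x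
  have h2 : ∀ μ ν, F.hInv μ ν x = ev x ((F.sys hθ hV hV').hI μ ν) := fun _ _ => rfl
  have key : (F.sys hθ hV hV').web.rsc = ∑ α, ∑ β, (F.sys hθ hV hV').hI α β *
    (FrameData.tr2 ((F.sys hθ hV hV').low ff) ((F.sys hθ hV hV').low tt)
      (F.sys hθ hV hV').web.ric α β) := by
    generalize F.sys hθ hV hV' = G
    have h00 := G.hI_h 0 0
    have h10 := G.hI_h 1 0
    have h01 := G.hI_h 0 1
    have h11 := G.hI_h 1 1
    simp only [FrameData.tr2, FrameSys.low, Web.rsc, sum_two, dl_00, dl_01, dl_10, dl_11] at *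
    linear_combination -G.web.ric 0 0 * h00 - G.web.ric 0 1 * h01 - G.web.ric 1 0 * h10
      - G.web.ric 1 1 * h11
  rw [key]
  simp only [map_sum, map_mul, ← h, ← h2]
  rfl

lemma rep_lee (α β : ι) : Rep (F.lee α β)
    (FrameData.tr2 ((F.sys hθ hV hV').low ff) ((F.sys hθ hV hV').low tt)
      (F.sys hθ hV hV').web.leeU α β) := fun x => by
  have h := F.rep_ricci hθ hV hV' α β x
  have h1 := F.rep_scal hθ hV hV' x
  have h3 : F.h x α β = ev x ((F.sys hθ hV hV').h α β) := rfl
  rw [lee, tfRicci, h, h1, h3]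
  generalize F.sys hθ hV hV' = G
  have key : FrameData.tr2 (G.low ff) (G.low tt) G.web.leeU α β =
      -jj _ * (hh _ * hh _ * (FrameData.tr2 (G.low ff) (G.low tt) G.web.ric α β
        - hh _ * G.web.rsc * G.h α β)) := by
    have e : ∑ p, ∑ q, G.low ff α p * G.low tt β q * dl p q = G.h α β := by
      fin_cases α <;> simp [FrameSys.low, dl]
    rw [← e]
    simp only [FrameData.tr2, Web.leeU, sum_two]
    ring
  rw [key]
  simp only [map_mul, map_neg, map_sub, ev_jj, ev_hh]
  ring

end PHFrame

end Manifold

section LinearAlgebra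

variable {V : Type*} [AddCommGroup V] [Module ℝ V] [TopologicalSpace V] [Module.Finite ℝ V]

lemma evalC_wedge_one_two (a : V [⋀^Fin 1]→L[ℝ] ℂ) (b : V [⋀^ι]→L[ℝ] ℂ) (u v w : ℂ ⊗[ℝ] V) :
    evalC (a ⋏ b) ![u, v, w] = evalC a ![u] * evalC b ![v, w] - evalC a ![v] * evalC b ![u, w]
      + evalC a ![w] * evalC b ![u, v] := by
  have h := congrArg (fun f => f ![u, v, w]) (evalA_wedge a b)
  exact h.trans (wedgeA_one_two _ _ _)

lemma evalC_wedge_two_one (a : V [⋀^ι]→L[ℝ] ℂ) (b : V [⋀^Fin 1]→L[ℝ] ℂ) (u v w : ℂ ⊗[ℝ] V) :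
    evalC (a ⋏ b) ![u, v, w] = evalC a ![u, v] * evalC b ![w] - evalC a ![u, w] * evalC b ![v]
      + evalC a ![v, w] * evalC b ![u] := by
  have h := congrArg (fun f => f ![u, v, w]) (evalA_wedge a b)
  exact h.trans (wedgeA_two_one _ _ _)

lemma evalC_wedge_one_three (a : V [⋀^Fin 1]→L[ℝ] ℂ) (b : V [⋀^Fin 3]→L[ℝ] ℂ)
    (u v w z : ℂ ⊗[ℝ] V) :
    evalC (a ⋏ b) ![u, v, w, z] = evalC a ![u] * evalC b ![v, w, z] - evalC a ![v] * evalC b ![u, w, z]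
      + evalC a ![w] * evalC b ![u, v, z] - evalC a ![z] * evalC b ![u, v, w] := by
  have h := congrArg (fun f => f ![u, v, w, z]) (evalA_wedge a b)
  exact h.trans (wedgeA_one_three _ _ _)

lemma evalC_wedge_two_two (a b : V [⋀^ι]→L[ℝ] ℂ) (u v w z : ℂ ⊗[ℝ] V) :
    evalC (a ⋏ b) ![u, v, w, z] = evalC a ![u, v] * evalC b ![w, z] - evalC a ![u, w] * evalC b ![v, z]
      + evalC a ![u, z] * evalC b ![v, w] + evalC a ![v, w] * evalC b ![u, z]
      - evalC a ![v, z] * evalC b ![u, w] + evalC a ![w, z] * evalC b ![u, v] := by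
  have h := congrArg (fun f => f ![u, v, w, z]) (evalA_wedge a b)
  exact h.trans (wedgeA_two_two _ _ _)

lemma evalC_wedge_one_four (a : V [⋀^Fin 1]→L[ℝ] ℂ) (b : V [⋀^Fin 4]→L[ℝ] ℂ)
    (u v w z t : ℂ ⊗[ℝ] V) (hv : evalC a ![v] = 0) (hw : evalC a ![w] = 0) (hz : evalC a ![z] = 0)
    (ht : evalC a ![t] = 0) :
    evalC (a ⋏ b) ![u, v, w, z, t] = evalC a ![u] * evalC b ![v, w, z, t] := by
  have h := congrArg (fun f => f ![u, v, w, z, t]) (evalA_wedge a b)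
  refine (h.trans (wedgeA_one_four _ _ _)).trans ?_
  change evalC a ![u] * evalC b ![v, w, z, t] - evalC a ![v] * evalC b ![u, w, z, t]
    + evalC a ![w] * evalC b ![u, v, z, t] - evalC a ![z] * evalC b ![u, v, w, t]
    + evalC a ![t] * evalC b ![u, v, w, z] = _
  rw [hv, hw, hz, ht]; ring

lemma evalC_wedge_assoc (a : V [⋀^Fin 1]→L[ℝ] ℂ) (b c : V [⋀^ι]→L[ℝ] ℂ)
    (v : Fin 5 → ℂ ⊗[ℝ] V) : evalC (a ⋏ b ⋏ c) v = evalC (a ⋏ (b ⋏ c)) v := by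
  have e1 : evalA (k := 3) (a ⋏ b) = wedgeA (k := 1) (l := 2) (evalA a) (evalA b) := evalA_wedge a b
  have e2 : evalA (k := 4) (b ⋏ c) = wedgeA (k := 2) (l := 2) (evalA b) (evalA c) := evalA_wedge b c
  have h1 := @evalA_wedge V _ _ _ _ 3 2 (a ⋏ b) c
  have h2 := @evalA_wedge V _ _ _ _ 1 4 a (b ⋏ c)
  rw [e1] at h1
  rw [e2] at h2
  have h3 := wedgeA_assoc (evalA a) (evalA b) (evalA c) v
  rw [← h1, ← h2] at h3
  have g1 : evalC (a ⋏ b ⋏ c) v = evalC (k := 3 + 2) (wedge (k := 3) (l := 2) (a ⋏ b) c) v := rfl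
  have g2 : evalC (a ⋏ (b ⋏ c)) v = evalC (k := 1 + 4) (wedge (k := 1) (l := 4) a (b ⋏ c)) v := rfl
  rw [evalA_apply, evalA_apply] at h3
  rw [g1, g2]
  exact h3

/-- A form is determined by its values on real vectors. -/
lemma form_four_ext {η τ : V [⋀^Fin 4]→L[ℝ] ℂ}
    (h : ∀ a b c d : ℂ ⊗[ℝ] V, evalC η ![a, b, c, d] = evalC τ ![a, b, c, d]) : η = τ := by
  refine form_ext (AlternatingMap.ext fun v => ?_)
  have e : v = ![v 0, v 1, v 2, v 3] := by funext i; fin_cases i <;> rfl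
  rw [e]; exact h _ _ _ _

lemma form_two_ext {η τ : V [⋀^ι]→L[ℝ] ℂ}
    (h : ∀ a b : ℂ ⊗[ℝ] V, evalC η ![a, b] = evalC τ ![a, b]) : η = τ := by
  refine form_ext (AlternatingMap.ext fun v => ?_)
  have e : v = ![v 0, v 1] := by funext i; fin_cases i <;> rfl
  rw [e]; exact h _ _

lemma evalC_self (η : V [⋀^ι]→L[ℝ] ℂ) (v : ℂ ⊗[ℝ] V) : evalC η ![v, v] = 0 :=
  alt2_self (evalA η) v

end LinearAlgebra

section Manifold

variable {k : ℕ} {M : Type*} {x : M} {U : Set M} {f : M → ℂ} [TopologicalSpace M] [ChartedSpace E5 M]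
  [IsManifold (𝓡 5) ∞ M]
variable {S : CRStructure M} {θ : Form M 1}

/-- The indices of an adapted frame, in the order `T, Z_0, Z_0̄, Z_1, Z_1̄`. -/
def fiveEquiv : Fin 5 ≃ Option (ι ⊕ ι) where
  toFun := ![none, some (.inl 0), some (.inr 0), some (.inl 1), some (.inr 1)]
  invFun c := match c with
    | none => 0
    | some (.inl 0) => 1
    | some (.inr 0) => 2
    | some (.inl 1) => 3
    | some (.inr 1) => 4
  left_inv i := by fin_cases i <;> rfl
  right_inv c := by rcases c with _ | α | α <;> [rfl; (fin_cases α <;> rfl); (fin_cases α <;> rfl)]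

namespace PHFrame

variable (F : PHFrame S θ)

/-- An adapted frame as a basis. -/
def basis (hθ : S.Contact θ) (hx : x ∈ F.U) :
    Module.Basis (Option (ι ⊕ ι)) ℂ (CTangent x) :=
  Module.Basis.ofEquivFun
    { toFun := fun v i => evalC (F.cofr i x) ![v]
      map_add' := fun v w => by funext i; simp only [← lin1_apply, map_add]; rfl
      map_smul' := fun c v => by funext i; simp only [← lin1_apply, map_smul]; rfl
      invFun := fun c => ∑ i, c i • F.fr i x
      left_inv := fun v => (F.expand hθ hx v).symm
      right_inv := fun c => by
        funext i
        change evalC (F.cofr i x) ![∑ i, c i • F.fr i x] = _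
        rw [← lin1_apply, map_sum]
        simp only [map_smul, lin1_apply, F.dual hθ _ _ hx]
        simp }

lemma basis_apply (hθ : S.Contact θ) (hx : x ∈ F.U)
    (i : Option (ι ⊕ ι)) : F.basis hθ hx i = F.fr i x := by
  rw [basis, Module.Basis.coe_ofEquivFun]
  change ∑ j, (Pi.single i (1 : ℂ) : _ → ℂ) j • F.fr j x = _
  simp [Pi.single_apply]

/-- The frame in the order `T, Z_0, Z_0̄, Z_1, Z_1̄`. -/
def fr5 (x : M) : Fin 5 → CTangent x :=
  ![mkC (F.T x) 0, F.Z 0 x, conjC (F.Z 0 x), F.Z 1 x, conjC (F.Z 1 x)]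

lemma top_form (hθ : S.Contact θ) (hx : x ∈ F.U)
    (A B : (TM x) [⋀^Fin 5]→L[ℝ] ℂ) :
    evalC B (F.fr5 x) • A = evalC A (F.fr5 x) • B := by
  have hb : ∀ C : (TM x) [⋀^Fin 5]→L[ℝ] ℂ,
      evalA C = evalC C (F.fr5 x) • ((F.basis hθ hx).reindex fiveEquiv.symm).det := by
    intro C
    refine (AlternatingMap.eq_smul_basis_det ((F.basis hθ hx).reindex fiveEquiv.symm) (evalA C)).trans ?_
    congr 1
    refine congrArg (evalC C) (funext fun i => ?_)
    rw [Module.Basis.reindex_apply, basis_apply]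
    fin_cases i <;> rfl
  refine form_ext (AlternatingMap.ext fun v => ?_)
  have hA := congrArg (fun f => f v) (hb A)
  have hB := congrArg (fun f => f v) (hb B)
  simp only [AlternatingMap.smul_apply, smul_eq_mul, evalA_apply] at hA hB
  rw [evalA_apply, evalA_apply, evalC_smul, evalC_smul, hA, hB]
  ring

/-! #### Values on an adapted frame -/

section Values

variable (hθ : S.Contact θ) {x : M} (hx : x ∈ F.U)

lemma dtheta_ZZ (α β : ι) (hx : x ∈ F.U) : evalC (extD θ x) ![F.Z α x, F.Z β x] = 0 := by
  rw [F.evalC_dtheta hx]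
  simp [F.φbar_Z _ _ hx]

lemma dtheta_conj_conj (α β : ι) (hx : x ∈ F.U) :
    evalC (extD θ x) ![conjC (F.Z α x), conjC (F.Z β x)] = 0 := by
  rw [F.evalC_dtheta hx]
  simp [F.φ_conj' _ _ hx]

lemma dtheta_conj_Z (hx : x ∈ F.U) (α β : ι) :
    evalC (extD θ x) ![conjC (F.Z β x), F.Z α x] = -(I * F.h x α β) := by
  rw [evalC_swap, F.dtheta_Z_conj hx]

lemma dtheta_T' (hx : x ∈ F.U) (v : CTangent x) : evalC (extD θ x) ![mkC (F.T x) 0, v] = 0 := by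
  rw [F.evalC_dtheta hx]
  simp [F.φ_T' _ hx, F.φbar_T _ hx]

lemma evalC_form11 (w : ι → ι → M → ℂ) (u v : CTangent x) :
    evalC (F.form11 w x) ![u, v] =
      ∑ α, ∑ β, w α β x * (evalC (F.φ α x) ![u] * evalC (conjForm (F.φ β x)) ![v]
        - evalC (F.φ α x) ![v] * evalC (conjForm (F.φ β x)) ![u])
      - ∑ β, (I * F.div11 w β x) * (evalC (θ x) ![u] * evalC (conjForm (F.φ β x)) ![v]
        - evalC (θ x) ![v] * evalC (conjForm (F.φ β x)) ![u])
      - ∑ β, (I * F.divBar11 w β x) * (evalC (θ x) ![u] * evalC (F.φ β x) ![v]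
        - evalC (θ x) ![v] * evalC (F.φ β x) ![u]) := by
  simp only [form11, φbar, evalC_sub, evalC_sum, evalC_smul, evalC_wedge_one_one]

lemma evalC_form01 (u : ι → M → ℂ) (v : CTangent x) :
    evalC (F.form01 u x) ![v] = ∑ β, u β x * evalC (conjForm (F.φ β x)) ![v]
      + (I / 2 * F.div01 u x) * evalC (θ x) ![v] := by
  simp only [form01, φbar, evalC_add, evalC_sum, evalC_smul]

lemma form11_Z_conj (hθ : S.Contact θ) (hx : x ∈ F.U) (w : ι → ι → M → ℂ) (α β : ι) :
    evalC (F.form11 w x) ![F.Z α x, conjC (F.Z β x)] = w α β x := by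
  rw [evalC_form11]
  simp only [F.φ_conj' _ _ hx, F.φbar_conj _ _ hx, hθ.theta_conj (F.Z_mem _ _ hx),
        F.φ_Z _ _ _ hx, F.φbar_Z _ _ hx, hθ.theta_mem (F.Z_mem _ _ hx)]
  simp

lemma form11_conj_Z (hθ : S.Contact θ) (hx : x ∈ F.U) (w : ι → ι → M → ℂ) (α β : ι) :
    evalC (F.form11 w x) ![conjC (F.Z β x), F.Z α x] = -w α β x := by
  rw [evalC_swap, F.form11_Z_conj hθ hx]

lemma form11_ZZ (hθ : S.Contact θ) (hx : x ∈ F.U) (w : ι → ι → M → ℂ) (α β : ι) :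
    evalC (F.form11 w x) ![F.Z α x, F.Z β x] = 0 := by
  rw [evalC_form11]
  simp [F.φbar_Z _ _ hx, hθ.theta_mem (F.Z_mem _ _ hx)]

lemma form11_conj_conj (hθ : S.Contact θ) (hx : x ∈ F.U) (w : ι → ι → M → ℂ) (α β : ι) :
    evalC (F.form11 w x) ![conjC (F.Z α x), conjC (F.Z β x)] = 0 := by
  rw [evalC_form11]
  simp [F.φ_conj' _ _ hx, hθ.theta_conj (F.Z_mem _ _ hx)]

lemma form11_T_conj (hθ : S.Contact θ) (hx : x ∈ F.U) (w : ι → ι → M → ℂ) (β : ι) :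
    evalC (F.form11 w x) ![mkC (F.T x) 0, conjC (F.Z β x)] = -(I * F.div11 w β x) := by
  rw [evalC_form11]
  simp only [F.φ_conj' _ _ hx, F.φbar_conj _ _ hx, hθ.theta_conj (F.Z_mem _ _ hx),
        F.φ_T' _ hx, F.φbar_T _ hx, F.theta_T' hx]
  simp

lemma form01_conj (hθ : S.Contact θ) (hx : x ∈ F.U) (u : ι → M → ℂ) (β : ι) :
    evalC (F.form01 u x) ![conjC (F.Z β x)] = u β x := by
  rw [evalC_form01]
  simp [F.φbar_conj _ _ hx, hθ.theta_conj (F.Z_mem _ _ hx)]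

lemma fr5_wedge (hθ : S.Contact θ) (hx : x ∈ F.U)
    (η : (TM x) [⋀^Fin 4]→L[ℝ] ℂ) :
    evalC (θ x ⋏ η) (F.fr5 x) =
      evalC η ![F.Z 0 x, conjC (F.Z 0 x), F.Z 1 x, conjC (F.Z 1 x)] := by
  have h := evalC_wedge_one_four (θ x) η (mkC (F.T x) 0) (F.Z 0 x) (conjC (F.Z 0 x)) (F.Z 1 x)
    (conjC (F.Z 1 x)) (hθ.theta_mem (F.Z_mem _ _ hx)) (hθ.theta_conj (F.Z_mem _ _ hx))
    (hθ.theta_mem (F.Z_mem _ _ hx)) (hθ.theta_conj (F.Z_mem _ _ hx))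
  rw [F.theta_T' hx, one_mul] at h
  exact h

lemma fr5_vol (hθ : S.Contact θ) (hx : x ∈ F.U) :
    evalC (θ x ⋏ extD θ x ⋏ extD θ x) (F.fr5 x) = -2 * (F.h x).det := by
  rw [evalC_wedge_assoc, F.fr5_wedge hθ hx, evalC_wedge_two_two, Matrix.det_fin_two]
  simp only [F.dtheta_Z_conj hx, F.dtheta_ZZ _ _ hx, F.dtheta_conj_conj _ _ hx, F.dtheta_conj_Z hx]
  linear_combination (2 * F.h x 0 0 * F.h x 1 1 - 2 * F.h x 0 1 * F.h x 1 0) * I_sq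

lemma fr5_vol_ne (hθ : S.Contact θ) (hx : x ∈ F.U) :
    evalC (θ x ⋏ extD θ x ⋏ extD θ x) (F.fr5 x) ≠ 0 := by
  rw [F.fr5_vol hθ hx]
  exact mul_ne_zero (by norm_num) (F.h_det hθ hx)

lemma vol_coeff (hθ : S.Contact θ) (hx : x ∈ F.U)
    {A : (TM x) [⋀^Fin 5]→L[ℝ] ℂ} {f : ℂ}
    (h : A = f • (θ x ⋏ extD θ x ⋏ extD θ x)) : f = evalC A (F.fr5 x) / (-2 * (F.h x).det) := by
  have h1 := congrArg (fun C => evalC C (F.fr5 x)) h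
  simp only [evalC_smul] at h1
  rw [F.fr5_vol hθ hx] at h1
  rw [h1, mul_div_assoc, div_self, mul_one]
  exact mul_ne_zero (by norm_num) (F.h_det hθ hx)

lemma exists_vol_coeff (hθ : S.Contact θ) (hx : x ∈ F.U)
    (A : (TM x) [⋀^Fin 5]→L[ℝ] ℂ) :
    ∃ f : ℂ, A = f • (θ x ⋏ extD θ x ⋏ extD θ x) := by
  have h := F.top_form hθ hx A (θ x ⋏ extD θ x ⋏ extD θ x)
  refine ⟨(evalC (θ x ⋏ extD θ x ⋏ extD θ x) (F.fr5 x))⁻¹ * evalC A (F.fr5 x), ?_⟩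
  rw [mul_smul, ← h, smul_smul, inv_mul_cancel₀ (F.fr5_vol_ne hθ hx), one_smul]

/-- `Γ` on two-forms, in an adapted frame. -/
lemma gamma2_eq (hθ : S.Contact θ) (hx : x ∈ F.U) (η : Form M 2) :
    gamma2 θ η x = (evalC (η x ⋏ extD θ x) ![F.Z 0 x, conjC (F.Z 0 x), F.Z 1 x, conjC (F.Z 1 x)]
      / (-2 * (F.h x).det)) • θ x := by
  have hex := F.exists_vol_coeff hθ hx (θ x ⋏ η x ⋏ extD θ x)
  rw [gamma2, dif_pos hex, F.vol_coeff hθ hx hex.choose_spec, evalC_wedge_assoc, F.fr5_wedge hθ hx]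

/-- `Γ` on four-forms, in an adapted frame. -/
lemma gamma4_eq (hθ : S.Contact θ) (hx : x ∈ F.U) (η : Form M 4) :
    gamma4 θ η x = (evalC (η x) ![F.Z 0 x, conjC (F.Z 0 x), F.Z 1 x, conjC (F.Z 1 x)]
      / (-2 * (F.h x).det)) • (θ x ⋏ extD θ x) := by
  have hex := F.exists_vol_coeff hθ hx (θ x ⋏ η x)
  rw [gamma4, dif_pos hex, F.vol_coeff hθ hx hex.choose_spec, F.fr5_wedge hθ hx]

end Values

end PHFrame

end Manifold

section LinearAlgebra

variable {V : Type*} [AddCommGroup V] [Module ℝ V] [TopologicalSpace V] [Module.Finite ℝ V]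

lemma smul_wedge_one_two (c : ℂ) (a : V [⋀^Fin 1]→L[ℝ] ℂ) (b : V [⋀^ι]→L[ℝ] ℂ) :
    (c • a) ⋏ b = c • (a ⋏ b) := by
  refine form_ext (AlternatingMap.ext fun v => ?_)
  have e : v = ![v 0, v 1, v 2] := by funext i; fin_cases i <;> rfl
  rw [e, evalA_apply, evalA_apply, evalC_smul]
  have h1 := evalC_wedge_one_two (c • a) b (v 0) (v 1) (v 2)
  have h2 := evalC_wedge_one_two a b (v 0) (v 1) (v 2)
  refine h1.trans (Eq.trans ?_ (congrArg (c * ·) h2).symm)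
  simp only [evalC_smul]; ring

end LinearAlgebra

section Manifold

variable {k : ℕ} {M : Type*} {x : M} {U : Set M} {f : M → ℂ} [TopologicalSpace M] [ChartedSpace E5 M]
  [IsManifold (𝓡 5) ∞ M]
variable {S : CRStructure M} {θ : Form M 1}

namespace PHFrame

variable (F : PHFrame S θ)

section Values

variable {x : M}

lemma hInv_00 : F.hInv 0 0 x = ((F.h x).det)⁻¹ * F.h x 1 1 := by
  rw [hInv, Matrix.inv_def, Ring.inverse_eq_inv', Matrix.adjugate_fin_two]; rfl

lemma hInv_11 : F.hInv 1 1 x = ((F.h x).det)⁻¹ * F.h x 0 0 := by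
  rw [hInv, Matrix.inv_def, Ring.inverse_eq_inv', Matrix.adjugate_fin_two]; rfl

lemma hInv_01 : F.hInv 0 1 x = ((F.h x).det)⁻¹ * -F.h x 1 0 := by
  rw [hInv, Matrix.inv_def, Ring.inverse_eq_inv', Matrix.adjugate_fin_two]; rfl

lemma hInv_10 : F.hInv 1 0 x = ((F.h x).det)⁻¹ * -F.h x 0 1 := by
  rw [hInv, Matrix.inv_def, Ring.inverse_eq_inv', Matrix.adjugate_fin_two]; rfl

lemma trace_conj (hθ : S.Contact θ) (hx : x ∈ F.U)
    (ξ : (TM x) [⋀^Fin 1]→L[ℝ] ℂ) (β : ι) :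
    ∑ μ, ∑ ν, F.hInv μ ν x * evalC (θ x ⋏ ξ ⋏ extD θ x)
      ![mkC (F.T x) 0, conjC (F.Z β x), F.Z μ x, conjC (F.Z ν x)] =
      I * evalC ξ ![conjC (F.Z β x)] := by
  have h1 : ∀ μ ν, evalC (θ x ⋏ ξ ⋏ extD θ x)
      ![mkC (F.T x) 0, conjC (F.Z β x), F.Z μ x, conjC (F.Z ν x)] =
      I * (evalC ξ ![conjC (F.Z β x)] * F.h x μ ν - evalC ξ ![conjC (F.Z ν x)] * F.h x μ β) := by
    intro μ ν
    have h := evalC_wedge_two_two (θ x ⋏ ξ) (extD θ x) (mkC (F.T x) 0) (conjC (F.Z β x)) (F.Z μ x)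
      (conjC (F.Z ν x))
    refine h.trans ?_
    simp only [evalC_wedge_one_one, F.dtheta_Z_conj hx, F.dtheta_conj_conj _ _ hx,
      F.dtheta_conj_Z hx, F.dtheta_T' hx, F.theta_T' hx, hθ.theta_mem (F.Z_mem _ _ hx),
      hθ.theta_conj (F.Z_mem _ _ hx)]
    ring
  simp only [h1]
  have a0 := F.hInv_h' hθ hx 0 β
  have a1 := F.hInv_h' hθ hx 1 β
  have b0 := F.hInv_h' hθ hx 0 0
  have b1 := F.hInv_h' hθ hx 1 1
  have e : (if (0 : ι) = β then (1 : ℂ) else 0) * evalC ξ ![conjC (F.Z 0 x)]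
    + (if (1 : ι) = β then (1 : ℂ) else 0) * evalC ξ ![conjC (F.Z 1 x)]
    = evalC ξ ![conjC (F.Z β x)] := by fin_cases β <;> simp
  simp only [sum_two, if_pos] at *
  linear_combination I * evalC ξ ![conjC (F.Z β x)] * (b0 + b1)
    - I * evalC ξ ![conjC (F.Z 0 x)] * a0 - I * evalC ξ ![conjC (F.Z 1 x)] * a1
    - I * e

lemma trace_Z (hθ : S.Contact θ) (hx : x ∈ F.U)
    (ξ : (TM x) [⋀^Fin 1]→L[ℝ] ℂ) (α : ι) :
    ∑ μ, ∑ ν, F.hInv μ ν x * evalC (θ x ⋏ ξ ⋏ extD θ x)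
      ![mkC (F.T x) 0, F.Z α x, F.Z μ x, conjC (F.Z ν x)] =
      I * evalC ξ ![F.Z α x] := by
  have h1 : ∀ μ ν, evalC (θ x ⋏ ξ ⋏ extD θ x)
      ![mkC (F.T x) 0, F.Z α x, F.Z μ x, conjC (F.Z ν x)] =
      I * (evalC ξ ![F.Z α x] * F.h x μ ν - evalC ξ ![F.Z μ x] * F.h x α ν) := by
    intro μ ν
    have h := evalC_wedge_two_two (θ x ⋏ ξ) (extD θ x) (mkC (F.T x) 0) (F.Z α x) (F.Z μ x)
      (conjC (F.Z ν x))
    refine h.trans ?_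
    simp only [evalC_wedge_one_one, F.dtheta_Z_conj hx, F.dtheta_ZZ _ _ hx,
      F.dtheta_T' hx, F.theta_T' hx, hθ.theta_mem (F.Z_mem _ _ hx),
      hθ.theta_conj (F.Z_mem _ _ hx)]
    ring
  simp only [h1]
  have a0 := F.hInv_h hθ hx 0 α
  have a1 := F.hInv_h hθ hx 1 α
  have b0 := F.hInv_h hθ hx 0 0
  have b1 := F.hInv_h hθ hx 1 1
  have e : (if (0 : ι) = α then (1 : ℂ) else 0) * evalC ξ ![F.Z 0 x]
    + (if (1 : ι) = α then (1 : ℂ) else 0) * evalC ξ ![F.Z 1 x]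
    = evalC ξ ![F.Z α x] := by fin_cases α <;> simp
  simp only [sum_two, if_pos] at *
  linear_combination I * evalC ξ ![F.Z α x] * (b0 + b1)
    - I * evalC ξ ![F.Z 0 x] * a0 - I * evalC ξ ![F.Z 1 x] * a1
    - I * e

/-- `θ ∧ ξ` is determined by `θ ∧ ξ ∧ dθ`. -/
lemma wedge_cancel (hθ : S.Contact θ) (hx : x ∈ F.U)
    {ξ ξ' : (TM x) [⋀^Fin 1]→L[ℝ] ℂ}
    (h : θ x ⋏ ξ ⋏ extD θ x = θ x ⋏ ξ' ⋏ extD θ x) : θ x ⋏ ξ = θ x ⋏ ξ' := by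
  have hZ : ∀ α, evalC ξ ![F.Z α x] = evalC ξ' ![F.Z α x] := by
    intro α
    have h1 := F.trace_Z hθ hx ξ α
    rw [h, F.trace_Z hθ hx ξ' α] at h1
    exact (mul_left_cancel₀ I_ne_zero h1).symm
  have hZ' : ∀ α, evalC ξ ![conjC (F.Z α x)] = evalC ξ' ![conjC (F.Z α x)] := by
    intro α
    have h1 := F.trace_conj hθ hx ξ α
    rw [h, F.trace_conj hθ hx ξ' α] at h1
    exact (mul_left_cancel₀ I_ne_zero h1).symm
  have hv : ∀ v : CTangent x, evalC ξ ![v] - evalC ξ' ![v] =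
      evalC (θ x) ![v] * (evalC ξ ![mkC (F.T x) 0] - evalC ξ' ![mkC (F.T x) 0]) := by
    intro v
    have hs : ∀ ζ : (TM x) [⋀^Fin 1]→L[ℝ] ℂ, evalC ζ ![v] =
        evalC (θ x) ![v] * evalC ζ ![mkC (F.T x) 0]
        + (∑ α, evalC (F.φ α x) ![v] * evalC ζ ![F.Z α x]
        + ∑ α, evalC (conjForm (F.φ α x)) ![v] * evalC ζ ![conjC (F.Z α x)]) := by
      intro ζ
      have e := congrArg (lin1 ζ) (F.expand hθ hx v)
      rw [map_sum, Fintype.sum_option, Fintype.sum_sum_type] at e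
      simp only [map_smul, lin1_apply, smul_eq_mul] at e
      exact e
    rw [hs ξ, hs ξ']
    simp only [hZ, hZ']
    ring
  refine form_two_ext fun a b => ?_
  rw [evalC_wedge_one_one, evalC_wedge_one_one]
  linear_combination evalC (θ x) ![a] * hv b - evalC (θ x) ![b] * hv a

/-- `Γ` on three-forms. -/
lemma gamma3_eq (hθ : S.Contact θ) (hx : x ∈ F.U) (η : Form M 3)
    (ξ : (TM x) [⋀^Fin 1]→L[ℝ] ℂ) (h : θ x ⋏ η x = θ x ⋏ ξ ⋏ extD θ x) :
    gamma3 θ η x = θ x ⋏ ξ := by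
  have hex : ∃ ξ, θ x ⋏ η x = θ x ⋏ ξ ⋏ extD θ x := ⟨ξ, h⟩
  rw [gamma3, dif_pos hex]
  exact F.wedge_cancel hθ hx (hex.choose_spec.symm.trans h)

lemma gamma3_Z_conj (hθ : S.Contact θ) (hx : x ∈ F.U) (η : Form M 3) (α β : ι) :
    evalC (gamma3 θ η x) ![F.Z α x, conjC (F.Z β x)] = 0 := by
  rw [gamma3]
  split_ifs with h
  · refine (evalC_wedge_one_one _ _ _ _).trans ?_
    rw [hθ.theta_mem (F.Z_mem _ _ hx), hθ.theta_conj (F.Z_mem _ _ hx)]; ring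
  · exact evalC_zero _

set_option maxHeartbeats 2000000 in
/-- The `(1,1)`-part of `θ ∧ (u ∧ w)` for trace-free `w`. -/
lemma wedge_form01_form11 (hx : x ∈ F.U) (u : ι → M → ℂ)
    (w : ι → ι → M → ℂ) (ξ : ι → ℂ)
    (h : ∀ α, u 0 x * w α 1 x - u 1 x * w α 0 x =
      I * (ξ 0 * F.h x α 1 - ξ 1 * F.h x α 0)) :
    θ x ⋏ (F.form01 u x ⋏ F.form11 w x) =
      θ x ⋏ (∑ β, ξ β • conjForm (F.φ β x)) ⋏ extD θ x := by
  refine form_four_ext fun a b c d => ?_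
  refine (evalC_wedge_one_three _ _ a b c d).trans
    (Eq.trans ?_ (evalC_wedge_two_two _ _ a b c d).symm)
  have e : ∀ a b c : CTangent x, evalC (F.form01 u x ⋏ F.form11 w x) ![a, b, c] =
      evalC (F.form01 u x) ![a] * evalC (F.form11 w x) ![b, c]
      - evalC (F.form01 u x) ![b] * evalC (F.form11 w x) ![a, c]
      + evalC (F.form01 u x) ![c] * evalC (F.form11 w x) ![a, b] := evalC_wedge_one_two _ _
  rw [e, e, e, e]
  simp only [evalC_form11, evalC_form01, evalC_wedge_one_one, F.evalC_dtheta hx, evalC_sum,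
    evalC_smul]
  have h0 := h 0
  have h1 := h 1
  simp only [sum_two]
  generalize F.div01 u x = q
  generalize F.div11 w 0 x = q0
  generalize F.div11 w 1 x = q1
  generalize F.divBar11 w 0 x = r0
  generalize F.divBar11 w 1 x = r1
  generalize evalC (θ x) ![a] = ta
  generalize evalC (F.φ 0 x) ![a] = z0a
  generalize evalC (conjForm (F.φ 0 x)) ![a] = p0a
  generalize evalC (F.φ 1 x) ![a] = z1a
  generalize evalC (conjForm (F.φ 1 x)) ![a] = p1a
  generalize evalC (θ x) ![b] = tb
  generalize evalC (F.φ 0 x) ![b] = z0b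
  generalize evalC (conjForm (F.φ 0 x)) ![b] = p0b
  generalize evalC (F.φ 1 x) ![b] = z1b
  generalize evalC (conjForm (F.φ 1 x)) ![b] = p1b
  generalize evalC (θ x) ![c] = tc
  generalize evalC (F.φ 0 x) ![c] = z0c
  generalize evalC (conjForm (F.φ 0 x)) ![c] = p0c
  generalize evalC (F.φ 1 x) ![c] = z1c
  generalize evalC (conjForm (F.φ 1 x)) ![c] = p1c
  generalize evalC (θ x) ![d] = td
  generalize evalC (F.φ 0 x) ![d] = z0d
  generalize evalC (conjForm (F.φ 0 x)) ![d] = p0d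
  generalize evalC (F.φ 1 x) ![d] = z1d
  generalize evalC (conjForm (F.φ 1 x)) ![d] = p1d
  linear_combination -((ta * z0b - tb * z0a) * (p0c * p1d - p0d * p1c) - (ta * z0c - tc * z0a) * (p0b * p1d - p0d * p1b)
    + (ta * z0d - td * z0a) * (p0b * p1c - p0c * p1b) + (tb * z0c - tc * z0b) * (p0a * p1d - p0d * p1a)
    - (tb * z0d - td * z0b) * (p0a * p1c - p0c * p1a) + (tc * z0d - td * z0c) * (p0a * p1b - p0b * p1a)) * h0
    - ((ta * z1b - tb * z1a) * (p0c * p1d - p0d * p1c) - (ta * z1c - tc * z1a) * (p0b * p1d - p0d * p1b)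
    + (ta * z1d - td * z1a) * (p0b * p1c - p0c * p1b) + (tb * z1c - tc * z1b) * (p0a * p1d - p0d * p1a)
    - (tb * z1d - td * z1b) * (p0a * p1c - p0c * p1a) + (tc * z1d - td * z1c) * (p0a * p1b - p0b * p1a)) * h1

end Values

end PHFrame

end Manifold

section Manifold

variable {k : ℕ} {M : Type*} {x : M} {U : Set M} {f : M → ℂ} [TopologicalSpace M] [ChartedSpace E5 M]
  [IsManifold (𝓡 5) ∞ M]
variable {S : CRStructure M} {θ : Form M 1} {V : Opens M}

namespace PHFrame

variable (F : PHFrame S θ) (hθ : S.Contact θ) (hV : (V : Set M) ⊆ F.U) {x₀ : M}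
  (hV' : (V : Set M) ⊆ (χ x₀).source)

lemma trace_eq (hθ : S.Contact θ) (hx : x ∈ F.U) (w : ι → ι → ℂ) :
    w 0 0 * F.h x 1 1 - w 0 1 * F.h x 1 0 - w 1 0 * F.h x 0 1 + w 1 1 * F.h x 0 0 =
      (F.h x).det * ∑ μ, ∑ ν, F.hInv μ ν x * w μ ν := by
  have hd := F.h_det hθ hx
  simp only [sum_two, hInv_00, hInv_01, hInv_10, hInv_11]
  field_simp
  ring

lemma prod00_11_eq (hθ : S.Contact θ) (hV : (V : Set M) ⊆ F.U) (f : M → ℂ)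
    (w : ι → ι → M → ℂ) (hw : ∀ x ∈ V, ∑ μ, ∑ ν, F.hInv μ ν x * w μ ν x = 0)
    (α β : ι) (hx : x ∈ V) : F.prod00_11 f w α β x = f x * w α β x := by
  have hg : ∀ y ∈ (V : Set M), gamma2 θ (fun x => f x • F.form11 w x) y = 0 := by
    intro y hy
    have hy' := hV hy
    rw [F.gamma2_eq hθ hy']
    have h := evalC_wedge_two_two (f y • F.form11 w y) (extD θ y) (F.Z 0 y) (conjC (F.Z 0 y))
      (F.Z 1 y) (conjC (F.Z 1 y))
    have ht := F.trace_eq hθ hy' (fun μ ν => w μ ν y)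
    rw [hw y hy, mul_zero] at ht
    have h0 : evalC (f y • F.form11 w y ⋏ extD θ y)
        ![F.Z 0 y, conjC (F.Z 0 y), F.Z 1 y, conjC (F.Z 1 y)] = 0 := by
      refine h.trans ?_
      simp only [evalC_smul, F.form11_Z_conj hθ hy', F.form11_ZZ hθ hy', F.form11_conj_conj hθ hy',
        F.form11_conj_Z hθ hy', F.dtheta_Z_conj hy', F.dtheta_ZZ _ _ hy',
        F.dtheta_conj_conj _ _ hy', F.dtheta_conj_Z hy']
      linear_combination (f y * I) * ht
    rw [h0, zero_div]
    exact zero_smul ℂ (θ y)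
  have hx' := hV hx
  have h1 : extD (gamma2 θ fun x => f x • F.form11 w x) x = 0 :=
    (extD_congr V.isOpen hg hx).trans (extD_zero x)
  have h2 : F.prod00_11 f w α β x = evalC (f x • F.form11 w x
      - extD (gamma2 θ fun x => f x • F.form11 w x) x
      - gamma3 θ (extD fun x => f x • F.form11 w x) x) ![F.Z α x, conjC (F.Z β x)] := rfl
  rw [h2, evalC_sub, evalC_sub, F.gamma3_Z_conj hθ hx', h1, evalC_zero, evalC_smul,
    F.form11_Z_conj hθ hx']
  ring

lemma prod01_11_eq (hθ : S.Contact θ) (hV : (V : Set M) ⊆ F.U) (u : ι → M → ℂ)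
    (w : ι → ι → M → ℂ) (hw : ∀ x ∈ V, ∑ μ, ∑ ν, F.hInv μ ν x * w μ ν x = 0)
    (ξ : ι → M → ℂ) (hξs : ∀ β, SmoothFun (ξ β) V)
    (hξ : ∀ β, ∀ x ∈ V, ξ β x = I * ∑ μ, ∑ ν, F.hInv μ ν x * (u ν x * w μ β x))
    (γ β : ι) (hx : x ∈ V) : F.prod01_11 u w γ β x =
      I * (u γ x * F.div11 w β x - u β x * F.div11 w γ x)
      + F.cov01 ξ (.inr γ) β x - F.cov01 ξ (.inr β) γ x := by
  have hx' := hV hx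
  set Ξ : Form M 1 := fun y => ∑ β, ξ β y • conjForm (F.φ β y) with hΞ
  have hφ : ∀ β, SmoothForm (fun y => conjForm (F.φ β y)) V := fun β =>
    (smoothForm_conj (F.φ_smooth β)).mono hV
  have hΞs : SmoothForm Ξ V := smoothForm_sum _ fun β => smoothForm_smul V.isOpen (hξs β) (hφ β)
  have hg : ∀ y ∈ (V : Set M), gamma3 θ (fun x => F.form01 u x ⋏ F.form11 w x) y = θ y ⋏ Ξ y := by
    intro y hy
    have hy' := hV hy
    refine F.gamma3_eq hθ hy' _ _ (F.wedge_form01_form11 hy' u w (fun β => ξ β y) fun α => ?_)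
    rw [hξ 0 y hy, hξ 1 y hy]
    have ht := F.trace_eq hθ hy' (fun μ ν => w μ ν y)
    rw [hw y hy, mul_zero] at ht
    have hd : ((F.h y).det)⁻¹ * (F.h y).det = 1 := inv_mul_cancel₀ (F.h_det hθ hy')
    simp only [sum_two, hInv_00, hInv_01, hInv_10, hInv_11]
    generalize ((F.h y).det)⁻¹ = D at hd ⊢
    rw [Matrix.det_fin_two] at hd
    have key : u 0 y * w α 1 y - u 1 y * w α 0 y =
        -(D * (F.h y 1 1 * u 0 y - F.h y 1 0 * u 1 y) * w 0 0 y
          + D * (F.h y 0 0 * u 1 y - F.h y 0 1 * u 0 y) * w 1 0 y) * F.h y α 1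
        + (D * (F.h y 1 1 * u 0 y - F.h y 1 0 * u 1 y) * w 0 1 y
          + D * (F.h y 0 0 * u 1 y - F.h y 0 1 * u 0 y) * w 1 1 y) * F.h y α 0 := by
      fin_cases α <;> simp only [Fin.zero_eta, Fin.mk_one]
      · linear_combination D * (u 0 y * F.h y 0 1 - u 1 y * F.h y 0 0) * ht
          - (u 0 y * w 0 1 y - u 1 y * w 0 0 y) * hd
      · linear_combination D * (u 0 y * F.h y 1 1 - u 1 y * F.h y 1 0) * ht
          - (u 0 y * w 1 1 y - u 1 y * w 1 0 y) * hd
    rw [key]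
    linear_combination (-(D * (F.h y 1 1 * u 0 y - F.h y 1 0 * u 1 y) * w 0 0 y
          + D * (F.h y 0 0 * u 1 y - F.h y 0 1 * u 0 y) * w 1 0 y) * F.h y α 1
        + (D * (F.h y 1 1 * u 0 y - F.h y 1 0 * u 1 y) * w 0 1 y
          + D * (F.h y 0 0 * u 1 y - F.h y 0 1 * u 0 y) * w 1 1 y) * F.h y α 0) * I_sq
  have hθV : SmoothForm θ V := hθ.smooth.mono (Set.subset_univ _)
  have h1 : extD (gamma3 θ fun x => F.form01 u x ⋏ F.form11 w x) x =
      extD θ x ⋏ Ξ x - θ x ⋏ extD Ξ x :=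
    (extD_congr V.isOpen hg hx).trans (extD_wedge_one_one hθV hΞs hx)
  have h2 : F.prod01_11 u w γ β x = evalC (F.form01 u x ⋏ F.form11 w x
      - extD (gamma3 θ fun x => F.form01 u x ⋏ F.form11 w x) x
      - gamma4 θ (extD fun x => F.form01 u x ⋏ F.form11 w x) x)
      ![mkC (F.T x) 0, conjC (F.Z γ x), conjC (F.Z β x)] := rfl
  have h3 : evalC (gamma4 θ (extD fun x => F.form01 u x ⋏ F.form11 w x) x)
      ![mkC (F.T x) 0, conjC (F.Z γ x), conjC (F.Z β x)] = 0 := by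
    rw [F.gamma4_eq hθ hx', evalC_smul]
    have h := evalC_wedge_one_two (θ x) (extD θ x) (mkC (F.T x) 0) (conjC (F.Z γ x)) (conjC (F.Z β x))
    rw [F.dtheta_conj_conj _ _ hx', hθ.theta_conj (F.Z_mem _ _ hx'),
      hθ.theta_conj (F.Z_mem _ _ hx')] at h
    refine (congrArg (_ * ·) h).trans ?_
    ring
  have h4 : evalC (F.form01 u x ⋏ F.form11 w x)
      ![mkC (F.T x) 0, conjC (F.Z γ x), conjC (F.Z β x)] =
      I * (u γ x * F.div11 w β x - u β x * F.div11 w γ x) := by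
    refine (evalC_wedge_one_two _ _ _ _ _).trans ?_
    rw [F.form11_conj_conj hθ hx', F.form11_T_conj hθ hx', F.form11_T_conj hθ hx',
      F.form01_conj hθ hx', F.form01_conj hθ hx']
    ring
  have hΞc : ∀ κ, ∀ y ∈ (V : Set M), F.comp01 Ξ κ y = ξ κ y := by
    intro κ y hy
    simp only [comp01, hΞ, evalC_sum, evalC_smul, F.φbar_conj _ _ (hV hy)]
    simp
  have h5 : evalC (extD θ x ⋏ Ξ x - θ x ⋏ extD Ξ x)
      ![mkC (F.T x) 0, conjC (F.Z γ x), conjC (F.Z β x)] =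
      -(F.cov01 ξ (.inr γ) β x - F.cov01 ξ (.inr β) γ x) := by
    have a1 := evalC_wedge_two_one (extD θ x) (Ξ x) (mkC (F.T x) 0) (conjC (F.Z γ x)) (conjC (F.Z β x))
    have a2 := evalC_wedge_one_two (θ x) (extD Ξ x) (mkC (F.T x) 0) (conjC (F.Z γ x)) (conjC (F.Z β x))
    rw [F.dtheta_conj_conj _ _ hx', F.dtheta_T' hx', F.dtheta_T' hx'] at a1
    rw [F.theta_T' hx', hθ.theta_conj (F.Z_mem _ _ hx'), hθ.theta_conj (F.Z_mem _ _ hx')] at a2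
    rw [evalC_sub]
    refine (congrArg₂ (· - ·) a1 a2).trans ?_
    have e := F.extD_anti hθ hV hΞs hx γ β
    have e2 : ∀ s κ, F.cov01 (F.comp01 Ξ) (.inr s) κ x = F.cov01 ξ (.inr s) κ x := by
      intro s κ
      simp only [cov01, hΞc _ x hx]
      rw [derivC_congr V.isOpen (hΞc κ) hx]
    rw [e, e2, e2]
    ring
  rw [h2, evalC_sub, evalC_sub, h3, h1]
  refine (congrArg₂ (fun a b => a - b - 0) h4 h5).trans ?_
  ring

lemma prod11_11_eq (hθ : S.Contact θ) (hV : (V : Set M) ⊆ F.U)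
    (w w' : ι → ι → M → ℂ) (hw : ∀ x ∈ V, ∑ μ, ∑ ν, F.hInv μ ν x * w μ ν x = 0)
    (hw' : ∀ x ∈ V, ∑ μ, ∑ ν, F.hInv μ ν x * w' μ ν x = 0)
    (f : M → ℂ) (hfs : SmoothFun f V)
    (hf : ∀ x ∈ V, f x = 1 / 2 * ∑ m, ∑ n, F.hInv m n x * ∑ m', ∑ n', F.hInv m' n' x *
      (w m n' x * w' m' n x))
    (β : ι) (hx : x ∈ V) : F.prod11_11 w w' β x =
      ∑ μ, ∑ ν, F.hInv μ ν x * (w' μ β x * F.div11 w ν x)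
      + ∑ μ, ∑ ν, F.hInv μ ν x * (w μ β x * F.div11 w' ν x)
      + derivC f x (conjC (F.Z β x)) := by
  have hx' := hV hx
  have hθV : SmoothForm θ V := hθ.smooth.mono (Set.subset_univ _)
  have hg : ∀ y ∈ (V : Set M), gamma4 θ (fun x => F.form11 w x ⋏ F.form11 w' x) y =
      (f y • θ y) ⋏ extD θ y := by
    intro y hy
    have hy' := hV hy
    rw [F.gamma4_eq hθ hy', smul_wedge_one_two]
    congr 1
    have h := evalC_wedge_two_two (F.form11 w y) (F.form11 w' y) (F.Z 0 y) (conjC (F.Z 0 y))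
      (F.Z 1 y) (conjC (F.Z 1 y))
    have ht := F.trace_eq hθ hy' (fun μ ν => w μ ν y)
    have ht' := F.trace_eq hθ hy' (fun μ ν => w' μ ν y)
    rw [hw y hy, mul_zero] at ht
    rw [hw' y hy, mul_zero] at ht'
    simp only [F.form11_Z_conj hθ hy', F.form11_ZZ hθ hy', F.form11_conj_conj hθ hy',
      F.form11_conj_Z hθ hy'] at h
    refine (congrArg (· / (-2 * (F.h y).det)) h).trans ?_
    rw [hf y hy]
    have hd0 := F.h_det hθ hy'
    have hd : ((F.h y).det)⁻¹ * (F.h y).det = 1 := inv_mul_cancel₀ hd0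
    rw [div_eq_iff (mul_ne_zero (by norm_num) hd0)]
    simp only [sum_two, hInv_00, hInv_01, hInv_10, hInv_11]
    generalize ((F.h y).det)⁻¹ = D at hd ⊢
    rw [Matrix.det_fin_two] at hd ⊢
    linear_combination -(w 0 0 y * w' 1 1 y + w 1 1 y * w' 0 0 y - w 0 1 y * w' 1 0 y
        - w 1 0 y * w' 0 1 y) * (1 + D * (F.h y 0 0 * F.h y 1 1 - F.h y 0 1 * F.h y 1 0)) * hd
      + (F.h y 0 0 * F.h y 1 1 - F.h y 0 1 * F.h y 1 0) * D ^ 2 * (w' 0 0 y * F.h y 1 1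
        - w' 0 1 y * F.h y 1 0 - w' 1 0 y * F.h y 0 1 + w' 1 1 y * F.h y 0 0) * ht
  have h1 : extD (gamma4 θ fun x => F.form11 w x ⋏ F.form11 w' x) x =
      (diffForm f x ⋏ θ x + f x • extD θ x) ⋏ extD θ x - (f x • θ x) ⋏ extD (extD θ) x := by
    refine (extD_congr V.isOpen hg hx).trans ?_
    refine (extD_wedge_one_two (smoothForm_smul V.isOpen hfs hθV)
      (smoothForm_extD V.isOpen hθV) hx).trans ?_
    rw [extD_smul_one V.isOpen hfs hθV hx]
  have h2 : F.prod11_11 w w' β x = -I * ∑ μ, ∑ ν, F.hInv μ ν x *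
      evalC (F.form11 w x ⋏ F.form11 w' x - extD (gamma4 θ fun x => F.form11 w x ⋏ F.form11 w' x) x)
      ![mkC (F.T x) 0, conjC (F.Z β x), F.Z μ x, conjC (F.Z ν x)] := rfl
  have hdd : extD (extD θ) x = 0 := extD_extD V.isOpen hθV hx
  have h3 : ∀ μ ν, evalC (F.form11 w x ⋏ F.form11 w' x)
      ![mkC (F.T x) 0, conjC (F.Z β x), F.Z μ x, conjC (F.Z ν x)] =
      I * (F.div11 w ν x * w' μ β x + w μ β x * F.div11 w' ν x)
      - I * (F.div11 w β x * w' μ ν x + w μ ν x * F.div11 w' β x) := by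
    intro μ ν
    refine (evalC_wedge_two_two _ _ _ _ _ _).trans ?_
    rw [F.form11_conj_conj hθ hx', F.form11_conj_conj hθ hx', F.form11_T_conj hθ hx',
      F.form11_T_conj hθ hx', F.form11_T_conj hθ hx', F.form11_T_conj hθ hx',
      F.form11_conj_Z hθ hx', F.form11_conj_Z hθ hx', F.form11_Z_conj hθ hx',
      F.form11_Z_conj hθ hx']
    ring
  have h4 : ∀ μ ν, evalC ((diffForm f x ⋏ θ x + f x • extD θ x) ⋏ extD θ x
      - (f x • θ x) ⋏ extD (extD θ) x)
      ![mkC (F.T x) 0, conjC (F.Z β x), F.Z μ x, conjC (F.Z ν x)] =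
      -(I * (derivC f x (conjC (F.Z β x)) * F.h x μ ν
        - derivC f x (conjC (F.Z ν x)) * F.h x μ β)) := by
    intro μ ν
    have a1 := evalC_wedge_two_two (diffForm f x ⋏ θ x + f x • extD θ x) (extD θ x) (mkC (F.T x) 0)
      (conjC (F.Z β x)) (F.Z μ x) (conjC (F.Z ν x))
    have a2 := evalC_wedge_one_three (f x • θ x) (extD (extD θ) x) (mkC (F.T x) 0)
      (conjC (F.Z β x)) (F.Z μ x) (conjC (F.Z ν x))
    rw [hdd] at a2
    simp only [evalC_zero, mul_zero, sub_zero, add_zero] at a2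
    rw [evalC_sub]
    refine (congrArg₂ (· - ·) a1 ((congrArg (fun ζ => evalC (f x • θ x ⋏ ζ) _) hdd).trans a2)).trans ?_
    simp only [evalC_add, evalC_smul, evalC_wedge_one_one, ← derivC_eq, F.dtheta_Z_conj hx',
      F.dtheta_conj_conj _ _ hx', F.dtheta_conj_Z hx', F.dtheta_T' hx', F.theta_T' hx',
      hθ.theta_mem (F.Z_mem _ _ hx'), hθ.theta_conj (F.Z_mem _ _ hx')]
    ring
  rw [h2]
  have h5 : ∀ μ ν, evalC (F.form11 w x ⋏ F.form11 w' x
      - extD (gamma4 θ fun x => F.form11 w x ⋏ F.form11 w' x) x)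
      ![mkC (F.T x) 0, conjC (F.Z β x), F.Z μ x, conjC (F.Z ν x)] =
      I * ((F.div11 w ν x * w' μ β x + w μ β x * F.div11 w' ν x)
      - (F.div11 w β x * w' μ ν x + w μ ν x * F.div11 w' β x)
      + (derivC f x (conjC (F.Z β x)) * F.h x μ ν
        - derivC f x (conjC (F.Z ν x)) * F.h x μ β)) := by
    intro μ ν
    rw [evalC_sub, h1]
    refine (congrArg₂ (· - ·) (h3 μ ν) (h4 μ ν)).trans ?_
    ring
  simp only [h5]
  have a0 := F.hInv_h' hθ hx' 0 β
  have a1 := F.hInv_h' hθ hx' 1 β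
  have b0 := F.hInv_h' hθ hx' 0 0
  have b1 := F.hInv_h' hθ hx' 1 1
  have e : (if (0 : ι) = β then (1 : ℂ) else 0) * derivC f x (conjC (F.Z 0 x))
    + (if (1 : ι) = β then (1 : ℂ) else 0) * derivC f x (conjC (F.Z 1 x))
    = derivC f x (conjC (F.Z β x)) := by fin_cases β <;> simp
  have t := hw x hx
  have t' := hw' x hx
  have hI : ∀ g : ι → ι → ℂ, -I * ∑ μ, ∑ ν, F.hInv μ ν x * (I * g μ ν) =
      ∑ μ, ∑ ν, F.hInv μ ν x * g μ ν := by
    intro g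
    simp only [sum_two]
    linear_combination -(F.hInv 0 0 x * g 0 0 + F.hInv 0 1 x * g 0 1 + F.hInv 1 0 x * g 1 0
      + F.hInv 1 1 x * g 1 1) * I_sq
  rw [hI]
  simp only [sum_two, if_pos] at *
  linear_combination -F.div11 w β x * t' - F.div11 w' β x * t
    + derivC f x (conjC (F.Z β x)) * (b0 + b1) - derivC f x (conjC (F.Z 0 x)) * a0
    - derivC f x (conjC (F.Z 1 x)) * a1 - e

end PHFrame

end Manifold

section Algebra

variable {A : Type*} [CommRing A] [Algebra ℂ A]

namespace FrameSys

variable (G : FrameSys A)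

lemma con_h : G.toFD.con G.h = 2 := by
  have h0 := G.hI_h 0 0
  have h1 := G.hI_h 1 1
  change ∑ μ, ∑ ν, G.hI μ ν * G.h μ ν = 2
  simp only [sum_two, dl_00, dl_11] at *
  linear_combination h0 + h1

lemma con_wOf (a : ι → A) : G.toFD.con (G.toFD.wOf a) = 0 := by
  have h := G.con_h
  have k := two_mul_hh (A := A)
  change G.toFD.con (fun α β => G.toFD.cov1 tt ff α a β
    - G.h α β * (hh A * G.toFD.con fun μ ν => G.toFD.cov1 tt ff μ a ν)) = 0
  simp only [FrameData.con, sum_two] at *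
  linear_combination (-(hh A * (G.toFD.hI 0 0 * G.toFD.cov1 tt ff 0 a 0
    + G.toFD.hI 0 1 * G.toFD.cov1 tt ff 0 a 1 + (G.toFD.hI 1 0 * G.toFD.cov1 tt ff 1 a 0
    + G.toFD.hI 1 1 * G.toFD.cov1 tt ff 1 a 1)))) * h
    - ((G.toFD.hI 0 0 * G.toFD.cov1 tt ff 0 a 0
    + G.toFD.hI 0 1 * G.toFD.cov1 tt ff 0 a 1 + (G.toFD.hI 1 0 * G.toFD.cov1 tt ff 1 a 0
    + G.toFD.hI 1 1 * G.toFD.cov1 tt ff 1 a 1))) * k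

/-- The components of the Lee form. -/
def leeL (α β : ι) : A := FrameData.tr2 (G.low ff) (G.low tt) G.web.leeU α β

lemma con_leeL : G.toFD.con G.leeL = 0 := by
  have h00 := G.hI_h 0 0
  have h10 := G.hI_h 1 0
  have h01 := G.hI_h 0 1
  have h11 := G.hI_h 1 1
  have hl : G.web.leeU 0 0 + G.web.leeU 1 1 = 0 := by
    have k := two_mul_hh (A := A)
    simp only [Web.leeU, Web.rsc, sum_two, dl_00, dl_11]
    linear_combination (jj A * hh A * hh A * (G.web.ric 0 0 + G.web.ric 1 1)) * k
  change ∑ μ, ∑ ν, G.hI μ ν * G.leeL μ ν = 0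
  simp only [leeL, FrameData.tr2, low, sum_two, dl_00, dl_01, dl_10, dl_11] at *
  linear_combination G.web.leeU 0 0 * h00 + G.web.leeU 0 1 * h01 + G.web.leeU 1 0 * h10
      + G.web.leeU 1 1 * h11 + hl

/-- One sixth of the scalar curvature. -/
def pot : A := hh A * algebraMap ℂ A (1 / 3) * G.web.rsc

/-- The fourth order operator in components. -/
def Q (a : ι → A) (β : ι) : A := G.toFD.Qop G.pot G.leeL a β

end FrameSys

end Algebra

section Manifold

variable {k : ℕ} {M : Type*} {x : M} {U : Set M} {f : M → ℂ} [TopologicalSpace M] [ChartedSpace E5 M]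
  [IsManifold (𝓡 5) ∞ M]
variable {S : CRStructure M} {θ : Form M 1} {V : Opens M}

namespace PHFrame

variable (F : PHFrame S θ) (hθ : S.Contact θ) (hV : (V : Set M) ⊆ F.U) {x₀ : M}
  (hV' : (V : Set M) ⊆ (χ x₀).source)

lemma rep_mul {f g : M → ℂ} {a b : smoothAlg V} (hf : Rep f a) (hg : Rep g b) :
    Rep (fun x => f x * g x) (a * b) := fun x => by rw [map_mul, ← hf x, ← hg x]

lemma rep_trace {w : ι → ι → M → ℂ} {b : ι → ι → smoothAlg V}
    (h : ∀ α β, Rep (w α β) (b α β)) (hb : (F.sys hθ hV hV').toFD.con b = 0) :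
    ∀ x ∈ V, ∑ μ, ∑ ν, F.hInv μ ν x * w μ ν x = 0 := fun x hx => by
  have h1 := F.rep_con hθ hV hV' h ⟨x, hx⟩
  rw [hb, map_zero] at h1
  exact h1

lemma rep_prod00_11 {a : smoothAlg V} (hf : Rep f a)
    {w : ι → ι → M → ℂ} {b : ι → ι → smoothAlg V}
    (h : ∀ α β, Rep (w α β) (b α β)) (hb : (F.sys hθ hV hV').toFD.con b = 0) (α β : ι) :
    Rep (F.prod00_11 f w α β) (a * b α β) := fun x => by
  rw [F.prod00_11_eq hθ hV f w (F.rep_trace hθ hV hV' h hb) α β x.2, map_mul, ← hf x, ← h α β x]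

lemma rep_prod01_11 {u : ι → M → ℂ} {a : ι → smoothAlg V} (hu : ∀ β, Rep (u β) (a β))
    {w : ι → ι → M → ℂ} {b : ι → ι → smoothAlg V}
    (h : ∀ α β, Rep (w α β) (b α β)) (hb : (F.sys hθ hV hV').toFD.con b = 0) (γ β : ι) :
    Rep (F.prod01_11 u w γ β) ((F.sys hθ hV hV').toFD.prodUH a b γ β) := fun x => by
  have h1 : ∀ σ, Rep (fun x => I * ∑ μ, ∑ ν, F.hInv μ ν x * (u ν x * w μ σ x))
      (jj _ * (F.sys hθ hV hV').toFD.con fun α ν => a ν * b α σ) := by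
    intro σ y
    have h2 := F.rep_con hθ hV hV' (fun μ ν => rep_mul (hu ν) (h μ σ)) y
    rw [map_mul, ← h2, ev_jj]
  rw [F.prod01_11_eq hθ hV u w (F.rep_trace hθ hV hV' h hb) _ (fun β => (h1 β).smooth)
    (fun _ _ _ => rfl) γ β x.2]
  have c : ∀ s β, F.cov01 (fun σ x => I * ∑ μ, ∑ ν, F.hInv μ ν x * (u ν x * w μ σ x))
      (.inr s) β x = I * ev x ((F.sys hθ hV hV').toFD.cov1 tt tt s
        (fun σ => (F.sys hθ hV hV').toFD.con fun α ν => a ν * b α σ) β) := by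
    intro s β
    have h3 := F.rep_cov01 hθ hV hV' h1 tt s β x
    refine h3.trans ?_
    rw [← ev_jj x, ← map_mul]
    congr 1
    simp only [FrameData.cov1, c1, leibniz, derivation_jj, smul_eq_mul,
      sum_two]
    ring
  rw [c, c]
  have d := fun β => F.rep_div11 hθ hV hV' h β x
  simp only [FrameData.prodUH, map_sub, map_mul, map_add, ← d, ← hu _ x, ev_jj]
  ring

lemma rep_prod11_11 {w' : ι → ι → M → ℂ} {b' : ι → ι → smoothAlg V}
    (h' : ∀ α β, Rep (w' α β) (b' α β)) (hb' : (F.sys hθ hV hV').toFD.con b' = 0)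
    {w : ι → ι → M → ℂ} {b : ι → ι → smoothAlg V}
    (h : ∀ α β, Rep (w α β) (b α β)) (hb : (F.sys hθ hV hV').toFD.con b = 0) (β : ι) :
    Rep (F.prod11_11 w' w β) ((F.sys hθ hV hV').toFD.prodHW b' b β) := fun x => by
  have h1 : Rep (fun x => 1 / 2 * ∑ m, ∑ n, F.hInv m n x * ∑ m', ∑ n', F.hInv m' n' x *
      (w' m n' x * w m' n x)) (hh _ * (F.sys hθ hV hV').toFD.con fun m n =>
        (F.sys hθ hV hV').toFD.con fun m' n' => b' m n' * b m' n) := by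
    intro y
    have h2 := F.rep_con hθ hV hV' (fun m n => F.rep_con hθ hV hV'
      (fun m' n' => rep_mul (h' m n') (h m' n))) y
    rw [map_mul, ← h2, ev_hh]
  rw [F.prod11_11_eq hθ hV w' w (F.rep_trace hθ hV hV' h' hb') (F.rep_trace hθ hV hV' h hb) _
    h1.smooth (fun _ _ => rfl) β x.2]
  have d := fun β => F.rep_div11 hθ hV hV' h β
  have d' := fun β => F.rep_div11 hθ hV hV' h' β
  have c1 := F.rep_con hθ hV hV' (fun α ν => rep_mul (h α β) (d' ν)) x
  have c2 := F.rep_con hθ hV hV' (fun α ν => rep_mul (h' α β) (d ν)) x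
  have c3 := F.rep_deriv hθ hV hV' h1 tt β x
  rw [leibniz, derivation_hh, smul_zero, add_zero, smul_eq_mul] at c3
  simp only [FrameData.prodHW, map_add, ← c1, ← c2, ← c3]
  rfl

/-- The fourth order operator in terms of the frame data. -/
lemma rep_qComp {u : ι → M → ℂ} {a : ι → smoothAlg V} (h : ∀ β, Rep (u β) (a β))
    (β : ι) : Rep (F.qComp u β) ((F.sys hθ hV hV').Q a β) := fun x => by
  have hw := F.rep_db01 hθ hV hV' h
  have tw := (F.sys hθ hV hV').con_wOf a
  have hl : ∀ α β, Rep (F.lee α β) ((F.sys hθ hV hV').leeL α β) := F.rep_lee hθ hV hV'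
  have tl := (F.sys hθ hV hV').con_leeL
  have hr : Rep (fun x => F.scal x / 6) (F.sys hθ hV hV').pot := by
    intro y
    have h1 : ev y (algebraMap ℂ (smoothAlg V) (1 / 3)) = 1 / 3 := by rw [AlgHom.commutes]; rfl
    rw [FrameSys.pot, map_mul, map_mul, ev_hh, h1]
    change F.scal y / 6 = _
    rw [F.rep_scal hθ hV hV' y]
    ring
  have hs : ∀ {w : ι → ι → M → ℂ} {b : ι → ι → smoothAlg V}
      (h : ∀ α β, Rep (w α β) (b α β)) (β : ι),
      Rep (F.dbStar11 w β) (-(F.sys hθ hV hV').toFD.divU b β) := by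
    intro w b h β y
    have h1 := F.rep_div11 hθ hV hV' (w := star11 w) (a := fun α β => -b α β)
      (fun α β z => by rw [map_neg, ← h α β z]; rfl) β y
    have h2 : (F.sys hθ hV hV').toFD.divU (fun α β => -b α β) β =
        -(F.sys hθ hV hV').toFD.divU b β := by
      simp only [FrameData.divU, FrameData.con, FrameData.cov2, c2, map_neg, sum_two]
      ring
    rw [← h2, ← h1]
    change I * (-I * F.div11 (star11 w) β y) = _
    linear_combination -F.div11 (star11 w) β y * I_sq
  have hs' : ∀ {w : ι → ι → M → ℂ} {b : ι → ι → smoothAlg V}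
      (h : ∀ α β, Rep (w α β) (b α β)) (β : ι),
      Rep (F.dbbarStar11 w β) ((F.sys hθ hV hV').toFD.divL b β) := by
    intro w b h β y
    have h1 := F.rep_divBar11 hθ hV hV' (w := star11 w) (a := fun α β => -b α β)
      (fun α β z => by rw [map_neg, ← h α β z]; rfl) β y
    have h2 : (F.sys hθ hV hV').toFD.divL (fun α β => -b α β) β =
        -(F.sys hθ hV hV').toFD.divL b β := by
      simp only [FrameData.divL, FrameData.con, FrameData.cov2, c2, map_neg, sum_two]
      ring
    rw [h2, map_neg] at h1
    change -I * (-I * F.divBar11 (star11 w) β y) = _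
    linear_combination F.divBar11 (star11 w) β y * I_sq - h1
  have hlap : ∀ α β, Rep ((F.db01 (F.dbStar11 (F.db01 u)) + F.dbbar10 (F.dbbarStar11 (F.db01 u))
      + F.prod00_11 (fun x => F.scal x / 6) (F.db01 u)) α β)
      ((F.sys hθ hV hV').toFD.lapl (F.sys hθ hV hV').pot ((F.sys hθ hV hV').toFD.wOf a) α β) := by
    intro α β y
    have a1 := F.rep_db01 hθ hV hV' (hs hw) α β y
    have a2 := F.rep_dbbar10 hθ hV hV' (hs' hw) α β y
    have a3 := F.rep_prod00_11 hθ hV hV' hr hw tw α β y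
    have e : (F.sys hθ hV hV').toFD.wOf
        (fun β => -(F.sys hθ hV hV').toFD.divU ((F.sys hθ hV hV').toFD.wOf a) β) α β =
        -(F.sys hθ hV hV').toFD.wOf
        ((F.sys hθ hV hV').toFD.divU ((F.sys hθ hV hV').toFD.wOf a)) α β := by
      generalize (F.sys hθ hV hV').toFD.divU ((F.sys hθ hV hV').toFD.wOf a) = v
      simp only [FrameData.wOf, FrameData.con, FrameData.cov1, c1, map_neg, sum_two]
      ring
    rw [e] at a1
    change F.db01 (F.dbStar11 (F.db01 u)) α β y + F.dbbar10 (F.dbbarStar11 (F.db01 u)) α β y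
      + F.prod00_11 (fun x => F.scal x / 6) (F.db01 u) α β y = _
    rw [a1, a2, a3, FrameData.lapl, sub_eq_add_neg, map_add, map_add]
  have q1 := hs hlap β x
  have q2 := F.rep_prod11_11 hθ hV hV' hl tl hw tw β x
  have q3 := F.rep_db12 hθ hV hV' (fun γ β => F.rep_prod01_11 hθ hV hV' h hl tl γ β) β x
  have e : F.qComp u β x = -I * F.dbStar11 (F.db01 (F.dbStar11 (F.db01 u))
      + F.dbbar10 (F.dbbarStar11 (F.db01 u)) + F.prod00_11 (fun x => F.scal x / 6) (F.db01 u)) β x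
      + 2 * F.prod11_11 F.lee (F.db01 u) β x - F.db12 (F.prod01_11 u F.lee) β x := rfl
  rw [e, q1, q2, q3]
  simp only [FrameSys.Q, FrameData.Qop, map_sub, map_add, map_mul, ev_jj, map_neg, map_ofNat]
  ring

end PHFrame

end Manifold

section Algebra

variable {A : Type*} [CommRing A] [Algebra ℂ A]

namespace FrameSys

variable (G G' : FrameSys A)

/-- Raising an index. -/
def up (a : ι → A) (p : ι) : A := ∑ ν, G.hI p ν * a ν

lemma tr1_low_up (a : ι → A) : FrameData.tr1 (G.low tt) (G.up a) = a := by
  funext ν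
  have h0 := G.hI_h' 0 ν
  have h1 := G.hI_h' 1 ν
  have e : dl 0 ν * a 0 + dl 1 ν * a 1 = a ν := by fin_cases ν <;> simp [dl]
  simp only [FrameData.tr1, low, up, sum_two] at *
  linear_combination a 0 * h0 + a 1 * h1 + e

lemma Q_low (a : ι → A) : G.Q (FrameData.tr1 (G.low tt) a) =
    FrameData.tr1 (G.low tt) (G.web.Qop G.pot G.web.leeU a) := by
  have h := G.gauge.Qop G.pot G.web.leeU a
  rw [Web.toFrameData_Qop] at h
  exact h

lemma Lop_low (a : ι → A) : G.toFD.Lop (FrameData.tr1 (G.low tt) a) =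
    FrameData.tr1 (G.low tt) (G.web.Lop a) := by
  have h := G.gauge.Lop a
  rw [Web.toFrameData_Lop] at h
  exact h

/-- Change of frame. -/
structure Change (a b : ι → ι → A) : Prop where
  X_false : ∀ i f, G'.X ff i f = ∑ p, a i p * G.X ff p f
  X_true : ∀ i f, G'.X tt i f = ∑ p, b i p * G.X tt p f
  T : ∀ f, G'.T f = G.T f
  h : ∀ i j, G'.h i j = ∑ p, ∑ q, a i p * b j q * G.h p q

namespace Change

variable {G G'} {a b : ι → ι → A}

/-- The induced change of the frame `Z_i`, `Z^i`. -/
def mat (G G' : FrameSys A) (a b : ι → ι → A) (s : Bool) (j p : ι) : A :=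
  match s with
  | false => a j p
  | true => ∑ ν, ∑ σ, G'.hI j ν * b ν σ * G.h p σ

lemma left (C : Change G G' a b) (i j : ι) :
    ∑ l, mat G G' a b ff i l * mat G G' a b tt j l = dl i j := by
  have h0 := C.h i 0
  have h1 := C.h i 1
  have h := G'.hI_h j i
  rw [dl_comm i j, ← h]
  simp only [mat, sum_two] at *
  linear_combination -G'.hI j 0 * h0 - G'.hI j 1 * h1

lemma right (C : Change G G' a b) (i j : ι) :
    ∑ l, mat G G' a b ff l i * mat G G' a b tt l j = dl i j := by
  have h : (Matrix.of (mat G G' a b ff)) * (Matrix.of (mat G G' a b tt)).transpose = 1 := by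
    ext i j
    rw [Matrix.mul_apply, Matrix.one_apply]
    exact C.left i j
  have h1 := mul_eq_one_comm.1 h
  have h2 := congrFun (congrFun h1 j) i
  rw [Matrix.mul_apply, Matrix.one_apply] at h2
  rw [dl_comm, dl, ← h2]
  exact Finset.sum_congr rfl fun _ _ => mul_comm _ _

lemma web (C : Change G G' a b) : Web.Change G.web G'.web (mat G G' a b) where
  E s i f := by
    cases s
    · exact C.X_false i f
    · have h0 := C.X_true 0 f
      have h1 := C.X_true 1 f
      have x0 := G.X_true 0 f
      have x1 := G.X_true 1 f
      change G'.EE tt i f = ∑ p, mat G G' a b tt i p * G.EE tt p f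
      rw [G'.EE_true]
      simp only [mat, sum_two] at *
      rw [h0, h1, x0, x1]
      ring
  T := C.T
  left := C.left
  right := C.right

lemma low_mat (_ : Change G G' a b) (u : ι → A) :
    FrameData.tr1 (G'.low tt) (FrameData.tr1 (mat G G' a b tt) u) =
      FrameData.tr1 b (FrameData.tr1 (G.low tt) u) := by
  funext ν
  have h0 := G'.hI_h' 0 ν
  have h1 := G'.hI_h' 1 ν
  have e : ∀ y : ι → A, dl 0 ν * y 0 + dl 1 ν * y 1 = y ν := by
    intro y; fin_cases ν <;> simp [dl]
  have e1 := e (fun ν => ∑ p, ∑ σ, b ν σ * G.h p σ * u p)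
  simp only [FrameData.tr1, low, mat, sum_two] at *
  linear_combination e1
    + ((b 0 0 * G.h 0 0 + b 0 1 * G.h 0 1) * u 0 + (b 0 0 * G.h 1 0 + b 0 1 * G.h 1 1) * u 1) * h0
    + ((b 1 0 * G.h 0 0 + b 1 1 * G.h 0 1) * u 0 + (b 1 0 * G.h 1 0 + b 1 1 * G.h 1 1) * u 1) * h1

lemma pot (C : Change G G' a b) : G'.pot = G.pot := by
  rw [FrameSys.pot, FrameSys.pot, C.web.rsc]

lemma Q (C : Change G G' a b) (u : ι → A) :
    G'.Q (FrameData.tr1 b u) = FrameData.tr1 b (G.Q u) := by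
  rw [← G.tr1_low_up u, ← C.low_mat, Q_low, Q_low, ← C.low_mat, C.pot, C.web.leeU,
    ← Web.toFrameData_Qop, ← Web.toFrameData_Qop, C.web.gauge.Qop]

lemma Lop (C : Change G G' a b) (u : ι → A) :
    G'.toFD.Lop (FrameData.tr1 b u) = FrameData.tr1 b (G.toFD.Lop u) := by
  rw [← G.tr1_low_up u, ← C.low_mat, Lop_low, Lop_low, ← C.low_mat,
    ← Web.toFrameData_Lop, ← Web.toFrameData_Lop, C.web.gauge.Lop]

end Change

/-- Conformal change of the contact form, for a fixed frame. -/
structure Scale (f ε e : A) : Prop where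
  X : ∀ s i g, G'.X s i g = G.X s i g
  T : ∃ x y : ι → A, ∀ g, G'.T g =
    ε * (G.T g + ∑ k, x k * G.X ff k g + ∑ k, y k * G.X tt k g)
  h : ∀ i j, G'.h i j = e * G.h i j
  unit : e * ε = 1
  X_eps : ∀ s i, G.X s i ε = -(ε * G.X s i f)

namespace Scale

variable {G G'} {f ε e : A}

lemma hI (C : Scale G G' f ε e) (i j : ι) : G'.hI i j = ε * G.hI i j := by
  have key : ∀ γ, ∑ ν, (G'.hI i ν - ε * G.hI i ν) * G'.h γ ν = 0 := by
    intro γ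
    have h0 := G'.hI_h i γ
    have h1 := G.hI_h i γ
    have h2 := C.h γ 0
    have h3 := C.h γ 1
    simp only [sum_two] at *
    linear_combination h0 - ε * G.hI i 0 * h2 - ε * G.hI i 1 * h3 - e * ε * h1
      - dl i γ * C.unit
  have k0 := key 0
  have k1 := key 1
  have b0 := G'.hI_h' j 0
  have b1 := G'.hI_h' j 1
  have ee : ∀ y : ι → A, dl j 0 * y 0 + dl j 1 * y 1 = y j := by
    intro y; fin_cases j <;> simp [dl]
  have e1 := ee (fun j => G'.hI i j - ε * G.hI i j)
  simp only [sum_two] at *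
  linear_combination -e1 + G'.hI 0 j * k0 + G'.hI 1 j * k1
    - (G'.hI i 0 - ε * G.hI i 0) * b0 - (G'.hI i 1 - ε * G.hI i 1) * b1

lemma web (C : Scale G G' f ε e) : Web.Conf G.web G'.web f ε where
  E_false i g := C.X ff i g
  E_true i g := by
    change G'.EE tt i g = ε * G.EE tt i g
    rw [EE_true, EE_true, C.X, C.X, C.hI, C.hI]; ring
  T_eq := by
    obtain ⟨x, y, hT⟩ := C.T
    refine ⟨x, fun p => ∑ ν, y ν * G.h p ν, fun g => ?_⟩
    have x0 := G.X_true 0 g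
    have x1 := G.X_true 1 g
    change G'.T g = ε * (G.T g + ∑ k, x k * G.X ff k g
      + ∑ k, (∑ ν, y ν * G.h k ν) * G.EE tt k g)
    rw [hT]
    simp only [sum_two] at *
    rw [x0, x1]; ring
  E_eps s i := by
    cases s
    · exact C.X_eps ff i
    · change G.EE tt i ε = -(ε * G.EE tt i f)
      rw [EE_true, EE_true, C.X_eps, C.X_eps]; ring
  unit := IsUnit.of_mul_eq_one e (by rw [mul_comm]; exact C.unit)

lemma closed_up {u : ι → A} (hu : ∀ i j, G.toFD.cov1 tt tt i u j =
    G.toFD.cov1 tt tt j u i) : G.web.Closed (G.up u) := by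
  have h1 : ∀ i j, G.toFD.cov1 tt tt i u j =
      ∑ p, ∑ q, G.h p i * G.h q j * G.web.d1 tt tt p (G.up u) q := by
    intro i j
    have h := G.gauge.cov1 tt tt i (G.up u) j
    rw [tr1_low_up] at h
    exact h
  have h2 := hu 0 1
  rw [h1, h1] at h2
  have hdet : (G.hI 0 0 * G.hI 1 1 - G.hI 0 1 * G.hI 1 0)
      * (G.h 0 0 * G.h 1 1 - G.h 0 1 * G.h 1 0) = 1 := by
    have a := G.hI_h 0 0
    have b := G.hI_h 0 1
    have c := G.hI_h 1 0
    have d := G.hI_h 1 1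
    simp only [sum_two, dl_00, dl_01, dl_10, dl_11] at *
    linear_combination (G.hI 1 0 * G.h 1 0 + G.hI 1 1 * G.h 1 1) * a + d
      - (G.hI 1 0 * G.h 0 0 + G.hI 1 1 * G.h 0 1) * b
  have h3 : G.web.d1 tt tt 0 (G.up u) 1 = G.web.d1 tt tt 1 (G.up u) 0 := by
    simp only [sum_two] at h2
    linear_combination (G.hI 0 0 * G.hI 1 1 - G.hI 0 1 * G.hI 1 0) * h2
      - (G.web.d1 tt tt 0 (G.up u) 1 - G.web.d1 tt tt 1 (G.up u) 0) * hdet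
  intro i j
  fin_cases i <;> fin_cases j
  · rfl
  · exact h3
  · exact h3.symm
  · rfl

/-- The transformation law. -/
lemma Q (C : Scale G G' f ε e) {u : ι → A} (hu : ∀ i j, G.toFD.cov1 tt tt i u j =
    G.toFD.cov1 tt tt j u i) (β : ι) :
    G'.Q u β = ε * ε * (G.Q u β + G.toFD.Lop (fun m => f * u m) β) := by
  have h1 := fun β => C.web.Qop (closed_up hu) β
  have e1 : FrameData.tr1 (G'.low tt) (fun m => ε * G.up u m) = u := by
    have : (fun m => ε * G.up u m) = G'.up u := by
      funext m
      simp only [up, C.hI, sum_two]; ring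
    rw [this, tr1_low_up]
  have e2 : FrameData.tr1 (G.low tt) (fun m => f * G.up u m) = fun m => f * u m := by
    have : (fun m => f * G.up u m) = G.up (fun m => f * u m) := by
      funext m
      simp only [up, sum_two]; ring
    rw [this, tr1_low_up]
  have h2 := congrFun (G'.Q_low (fun m => ε * G.up u m)) β
  have h3 := congrFun (G.Q_low (G.up u)) β
  have h4 := congrFun (G.Lop_low (fun m => f * G.up u m)) β
  rw [e1] at h2
  rw [tr1_low_up] at h3
  rw [e2] at h4
  rw [h2, h3, h4]
  have a0 := h1 0
  have a1 := h1 1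
  have b0 := C.h 0 β
  have b1 := C.h 1 β
  simp only [FrameData.tr1, low, sum_two, pot] at *
  rw [a0, a1, b0, b1]
  linear_combination (ε * ε * (G.h 0 β * (G.web.Qop (hh A * algebraMap ℂ A (1 / 3) * G.web.rsc)
      G.web.leeU (G.up u) 0 + G.web.Lop (fun m => f * G.up u m) 0)
    + G.h 1 β * (G.web.Qop (hh A * algebraMap ℂ A (1 / 3) * G.web.rsc) G.web.leeU (G.up u) 1
      + G.web.Lop (fun m => f * G.up u m) 1))) * C.unit

end Scale

end FrameSys

end Algebra

section Manifold

variable {k : ℕ} {M : Type*} {x : M} {U : Set M} {f : M → ℂ} [TopologicalSpace M] [ChartedSpace E5 M]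
  [IsManifold (𝓡 5) ∞ M]
variable {S : CRStructure M} {θ : Form M 1}

/-- `θ ∧ ζ ∧ dθ` is linear in `ζ`. -/
lemma sum_wedge {V : Type*} [AddCommGroup V] [Module ℝ V] [TopologicalSpace V] [Module.Finite ℝ V]
    (t : V [⋀^Fin 1]→L[ℝ] ℂ) (b : V [⋀^ι]→L[ℝ] ℂ) (c : ι → ℂ)
    (ζ : ι → V [⋀^Fin 1]→L[ℝ] ℂ) :
    ∑ β, c β • (t ⋏ ζ β ⋏ b) = t ⋏ (∑ β, c β • ζ β) ⋏ b := by
  refine form_four_ext fun v₁ v₂ v₃ v₄ => ?_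
  have h : ∀ η : V [⋀^Fin 1]→L[ℝ] ℂ, evalC (t ⋏ η ⋏ b) ![v₁, v₂, v₃, v₄] = _ := fun η =>
    evalC_wedge_two_two (t ⋏ η) b v₁ v₂ v₃ v₄
  rw [evalC_sum]
  simp only [evalC_smul]
  refine Eq.trans ?_ (h _).symm
  refine (Finset.sum_congr rfl fun β _ => congrArg (c β * ·) (h (ζ β))).trans ?_
  simp only [evalC_wedge_one_one, evalC_add, evalC_smul, sum_two]
  ring

namespace PHFrame

lemma form22_eq (F : PHFrame S θ) (c : ι → M → ℂ) (x : M) :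
    F.form22 c x = θ x ⋏ (∑ β, c β x • conjForm (F.φ β x)) ⋏ extD θ x :=
  sum_wedge _ _ (fun β => c β x) fun β => conjForm (F.φ β x)

variable (F F' : PHFrame S θ)

section Pointwise

variable {x : M}

lemma φbar_mem {W : CTangent x} (hx : x ∈ F.U) (hW : W ∈ S.T10 x) (α : ι) :
    evalC (conjForm (F.φ α x)) ![W] = 0 := by
  have h := evalC_conj_one (F.φ α x) (conjC W)
  rw [conjC_conjC, F.φ_conj α x hx W hW, map_zero] at h; exact h

lemma conj_mem {W : CTangent x} (hx : x ∈ F.U) (hW : W ∈ S.T10 x) :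
    conjC W = ∑ α, evalC (conjForm (F.φ α x)) ![conjC W] • conjC (F.Z α x) := by
  conv_lhs => rw [F.mem_T10 hx hW]
  rw [sum_two, sum_two, conjC_add, conjC_smul, conjC_smul, evalC_conj_one,
    evalC_conj_one]

lemma T_unique (hθ : S.Contact θ) (hx : x ∈ F.U) (hx' : x ∈ F'.U) :
    mkC (F'.T x) 0 = mkC (F.T x) 0 := by
  have h1 : ∀ β, ∑ α, evalC (F.φ α x) ![mkC (F'.T x) 0] * F.h x α β = 0 := by
    intro β
    have h := F'.dtheta_T' hx' (conjC (F.Z β x))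
    rw [F.evalC_dtheta hx] at h
    simp only [F.φ_conj' _ _ hx, F.φbar_conj _ _ hx] at h
    have h2 : I * ∑ α, evalC (F.φ α x) ![mkC (F'.T x) 0] * F.h x α β = 0 := by
      rw [← h]; fin_cases β <;> simp <;> ring
    exact (mul_eq_zero.1 h2).resolve_left I_ne_zero
  have h2 : ∀ α, evalC (F.φ α x) ![mkC (F'.T x) 0] = 0 := by
    intro α
    have a0 := F.hInv_h hθ hx α 0
    have a1 := F.hInv_h hθ hx α 1
    have b0 := h1 0
    have b1 := h1 1
    have e : (if α = 0 then (1 : ℂ) else 0) * evalC (F.φ 0 x) ![mkC (F'.T x) 0]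
      + (if α = 1 then (1 : ℂ) else 0) * evalC (F.φ 1 x) ![mkC (F'.T x) 0]
      = evalC (F.φ α x) ![mkC (F'.T x) 0] := by fin_cases α <;> simp
    simp only [sum_two] at *
    linear_combination F.hInv α 0 x * b0 + F.hInv α 1 x * b1 - e
      - evalC (F.φ 0 x) ![mkC (F'.T x) 0] * a0 - evalC (F.φ 1 x) ![mkC (F'.T x) 0] * a1
  have h3 : ∀ α, evalC (conjForm (F.φ α x)) ![mkC (F'.T x) 0] = 0 := by
    intro α
    have h := evalC_conj_one (F.φ α x) (mkC (F'.T x) 0)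
    rw [conjC_mkC_zero, h2, map_zero] at h; exact h
  have h4 := F.expand hθ hx (mkC (F'.T x) 0)
  rw [Fintype.sum_option, Fintype.sum_sum_type] at h4
  refine h4.trans ?_
  change evalC (θ x) ![mkC (F'.T x) 0] • mkC (F.T x) 0
    + (∑ α, evalC (F.φ α x) ![mkC (F'.T x) 0] • F.Z α x
    + ∑ α, evalC (conjForm (F.φ α x)) ![mkC (F'.T x) 0] • conjC (F.Z α x)) = _
  simp only [h2, h3, F'.theta_T' hx', sum_two, zero_smul, one_smul, add_zero]

lemma h_change (hx : x ∈ F.U) (hx' : x ∈ F'.U) (i j : ι) :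
    F'.h x i j = ∑ p, ∑ q, evalC (F.φ p x) ![F'.Z i x]
      * evalC (conjForm (F.φ q x)) ![conjC (F'.Z j x)] * F.h x p q := by
  have h := F'.dtheta_Z_conj hx' i j
  rw [F.evalC_dtheta hx] at h
  have e1 : ∀ α, evalC (F.φ α x) ![conjC (F'.Z j x)] = 0 := fun α =>
    F.φ_conj α x hx _ (F'.Z_mem j x hx')
  simp only [e1, zero_mul, sub_zero] at h
  refine mul_left_cancel₀ I_ne_zero (h.symm.trans ?_)
  simp only [sum_two]; ring

lemma φbar_change (hθ : S.Contact θ) (hx : x ∈ F.U) (hx' : x ∈ F'.U) (q : ι) :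
    conjForm (F.φ q x) = ∑ j, evalC (conjForm (F.φ q x)) ![conjC (F'.Z j x)] • conjForm (F'.φ j x) := by
  have h := (F'.cframe hθ).form_eq (fun y => conjForm (F.φ q y)) hx'
  rw [Fintype.sum_option, Fintype.sum_sum_type] at h
  refine h.trans ?_
  change evalC (conjForm (F.φ q x)) ![mkC (F'.T x) 0] • θ x
    + (∑ α, evalC (conjForm (F.φ q x)) ![F'.Z α x] • F'.φ α x
    + ∑ α, evalC (conjForm (F.φ q x)) ![conjC (F'.Z α x)] • conjForm (F'.φ α x)) = _
  rw [F.T_unique F' hθ hx hx', F.φbar_T _ hx]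
  simp only [F.φbar_mem hx (F'.Z_mem _ x hx')]
  simp only [sum_two]
  module

lemma form22_change (hθ : S.Contact θ) (hx : x ∈ F.U) (hx' : x ∈ F'.U)
    (c c' : ι → M → ℂ)
    (h : ∀ j, c' j x = ∑ q, evalC (conjForm (F.φ q x)) ![conjC (F'.Z j x)] * c q x) :
    F.form22 c x = F'.form22 c' x := by
  rw [form22_eq, form22_eq]
  congr 2
  rw [sum_two, F.φbar_change F' hθ hx hx' 0, F.φbar_change F' hθ hx hx' 1]
  simp only [h, sum_two]
  module

lemma comp01_change (hx : x ∈ F.U) (hx' : x ∈ F'.U) (η : Form M 1) (j : ι) :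
    F'.comp01 η j x = ∑ q, evalC (conjForm (F.φ q x)) ![conjC (F'.Z j x)] * F.comp01 η q x := by
  rw [comp01, F.conj_mem hx (F'.Z_mem j x hx'), ← lin1_apply, map_sum]
  simp only [map_smul, lin1_apply, smul_eq_mul]
  refine Finset.sum_congr rfl fun q _ => ?_
  rw [← F.conj_mem hx (F'.Z_mem j x hx')]
  rfl

end Pointwise

section Change

variable {V : Opens M} (hθ : S.Contact θ) (hV : (V : Set M) ⊆ F.U)
  (hW : (V : Set M) ⊆ F'.U) {x₀ : M} (hV' : (V : Set M) ⊆ (χ x₀).source)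

/-- The matrix of a change of frame. -/
def chg (i p : ι) : smoothAlg V :=
  res (fun y => evalC (F.φ p y) ![F'.Z i y])
    (smoothFun_evalC_one V.isOpen ((F.φ_smooth p).mono hV) ((F'.Z_smooth i).mono hW))

/-- The conjugate matrix. -/
def chgBar (i p : ι) : smoothAlg V :=
  res (fun y => evalC (conjForm (F.φ p y)) ![conjC (F'.Z i y)])
    (smoothFun_evalC_one V.isOpen ((smoothForm_conj (F.φ_smooth p)).mono hV)
      ((smoothCVF_conj F'.isOpen_U (F'.Z_smooth i)).mono hW))

lemma derivC_sum_smul (f : M → ℂ) (x : M) (c : ι → ℂ) (v : ι → CTangent x) :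
    derivC f x (∑ i, c i • v i) = ∑ i, c i * derivC f x (v i) := by
  simp only [derivC_eq]
  rw [← lin1_apply, map_sum]
  simp only [map_smul, lin1_apply, smul_eq_mul]

lemma change : FrameSys.Change (F.sys hθ hV hV') (F'.sys hθ hW hV') (F.chg F' hV hW)
    (F.chgBar F' hV hW) where
  X_false i f := ev_ext fun x => by
    rw [map_sum]
    simp only [map_mul]
    change derivC (extZ f.1) x (F'.Z i x) =
      ∑ p, evalC (F.φ p x) ![F'.Z i x] * derivC (extZ f.1) x (F.Z p x)
    rw [← derivC_sum_smul, ← F.mem_T10 (hV x.2) (F'.Z_mem i x (hW x.2))]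
  X_true i f := ev_ext fun x => by
    rw [map_sum]
    simp only [map_mul]
    change derivC (extZ f.1) x (conjC (F'.Z i x)) =
      ∑ p, evalC (conjForm (F.φ p x)) ![conjC (F'.Z i x)] * derivC (extZ f.1) x (conjC (F.Z p x))
    rw [← derivC_sum_smul, ← F.conj_mem (hV x.2) (F'.Z_mem i x (hW x.2))]
  T f := ev_ext fun x => by
    change derivC (extZ f.1) x (mkC (F'.T x) 0) = derivC (extZ f.1) x (mkC (F.T x) 0)
    rw [F.T_unique F' hθ (hV x.2) (hW x.2)]
  h i j := ev_ext fun x => by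
    simp only [map_sum, map_mul]
    exact F.h_change F' (hV x.2) (hW x.2) i j

end Change

lemma smooth_comp01 {V : Set M} (hV : V ⊆ F.U) (hVo : IsOpen V) {η : Form M 1}
    (hη : SmoothForm η V) (β : ι) : SmoothFun (F.comp01 η β) V :=
  smoothFun_evalC_one hVo hη ((smoothCVF_conj F.isOpen_U (F.Z_smooth β)).mono hV)

/-- The operators do not depend on the frame. -/
lemma frame_indep (hθ : S.Contact θ) (hx : x ∈ F.U) (hx' : x ∈ F'.U)
    {η : Form M 1} (hη : SmoothForm η Set.univ) :
    F.form22 (F.qComp (F.comp01 η)) x = F'.form22 (F'.qComp (F'.comp01 η)) x ∧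
    F.form22 (F.lComp (F.comp01 η)) x = F'.form22 (F'.lComp (F'.comp01 η)) x := by
  let V : Opens M := ⟨F.U ∩ F'.U ∩ (χ x).source,
    (F.isOpen_U.inter F'.isOpen_U).inter (isOpen_extChartAt_source x)⟩
  have hV : (V : Set M) ⊆ F.U := fun y hy => hy.1.1
  have hW : (V : Set M) ⊆ F'.U := fun y hy => hy.1.2
  have hV' : (V : Set M) ⊆ (χ x).source := fun y hy => hy.2
  have hxV : x ∈ V := ⟨⟨hx, hx'⟩, mem_extChartAt_source x⟩
  have hηV : SmoothForm η V := hη.mono (Set.subset_univ _)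
  have C := F.change F' hθ hV hW hV'
  set a : ι → smoothAlg V := fun β => res (F.comp01 η β) (F.smooth_comp01 hV V.isOpen hηV β)
  have r1 : ∀ β, Rep (F.comp01 η β) (a β) := fun β => rep_res _ _
  have r2 : ∀ β, Rep (F'.comp01 η β) (FrameData.tr1 (F.chgBar F' hV hW) a β) := by
    intro β y
    simp only [FrameData.tr1, map_sum, map_mul]
    exact F.comp01_change F' (hV y.2) (hW y.2) η β
  constructor
  · refine F.form22_change F' hθ hx hx' _ _ fun j => ?_
    have h1 := F'.rep_qComp hθ hW hV' r2 j ⟨x, hxV⟩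
    rw [C.Q] at h1
    refine h1.trans ?_
    simp only [FrameData.tr1, map_sum, map_mul]
    exact Finset.sum_congr rfl fun q _ => congrArg (_ * ·) (F.rep_qComp hθ hV hV' r1 q ⟨x, hxV⟩).symm
  · refine F.form22_change F' hθ hx hx' _ _ fun j => ?_
    have h1 := F'.rep_lComp hθ hW hV' r2 j ⟨x, hxV⟩
    rw [C.Lop] at h1
    refine h1.trans ?_
    simp only [FrameData.tr1, map_sum, map_mul]
    exact Finset.sum_congr rfl fun q _ => congrArg (_ * ·) (F.rep_lComp hθ hV hV' r1 q ⟨x, hxV⟩).symm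

end PHFrame

lemma smoothFun_ofReal {Υ : M → ℝ} (hΥ : ContMDiff (𝓡 5) 𝓘(ℝ, ℝ) ∞ Υ) (U : Set M) :
    SmoothFun (fun y => (Υ y : ℂ)) U :=
  (Complex.ofRealCLM.contDiff.contMDiff.comp hΥ).contMDiffOn

lemma SmoothFun.cexp (hf : SmoothFun f U) :
    SmoothFun (fun y => exp (f y)) U :=
  ((Complex.contDiff_exp (𝕜 := ℝ) (n := ∞)).contMDiff.contMDiffOn (s := Set.univ)).comp hf
    (fun _ _ => Set.mem_univ _)

lemma derivC_cexp (hU : IsOpen U) (hf : SmoothFun f U)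
    (hx : x ∈ U) (v : CTangent x) :
    derivC (fun y => exp (f y)) x v = exp (f x) * derivC f x v := by
  have h1 : ∀ w : TM x, diffFun (fun y => exp (f y)) x w =
      exp (f x) * diffFun f x w := by
    intro w
    have h := hf.contMDiffAt (hU.mem_nhds hx)
    have h' := hf.cexp.contMDiffAt (hU.mem_nhds hx)
    have hd : DifferentiableAt ℝ (f ∘ (χ x).symm) (χ x x) :=
      ((smoothFun_iff hU).1 hf x hx).differentiableAt (by simp)
    have e1 := diffFun_eq h'
    have e2 := diffFun_eq h
    have e3 := hd.hasFDerivAt.cexp.fderiv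
    have e4 : (f ∘ (χ x).symm) (χ x x) = f x := by
      simp
    rw [e4] at e3
    have e5 := (e1.trans e3).trans (congrArg (exp (f x) • ·) e2.symm)
    exact congrArg (fun L : E5 →L[ℝ] ℂ => L w) e5
  rw [derivC, derivC, h1, h1]; ring

lemma isContactForm_rescale (hθ : S.Contact θ) {Υ : M → ℝ}
    (hΥ : ContMDiff (𝓡 5) 𝓘(ℝ, ℝ) ∞ Υ) : IsContactForm S.T10 (rescale Υ θ) where
  smooth := by
    have h := smoothForm_smul isOpen_univ (smoothFun_ofReal hΥ Set.univ).cexp hθ.smooth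
    refine smoothForm_congr isOpen_univ (fun x _ => ?_) h
    rw [rescale, Complex.ofReal_exp]
  real x := by
    have h : conjForm (((Real.exp (Υ x) : ℝ) : ℂ) • θ x) = ((Real.exp (Υ x) : ℝ) : ℂ) • conjForm (θ x) := by
      ext v
      change starRingEnd ℂ (((Real.exp (Υ x) : ℝ) : ℂ) * θ x v) =
        ((Real.exp (Υ x) : ℝ) : ℂ) * starRingEnd ℂ (θ x v)
      rw [map_mul, Complex.conj_ofReal]
    rw [rescale, h, hθ.real]
  ker x v := by
    rw [← hθ.ker x v]
    change ((Real.exp (Υ x) : ℝ) : ℂ) * θ x ![v] = 0 ↔ _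
    simp

lemma extD_rescale (hθ : S.Contact θ) {Υ : M → ℝ}
    (hΥ : ContMDiff (𝓡 5) 𝓘(ℝ, ℝ) ∞ Υ) (x : M) : extD (rescale Υ θ) x =
      diffForm (fun y => exp (Υ y)) x ⋏ θ x + exp (Υ x) • extD θ x := by
  rw [← extD_smul_one isOpen_univ (smoothFun_ofReal hΥ Set.univ).cexp hθ.smooth (Set.mem_univ x)]
  congr 1
  funext y
  rw [rescale, Complex.ofReal_exp]

lemma theta_rescale (Υ : M → ℝ) (x : M) (v : CTangent x) :
    evalC (rescale Υ θ x) ![v] = exp (Υ x) * evalC (θ x) ![v] := by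
  rw [rescale, evalC_smul, Complex.ofReal_exp]

namespace PHFrame

variable {Υ : M → ℝ} (hΥ : ContMDiff (𝓡 5) 𝓘(ℝ, ℝ) ∞ Υ) (F : PHFrame S θ)
  (F' : PHFrame S (rescale Υ θ))

lemma h_rescale (hθ : S.Contact θ) (hΥ : ContMDiff (𝓡 5) 𝓘(ℝ, ℝ) ∞ Υ)
    (hx : x ∈ F.U) (hx' : x ∈ F'.U)
    (hZ : ∀ α, F'.Z α x = F.Z α x) (i j : ι) :
    F'.h x i j = exp (Υ x) * F.h x i j := by
  have h := F'.dtheta_Z_conj hx' i j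
  rw [hZ, hZ, extD_rescale hθ hΥ, evalC_add, evalC_smul, evalC_wedge_one_one, F.dtheta_Z_conj hx,
    hθ.theta_mem (F.Z_mem _ _ hx), hθ.theta_conj (F.Z_mem _ _ hx)] at h
  refine mul_left_cancel₀ I_ne_zero (h.symm.trans ?_)
  ring

lemma φbar_rescale (hθ : S.Contact θ) (hx : x ∈ F.U) (hx' : x ∈ F'.U)
    (hZ : ∀ α, F'.Z α x = F.Z α x) (q : ι) (v : CTangent x) :
    evalC (conjForm (F'.φ q x)) ![v] = evalC (conjForm (F.φ q x)) ![v]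
      + evalC (conjForm (F'.φ q x)) ![mkC (F.T x) 0] * evalC (θ x) ![v] := by
  have h := (F.cframe hθ).form_eq (fun y => conjForm (F'.φ q y)) hx
  rw [Fintype.sum_option, Fintype.sum_sum_type] at h
  have h' : conjForm (F'.φ q x) = evalC (conjForm (F'.φ q x)) ![mkC (F.T x) 0] • θ x
    + (∑ α, evalC (conjForm (F'.φ q x)) ![F.Z α x] • F.φ α x
    + ∑ α, evalC (conjForm (F'.φ q x)) ![conjC (F.Z α x)] • conjForm (F.φ α x)) := h
  have e1 : ∀ α, evalC (conjForm (F'.φ q x)) ![F.Z α x] = 0 := fun α => by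
    rw [← hZ]; exact F'.φbar_Z q α hx'
  have e2 : ∀ α, evalC (conjForm (F'.φ q x)) ![conjC (F.Z α x)] = if q = α then 1 else 0 := fun α => by
    rw [← hZ]; exact F'.φbar_conj q α hx'
  simp only [e1, e2] at h'
  have h2 := congrArg (fun ζ => evalC ζ ![v]) h'
  simp only [evalC_add, evalC_smul, evalC_sum] at h2
  rw [h2]
  simp
  ring

lemma form22_rescale (hθ : S.Contact θ) (hΥ : ContMDiff (𝓡 5) 𝓘(ℝ, ℝ) ∞ Υ)
    (hx : x ∈ F.U) (hx' : x ∈ F'.U)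
    (hZ : ∀ α, F'.Z α x = F.Z α x) (c c' : ι → M → ℂ)
    (h : ∀ j, c' j x = exp (-Υ x) * exp (-Υ x) * c j x) :
    F'.form22 c' x = F.form22 c x := by
  rw [form22_eq, form22_eq]
  refine form_four_ext fun a b u v => ?_
  refine (evalC_wedge_two_two _ _ a b u v).trans (Eq.trans ?_ (evalC_wedge_two_two _ _ a b u v).symm)
  rw [extD_rescale hθ hΥ]
  have he : exp (Υ x) * exp (-Υ x) = 1 := by rw [← exp_add]; simp
  have hζ : ∀ v : CTangent x, evalC (∑ β, c' β x • conjForm (F'.φ β x)) ![v] =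
      exp (-Υ x) * exp (-Υ x) * evalC (∑ β, c β x • conjForm (F.φ β x)) ![v]
      + evalC (∑ β, c' β x • conjForm (F'.φ β x)) ![mkC (F.T x) 0] * evalC (θ x) ![v] := by
    intro v
    have h0 := F.φbar_rescale F' hθ hx hx' hZ 0 v
    have h1 := F.φbar_rescale F' hθ hx hx' hZ 1 v
    simp only [evalC_add, evalC_smul, sum_two]
    rw [h0, h1, h, h]
    ring
  simp only [evalC_add, evalC_wedge_one_one, evalC_smul, theta_rescale]
  rw [hζ a, hζ b, hζ u, hζ v]
  generalize evalC (∑ β, c' β x • conjForm (F'.φ β x)) ![mkC (F.T x) 0] = τ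
  generalize exp (Υ x) = e at he ⊢
  generalize exp (-Υ x) = ε at he ⊢
  conv_rhs => rw [← one_mul (_ + _), ← one_pow 2, ← he]
  ring

lemma scale (hθ : S.Contact θ) (hθ' : IsContactForm S.T10 (rescale Υ θ))
    (hΥ : ContMDiff (𝓡 5) 𝓘(ℝ, ℝ) ∞ Υ)
    {V : Opens M} (hV : (V : Set M) ⊆ F.U)
    (hW : (V : Set M) ⊆ F'.U) {x₀ : M} (hV' : (V : Set M) ⊆ (χ x₀).source)
    (hZ : ∀ α, ∀ x ∈ V, F'.Z α x = F.Z α x) :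
    FrameSys.Scale (F.sys hθ hV hV') (F'.sys hθ' hW hV')
      (res (fun y => (Υ y : ℂ)) (smoothFun_ofReal hΥ V))
      (res (fun y => exp (-Υ y)) (smoothFun_ofReal hΥ V).neg.cexp)
      (res (fun y => exp (Υ y)) (smoothFun_ofReal hΥ V).cexp) where
  X s i g := ev_ext fun x => by
    cases s
    · change derivC (extZ g.1) x (F'.Z i x) = derivC (extZ g.1) x (F.Z i x)
      rw [hZ i x x.2]
    · change derivC (extZ g.1) x (conjC (F'.Z i x)) = derivC (extZ g.1) x (conjC (F.Z i x))
      rw [hZ i x x.2]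
  T := by
    have hT : SmoothCVF (fun x => mkC (F'.T x) 0) V :=
      (smoothCVF_real F'.isOpen_U F'.T_smooth).mono hW
    have hφ := fun k => smoothFun_evalC_one V.isOpen ((F.φ_smooth k).mono hV) hT
    have hφ' := fun k => smoothFun_evalC_one V.isOpen ((smoothForm_conj (F.φ_smooth k)).mono hV) hT
    refine ⟨fun k => res (fun y => exp (Υ y)) (smoothFun_ofReal hΥ V).cexp * res _ (hφ k),
      fun k => res (fun y => exp (Υ y)) (smoothFun_ofReal hΥ V).cexp * res _ (hφ' k),
      fun g => ev_ext fun x => ?_⟩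
    simp only [map_sum, map_mul, map_add, ev_res]
    change derivC (extZ g.1) x (mkC (F'.T x) 0) = exp (-Υ x) *
      (derivC (extZ g.1) x (mkC (F.T x) 0)
      + ∑ k, exp (Υ x) * evalC (F.φ k x) ![mkC (F'.T x) 0] * derivC (extZ g.1) x (F.Z k x)
      + ∑ k, exp (Υ x) * evalC (conjForm (F.φ k x)) ![mkC (F'.T x) 0]
        * derivC (extZ g.1) x (conjC (F.Z k x)))
    have he : exp (Υ x) * exp (-Υ x) = 1 := by rw [← exp_add]; simp
    have ht : evalC (θ (x : M)) ![mkC (F'.T x) 0] = exp (-Υ x) := by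
      have h := F'.theta_T' (hW x.2)
      rw [theta_rescale] at h
      linear_combination exp (-Υ x) * h - evalC (θ (x : M)) ![mkC (F'.T x) 0] * he
    have h4 := F.expand hθ (hV x.2) (mkC (F'.T x) 0)
    rw [Fintype.sum_option, Fintype.sum_sum_type] at h4
    have h5 : mkC (F'.T x) 0 = evalC (θ (x : M)) ![mkC (F'.T x) 0] • mkC (F.T x) 0
      + (∑ α, evalC (F.φ α x) ![mkC (F'.T x) 0] • F.Z α x
      + ∑ α, evalC (conjForm (F.φ α x)) ![mkC (F'.T x) 0] • conjC (F.Z α x)) := h4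
    have h6 := congrArg (lin1 (diffForm (extZ g.1) x)) h5
    simp only [map_add, map_sum, map_smul, lin1_apply, ← derivC_eq, smul_eq_mul, ht] at h6
    rw [h6]
    simp only [sum_two]
    linear_combination -(evalC (F.φ 0 x) ![mkC (F'.T x) 0] * derivC (extZ g.1) x (F.Z 0 x)
      + evalC (F.φ 1 x) ![mkC (F'.T x) 0] * derivC (extZ g.1) x (F.Z 1 x)
      + evalC (conjForm (F.φ 0 x)) ![mkC (F'.T x) 0] * derivC (extZ g.1) x (conjC (F.Z 0 x))
      + evalC (conjForm (F.φ 1 x)) ![mkC (F'.T x) 0] * derivC (extZ g.1) x (conjC (F.Z 1 x))) * he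
  h i j := ev_ext fun x => by
    rw [map_mul]
    exact F.h_rescale F' hθ hΥ (hV x.2) (hW x.2) (fun α => hZ α x x.2) i j
  unit := ev_ext fun x => by
    rw [map_mul, map_one, ev_res, ev_res, ← exp_add]; simp
  X_eps s i := ev_ext fun x => by
    rw [map_neg, map_mul]
    change ev x (dv _ _ (res _ _)) = -(ev x (res _ _) * ev x (dv _ _ (res _ _)))
    rw [ev_dv_res, ev_dv_res, ev_res, derivC_cexp V.isOpen (smoothFun_ofReal hΥ V).neg x.2]
    have h := derivC_mul V.isOpen (smoothFun_const (-1) _) (smoothFun_ofReal hΥ V) x.2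
      (F.fr (some (ix s i)) x)
    rw [derivC_const] at h
    have h2 : derivC (fun y : M => -(Υ y : ℂ)) x (F.fr (some (ix s i)) x) =
      -derivC (fun y : M => (Υ y : ℂ)) x (F.fr (some (ix s i)) x) := by
      refine Eq.trans ?_ (h.trans (by ring))
      congr 1; funext y; ring
    rw [h2]; ring

lemma comp01_mul01 (hθ : S.Contact θ) (Υ : M → ℝ) (η : Form M 1) (β : ι)
    (hx : x ∈ F.U) : F.comp01 (mul01 θ Υ η) β x = Υ x * F.comp01 η β x := by
  have h : F.comp01 (mul01 θ Υ η) β x = evalC ((Υ x : ℂ) • η x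
      - gamma2 θ (extD fun x => (Υ x : ℂ) • η x) x) ![conjC (F.Z β x)] := rfl
  rw [h, evalC_sub, evalC_smul, F.gamma2_eq hθ hx, evalC_smul, hθ.theta_conj (F.Z_mem _ _ hx)]
  rw [comp01]; ring

lemma qComp_rescale (hθ : S.Contact θ) (hθ' : IsContactForm S.T10 (rescale Υ θ))
    (hΥ : ContMDiff (𝓡 5) 𝓘(ℝ, ℝ) ∞ Υ)
    {V : Opens M} (hV : (V : Set M) ⊆ F.U)
    (hW : (V : Set M) ⊆ F'.U) {x₀ : M} (hV' : (V : Set M) ⊆ (χ x₀).source)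
    (hZ : ∀ α, ∀ y ∈ V, F'.Z α y = F.Z α y) {η : Form M 1} (hη : SmoothForm η V)
    (hcl : IsDbbarClosed S θ η) (j : ι) (x : V) :
    F'.qComp (F'.comp01 η) j x = exp (-Υ x) * exp (-Υ x) *
      (F.qComp (F.comp01 η) j x + F.lComp (F.comp01 (mul01 θ Υ η)) j x) := by
  obtain ⟨a, r1⟩ : ∃ a : ι → smoothAlg V, ∀ β, Rep (F.comp01 η β) (a β) :=
    ⟨fun β => res (F.comp01 η β) (F.smooth_comp01 hV V.isOpen hη β), fun β => rep_res _ _⟩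
  have r2 : ∀ β, Rep (F'.comp01 η β) (a β) := by
    intro β y
    rw [← r1 β y, comp01, comp01, hZ β y y.2]
  have r3 : ∀ β, Rep (F.comp01 (mul01 θ Υ η) β)
      (res (fun y => (Υ y : ℂ)) (smoothFun_ofReal hΥ V) * a β) := by
    intro β y
    rw [F.comp01_mul01 hθ Υ η β (hV y.2), map_mul, ← r1 β y]; rfl
  have hu : ∀ i j, (F.sys hθ hV hV').toFD.cov1 tt tt i a j =
      (F.sys hθ hV hV').toFD.cov1 tt tt j a i := by
    refine fun i j => ev_ext fun y => ?_
    rw [← F.rep_cov01 hθ hV hV' r1 tt i j y, ← F.rep_cov01 hθ hV hV' r1 tt j i y]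
    exact sub_eq_zero.1 (hcl F y (hV y.2) i j)
  have C := (F.scale F' hθ hθ' hΥ hV hW hV' hZ).Q hu j
  rw [F'.rep_qComp hθ' hW hV' r2 j x, F.rep_qComp hθ hV hV' r1 j x,
    F.rep_lComp hθ hV hV' r3 j x, C, map_mul, map_mul, map_add, ev_res]

lemma form22_add (c c' : ι → M → ℂ) (x : M) :
    F.form22 c x + F.form22 c' x = F.form22 (fun β x => c β x + c' β x) x := by
  rw [form22, form22, form22, ← Finset.sum_add_distrib]
  exact Finset.sum_congr rfl fun β _ => (add_smul _ _ _).symm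

/-- The transformation law of the fourth order operator, for frames of `θ` and `e^Υ θ` with the same
frame of `T10`. -/
lemma transform (hθ : S.Contact θ) (hΥ : ContMDiff (𝓡 5) 𝓘(ℝ, ℝ) ∞ Υ)
    (hx : x ∈ F.U) (hx' : x ∈ F'.U) (hZ : ∀ α, ∀ y ∈ F'.U, F'.Z α y = F.Z α y)
    {η : Form M 1} (hη : SmoothForm η Set.univ) (hcl : IsDbbarClosed S θ η) :
    F'.form22 (F'.qComp (F'.comp01 η)) x = F.form22 (F.qComp (F.comp01 η)) x
      + F.form22 (F.lComp (F.comp01 (mul01 θ Υ η))) x := by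
  rw [form22_add]
  refine F.form22_rescale F' hθ hΥ hx hx' (fun α => hZ α x hx') _ _ fun j => ?_
  exact F.qComp_rescale F' hθ (isContactForm_rescale hθ hΥ) hΥ
    (V := ⟨F.U ∩ F'.U ∩ (χ x).source,
      (F.isOpen_U.inter F'.isOpen_U).inter (isOpen_extChartAt_source x)⟩)
    (fun y hy => hy.1.1) (fun y hy => hy.1.2) (fun y hy => hy.2)
    (fun α y hy => hZ α y hy.1.2) (hη.mono (Set.subset_univ _)) hcl j
    ⟨x, ⟨hx, hx'⟩, mem_extChartAt_source x⟩

end PHFrame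

lemma mlieBracket_eq (X Y : (x : M) → TM x) (x : M) :
    (VectorField.mlieBracket (𝓡 5) X Y x : E5) =
      VectorField.lieBracket ℝ (vRep X x) (vRep Y x) (χ x x) := by
  have e : ∀ X : (x : M) → TM x,
      VectorField.mpullbackWithin 𝓘(ℝ, E5) (𝓡 5) (χ x).symm X (Set.range (𝓡 5))
        =ᶠ[nhds (χ x x)] vRep X x := by
    intro X
    filter_upwards [extChartAt_target_mem_nhds (I := 𝓡 5) x] with p hp
    rw [VectorField.mpullbackWithin_apply, ModelWithCorners.range_eq_univ, mfderivWithin_univ]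
    have h : (cS x p).inverse = cD x ((χ x).symm p) := by
      refine ContinuousLinearMap.inverse_eq ?_ ?_
      · ext1 v
        have := cS_cD x ((χ x).map_target hp) v
        rw [(χ x).right_inv hp] at this
        exact this
      · ext1 v
        exact cD_cS x hp v
    exact congrArg (fun L : E5 →L[ℝ] E5 => L (X ((χ x).symm p))) h
  have h3 : (cD x x).inverse = ContinuousLinearMap.id ℝ E5 := by
    rw [cD_self, ContinuousLinearMap.inverse_id]
  have h4 : ∀ {A B A' B' : E5 → E5} {s : Set E5} {p : E5}, s = Set.univ → A =ᶠ[nhds p] A' →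
      B =ᶠ[nhds p] B' → VectorField.lieBracketWithin ℝ A B s p = VectorField.lieBracket ℝ A' B' p := by
    rintro A B A' B' s p rfl hA hB
    rw [VectorField.lieBracketWithin_univ]
    exact hA.lieBracket_vectorField_eq hB
  rw [← VectorField.mlieBracketWithin_univ, VectorField.mlieBracketWithin_apply]
  refine (congrArg (fun L : E5 →L[ℝ] E5 => L _) h3).trans (h4 ?_ (e X) (e Y))
  rw [Set.preimage_univ, Set.univ_inter, ModelWithCorners.range_eq_univ]

lemma extDeriv_cartan {η : E5 → E5 [⋀^Fin 1]→L[ℝ] ℂ} {X Y : E5 → E5} {p : E5}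
    (hη : ContDiffAt ℝ ∞ η p) (hX : ContDiffAt ℝ ∞ X p) (hY : ContDiffAt ℝ ∞ Y p) :
    extDeriv η p ![X p, Y p] = fderiv ℝ (fun q => η q ![Y q]) p (X p)
      - fderiv ℝ (fun q => η q ![X q]) p (Y p) - η p ![VectorField.lieBracket ℝ X Y p] := by
  have h := extDeriv_apply_vectorField (V := ![X, Y]) (hη.differentiableAt (by simp))
    (fun i => by
      fin_cases i
      exacts [hX.differentiableAt (by simp), hY.differentiableAt (by simp)])
  have h1 : (fun i => (![X, Y] : ι → E5 → E5) i p) = ![X p, Y p] := by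
    funext i; fin_cases i <;> rfl
  have h2 : ∀ q, (Fin.removeNth 0 fun i => (![X, Y] : ι → E5 → E5) i q) = ![Y q] := by
    intro q; funext i; fin_cases i; rfl
  have h3 : ∀ q, (Fin.removeNth 1 fun i => (![X, Y] : ι → E5 → E5) i q) = ![X q] := by
    intro q; funext i; fin_cases i; rfl
  rw [h1] at h
  rw [h, sum_two]
  simp only [h2, h3]
  simp [sub_eq_add_neg]

/-- Cartan's formula for the exterior derivative of a one-form. -/
lemma extD_cartan {η : Form M 1} {X Y : (x : M) → TM x}
    (hU : IsOpen U) (hη : SmoothForm η U) (hX : SmoothVF X U) (hY : SmoothVF Y U)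
    (hx : x ∈ U) : extD η x ![X x, Y x] = diffFun (fun y => η y ![Y y]) x (X x)
      - diffFun (fun y => η y ![X y]) x (Y x) - η x ![VectorField.mlieBracket (𝓡 5) X Y x] := by
  have hs : ∀ {X : (x : M) → TM x}, SmoothVF X U → ∀ v : E5,
      diffFun (fun y => η y ![X y]) x v = fderiv ℝ (fun q => chartRep η x q ![vRep X x q])
        (χ x x) v := by
    intro X hX v
    have hf : SmoothFun (fun y => η y ![X y]) U := by
      have h := smoothFun_apply (X := ![X]) hU hη (by intro i; fin_cases i; exact hX)
      refine h.congr fun y _ => congrArg (η y) ?_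
      funext i; fin_cases i; rfl
    rw [diffFun_eq (hf.contMDiffAt (hU.mem_nhds hx))]
    congr 1
    refine Filter.EventuallyEq.fderiv_eq ?_
    filter_upwards [eventually_mem_chart hU hx] with p hp
    have := fE_apply_of_mem η x ((χ x).map_target hp.1)
      ![vE X ((χ x).symm p)]
    rw [(χ x).right_inv hp.1] at this
    refine this.trans (congrArg _ ?_)
    funext i; fin_cases i; rfl
  have h := extDeriv_cartan (hη x hx) ((smoothVF_iff hU).1 hX x hx) ((smoothVF_iff hU).1 hY x hx)
  rw [← extD_eq, vRep_self, vRep_self, chartRep_self, ← mlieBracket_eq, ← hs hX, ← hs hY] at h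
  exact h

lemma cBracket_cartan {η : Form M 1} {Z W : CVectorField M}
    (hU : IsOpen U) (hη : SmoothForm η U) (hZ : SmoothCVF Z U) (hW : SmoothCVF W U)
    (hZ0 : ∀ x ∈ U, evalC (η x) ![Z x] = 0) (hW0 : ∀ x ∈ U, evalC (η x) ![W x] = 0)
    (hx : x ∈ U) : evalC (extD η x) ![Z x, W x] = -evalC (η x) ![cBracket Z W x] := by
  have hs : ∀ {X : (x : M) → TM x}, SmoothVF X U → SmoothFun (fun y => η y ![X y]) U :=
    fun hX => (smoothFun_evalC_one hU hη (smoothCVF_real hU hX)).congr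
      fun y _ => (evalC_real_one _ _).symm
  have hd : ∀ {Z : CVectorField M}, SmoothCVF Z U → (∀ x ∈ U, evalC (η x) ![Z x] = 0) →
      ∀ v, diffFun (fun y => η y ![reC (Z y)]) x v
        + I * diffFun (fun y => η y ![imC (Z y)]) x v = 0 := by
    intro Z hZ h0 v
    have h1 := derivC_congr hU (fun y hy => (evalC_one (η y) (Z y)).symm.trans (h0 y hy)) hx (mkC v 0)
    rw [derivC_const, derivC_add hU (hs hZ.1) ((smoothFun_const _ _).mul hU (hs hZ.2)) hx,
      derivC_mul hU (smoothFun_const _ _) (hs hZ.2) hx, derivC_const] at h1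
    simp only [derivC, reC_mkC, imC_mkC, map_zero] at h1
    linear_combination h1
  have h2 : evalC (extD η x) ![Z x, W x] = extD η x ![reC (Z x), reC (W x)]
      - extD η x ![imC (Z x), imC (W x)] + I * (extD η x ![reC (Z x), imC (W x)]
      + extD η x ![imC (Z x), reC (W x)]) := by
    have e : ∀ v : CTangent x, v = mkC (reC v) 0 + I • mkC (imC v) 0 := fun v => by
      apply ext_re_im <;> simp
    have r : ∀ v w : TM x, evalC (extD η x) ![mkC v 0, mkC w 0] = extD η x ![v, w] :=
      evalA_real_two _
    rw [e (Z x), e (W x), ← lin2_apply, map_add, map_smul, lin2_apply, lin2_apply,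
      evalC_swap _ _ (mkC (reC (Z x)) 0), evalC_swap _ _ (mkC (imC (Z x)) 0), ← lin2_apply,
      ← lin2_apply, map_add, map_smul, map_add, map_smul]
    simp only [lin2_apply]
    rw [evalC_swap _ (mkC (reC (Z x)) 0), evalC_swap _ (mkC (reC (Z x)) 0),
      evalC_swap _ (mkC (imC (Z x)) 0), evalC_swap _ (mkC (imC (Z x)) 0), r, r, r, r]
    simp only [reC_add, imC_add, reC_mkC, imC_mkC, reC_smul, imC_smul, smul_eq_mul, Complex.I_re,
      Complex.I_im, zero_smul, one_smul, smul_zero, sub_zero, add_zero, zero_add]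
    linear_combination extD η x ![imC (Z x), imC (W x)] * I_mul_I
  have hl : ∀ u v : TM x, η x ![u + v] = η x ![u] + η x ![v] := fun u v => by
    have h := map_add (lin1 (η x)) (mkC u 0) (mkC v 0)
    have e : mkC u 0 + mkC v 0 = mkC (u + v) 0 := by apply ext_re_im <;> simp
    rwa [e, lin1_apply, lin1_apply, lin1_apply, evalC_real_one, evalC_real_one, evalC_real_one] at h
  have hl' : ∀ u v : TM x, η x ![u - v] = η x ![u] - η x ![v] := fun u v => by
    rw [eq_sub_iff_add_eq, ← hl, sub_add_cancel]
  rw [h2, extD_cartan hU hη hZ.1 hW.1 hx, extD_cartan hU hη hZ.2 hW.2 hx,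
    extD_cartan hU hη hZ.1 hW.2 hx, extD_cartan hU hη hZ.2 hW.1 hx, cBracket, evalC_one, reC_mkC,
    imC_mkC, hl, hl']
  linear_combination hd hW hW0 (reC (Z x)) + I * hd hW hW0 (imC (Z x))
    - hd hZ hZ0 (reC (W x)) - I * hd hZ hZ0 (imC (W x))
    + (diffFun (fun y => η y ![imC (Z y)]) x (imC (W x))
      - diffFun (fun y => η y ![imC (W y)]) x (imC (Z x))) * I_mul_I

lemma smoothVF_add {X Y : (x : M) → TM x} (hU : IsOpen U)
    (hX : SmoothVF X U) (hY : SmoothVF Y U) : SmoothVF (fun x => X x + Y x) U := by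
  rw [smoothVF_iff hU] at *
  intro x hx
  refine ((hX x hx).add (hY x hx)).congr_of_eventuallyEq (.of_forall fun p => ?_)
  exact map_add (cD x _) (vE X _) (vE Y _)

lemma smoothVF_smul {X : (x : M) → TM x} (L : ℂ →L[ℝ] ℝ)
    (hU : IsOpen U) (hf : SmoothFun f U) (hX : SmoothVF X U) : SmoothVF (fun x => L (f x) • X x) U := by
  rw [smoothVF_iff hU, smoothFun_iff hU] at *
  intro x hx
  refine ((L.contDiff.contDiffAt.comp _ (hf x hx)).smul (hX x hx)).congr_of_eventuallyEq
    (.of_forall fun p => ?_)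
  exact map_smul (cD x _) (L (f _)) (vE X _)

lemma SmoothCVF.add {Z W : CVectorField M} (hU : IsOpen U) (hZ : SmoothCVF Z U)
    (hW : SmoothCVF W U) : SmoothCVF (fun x => Z x + W x) U := by
  refine ⟨?_, ?_⟩
  · simp only [reC_add]; exact smoothVF_add hU hZ.1 hW.1
  · simp only [imC_add]; exact smoothVF_add hU hZ.2 hW.2

lemma SmoothCVF.smul {Z : CVectorField M} (hU : IsOpen U)
    (hf : SmoothFun f U) (hZ : SmoothCVF Z U) : SmoothCVF (fun x => f x • Z x) U := by
  refine ⟨?_, ?_⟩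
  · simp only [reC_smul, sub_eq_add_neg]
    exact smoothVF_add hU (smoothVF_smul Complex.reCLM hU hf hZ.1)
      (smoothVF_neg hU (smoothVF_smul Complex.imCLM hU hf hZ.2))
  · simp only [imC_smul]
    exact smoothVF_add hU (smoothVF_smul Complex.reCLM hU hf hZ.2)
      (smoothVF_smul Complex.imCLM hU hf hZ.1)

lemma extD_involutive {η : Form M 1} {Z W : CVectorField M} (hU : IsOpen U)
    (hη : SmoothForm η U) (h0 : ∀ x ∈ U, ∀ W ∈ S.T10 x, evalC (η x) ![W] = 0)
    (hZ : SmoothCVF Z U) (hW : SmoothCVF W U) (hZm : ∀ x ∈ U, Z x ∈ S.T10 x)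
    (hWm : ∀ x ∈ U, W x ∈ S.T10 x) (hx : x ∈ U) : evalC (extD η x) ![Z x, W x] = 0 := by
  rw [cBracket_cartan hU hη hZ hW (fun y hy => h0 y hy _ (hZm y hy)) (fun y hy => h0 y hy _ (hWm y hy))
    hx, h0 x hx _ (S.involutive U hU Z W hZ hW hZm hWm x hx), neg_zero]

/-- The contraction of a two-form with a vector field. -/
def interior (η : Form M 2) (X : (x : M) → TM x) : Form M 1 := fun x =>
  (((fE η x).curryLeft (vE X x) : E5 [⋀^Fin 1]→L[ℝ] ℂ) :)

lemma smoothForm_interior {η : Form M 2} {X : (x : M) → TM x}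
    (hU : IsOpen U) (hη : SmoothForm η U) (hX : SmoothVF X U) : SmoothForm (interior η X) U := by
  intro x hx
  refine contDiffAt_alternating fun v => ?_
  have h := contDiffAt_alternating_apply_vec (hη x hx) (X := ![vRep X x, fun _ => v 0]) (by
    intro i; fin_cases i
    exacts [(smoothVF_iff hU).1 hX x hx, contDiffAt_const])
  refine h.congr_of_eventuallyEq ?_
  filter_upwards [eventually_mem_chart hU hx] with p hp
  rw [chartRep_apply, chartRep_apply]
  refine congrArg (fE η ((χ x).symm p)) ?_
  funext i
  fin_cases i
  · have := cS_cD x ((χ x).map_target hp.1) (vE X ((χ x).symm p))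
    rw [(χ x).right_inv hp.1] at this
    exact this.symm
  · rfl

/-- The contraction of a two-form with a complex vector field. -/
def interiorC (η : Form M 2) (Z : CVectorField M) : Form M 1 := fun x =>
  interior η (fun y => reC (Z y)) x + I • interior η (fun y => imC (Z y)) x

lemma evalC_interiorC (η : Form M 2) (Z : CVectorField M) (v : CTangent x) :
    evalC (interiorC η Z x) ![v] = evalC (η x) ![Z x, v] := by
  have e : ∀ v : CTangent x, v = mkC (reC v) 0 + I • mkC (imC v) 0 := fun v => by
    apply ext_re_im <;> simp
  have r : ∀ v w : TM x, evalC (η x) ![mkC v 0, mkC w 0] = η x ![v, w] :=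
    evalA_real_two _
  have h : ∀ w : TM x, evalC (η x) ![Z x, mkC w 0] = interiorC η Z x ![w] := by
    intro w
    rw [e (Z x), ← lin2_apply, map_add, map_smul, lin2_apply, lin2_apply, r, r]
    rfl
  rw [evalC_one, ← h, ← h]
  conv_rhs => rw [e v, evalC_swap, ← lin2_apply, map_add, map_smul, lin2_apply, lin2_apply,
    evalC_swap, evalC_swap _ (Z x)]
  rw [smul_eq_mul]; ring

lemma smoothForm_interiorC {η : Form M 2} {Z : CVectorField M}
    (hU : IsOpen U) (hη : SmoothForm η U) (hZ : SmoothCVF Z U) : SmoothForm (interiorC η Z) U :=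
  smoothForm_add (smoothForm_interior hU hη hZ.1)
    (smoothForm_smul hU (smoothFun_const _ _) (smoothForm_interior hU hη hZ.2))

lemma exists_smoothVF (x : M) (n : E5) : ∃ N : (y : M) → TM y,
    SmoothVF N (χ x).source ∧ N x = n := by
  refine ⟨fun y => cS x (χ x y) n, ?_,
    congrArg (fun L : E5 →L[ℝ] E5 => L n) (cS_self x)⟩
  refine (smoothVF_iff (isOpen_extChartAt_source x)).2 fun y hy => ?_
  have hq := (χ x).map_source hy
  have hy' := (χ x).left_inv hy
  have h1 : ContDiffAt ℝ ∞ (χ y ∘ (χ x).symm) (χ x y) :=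
    contDiffAt_transition hq (by rw [hy']; exact mem_extChartAt_source y)
  have h2 : ContDiffAt ℝ ∞ (χ x ∘ (χ y).symm) (χ y y) :=
    contDiffAt_transition (mem_extChartAt_target y)
      (by rw [(χ y).left_inv (mem_extChartAt_source y)]; exact hy)
  have h3 := h1.fderiv_right (m := ∞) (by simp)
  refine ((ContDiffAt.comp (χ y y) (g := fderiv ℝ (χ y ∘
    (χ x).symm)) (by simpa using h3) h2).clm_apply (contDiffAt_const (c := n))).congr_of_eventuallyEq ?_
  filter_upwards [eventually_mem_chart (isOpen_extChartAt_source x) hy] with p hp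
  have hp' := (χ x).left_inv hp.2
  have h4 := fderiv_transition (x := y) ((χ x).map_source hp.2)
    (by rw [hp']; exact (χ y).map_target hp.1) n
  rw [hp'] at h4
  exact h4.symm

lemma IsContactForm.exists_ne_zero (hθ : S.Contact θ) (x : M) :
    ∃ n : TM x, θ x ![n] ≠ 0 := by
  by_contra! h
  let L : S.T10 x →ₗ[ℝ] TM x := reL.comp ((S.T10 x).subtype.restrictScalars ℝ)
  have hL : Function.Surjective L := by
    intro v
    obtain ⟨Z, hZ, hv⟩ := (hθ.ker x v).1 (h v)
    rw [← mkC_smul_two] at hv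
    refine ⟨(2 : ℝ) • ⟨Z, hZ⟩, ?_⟩
    rw [map_smul]
    have := congrArg reC hv
    rw [reC_mkC, reC_mkC] at this
    exact this.symm
  have : Module.Finite ℂ (S.T10 x) := Module.finite_of_finrank_eq_succ (finrank_T10 S x)
  have : Module.Finite ℝ (S.T10 x) := Module.Finite.trans ℂ _
  have h1 := LinearMap.finrank_le_finrank_of_surjective hL
  have h2 : Module.finrank ℝ (TM x) = 5 := finrank_euclideanSpace_fin
  have h3 := Module.finrank_mul_finrank ℝ ℂ (S.T10 x)
  rw [finrank_T10, Complex.finrank_real_complex] at h3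
  omega

lemma mkC_reC_of_conj {v : CTangent x} (h : conjC v = v) : mkC (reC v) 0 = v := by
  have h2 := mkC_smul_two v
  rw [h] at h2
  apply ext_re_im
  · simp
  · have h3 := congrArg imC h2
    rw [imC_mkC, imC_add, ← two_smul ℝ] at h3
    rw [imC_mkC]
    exact ((smul_eq_zero.1 h3.symm).resolve_left two_ne_zero).symm

lemma IsContactForm.dtheta_conj (hθ : S.Contact θ) (v w : CTangent x) :
    evalC (extD θ x) ![conjC v, conjC w] = starRingEnd ℂ (evalC (extD θ x) ![v, w]) := by
  have h := evalC_conj_two (extD θ x) v w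
  rwa [hθ.extD_real] at h

/-- Smooth frames of `T10`. -/
structure IsFrame (S : CRStructure M) (Z : ι → CVectorField M) (U : Set M) : Prop where
  isOpen : IsOpen U
  smooth : ∀ α, SmoothCVF (Z α) U
  mem : ∀ α, ∀ x ∈ U, Z α x ∈ S.T10 x
  indep : ∀ x ∈ U, LinearIndependent ℂ (fun α => Z α x)

namespace IsFrame

variable {Z : ι → CVectorField M} {U : Set M} (hZ : IsFrame S Z U)

lemma dtheta (hZ : IsFrame S Z U) (hθ : S.Contact θ) (hx : x ∈ U) (α β : ι) :
    evalC (extD θ x) ![Z α x, Z β x] = 0 :=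
  extD_involutive hZ.isOpen (hθ.smooth.mono (Set.subset_univ _)) (fun _ _ _ h => hθ.theta_mem h)
    (hZ.smooth α) (hZ.smooth β) (hZ.mem α) (hZ.mem β) hx

lemma dtheta_conj (hZ : IsFrame S Z U) (hθ : S.Contact θ) (hx : x ∈ U)
    (α β : ι) : evalC (extD θ x) ![conjC (Z α x), conjC (Z β x)] = 0 := by
  rw [hθ.dtheta_conj, hZ.dtheta hθ hx, map_zero]

lemma exists_expand (hZ : IsFrame S Z U) (hx : x ∈ U) {W : CTangent x}
    (hW : W ∈ S.T10 x) : ∃ c : ι → ℂ, W = ∑ α, c α • Z α x := by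
  rw [← span_eq_T10 S (fun α => hZ.mem α x hx) (hZ.indep x hx)] at hW
  obtain ⟨c, hc⟩ := (Submodule.mem_span_range_iff_exists_fun ℂ).1 hW
  exact ⟨c, hc.symm⟩

/-- The Levi matrix of a frame. -/
def levi (θ : Form M 1) (Z : ι → CVectorField M) (x : M) : Matrix (ι) (ι) ℂ :=
  Matrix.of fun α β => leviForm θ x (Z α x) (Z β x)

lemma dtheta_Z_conj (θ : Form M 1) (Z : ι → CVectorField M) (x : M) (α β : ι) :
    evalC (extD θ x) ![Z α x, conjC (Z β x)] = I * levi θ Z x α β := by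
  rw [levi, Matrix.of_apply, leviForm]
  linear_combination evalC (extD θ x) ![Z α x, conjC (Z β x)] * I_mul_I

lemma smooth_levi (hZ : IsFrame S Z U) (hθ : S.Contact θ) (α β : ι) :
    SmoothFun (fun x => levi θ Z x α β) U :=
  (smoothFun_const _ _).mul hZ.isOpen (smoothFun_evalC_two hZ.isOpen
    (smoothForm_extD hZ.isOpen (hθ.smooth.mono (Set.subset_univ _))) (hZ.smooth α)
    (smoothCVF_conj hZ.isOpen (hZ.smooth β)))

lemma smooth_inv (hZ : IsFrame S Z U) (hθ : S.Contact θ) (α β : ι) :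
    SmoothFun (fun x => (levi θ Z x)⁻¹ α β) U :=
  smoothFun_matrix_inv hZ.isOpen (hZ.smooth_levi hθ)
    (fun x hx => hθ.levi_det (fun α => hZ.mem α x hx) (hZ.indep x hx)) α β

lemma levi_inv (hZ : IsFrame S Z U) (hθ : S.Contact θ) (hx : x ∈ U)
    (α β : ι) : ∑ ν, (levi θ Z x) α ν * (levi θ Z x)⁻¹ ν β = if α = β then 1 else 0 := by
  have h := congrFun (congrFun (Matrix.mul_nonsing_inv (levi θ Z x) (isUnit_iff_ne_zero.2
    (hθ.levi_det (fun α => hZ.mem α x hx) (hZ.indep x hx)))) α) β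
  rwa [Matrix.mul_apply, Matrix.one_apply] at h

lemma inv_levi (hZ : IsFrame S Z U) (hθ : S.Contact θ) (hx : x ∈ U)
    (α β : ι) : ∑ ν, (levi θ Z x)⁻¹ α ν * (levi θ Z x) ν β = if α = β then 1 else 0 := by
  have h := congrFun (congrFun (Matrix.nonsing_inv_mul (levi θ Z x) (isUnit_iff_ne_zero.2
    (hθ.levi_det (fun α => hZ.mem α x hx) (hZ.indep x hx)))) α) β
  rwa [Matrix.mul_apply, Matrix.one_apply] at h

lemma mono (hZ : IsFrame S Z U) {V : Set M} (hV : IsOpen V) (h : V ⊆ U) : IsFrame S Z V :=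
  ⟨hV, fun α => (hZ.smooth α).mono h, fun α x hx => hZ.mem α x (h hx), fun x hx => hZ.indep x (h hx)⟩

/-- The Reeb field, built from a vector field `N` with `θ(N) ≠ 0`. -/
lemma exists_reeb (hZ : IsFrame S Z U) (hθ : S.Contact θ)
    {N : (y : M) → TM y} (hN : SmoothVF N U) (h0 : ∀ y ∈ U, θ y ![N y] ≠ 0) :
    ∃ T : (y : M) → TM y, SmoothVF T U ∧ ∀ y ∈ U, θ y ![T y] = 1 ∧
      ∀ v, evalC (extD θ y) ![mkC (T y) 0, v] = 0 := by
  have hNc := smoothCVF_real hZ.isOpen hN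
  have hθU : SmoothForm θ U := hθ.smooth.mono (Set.subset_univ _)
  have hθN := smoothFun_evalC_one hZ.isOpen hθU hNc
  simp only [evalC_real_one] at hθN
  have hN' := hNc.smul hZ.isOpen (hθN.inv hZ.isOpen h0)
  obtain ⟨N', eN⟩ : ∃ N' : CVectorField M, N' = fun y => (θ y ![N y])⁻¹ • mkC (N y) 0 := ⟨_, rfl⟩
  rw [← eN] at hN'
  have hcN : ∀ y, conjC (N' y) = N' y := fun y => by
    obtain ⟨t, ht⟩ := hθ.exists_real (N y)
    rw [eN]
    simp only [conjC_smul, conjC_mkC_zero, ht, map_inv₀, Complex.conj_ofReal]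
  obtain ⟨c, ec⟩ : ∃ c : ι → M → ℂ, c = fun α y => ∑ β, I * (levi θ Z y)⁻¹ β α *
    evalC (extD θ y) ![N' y, conjC (Z β y)] := ⟨_, rfl⟩
  have hc : ∀ α, SmoothFun (c α) U := fun α => by
    rw [ec]
    exact smoothFun_sum _ fun β => ((smoothFun_const _ _).mul hZ.isOpen (hZ.smooth_inv hθ β α)).mul
      hZ.isOpen (smoothFun_evalC_two hZ.isOpen (smoothForm_extD hZ.isOpen hθU) hN'
        (smoothCVF_conj hZ.isOpen (hZ.smooth β)))
  obtain ⟨T', eT⟩ : ∃ T' : CVectorField M, T' = fun y => N' y + ((c 0 y • Z 0 y + c 1 y • Z 1 y)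
    + conjC (c 0 y • Z 0 y + c 1 y • Z 1 y)) := ⟨_, rfl⟩
  have hs := ((hZ.smooth 0).smul hZ.isOpen (hc 0)).add hZ.isOpen ((hZ.smooth 1).smul hZ.isOpen (hc 1))
  have hT' : SmoothCVF T' U := by
    rw [eT]
    exact hN'.add hZ.isOpen (hs.add hZ.isOpen (smoothCVF_conj hZ.isOpen hs))
  have hr : ∀ y, mkC (reC (T' y)) 0 = T' y := fun y => mkC_reC_of_conj (by
    rw [eT]
    simp only [conjC_add, conjC_conjC, hcN]
    abel)
  refine ⟨fun y => reC (T' y), hT'.1, fun y hy => ?_⟩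
  have h1 : θ y ![reC (T' y)] = 1 := by
    rw [← evalC_real_one, hr, eT, ← lin1_apply]
    simp only [map_add, map_smul, conjC_add, conjC_smul, lin1_apply, hθ.theta_mem (hZ.mem _ y hy),
      hθ.theta_conj (hZ.mem _ y hy), eN, evalC_real_one]
    simp [h0 y hy]
  have h2 : ∀ β, evalC (extD θ y) ![T' y, conjC (Z β y)] = 0 := fun β => by
    rw [eT, ← lin2_apply]
    simp only [map_add, map_smul, conjC_add, conjC_smul, lin2_apply, hZ.dtheta_conj hθ hy,
      dtheta_Z_conj, ec, smul_eq_mul]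
    have k := hZ.inv_levi hθ hy
    have k0 := k 0 β
    have k1 := k 1 β
    rw [sum_two] at k0 k1
    simp only [sum_two]
    have e : evalC (extD θ y) ![N' y, conjC (Z β y)] =
        evalC (extD θ y) ![N' y, conjC (Z 0 y)] * (if 0 = β then 1 else 0)
        + evalC (extD θ y) ![N' y, conjC (Z 1 y)] * (if 1 = β then 1 else 0) := by
      fin_cases β <;> simp
    rw [e]
    linear_combination -evalC (extD θ y) ![N' y, conjC (Z 0 y)] * k0
      - evalC (extD θ y) ![N' y, conjC (Z 1 y)] * k1
      + (evalC (extD θ y) ![N' y, conjC (Z 0 y)] * ((levi θ Z y)⁻¹ 0 0 * levi θ Z y 0 β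
        + (levi θ Z y)⁻¹ 0 1 * levi θ Z y 1 β)
      + evalC (extD θ y) ![N' y, conjC (Z 1 y)] * ((levi θ Z y)⁻¹ 1 0 * levi θ Z y 0 β
        + (levi θ Z y)⁻¹ 1 1 * levi θ Z y 1 β)) * I_mul_I
  have h3 : ∀ β, evalC (extD θ y) ![T' y, Z β y] = 0 := fun β => by
    have h := hθ.dtheta_conj (mkC (reC (T' y)) 0) (conjC (Z β y))
    rwa [conjC_mkC_zero, conjC_conjC, hr, h2, map_zero] at h
  have h4 : ∀ v : TM y, evalC (extD θ y) ![T' y, mkC v 0] = 0 := fun v => by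
    obtain ⟨t, W, hW, hv⟩ := hθ.decompose h1 v
    obtain ⟨d, rfl⟩ := hZ.exists_expand hy hW
    have h2' : ∀ β, evalC (extD θ y) ![conjC (Z β y), T' y] = 0 := fun β => by
      rw [evalC_swap, h2, neg_zero]
    have h3' : ∀ β, evalC (extD θ y) ![Z β y, T' y] = 0 := fun β => by rw [evalC_swap, h3, neg_zero]
    rw [hv, hr, evalC_swap, ← lin2_apply]
    simp only [sum_two, map_add, map_smul, conjC_add, conjC_smul, lin2_apply, h2', h3',
      evalC_self]
    simp
  refine ⟨h1, fun v => ?_⟩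
  have e : v = mkC (reC v) 0 + I • mkC (imC v) 0 := by apply ext_re_im <;> simp
  rw [hr, e, evalC_swap, ← lin2_apply, map_add, map_smul, lin2_apply, lin2_apply,
    evalC_swap _ (T' y), evalC_swap _ (T' y), h4, h4]
  simp

lemma exists_admissible (hZ : IsFrame S Z U) (hθ : S.Contact θ) (hx : x ∈ U) :
    ∃ F : AdmissibleCoframe S θ, x ∈ F.U ∧ F.U ⊆ U ∧ F.Z = Z := by
  obtain ⟨n, hn⟩ := hθ.exists_ne_zero x
  obtain ⟨N, hN, rfl⟩ := exists_smoothVF x n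
  have hf : SmoothFun (fun y => θ y ![N y]) (χ x).source :=
    (smoothFun_evalC_one (isOpen_extChartAt_source x) (hθ.smooth.mono (Set.subset_univ _))
      (smoothCVF_real (isOpen_extChartAt_source x) hN)).congr fun y _ => (evalC_real_one _ _).symm
  have hV := hZ.isOpen.inter (hf.continuousOn.isOpen_inter_preimage (isOpen_extChartAt_source x)
    (isOpen_ne (x := (0 : ℂ))))
  have hZ' := hZ.mono hV Set.inter_subset_left
  obtain ⟨T, hT, h⟩ := hZ'.exists_reeb hθ (hN.mono fun y hy => hy.2.1) fun y hy => hy.2.2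
  have hφ : ∀ α y (v : CTangent y), evalC (∑ β, (I * (levi θ Z y)⁻¹ β α) •
      interiorC (extD θ) (fun y => conjC (Z β y)) y) ![v] = ∑ β, (I * (levi θ Z y)⁻¹ β α) *
        evalC (extD θ y) ![conjC (Z β y), v] := fun α y v => by
    simp only [evalC_sum, evalC_smul, evalC_interiorC]
  refine ⟨{ U := _
            isOpen_U := hV
            T := T
            T_smooth := hT
            theta_T := fun y hy => (h y hy).1
            dtheta_T := fun y hy v => ?_
            φ := fun α y => ∑ β, (I * (levi θ Z y)⁻¹ β α) •
              interiorC (extD θ) (fun y => conjC (Z β y)) y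
            φ_smooth := fun α => smoothForm_sum _ fun β => smoothForm_smul hV
              ((smoothFun_const _ _).mul hV (hZ'.smooth_inv hθ β α))
              (smoothForm_interiorC hV (smoothForm_extD hV (hθ.smooth.mono (Set.subset_univ _)))
                (smoothCVF_conj hV (hZ'.smooth β)))
            φ_T := fun α y hy => ?_
            φ_conj := fun α y hy W hW => ?_
            Z := Z
            Z_smooth := hZ'.smooth
            Z_mem := hZ'.mem
            φ_Z := fun α β y hy => ?_ }, ⟨hx, mem_extChartAt_source x, hn⟩, Set.inter_subset_left, rfl⟩
  · have h1 := (h y hy).2 (mkC v 0)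
    rw [← h1]
    exact (evalA_real_two (extD θ y) (T y) v).symm
  · rw [← evalC_real_one, hφ]
    simp only [fun v => evalC_swap (extD θ y) (mkC (T y) 0) v, (h y hy).2]
    simp
  · obtain ⟨d, rfl⟩ := hZ'.exists_expand hy hW
    rw [hφ]
    refine Finset.sum_eq_zero fun β _ => ?_
    rw [evalC_swap, ← lin2_apply]
    simp only [sum_two, conjC_add, conjC_smul, map_add, map_smul, lin2_apply,
      hZ'.dtheta_conj hθ hy]
    simp
  · rw [hφ]
    simp only [fun γ => evalC_swap (extD θ y) (Z β y) (conjC (Z γ y)), dtheta_Z_conj]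
    have k := hZ'.levi_inv hθ hy β α
    simp only [sum_two, eq_comm (a := α)] at k ⊢
    rw [← k]
    linear_combination -(levi θ Z y β 0 * (levi θ Z y)⁻¹ 0 α + levi θ Z y β 1 * (levi θ Z y)⁻¹ 1 α) *
      I_mul_I

end IsFrame

namespace AdmissibleCoframe

variable (F : AdmissibleCoframe S θ)

lemma isFrame : IsFrame S F.Z F.U :=
  ⟨F.isOpen_U, F.Z_smooth, F.Z_mem, fun _ hx => F.linearIndependent hx⟩

lemma two_form_ext (hθ : S.Contact θ) (hx : x ∈ F.U)
    {η τ : (TM x) [⋀^ι]→L[ℝ] ℂ}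
    (h : ∀ i j, evalC η ![F.fr i x, F.fr j x] = evalC τ ![F.fr i x, F.fr j x]) : η = τ := by
  refine form_two_ext fun a b => ?_
  have hb : ∀ i, evalC η ![F.fr i x, b] = evalC τ ![F.fr i x, b] := fun i => by
    rw [F.expand hθ hx b, evalC_swap, evalC_swap τ, ← lin2_apply, ← lin2_apply, map_sum, map_sum]
    simp only [map_smul, lin2_apply, h]
  rw [F.expand hθ hx a, ← lin2_apply, ← lin2_apply, map_sum, map_sum]
  simp only [map_smul, lin2_apply, hb]

lemma two_form_ext' (hθ : S.Contact θ) (hx : x ∈ F.U)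
    {η τ : (TM x) [⋀^ι]→L[ℝ] ℂ}
    (h1 : ∀ α, evalC η ![mkC (F.T x) 0, F.Z α x] = evalC τ ![mkC (F.T x) 0, F.Z α x])
    (h2 : ∀ α, evalC η ![mkC (F.T x) 0, conjC (F.Z α x)] = evalC τ ![mkC (F.T x) 0, conjC (F.Z α x)])
    (h3 : ∀ α β, evalC η ![F.Z α x, F.Z β x] = evalC τ ![F.Z α x, F.Z β x])
    (h4 : ∀ α β, evalC η ![F.Z α x, conjC (F.Z β x)] = evalC τ ![F.Z α x, conjC (F.Z β x)])
    (h5 : ∀ α β, evalC η ![conjC (F.Z α x), conjC (F.Z β x)] =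
      evalC τ ![conjC (F.Z α x), conjC (F.Z β x)]) : η = τ := by
  refine F.two_form_ext hθ hx ?_
  rintro (_ | α | α) (_ | β | β)
  · exact (evalC_self η _).trans (evalC_self τ _).symm
  · exact h1 β
  · exact h2 β
  · exact (evalC_swap η _ _).trans ((congrArg Neg.neg (h1 α)).trans (evalC_swap τ _ _).symm)
  · exact h3 α β
  · exact h4 α β
  · exact (evalC_swap η _ _).trans ((congrArg Neg.neg (h2 α)).trans (evalC_swap τ _ _).symm)
  · exact (evalC_swap η _ _).trans ((congrArg Neg.neg (h4 β α)).trans (evalC_swap τ _ _).symm)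
  · exact h5 α β

/-- The Levi matrix. -/
def lev (x : M) : Matrix (ι) (ι) ℂ := IsFrame.levi θ F.Z x

lemma lev_smooth (hθ : S.Contact θ) (α β : ι) : SmoothFun (fun x => F.lev x α β) F.U :=
  F.isFrame.smooth_levi hθ α β

lemma lev_conj (hθ : S.Contact θ) (x : M) (α β : ι) :
    starRingEnd ℂ (F.lev x α β) = F.lev x β α := by
  have h := hθ.dtheta_conj (F.Z α x) (conjC (F.Z β x))
  rw [conjC_conjC, evalC_swap, IsFrame.dtheta_Z_conj, IsFrame.dtheta_Z_conj, map_mul,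
    conj_I] at h
  rw [lev]
  linear_combination -I * h + (starRingEnd ℂ (IsFrame.levi θ F.Z x α β)
    - IsFrame.levi θ F.Z x β α) * I_mul_I

lemma dtheta_T' (x : M) (hx : x ∈ F.U) (v : CTangent x) :
    evalC (extD θ x) ![mkC (F.T x) 0, v] = 0 := by
  have r : ∀ w : TM x, evalC (extD θ x) ![mkC (F.T x) 0, mkC w 0] = 0 := fun w =>
    (evalA_real_two (extD θ x) (F.T x) w).trans (F.dtheta_T x hx w)
  have e : v = mkC (reC v) 0 + I • mkC (imC v) 0 := by apply ext_re_im <;> simp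
  rw [e, evalC_swap, ← lin2_apply, map_add, map_smul, lin2_apply, lin2_apply,
    evalC_swap _ (mkC (F.T x) 0), evalC_swap _ (mkC (F.T x) 0), r, r]
  simp

lemma dtheta_eq (hθ : S.Contact θ) (hx : x ∈ F.U) :
    extD θ x = ∑ α, ∑ β, (I * F.lev x α β) • (F.φ α x ⋏ conjForm (F.φ β x)) := by
  refine F.two_form_ext' hθ hx ?_ ?_ ?_ ?_ ?_ <;> intros <;>
    simp only [evalC_sum, evalC_smul, evalC_wedge_one_one, F.φ_T' _ hx, F.φ_Z _ _ x hx,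
      F.φ_conj' _ _ hx, F.φbar_T _ hx, F.φbar_Z _ _ hx, F.φbar_conj _ _ hx, F.dtheta_T' x hx,
      F.isFrame.dtheta hθ hx, F.isFrame.dtheta_conj hθ hx, IsFrame.dtheta_Z_conj] <;>
    simp [lev]

/-- `dφ^α(v, w)`. -/
def D (α : ι) (x : M) (v w : CTangent x) : ℂ := evalC (extD (F.φ α) x) ![v, w]

lemma D_swap (α : ι) (x : M) (v w : CTangent x) : F.D α x w v = -F.D α x v w := evalC_swap _ _ _

lemma D_eq (α : ι) (x : M) (v w : CTangent x) :
    evalC (extD (F.φ α) x) ![v, w] = F.D α x v w := rfl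

lemma D_conj (α : ι) (hx : x ∈ F.U) (v w : CTangent x) :
    evalC (extD (fun y => conjForm (F.φ α y)) x) ![v, w] =
      starRingEnd ℂ (F.D α x (conjC v) (conjC w)) := by
  rw [extD_conj (F.φ_smooth α) hx, D, ← evalC_conj_two, conjC_conjC, conjC_conjC]

lemma D_conj_conj (α β γ : ι) (hx : x ∈ F.U) :
    F.D α x (conjC (F.Z β x)) (conjC (F.Z γ x)) = 0 := by
  have h := extD_involutive (S := S) F.isOpen_U (smoothForm_conj (F.φ_smooth α)) (fun y hy W hW => by
    rw [PHFrame.evalC_conjForm, F.φ_conj α y hy W hW, map_zero]) (F.Z_smooth β) (F.Z_smooth γ) (F.Z_mem β)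
    (F.Z_mem γ) hx
  rw [F.D_conj α hx] at h
  exact (map_eq_zero _).1 h

/-- `d(dθ) = 0`. -/
lemma structure_identity (hθ : S.Contact θ) (hx : x ∈ F.U) (a b c : CTangent x) :
    ∑ β, evalC (((∑ α, (diffForm (fun y => I * F.lev y α β) x ⋏ F.φ α x
      + (I * F.lev x α β) • extD (F.φ α) x)) ⋏ conjForm (F.φ β x))
      - (∑ α, (I * F.lev x α β) • F.φ α x) ⋏ extD (fun y => conjForm (F.φ β y)) x)
        ![a, b, c] = 0 := by
  have hf : ∀ α β, SmoothFun (fun y => I * F.lev y α β) F.U := fun α β =>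
    (smoothFun_const _ _).mul F.isOpen_U (F.lev_smooth hθ α β)
  have hψ : ∀ β, SmoothForm (fun y => ∑ α, (I * F.lev y α β) • F.φ α y) F.U := fun β =>
    smoothForm_sum _ fun α => smoothForm_smul F.isOpen_U (hf α β) (F.φ_smooth α)
  have h1 : extD (fun y => ∑ β, (∑ α, (I * F.lev y α β) • F.φ α y) ⋏ conjForm (F.φ β y)) x
      = 0 := by
    rw [← extD_extD isOpen_univ hθ.smooth (Set.mem_univ x)]
    refine extD_congr F.isOpen_U (fun y hy => ?_) hx
    rw [F.dtheta_eq hθ hy]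
    refine form_two_ext fun a b => ?_
    simp only [evalC_add, evalC_smul, evalC_wedge_one_one, sum_two]
    ring
  rw [extD_sum _ (fun β => smoothForm_wedge (hψ β) (smoothForm_conj (F.φ_smooth β))) hx] at h1
  rw [← evalC_sum, ← evalC_zero ![a, b, c], ← h1]
  congr 1
  refine Finset.sum_congr rfl fun β _ => ?_
  rw [extD_wedge_one_one (hψ β) (smoothForm_conj (F.φ_smooth β)) hx,
    extD_sum _ (fun α => smoothForm_smul F.isOpen_U (hf α β) (F.φ_smooth α)) hx]
  simp only [fun α => extD_smul_one F.isOpen_U (hf α β) (F.φ_smooth α) hx]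

lemma derivC_I_mul (hθ : S.Contact θ) (hx : x ∈ F.U) (α β : ι)
    (v : CTangent x) : evalC (diffForm (fun y => I * F.lev y α β) x) ![v] =
      I * derivC (fun y => F.lev y α β) x v := by
  rw [← derivC_eq, derivC_mul F.isOpen_U (smoothFun_const _ _) (F.lev_smooth hθ α β) hx,
    derivC_const, mul_zero, add_zero]

lemma structure_identity' (hθ : S.Contact θ) (hx : x ∈ F.U)
    (a b c : CTangent x) :
    ∑ β, ((∑ α, (derivC (fun y => F.lev y α β) x a * evalC (F.φ α x) ![b]
        - derivC (fun y => F.lev y α β) x b * evalC (F.φ α x) ![a] + F.lev x α β * F.D α x a b)) *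
          evalC (conjForm (F.φ β x)) ![c]
      - (∑ α, (derivC (fun y => F.lev y α β) x a * evalC (F.φ α x) ![c]
        - derivC (fun y => F.lev y α β) x c * evalC (F.φ α x) ![a] + F.lev x α β * F.D α x a c)) *
          evalC (conjForm (F.φ β x)) ![b]
      + (∑ α, (derivC (fun y => F.lev y α β) x b * evalC (F.φ α x) ![c]
        - derivC (fun y => F.lev y α β) x c * evalC (F.φ α x) ![b] + F.lev x α β * F.D α x b c)) *
          evalC (conjForm (F.φ β x)) ![a]
      - (∑ α, F.lev x α β * evalC (F.φ α x) ![a]) * starRingEnd ℂ (F.D β x (conjC b) (conjC c))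
      + (∑ α, F.lev x α β * evalC (F.φ α x) ![b]) * starRingEnd ℂ (F.D β x (conjC a) (conjC c))
      - (∑ α, F.lev x α β * evalC (F.φ α x) ![c]) * starRingEnd ℂ (F.D β x (conjC a) (conjC b))) = 0
      := by
  refine mul_left_cancel₀ I_ne_zero ?_
  have h := F.structure_identity hθ hx a b c
  simp only [evalC_add, evalC_sub, evalC_smul, evalC_wedge_one_one, evalC_wedge_two_one,
    evalC_wedge_one_two, F.D_conj _ hx, F.derivC_I_mul hθ hx, D_eq, sum_two] at h ⊢
  linear_combination h

lemma deriv_T (hθ : S.Contact θ) (hx : x ∈ F.U) (ρ σ : ι) :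
    derivC (fun y => F.lev y ρ σ) x (mkC (F.T x) 0) =
      ∑ α, F.lev x α σ * F.D α x (F.Z ρ x) (mkC (F.T x) 0)
      + ∑ β, F.lev x ρ β * starRingEnd ℂ (F.D β x (F.Z σ x) (mkC (F.T x) 0)) := by
  have h := F.structure_identity' hθ hx (mkC (F.T x) 0) (F.Z ρ x) (conjC (F.Z σ x))
  simp only [F.φ_T' _ hx, F.φ_Z _ _ x hx, F.φ_conj' _ _ hx, F.φbar_T _ hx, F.φbar_Z _ _ hx,
    F.φbar_conj _ _ hx, conjC_conjC, conjC_mkC_zero, sum_two,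
    fun α ρ => F.D_swap α x (F.Z ρ x) (mkC (F.T x) 0)] at h ⊢
  fin_cases ρ <;> fin_cases σ <;> simp at h ⊢ <;> linear_combination h

lemma D_Z_Z (hθ : S.Contact θ) (hx : x ∈ F.U) (ρ σ τ : ι) :
    ∑ α, F.lev x α τ * F.D α x (F.Z ρ x) (F.Z σ x) =
      (derivC (fun y => F.lev y ρ τ) x (F.Z σ x)
        - ∑ ν, F.lev x ρ ν * starRingEnd ℂ (F.D ν x (F.Z τ x) (conjC (F.Z σ x))))
      - (derivC (fun y => F.lev y σ τ) x (F.Z ρ x)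
        - ∑ ν, F.lev x σ ν * starRingEnd ℂ (F.D ν x (F.Z τ x) (conjC (F.Z ρ x)))) := by
  have h := F.structure_identity' hθ hx (F.Z ρ x) (F.Z σ x) (conjC (F.Z τ x))
  simp only [F.φ_Z _ _ x hx, F.φ_conj' _ _ hx, F.φbar_Z _ _ hx, F.φbar_conj _ _ hx, conjC_conjC,
    sum_two, fun α ρ σ => F.D_swap α x (F.Z ρ x) (conjC (F.Z σ x)), map_neg] at h ⊢
  fin_cases ρ <;> fin_cases σ <;> fin_cases τ <;> simp at h ⊢ <;> linear_combination h

lemma D_symm (hθ : S.Contact θ) (hx : x ∈ F.U) (β γ : ι) :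
    ∑ α, F.lev x α γ * F.D α x (mkC (F.T x) 0) (conjC (F.Z β x)) =
      ∑ α, F.lev x α β * F.D α x (mkC (F.T x) 0) (conjC (F.Z γ x)) := by
  have h := F.structure_identity' hθ hx (mkC (F.T x) 0) (conjC (F.Z β x)) (conjC (F.Z γ x))
  simp only [F.φ_T' _ hx, F.φ_conj' _ _ hx, F.φbar_T _ hx, F.φbar_conj _ _ hx, sum_two] at h ⊢
  fin_cases β <;> fin_cases γ <;> simp at h ⊢ <;> linear_combination h

end AdmissibleCoframe

lemma derivC_conj (hU : IsOpen U) (hf : SmoothFun f U)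
    (hx : x ∈ U) (v : CTangent x) :
    derivC (fun y => starRingEnd ℂ (f y)) x (conjC v) = starRingEnd ℂ (derivC f x v) := by
  have h1 := hf.contMDiffAt (hU.mem_nhds hx)
  have h2 := (hf.conj hU).contMDiffAt (hU.mem_nhds hx)
  have h3 : ∀ w : TM x,
      diffFun (fun y => starRingEnd ℂ (f y)) x w = starRingEnd ℂ (diffFun f x w) := by
    intro w
    have h4 := Complex.conjCLE.comp_fderiv (f := f ∘ (χ x).symm)
      (x := χ x x)
    rw [diffFun_eq h2, diffFun_eq h1]
    exact congrArg (fun L : E5 →L[ℝ] ℂ => L w) h4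
  rw [derivC, derivC, h3, h3, reC_conjC, imC_conjC, map_neg, map_neg, map_add, map_mul, conj_I]
  ring

namespace AdmissibleCoframe

variable (F : AdmissibleCoframe S θ)

/-- `ω_{ρβ̄}(Z_σ)`. -/
def connLow (ρ β σ : ι) (x : M) : ℂ :=
  derivC (fun y => F.lev y ρ β) x (F.Z σ x)
    - ∑ ν, F.lev x ρ ν * starRingEnd ℂ (F.D ν x (F.Z β x) (conjC (F.Z σ x)))

/-- `ω_ρ{}^γ(Z_σ)`. -/
def connZ (ρ γ σ : ι) (x : M) : ℂ := ∑ β, (F.lev x)⁻¹ β γ * F.connLow ρ β σ x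

/-- The Tanaka–Webster connection forms of an admissible coframe. -/
def connForm (ρ γ : ι) : Form M 1 := fun x =>
  F.D γ x (F.Z ρ x) (mkC (F.T x) 0) • θ x + ∑ σ, F.connZ ρ γ σ x • F.φ σ x
    + ∑ σ, F.D γ x (F.Z ρ x) (conjC (F.Z σ x)) • conjForm (F.φ σ x)

lemma smooth_D (γ : ι) {Z W : CVectorField M} (hZ : SmoothCVF Z F.U) (hW : SmoothCVF W F.U) :
    SmoothFun (fun x => F.D γ x (Z x) (W x)) F.U :=
  smoothFun_evalC_two F.isOpen_U (smoothForm_extD F.isOpen_U (F.φ_smooth γ)) hZ hW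

lemma smooth_connForm (hθ : S.Contact θ) (ρ γ : ι) :
    SmoothForm (F.connForm ρ γ) F.U := by
  have hU := F.isOpen_U
  have hb := fun σ => smoothCVF_conj hU (F.Z_smooth σ)
  refine smoothForm_add (smoothForm_add (smoothForm_smul hU (F.smooth_D γ (F.Z_smooth ρ)
    (smoothCVF_real hU F.T_smooth)) (hθ.smooth.mono (Set.subset_univ _)))
    (smoothForm_sum _ fun σ => smoothForm_smul hU ?_ (F.φ_smooth σ)))
    (smoothForm_sum _ fun σ => smoothForm_smul hU (F.smooth_D γ (F.Z_smooth ρ) (hb σ))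
      (smoothForm_conj (F.φ_smooth σ)))
  exact smoothFun_sum _ fun β => (F.isFrame.smooth_inv hθ β γ).mul hU
    ((smoothFun_derivC hU (F.lev_smooth hθ ρ β) (F.Z_smooth σ)).sub (smoothFun_sum _ fun ν =>
      (F.lev_smooth hθ ρ ν).mul hU ((F.smooth_D ν (F.Z_smooth β) (hb σ)).conj hU)))

lemma lev_connZ (hθ : S.Contact θ) (hx : x ∈ F.U) (ρ β σ : ι) :
    ∑ γ, F.lev x γ β * F.connZ ρ γ σ x = F.connLow ρ β σ x := by
  have h0 := F.isFrame.inv_levi hθ hx 0 β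
  have h1 := F.isFrame.inv_levi hθ hx 1 β
  rw [sum_two] at h0 h1
  simp only [connZ, sum_two]
  change _ * (F.lev x _ _) + _ * (F.lev x _ _) = _ at h0
  change _ * (F.lev x _ _) + _ * (F.lev x _ _) = _ at h1
  have e : F.connLow ρ β σ x = F.connLow ρ 0 σ x * (if 0 = β then 1 else 0)
      + F.connLow ρ 1 σ x * (if 1 = β then 1 else 0) := by
    fin_cases β <;> simp
  rw [e, ← h0, ← h1]
  change _ = _ * ((F.lev x)⁻¹ _ _ * _ + (F.lev x)⁻¹ _ _ * _) + _ * ((F.lev x)⁻¹ _ _ * _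
    + (F.lev x)⁻¹ _ _ * _)
  ring

lemma connZ_sub (hθ : S.Contact θ) (hx : x ∈ F.U) (ρ γ σ : ι) :
    F.connZ ρ γ σ x - F.connZ σ γ ρ x = F.D γ x (F.Z ρ x) (F.Z σ x) := by
  have h0 := F.isFrame.levi_inv hθ hx 0 γ
  have h1 := F.isFrame.levi_inv hθ hx 1 γ
  rw [sum_two] at h0 h1
  change (F.lev x _ _) * (F.lev x)⁻¹ _ _ + (F.lev x _ _) * (F.lev x)⁻¹ _ _ = _ at h0
  change (F.lev x _ _) * (F.lev x)⁻¹ _ _ + (F.lev x _ _) * (F.lev x)⁻¹ _ _ = _ at h1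
  have k0 := F.D_Z_Z hθ hx ρ σ 0
  have k1 := F.D_Z_Z hθ hx ρ σ 1
  change _ = F.connLow ρ 0 σ x - F.connLow σ 0 ρ x at k0
  change _ = F.connLow ρ 1 σ x - F.connLow σ 1 ρ x at k1
  have e : F.D γ x (F.Z ρ x) (F.Z σ x) = F.D 0 x (F.Z ρ x) (F.Z σ x) * (if 0 = γ then 1 else 0)
      + F.D 1 x (F.Z ρ x) (F.Z σ x) * (if 1 = γ then 1 else 0) := by
    fin_cases γ <;> simp
  rw [e, ← h0, ← h1]
  simp only [connZ, sum_two] at k0 k1 ⊢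
  linear_combination -(F.lev x)⁻¹ 0 γ * k0 - (F.lev x)⁻¹ 1 γ * k1

variable (hθ : S.Contact θ) {x : M} (hx : x ∈ F.U)

lemma connForm_T (hx : x ∈ F.U) (ρ γ : ι) :
    evalC (F.connForm ρ γ x) ![mkC (F.T x) 0] = F.D γ x (F.Z ρ x) (mkC (F.T x) 0) := by
  simp only [connForm, evalC_add, evalC_sum, evalC_smul, F.theta_T' hx, F.φ_T' _ hx, F.φbar_T _ hx]
  simp

lemma connForm_Z (hθ : S.Contact θ) (hx : x ∈ F.U) (ρ γ σ : ι) :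
    evalC (F.connForm ρ γ x) ![F.Z σ x] = F.connZ ρ γ σ x := by
  simp only [connForm, evalC_add, evalC_sum, evalC_smul, hθ.theta_mem (F.Z_mem _ x hx),
    F.φ_Z _ _ x hx, F.φbar_Z _ _ hx]
  simp

lemma connForm_conj (hθ : S.Contact θ) (hx : x ∈ F.U) (ρ γ σ : ι) :
    evalC (F.connForm ρ γ x) ![conjC (F.Z σ x)] = F.D γ x (F.Z ρ x) (conjC (F.Z σ x)) := by
  simp only [connForm, evalC_add, evalC_sum, evalC_smul, hθ.theta_conj (F.Z_mem _ x hx),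
    F.φ_conj' _ _ hx, F.φbar_conj _ _ hx]
  simp

lemma dφ_eq (hθ : S.Contact θ) (hx : x ∈ F.U) (α : ι) :
    extD (F.φ α) x = ∑ μ, F.φ μ x ⋏ F.connForm μ α x
      + ∑ β, F.D α x (mkC (F.T x) 0) (conjC (F.Z β x)) • (θ x ⋏ conjForm (F.φ β x)) := by
  refine F.two_form_ext' hθ hx ?_ ?_ ?_ ?_ ?_ <;> intros <;>
    simp only [evalC_add, evalC_sum, evalC_smul, evalC_wedge_one_one, F.φ_T' _ hx, F.φ_Z _ _ x hx,
      F.φ_conj' _ _ hx, F.φbar_T _ hx, F.φbar_Z _ _ hx, F.φbar_conj _ _ hx, F.theta_T' hx,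
      hθ.theta_mem (F.Z_mem _ x hx), hθ.theta_conj (F.Z_mem _ x hx), F.connForm_T hx,
      F.connForm_Z hθ hx, F.connForm_conj hθ hx, D_eq, F.D_conj_conj _ _ _ hx,
      ← F.connZ_sub hθ hx, fun α ρ => F.D_swap α x (F.Z ρ x) (mkC (F.T x) 0)] <;>
    simp

lemma dlev_eq (hθ : S.Contact θ) (hx : x ∈ F.U) (α β : ι) :
    diffForm (fun y => F.lev y α β) x = ∑ γ, F.lev x γ β • F.connForm α γ x
      + ∑ γ, F.lev x α γ • conjForm (F.connForm β γ x) := by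
  have hc : ∀ v : CTangent x, evalC (∑ γ, F.lev x α γ • conjForm (F.connForm β γ x)) ![v] =
      starRingEnd ℂ (∑ γ, F.lev x γ α * evalC (F.connForm β γ x) ![conjC v]) := by
    intro v
    simp only [evalC_sum, evalC_smul, map_sum, map_mul, F.lev_conj hθ, PHFrame.evalC_conjForm]
  suffices h : ∀ i, evalC (diffForm (fun y => F.lev y α β) x) ![F.fr i x] =
      evalC (∑ γ, F.lev x γ β • F.connForm α γ x
        + ∑ γ, F.lev x α γ • conjForm (F.connForm β γ x)) ![F.fr i x] by
    refine form_one_ext fun v => ?_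
    rw [← evalC_real_one, ← evalC_real_one, F.expand hθ hx (mkC v 0), ← lin1_apply, ← lin1_apply,
      map_sum, map_sum]
    simp only [map_smul, lin1_apply, h]
  rintro (_ | σ | σ)
  · change evalC _ ![mkC (F.T x) 0] = evalC _ ![mkC (F.T x) 0]
    rw [← derivC_eq, F.deriv_T hθ hx, evalC_add, hc, conjC_mkC_zero]
    simp only [evalC_sum, evalC_smul, F.connForm_T hx, map_sum, map_mul, F.lev_conj hθ]
  · change evalC _ ![F.Z σ x] = evalC _ ![F.Z σ x]
    rw [← derivC_eq, evalC_add, hc]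
    simp only [evalC_sum, evalC_smul, F.connForm_Z hθ hx, F.connForm_conj hθ hx, F.lev_connZ hθ hx,
      map_sum, map_mul, F.lev_conj hθ, connLow]
    ring
  · change evalC _ ![conjC (F.Z σ x)] = evalC _ ![conjC (F.Z σ x)]
    rw [← derivC_eq, evalC_add, hc, conjC_conjC]
    have h := derivC_conj F.isOpen_U (F.lev_smooth hθ β α) hx (F.Z σ x)
    simp only [F.lev_conj hθ] at h
    simp only [evalC_sum, evalC_smul, F.connForm_Z hθ hx, F.connForm_conj hθ hx, F.lev_connZ hθ hx,
      map_sum, map_sub, map_mul, F.lev_conj hθ, connLow, Complex.conj_conj, h]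
    ring

/-- The pseudohermitian frame of an admissible coframe. -/
def toPHFrame (hθ : S.Contact θ) : PHFrame S θ where
  toAdmissibleCoframe := F
  h := F.lev
  h_smooth := F.lev_smooth hθ
  dtheta_eq _ hx := F.dtheta_eq hθ hx
  conn := F.connForm
  conn_smooth := F.smooth_connForm hθ
  tors α β x := F.D α x (mkC (F.T x) 0) (conjC (F.Z β x))
  tors_smooth α β := F.smooth_D α (smoothCVF_real F.isOpen_U F.T_smooth)
    (smoothCVF_conj F.isOpen_U (F.Z_smooth β))
  dφ_eq α _ hx := F.dφ_eq hθ hx α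
  dh_eq α β x hx v := by
    have h := congrArg (fun η => evalC η ![mkC v 0]) (F.dlev_eq hθ hx α β)
    simp only [evalC_add, evalC_sum, evalC_smul] at h
    simpa only [evalC_real_one, diffForm_apply] using h
  tors_symm β γ _ hx := F.D_symm hθ hx β γ

end AdmissibleCoframe

/-- Every frame of `T10` is, near a given point, the frame dual to an admissible coframe. -/
lemma exists_phFrame (hθ : S.Contact θ) {Z : ι → CVectorField M}
    (hZ : IsFrame S Z U) (hx : x ∈ U) :
    ∃ F : PHFrame S θ, x ∈ F.U ∧ F.U ⊆ U ∧ F.Z = Z := by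
  obtain ⟨F, h1, h2, h3⟩ := hZ.exists_admissible hθ hx
  exact ⟨F.toPHFrame hθ, h1, h2, h3⟩

lemma exists_phFrame_at (hθ : S.Contact θ) (x : M) : ∃ F : PHFrame S θ, x ∈ F.U := by
  obtain ⟨U, hU, hx, Z, hZ, h⟩ := S.locally_framed x
  obtain ⟨F, hF, -⟩ := exists_phFrame hθ (U := U) (Z := Z) ⟨hU, hZ, fun α y hy => by
    rw [← (h y hy).2]; exact Submodule.subset_span ⟨α, rfl⟩, fun y hy => (h y hy).1⟩ hx
  exact ⟨F, hF⟩

lemma smoothForm_of_isR01 (hθ : S.Contact θ) {η : Form M 1} (h : IsR01 S θ η) :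
    SmoothForm η Set.univ := by
  intro x _
  obtain ⟨F, hF⟩ := exists_phFrame_at hθ x
  obtain ⟨u, hu, hη⟩ := h F
  let V : Opens M := ⟨F.U ∩ (χ x).source,
    F.isOpen_U.inter (isOpen_extChartAt_source x)⟩
  have hV : (V : Set M) ⊆ F.U := fun y hy => hy.1
  have hu' : ∀ β, SmoothFun (u β) V := fun β => (hu β).mono hV
  have hdiv : SmoothFun (F.div01 u) V :=
    (F.rep_div01 hθ hV (fun y hy => hy.2) fun β => rep_res (u β) (hu' β)).smooth
  refine smoothForm_congr V.isOpen (fun y hy => (hη y (hV hy)).symm) ?_ x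
    ⟨hF, mem_extChartAt_source x⟩
  exact smoothForm_add (smoothForm_sum _ fun β => smoothForm_smul V.isOpen (hu' β)
    ((smoothForm_conj (F.φ_smooth β)).mono hV)) (smoothForm_smul V.isOpen
      ((smoothFun_const _ _).mul V.isOpen hdiv) (hθ.smooth.mono (Set.subset_univ _)))

lemma PHFrame.smooth_qComp (F : PHFrame S θ) (hθ : S.Contact θ) {η : Form M 1}
    (hη : SmoothForm η Set.univ) (β : ι) : SmoothFun (F.qComp (F.comp01 η) β) F.U := by
  intro x hx
  let V : Opens M := ⟨F.U ∩ (χ x).source,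
    F.isOpen_U.inter (isOpen_extChartAt_source x)⟩
  have hV : (V : Set M) ⊆ F.U := fun y hy => hy.1
  have hu : ∀ β, SmoothFun (F.comp01 η β) V :=
    F.smooth_comp01 hV V.isOpen (hη.mono (Set.subset_univ _))
  have h := (F.rep_qComp hθ hV (fun y hy => hy.2) (fun β => rep_res _ (hu β)) β).smooth
  exact (h.contMDiffAt (V.isOpen.mem_nhds ⟨hx, mem_extChartAt_source x⟩)).contMDiffWithinAt

lemma globalize_eq {f : PHFrame S θ → Form M k} (F : PHFrame S θ) (hx : x ∈ F.U)
    (h : ∀ G : PHFrame S θ, x ∈ G.U → f G x = f F x) : globalize S θ f x = f F x := by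
  have hex : ∃ F : PHFrame S θ, x ∈ F.U := ⟨F, hx⟩
  rw [globalize, dif_pos hex]
  exact h _ hex.choose_spec

lemma Q01_eq (hθ : S.Contact θ) {η : Form M 1} (hη : SmoothForm η Set.univ)
    (F : PHFrame S θ) (hx : x ∈ F.U) : Q01 S θ η x = F.form22 (F.qComp (F.comp01 η)) x :=
  globalize_eq F hx fun G hG => (G.frame_indep F hθ hG hx hη).1

lemma L01_eq (hθ : S.Contact θ) {η : Form M 1} (hη : SmoothForm η Set.univ)
    (F : PHFrame S θ) (hx : x ∈ F.U) : L01 S θ η x = F.form22 (F.lComp (F.comp01 η)) x :=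
  globalize_eq F hx fun G hG => (G.frame_indep F hθ hG hx hη).2

lemma Q01_rescale (hθ : S.Contact θ) {Υ : M → ℝ} (hΥ : ContMDiff (𝓡 5) 𝓘(ℝ, ℝ) ∞ Υ)
    {η : Form M 1} (hη : SmoothForm η Set.univ) (hcl : IsDbbarClosed S θ η) :
    Q01 S (rescale Υ θ) η = Q01 S θ η + L01 S θ (mul01 θ Υ η) := by
  funext x
  have hθ' := isContactForm_rescale hθ hΥ
  have hex := exists_phFrame_at hθ x
  obtain ⟨F, hF, e1, e2⟩ : ∃ F : PHFrame S θ, x ∈ F.U ∧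
      Q01 S θ η x = F.form22 (F.qComp (F.comp01 η)) x ∧
      L01 S θ (mul01 θ Υ η) x = F.form22 (F.lComp (F.comp01 (mul01 θ Υ η))) x :=
    ⟨hex.choose, hex.choose_spec, dif_pos hex, dif_pos hex⟩
  obtain ⟨F', hF', hU, hZ⟩ := exists_phFrame hθ' F.isFrame hF
  rw [Pi.add_apply, e1, e2, Q01_eq hθ' hη F' hF']
  exact F.transform F' hθ hΥ hF hF' (fun α y _ => by rw [hZ]) hη hcl

end Manifold

end CRQ

end

open scoped Manifold ContDiff

theorem theorem1p1 {M : Type*} [TopologicalSpace M] [ChartedSpace CRQ.E5 M]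
    [IsManifold (𝓡 5) ∞ M] (S : CRQ.CRStructure M) (θ : CRQ.Form M 1)
    (hθ : CRQ.IsContactForm S.T10 θ) :
    (∀ x, ∃ F : CRQ.PHFrame S θ, x ∈ F.U) ∧
    (∀ η, CRQ.IsR01 S θ η →
      CRQ.IsR22 S θ (CRQ.Q01 S θ η) ∧
      ∀ F : CRQ.PHFrame S θ, ∀ x ∈ F.U,
        CRQ.Q01 S θ η x = F.form22 (F.qComp (F.comp01 η)) x ∧
        CRQ.L01 S θ η x = F.form22 (F.lComp (F.comp01 η)) x) ∧
    (∀ Υ : M → ℝ, ContMDiff (𝓡 5) 𝓘(ℝ, ℝ) ∞ Υ → ∀ η, CRQ.IsR01 S θ η →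
      CRQ.IsDbbarClosed S θ η →
      CRQ.Q01 S (CRQ.rescale Υ θ) η = CRQ.Q01 S θ η + CRQ.L01 S θ (CRQ.mul01 θ Υ η)) := by
  refine ⟨CRQ.exists_phFrame_at hθ, fun η hη => ?_, fun Υ hΥ η hη hcl =>
    CRQ.Q01_rescale hθ hΥ (CRQ.smoothForm_of_isR01 hθ hη) hcl⟩
  have h := CRQ.smoothForm_of_isR01 hθ hη
  exact ⟨fun F => ⟨F.qComp (F.comp01 η), F.smooth_qComp hθ h, fun x hx => CRQ.Q01_eq hθ h F hx⟩,
    fun F x hx => ⟨CRQ.Q01_eq hθ h F hx, CRQ.L01_eq hθ h F hx⟩⟩
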